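/- Spaces are pointed, maps, homotopies ($\simeq$) and homotopy equivalences are pointed; $\Sigma$, $C$ and $M_f$ denote the reduced suspension, the reduced cone and the reduced mapping cylinder, $\wedge$ and $\vee$ the smash product and the wedge. Products are given the compactly generated (for CW complexes: the CW) topology. CW complexes have a vertex as base point. For a pair $(P,A)$ with inclusion $i_A:A\hookrightarrow P$ let $J_2(P,A)=(P\times A)/((a,*)\sim(*,a))$ and $J_3(P,A)=(P\times A\times A)/((x,*,a)\sim(x,a,*);\ (a,a',*)\sim(*,a,a')\sim(a,*,a'))$ be the second and third filtration of Gray's relative James construction, with the inclusions $j_P:P\hookrightarrow J_2(P,A)$, $x\mapsto(x,*)$, and $I_2:J_2(P,A)\hookrightarrow J_3(P,A)$. Let $p_{P\wedge A}:J_2(P,A)\to J_2(P,A)/P\cong P\wedge A$ be the canonical projection. Let $A=\Sigma A'$ and let $\varepsilon:\Sigma P'\to P$ be a homotopy equivalence. Write $T_1$ for the fat wedge (at least one coordinate is the base point), and let $W_3:\Sigma^2P'\wedge A'\wedge A'\simeq P'*A'*A'=\partial(CP'\times CA'\times CA')\to T_1(\Sigma P',\Sigma A',\Sigma A')$ be the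 universal third order Whitehead product map. The projection $P\times A\times A\to J_3(P,A)$ maps $T_1(P,A,A)$ to $J_2(P,A)$, and $\gamma_3:\Sigma^2P'\wedge A'\wedge A'\to J_2(P,A)$ is the composite of $W_3$, the map $T_1(\Sigma P',A,A)\to T_1(P,A,A)$ induced by $\varepsilon$, and this map; it is determined up to homotopy. For $u:\Sigma U\to Z$ and $v:\Sigma V\to Z$ the generalized Whitehead product $[u,v]:\Sigma U\wedge V\to Z$ is adjoint to the Samelson product of the adjoints of $u$ and $v$. For a connected CW complex $Z$ and $g:\Sigma W\to\Sigma Z$, the second James-Hopf invariant $H_2(g):\Sigma W\to\Sigma Z\wedge Z$ is the adjoint of $W\to\Omega\Sigma Z\simeq J(Z)\to J(Z\wedge Z)\simeq\Omega\Sigma(Z\wedge Z)$, where $J(Z)\to J(Z\wedge Z)$ is $z_1\cdots z_t\mapsto\prod_{k<l}z_k\wedge z_l$. **Lemma.** Let $(X,A)$ be a CW pair with $X=\Sigma X'$, $A=\Sigma A'$ for CW complexes $X',A'$, with inclusion $i_A:A\hookrightarrow X$, and let $\gamma_3:\Sigma^2X'\wedge A'\wedge A'\to J_2(X,A)$ be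 as above (with $P=X$, $\varepsilon=\mathrm{id}$). Then: (a) $J_3(X,A)\simeq J_2(X,A)\cup_{\gamma_3}C(\Sigma^2X'\wedge A'\wedge A')$, compatibly with the inclusions of $J_2(X,A)$. (b) $p_{X\wedge A}\gamma_3\simeq 0$. (c) If $[\mathrm{id}_X,i_A]=0$, then there is a homotopy equivalence $e:X\vee(X\wedge A)\to J_2(X,A)$ that restricts to $j_X$ on $X$ and satisfies $p_{X\wedge A}e\simeq$ the projection to $X\wedge A$. For every such $e$, if $\gamma_3$ is regarded via $e$ as a map to $X\vee(X\wedge A)$, then $J_3(X,A)\simeq(X\vee(X\wedge A))\cup_{\gamma_3}C(\Sigma^2X'\wedge A'\wedge A')$, compatibly with the inclusions; and if $X'$ is connected, then $$p_X\gamma_3\simeq[p_X,\mu\,p_{X\wedge A}]\,H_2(\gamma_3)\quad\text{for some }\mu\in[X\wedge A,X],$$ where $p_X$ and $p_{X\wedge A}$ are the projections of $X\vee(X\wedge A)$ onto its summands, and $X\vee(X\wedge A)$ is regarded as the suspension $\Sigma(X'\vee(X'\wedge A))$. **Corollary.** Let $f:X\to Y$ be a map with $X=\Sigma X'$, $Y=\Sigma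 Y'$ for CW complexes $X',Y'$, and let $\gamma_3:\Sigma^2Y'\wedge X'\wedge X'\to J_2(M_f,X)$ be as above for the pair $(M_f,X)$ (with $\varepsilon:Y\simeq M_f$ the inclusion). Let $p_{Y\wedge X}:J_2(M_f,X)\to M_f\wedge X\simeq Y\wedge X$ be the canonical projection. Then: (a) $J_3(M_f,X)\simeq J_2(M_f,X)\cup_{\gamma_3}C(\Sigma^2Y'\wedge X'\wedge X')$, compatibly with the inclusions of $J_2(M_f,X)$. (b) $p_{Y\wedge X}\gamma_3\simeq 0$. (c) If $[\mathrm{id}_Y,f]=0$, then there is a homotopy equivalence $e:Y\vee(Y\wedge X)\to J_2(M_f,X)$ that restricts up to homotopy to the inclusion of $Y$ and satisfies $p_{Y\wedge X}e\simeq$ the projection to $Y\wedge X$. For every such $e$, if $\gamma_3$ is regarded via $e$ as a map to $Y\vee(Y\wedge X)$, then $J_3(M_f,X)\simeq(Y\vee(Y\wedge X))\cup_{\gamma_3}C(\Sigma^2Y'\wedge X'\wedge X')$, compatibly with the inclusions; and if $Y'$ is connected, then $$p_Y\gamma_3\simeq[p_Y,\mu\,p_{Y\wedge X}]\,H_2(\gamma_3)\quad\text{for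 some }\mu\in[Y\wedge X,Y],$$ where $p_Y$ and $p_{Y\wedge X}$ are the projections of $Y\vee(Y\wedge X)=\Sigma(Y'\vee(Y'\wedge X))$ onto its summands. -/

import Mathlib

open Topology unitInterval

universe u

noncomputable section

namespace RelJames

/-! ### Delta-generated topologies

Products are formed with the delta-generated topology, the topology coinduced by all continuous
maps from the spaces `ℝⁿ`.  On a product of CW complexes it is the usual CW topology. -/

instance deltaGenerated_prod_cube (n : ℕ) : DeltaGeneratedSpace (I × (Fin n → ℝ)) := by
  have hq : IsQuotientMap
      (fun v : Fin (n + 1) → ℝ ↦ ((Set.projIcc (0 : ℝ) 1 zero_le_one (v 0) : I), Fin.tail v)) := by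
    refine IsQuotientMap.of_inverse
      (f := fun p : I × (Fin n → ℝ) ↦ (Fin.cons (p.1 : ℝ) p.2 : Fin (n + 1) → ℝ)) ?_ ?_ ?_
    · exact Continuous.finCons (by fun_prop) (by fun_prop)
    · refine Continuous.prodMk (continuous_projIcc.comp (continuous_apply 0)) ?_
      exact continuous_pi fun i ↦ continuous_apply _
    · intro p
      simp
  exact hq.isGeneratedBy

/-- The ordinary product of the unit interval with a delta-generated space is delta-generated, so
no change of topology is needed in `I × X`. -/
instance deltaGenerated_prod_I {X : Type*} [TopologicalSpace X] [DeltaGeneratedSpace X] :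
    DeltaGeneratedSpace (I × X) := by
  refine ⟨?_⟩
  have hs : ∀ x : X, Continuous (fun t : I ↦
      (WithGeneratedByTopology.equiv (X := fun n ↦ Fin n → ℝ)).symm (t, x)) := by
    intro x
    have h1 : Continuous (fun p : I × (Fin 0 → ℝ) ↦
        (WithGeneratedByTopology.equiv (X := fun n ↦ Fin n → ℝ)).symm (p.1, x)) :=
      (IsGeneratedBy.equiv_symm_comp_continuous_iff (X := fun n ↦ Fin n → ℝ)
        (fun p : I × (Fin 0 → ℝ) ↦ (p.1, x))).2 (by fun_prop)
    exact h1.comp (g := _) (f := fun t : I ↦ (t, (0 : Fin 0 → ℝ))) (by fun_prop)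
  let c : X → C(I, WithGeneratedByTopology (fun n ↦ Fin n → ℝ) (I × X)) :=
    fun x ↦ ⟨_, hs x⟩
  have hc : Continuous c := by
    rw [IsGeneratedBy.continuous_iff (fun n ↦ Fin n → ℝ)]
    intro n f
    refine ContinuousMap.continuous_of_continuous_uncurry _ ?_
    have h2 : Continuous (fun p : I × (Fin n → ℝ) ↦
        (WithGeneratedByTopology.equiv (X := fun n ↦ Fin n → ℝ)).symm (p.1, f p.2)) :=
      (IsGeneratedBy.equiv_symm_comp_continuous_iff (X := fun n ↦ Fin n → ℝ)
        (fun p : I × (Fin n → ℝ) ↦ (p.1, f p.2))).2 (by fun_prop)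
    exact h2.comp continuous_swap
  exact (ContinuousMap.continuous_uncurry_of_continuous ⟨c, hc⟩).comp continuous_swap

/-- The product of two spaces, with the delta-generated topology. -/
abbrev DProd (X Y : Type u) [TopologicalSpace X] [TopologicalSpace Y] : Type u :=
  WithGeneratedByTopology (fun n ↦ Fin n → ℝ) (X × Y)

section DProd

variable {X Y Z : Type u} [TopologicalSpace X] [TopologicalSpace Y] [TopologicalSpace Z]

/-- The point `(x, y)` of the product. -/
def dpair (x : X) (y : Y) : DProd X Y := WithGeneratedByTopology.equiv.symm (x, y)

/-- The first projection. -/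
def dfst (p : DProd X Y) : X := (WithGeneratedByTopology.equiv p).1

/-- The second projection. -/
def dsnd (p : DProd X Y) : Y := (WithGeneratedByTopology.equiv p).2

@[simp] theorem dfst_dpair (x : X) (y : Y) : dfst (dpair x y) = x := rfl

@[simp] theorem dsnd_dpair (x : X) (y : Y) : dsnd (dpair x y) = y := rfl

@[fun_prop] theorem continuous_dfst : Continuous (dfst : DProd X Y → X) :=
  continuous_fst.comp WithGeneratedByTopology.continuous_equiv

@[fun_prop] theorem continuous_dsnd : Continuous (dsnd : DProd X Y → Y) :=
  continuous_snd.comp WithGeneratedByTopology.continuous_equiv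

@[fun_prop] theorem continuous_dpair [DeltaGeneratedSpace Z] {f : Z → X} {g : Z → Y}
    (hf : Continuous f) (hg : Continuous g) : Continuous (fun z ↦ dpair (f z) (g z)) :=
  (IsGeneratedBy.equiv_symm_comp_continuous_iff (X := fun n ↦ Fin n → ℝ)
    (fun z ↦ (f z, g z))).2 (hf.prodMk hg)

end DProd

/-- A map out of `I × (quotient)` is continuous if it is so before passing to the quotient. -/
theorem continuous_I_prod_quot {T S : Type*} [TopologicalSpace T] [TopologicalSpace S]
    {r : T → T → Prop} {f : I × Quot r → S}
    (h : Continuous (fun p : I × T ↦ f (p.1, Quot.mk r p.2))) : Continuous f :=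
  isQuotientMap_quot_mk.continuous_lift_prod_right h

/-- A map out of `I × (disjoint union)` is continuous if it is so on both summands. -/
theorem continuous_I_prod_sum {T₁ T₂ S : Type*} [TopologicalSpace T₁] [TopologicalSpace T₂]
    [TopologicalSpace S] {f : I × (T₁ ⊕ T₂) → S}
    (h₁ : Continuous (fun p : I × T₁ ↦ f (p.1, Sum.inl p.2)))
    (h₂ : Continuous (fun p : I × T₂ ↦ f (p.1, Sum.inr p.2))) : Continuous f := by
  have h₁' : Continuous (fun p : T₁ × I ↦ f (p.2, Sum.inl p.1)) := h₁.comp continuous_swap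
  have h₂' : Continuous (fun p : T₂ × I ↦ f (p.2, Sum.inr p.1)) := h₂.comp continuous_swap
  have hs : ∀ z : T₁ ⊕ T₂, Continuous (fun t : I ↦ f (t, z)) := by
    rintro (x | y)
    · exact h₁.comp (f := fun t : I ↦ (t, x)) (by fun_prop)
    · exact h₂.comp (f := fun t : I ↦ (t, y)) (by fun_prop)
  let c : T₁ ⊕ T₂ → C(I, S) := fun z ↦ ⟨_, hs z⟩
  have hc : Continuous c := by
    rw [continuous_sum_dom]
    exact ⟨ContinuousMap.continuous_of_continuous_uncurry _ h₁',
      ContinuousMap.continuous_of_continuous_uncurry _ h₂'⟩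
  exact (ContinuousMap.continuous_uncurry_of_continuous ⟨c, hc⟩).comp continuous_swap

/-! ### Pointed spaces, pointed maps, pointed homotopy -/

/-- A pointed (delta-generated) topological space.  Every CW complex is delta-generated, see
`deltaGenerated_of_cwComplex`. -/
structure PtdSpace where
  /-- the underlying space -/
  carrier : Type u
  [top : TopologicalSpace carrier]
  [dg : DeltaGeneratedSpace carrier]
  /-- the base point -/
  pt : carrier

instance : CoeSort PtdSpace.{u} (Type u) := ⟨PtdSpace.carrier⟩

attribute [instance] PtdSpace.top PtdSpace.dg

/-- A continuous map preserving base points. -/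
structure PtdMap (X Y : PtdSpace.{u}) extends C(X, Y) where
  /-- the base point is preserved -/
  map_pt : toFun X.pt = Y.pt

instance {X Y : PtdSpace.{u}} : CoeFun (PtdMap X Y) (fun _ ↦ X → Y) := ⟨fun f ↦ f.toFun⟩

theorem PtdMap.cont {X Y : PtdSpace.{u}} (f : PtdMap X Y) : Continuous f := f.continuous_toFun

@[fun_prop] theorem PtdMap.cont_comp {X Y : PtdSpace.{u}} (f : PtdMap X Y) {T : Type*}
    [TopologicalSpace T] {g : T → X} (hg : Continuous g) : Continuous (fun t ↦ f (g t)) :=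
  f.cont.comp hg

/-- The identity map. -/
def PtdMap.id (X : PtdSpace.{u}) : PtdMap X X := ⟨ContinuousMap.id X, rfl⟩

/-- The constant map `0` to the base point. -/
def PtdMap.zero (X Y : PtdSpace.{u}) : PtdMap X Y := ⟨ContinuousMap.const X Y.pt, rfl⟩

/-- The composite `g f`. -/
def PtdMap.comp {X Y Z : PtdSpace.{u}} (g : PtdMap Y Z) (f : PtdMap X Y) : PtdMap X Z where
  toFun x := g (f x)
  continuous_toFun := g.cont.comp f.cont
  map_pt := (congrArg g f.map_pt).trans g.map_pt

/-- Pointed homotopy. -/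
def PtdMap.Homotopic {X Y : PtdSpace.{u}} (f g : PtdMap X Y) : Prop :=
  f.toContinuousMap.HomotopicRel g.toContinuousMap {X.pt}

/-- Pointed homotopy equivalences. -/
def PtdMap.IsHomotopyEquiv {X Y : PtdSpace.{u}} (f : PtdMap X Y) : Prop :=
  ∃ g : PtdMap Y X, (g.comp f).Homotopic (PtdMap.id X) ∧ (f.comp g).Homotopic (PtdMap.id Y)

/-- `X` is a (Hausdorff) CW complex whose base point is a vertex. -/
def PtdSpace.IsCW (X : PtdSpace.{u}) : Prop :=
  T2Space X ∧ ∃ _ : CWComplex (Set.univ : Set X),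
    ∃ v : RelCWComplex.cell (Set.univ : Set X) 0, X.pt ∈ RelCWComplex.closedCell 0 v

/-- `i : A → X` is, up to a homeomorphism of `A`, the inclusion of a subcomplex of a CW complex;
the base points are vertices. -/
def PtdMap.IsCWPair {A X : PtdSpace.{u}} (i : PtdMap A X) : Prop :=
  T2Space X ∧ IsEmbedding i ∧ ∃ _ : CWComplex (Set.univ : Set X),
    (∃ v : RelCWComplex.cell (Set.univ : Set X) 0, X.pt ∈ RelCWComplex.closedCell 0 v) ∧
    ∃ E : RelCWComplex.Subcomplex (Set.univ : Set X), Set.range i = (E : Set X)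

/-- Every CW complex is delta-generated. -/
theorem deltaGenerated_of_cwComplex {X : Type*} [TopologicalSpace X] [T2Space X]
    [CWComplex (Set.univ : Set X)] : DeltaGeneratedSpace X := by
  refine ⟨?_⟩
  rw [continuous_iff_isClosed]
  intro C hC
  rw [WithGeneratedByTopology.isClosed_iff] at hC
  refine RelCWComplex.closed' (C := (Set.univ : Set X)) _ (Set.subset_univ _)
    ⟨fun n j ↦ ?_, by simp⟩
  have hclip : Continuous fun (v : Fin n → ℝ) (k : Fin n) ↦ max (-1) (min 1 (v k)) := by fun_prop
  have hmem : ∀ v : Fin n → ℝ, (fun k ↦ max (-1) (min 1 (v k))) ∈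
      Metric.closedBall (0 : Fin n → ℝ) 1 := by
    intro v
    rw [mem_closedBall_zero_iff, pi_norm_le_iff_of_nonneg zero_le_one]
    intro k
    rw [Real.norm_eq_abs, abs_le]
    exact ⟨le_max_left _ _, max_le (by norm_num) (min_le_left _ _)⟩
  have hfix : ∀ v ∈ Metric.closedBall (0 : Fin n → ℝ) 1,
      (fun k ↦ max (-1) (min 1 (v k))) = v := by
    intro v hv
    rw [mem_closedBall_zero_iff, pi_norm_le_iff_of_nonneg zero_le_one] at hv
    funext k
    have := hv k
    rw [Real.norm_eq_abs, abs_le] at this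
    rw [min_eq_right this.2, max_eq_right this.1]
  have hf : Continuous fun v : Fin n → ℝ ↦
      RelCWComplex.map (C := (Set.univ : Set X)) n j (fun k ↦ max (-1) (min 1 (v k))) :=
    (RelCWComplex.continuousOn (C := (Set.univ : Set X)) n j).comp_continuous hclip hmem
  have hcl := hC (⟨_, hf⟩ : C(Fin n → ℝ, X))
  refine IsCompact.isClosed ?_
  convert ((isCompact_closedBall (0 : Fin n → ℝ) 1).inter_right hcl).image hf using 1
  ext x
  constructor
  · rintro ⟨hx, v, hv, rfl⟩
    refine ⟨v, ⟨hv, ?_⟩, ?_⟩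
    · change RelCWComplex.map (C := (Set.univ : Set X)) n j (fun k ↦ max (-1) (min 1 (v k))) ∈ C
      rw [hfix v hv]
      exact hx
    · exact congrArg _ (hfix v hv)
  · rintro ⟨v, ⟨hv, hx⟩, rfl⟩
    exact ⟨hx, _, hmem v, rfl⟩

/-! ### Suspension, smash product, wedge, mapping cone, mapping cylinder -/

/-- The points of `I × X` that are collapsed in the reduced suspension. -/
def SuspCollapsed (X : PtdSpace.{u}) (p : I × X) : Prop := p.1 = 0 ∨ p.1 = 1 ∨ p.2 = X.pt

/-- The reduced suspension `ΣX`: the quotient of `I × X` by `{0, 1} × X ∪ I × *`. -/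
def Susp (X : PtdSpace.{u}) : PtdSpace.{u} where
  carrier := Quot fun p q : I × X ↦ SuspCollapsed X p ∧ SuspCollapsed X q
  pt := Quot.mk _ (0, X.pt)

/-- The point `t ∧ x` of `ΣX`. -/
def Susp.mk {X : PtdSpace.{u}} (t : I) (x : X) : Susp X := Quot.mk _ (t, x)

theorem Susp.mk_eq_pt {X : PtdSpace.{u}} {t : I} {x : X} (h : t = 0 ∨ t = 1 ∨ x = X.pt) :
    Susp.mk t x = (Susp X).pt :=
  Quot.sound ⟨h, Or.inl rfl⟩

@[fun_prop] theorem Susp.continuous_mk {X : PtdSpace.{u}} {T : Type*} [TopologicalSpace T]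
    {f : T → I} {g : T → X} (hf : Continuous f) (hg : Continuous g) :
    Continuous (fun z ↦ Susp.mk (f z) (g z)) :=
  continuous_quot_mk.comp (hf.prodMk hg)

/-- A pointed map out of a suspension from a map on `I × X`. -/
def Susp.lift {X Y : PtdSpace.{u}} (f : I → X → Y) (hf : Continuous fun p : I × X ↦ f p.1 p.2)
    (h : ∀ t x, (t = 0 ∨ t = 1 ∨ x = X.pt) → f t x = Y.pt) : PtdMap (Susp X) Y where
  toFun := Quot.lift (fun p ↦ f p.1 p.2) fun _ _ hpq ↦ (h _ _ hpq.1).trans (h _ _ hpq.2).symm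
  continuous_toFun := continuous_quot_lift _ hf
  map_pt := h _ _ (Or.inl rfl)

/-- The suspension of a map. -/
def Susp.map {X Y : PtdSpace.{u}} (f : PtdMap X Y) : PtdMap (Susp X) (Susp Y) :=
  Susp.lift (fun t x ↦ Susp.mk t (f x)) (by fun_prop) fun t x h ↦ Susp.mk_eq_pt <| by
    rcases h with h | h | h
    · exact Or.inl h
    · exact Or.inr (Or.inl h)
    · exact Or.inr (Or.inr (h ▸ f.map_pt))

/-- The product of two pointed spaces. -/
def PProd (X Y : PtdSpace.{u}) : PtdSpace.{u} where
  carrier := DProd X Y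
  pt := dpair X.pt Y.pt

/-- The points of `X ∨ Y ⊆ X × Y`. -/
def OnAxes (X Y : PtdSpace.{u}) (p : DProd X Y) : Prop := dfst p = X.pt ∨ dsnd p = Y.pt

/-- The smash product `X ∧ Y`: the quotient of `X × Y` by `X ∨ Y`. -/
def Smash (X Y : PtdSpace.{u}) : PtdSpace.{u} where
  carrier := Quot fun p q : DProd X Y ↦ OnAxes X Y p ∧ OnAxes X Y q
  pt := Quot.mk _ (dpair X.pt Y.pt)

/-- The point `x ∧ y`. -/
def Smash.mk {X Y : PtdSpace.{u}} (x : X) (y : Y) : Smash X Y := Quot.mk _ (dpair x y)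

theorem Smash.mk_eq_pt {X Y : PtdSpace.{u}} {x : X} {y : Y} (h : x = X.pt ∨ y = Y.pt) :
    Smash.mk x y = (Smash X Y).pt :=
  Quot.sound ⟨h, Or.inl rfl⟩

@[fun_prop] theorem Smash.continuous_mk {X Y : PtdSpace.{u}} {T : Type u} [TopologicalSpace T]
    [DeltaGeneratedSpace T] {f : T → X} {g : T → Y} (hf : Continuous f) (hg : Continuous g) :
    Continuous (fun z ↦ Smash.mk (f z) (g z)) :=
  continuous_quot_mk.comp (continuous_dpair hf hg)

/-- The quotient map `X × Y → X ∧ Y`. -/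
def Smash.proj (X Y : PtdSpace.{u}) : PtdMap (PProd X Y) (Smash X Y) where
  toFun p := Quot.mk _ p
  continuous_toFun := continuous_quot_mk
  map_pt := rfl

/-- The smash product `f ∧ g` of two maps. -/
def Smash.map {X Y X₁ Y₁ : PtdSpace.{u}} (f : PtdMap X X₁) (g : PtdMap Y Y₁) :
    PtdMap (Smash X Y) (Smash X₁ Y₁) where
  toFun := Quot.lift (fun p : DProd X Y ↦ Smash.mk (f (dfst p)) (g (dsnd p))) <| by
    have key : ∀ p : DProd X Y, OnAxes X Y p →
        Smash.mk (f (dfst p)) (g (dsnd p)) = (Smash X₁ Y₁).pt := by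
      rintro p (h | h)
      · exact Smash.mk_eq_pt (Or.inl (h ▸ f.map_pt))
      · exact Smash.mk_eq_pt (Or.inr (h ▸ g.map_pt))
    exact fun p q hpq ↦ (key p hpq.1).trans (key q hpq.2).symm
  continuous_toFun := continuous_quot_lift _ (by fun_prop)
  map_pt := Smash.mk_eq_pt (Or.inl f.map_pt)

/-- The wedge `X ∨ Y`: the disjoint union with the base points identified. -/
def Wedge (X Y : PtdSpace.{u}) : PtdSpace.{u} where
  carrier := Quot fun p q : X ⊕ Y ↦ p = Sum.inl X.pt ∧ q = Sum.inr Y.pt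
  pt := Quot.mk _ (Sum.inl X.pt)

/-- The inclusion of the first wedge summand. -/
def Wedge.inl (X Y : PtdSpace.{u}) : PtdMap X (Wedge X Y) where
  toFun x := Quot.mk _ (Sum.inl x)
  continuous_toFun := continuous_quot_mk.comp continuous_inl
  map_pt := rfl

/-- The inclusion of the second wedge summand. -/
def Wedge.inr (X Y : PtdSpace.{u}) : PtdMap Y (Wedge X Y) where
  toFun y := Quot.mk _ (Sum.inr y)
  continuous_toFun := continuous_quot_mk.comp continuous_inr
  map_pt := (Quot.sound ⟨rfl, rfl⟩).symm

/-- The map `(f, g) : X ∨ Y → Z` that is `f` on `X` and `g` on `Y`. -/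
def Wedge.desc {X Y Z : PtdSpace.{u}} (f : PtdMap X Z) (g : PtdMap Y Z) :
    PtdMap (Wedge X Y) Z where
  toFun := Quot.lift (Sum.elim f g) <| by
    rintro _ _ ⟨rfl, rfl⟩
    exact f.map_pt.trans g.map_pt.symm
  continuous_toFun := continuous_quot_lift _ (f.cont.sumElim g.cont)
  map_pt := f.map_pt

/-- The canonical projection of `X ∨ Y` onto the first wedge summand. -/
def Wedge.fst (X Y : PtdSpace.{u}) : PtdMap (Wedge X Y) X :=
  Wedge.desc (PtdMap.id X) (PtdMap.zero Y X)

/-- The canonical projection of `X ∨ Y` onto the second wedge summand. -/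
def Wedge.snd (X Y : PtdSpace.{u}) : PtdMap (Wedge X Y) Y :=
  Wedge.desc (PtdMap.zero X Y) (PtdMap.id Y)

/-- The identifications in the reduced mapping cone: the end `1` of the cone is glued to `Y` along
`f`, the end `0` is the apex. -/
inductive ConeRel {X Y : PtdSpace.{u}} (f : PtdMap X Y) : Y ⊕ I × X → Y ⊕ I × X → Prop
  | glue (x : X) : ConeRel f (Sum.inr (1, x)) (Sum.inl (f x))
  | apex (x : X) : ConeRel f (Sum.inr (0, x)) (Sum.inl Y.pt)
  | base (t : I) : ConeRel f (Sum.inr (t, X.pt)) (Sum.inl Y.pt)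

/-- The reduced mapping cone `Y ∪_f CX`. -/
def MapCone {X Y : PtdSpace.{u}} (f : PtdMap X Y) : PtdSpace.{u} where
  carrier := Quot (ConeRel f)
  pt := Quot.mk _ (Sum.inl Y.pt)

/-- The inclusion `Y → Y ∪_f CX`. -/
def MapCone.incl {X Y : PtdSpace.{u}} (f : PtdMap X Y) : PtdMap Y (MapCone f) where
  toFun y := Quot.mk _ (Sum.inl y)
  continuous_toFun := continuous_quot_mk.comp continuous_inl
  map_pt := rfl

/-- The identifications in the reduced mapping cylinder. -/
inductive CylRel {X Y : PtdSpace.{u}} (f : PtdMap X Y) : Y ⊕ I × X → Y ⊕ I × X → Prop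
  | glue (x : X) : CylRel f (Sum.inr (1, x)) (Sum.inl (f x))
  | base (t : I) : CylRel f (Sum.inr (t, X.pt)) (Sum.inl Y.pt)

/-- The reduced mapping cylinder `M_f`. -/
def MapCyl {X Y : PtdSpace.{u}} (f : PtdMap X Y) : PtdSpace.{u} where
  carrier := Quot (CylRel f)
  pt := Quot.mk _ (Sum.inl Y.pt)

/-- The inclusion `X → M_f` at the free end of the cylinder. -/
def MapCyl.source {X Y : PtdSpace.{u}} (f : PtdMap X Y) : PtdMap X (MapCyl f) where
  toFun x := Quot.mk _ (Sum.inr (0, x))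
  continuous_toFun := continuous_quot_mk.comp (continuous_inr.comp (by fun_prop))
  map_pt := Quot.sound (CylRel.base 0)

/-- The inclusion `Y → M_f`, a homotopy equivalence. -/
def MapCyl.target {X Y : PtdSpace.{u}} (f : PtdMap X Y) : PtdMap Y (MapCyl f) where
  toFun y := Quot.mk _ (Sum.inl y)
  continuous_toFun := continuous_quot_mk.comp continuous_inl
  map_pt := rfl

/-- The retraction `M_f → Y`, a homotopy inverse of the inclusion of `Y`. -/
def MapCyl.retr {X Y : PtdSpace.{u}} (f : PtdMap X Y) : PtdMap (MapCyl f) Y where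
  toFun := Quot.lift (Sum.elim (fun y ↦ y) fun p ↦ f p.2) <| by
    rintro _ _ (x | t)
    · rfl
    · exact f.map_pt
  continuous_toFun := continuous_quot_lift _ (continuous_id.sumElim (by fun_prop))
  map_pt := rfl

/-! ### The generalized Whitehead product -/

section Whitehead

variable {A B Z : PtdSpace.{u}}

/-- The loop in `Z` adjoint to `f : ΣA → Z` at the point `a`. -/
def adjLoop (f : PtdMap (Susp A) Z) (a : A) : Path Z.pt Z.pt where
  toFun t := f (Susp.mk t a)
  continuous_toFun := by fun_prop
  source' := (congrArg f (Susp.mk_eq_pt (Or.inl rfl))).trans f.map_pt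
  target' := (congrArg f (Susp.mk_eq_pt (Or.inr (Or.inl rfl)))).trans f.map_pt

/-- The commutator loop `f(a) g(b) f(a)⁻¹ g(b)⁻¹` of the loops adjoint to `f` and `g`. -/
def commLoop (f : PtdMap (Susp A) Z) (g : PtdMap (Susp B) Z) (a : A) (b : B) :
    Path Z.pt Z.pt :=
  ((adjLoop f a).trans (adjLoop g b)).trans ((adjLoop f a).symm.trans (adjLoop g b).symm)

/-- The map `Σ(A × B) → Z` adjoint to the commutator map `A × B → ΩZ`. -/
def commMap (f : PtdMap (Susp A) Z) (g : PtdMap (Susp B) Z) : PtdMap (Susp (PProd A B)) Z :=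
  Susp.lift (fun t p ↦ commLoop f g (dfst p) (dsnd p) t)
    (by
      have hf : Continuous fun q : (A × B) × I ↦ adjLoop f q.1.1 q.2 :=
        f.cont_comp (by fun_prop)
      have hg : Continuous fun q : (A × B) × I ↦ adjLoop g q.1.2 q.2 :=
        g.cont_comp (by fun_prop)
      have h1 := Path.trans_continuous_family (fun q : A × B ↦ adjLoop f q.1) hf
        (fun q : A × B ↦ adjLoop g q.2) hg
      have h2 := Path.trans_continuous_family (fun q : A × B ↦ (adjLoop f q.1).symm)
        (Path.symm_continuous_family (fun q : A × B ↦ adjLoop f q.1) hf)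
        (fun q : A × B ↦ (adjLoop g q.2).symm)
        (Path.symm_continuous_family (fun q : A × B ↦ adjLoop g q.2) hg)
      have h := Path.trans_continuous_family _ h1 _ h2
      exact h.comp (f := fun p : I × PProd A B ↦ ((dfst p.2, dsnd p.2), p.1)) <|
        ((continuous_dfst.comp continuous_snd).prodMk
          (continuous_dsnd.comp continuous_snd)).prodMk continuous_fst)
    (by
      rintro t p (rfl | rfl | rfl)
      · exact Path.source _
      · exact Path.target _
      · have ha : adjLoop f A.pt = Path.refl Z.pt := by
          ext t
          exact (congrArg f (Susp.mk_eq_pt (Or.inr (Or.inr rfl)))).trans f.map_pt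
        have hb : adjLoop g B.pt = Path.refl Z.pt := by
          ext t
          exact (congrArg g (Susp.mk_eq_pt (Or.inr (Or.inr rfl)))).trans g.map_pt
        change commLoop f g A.pt B.pt t = Z.pt
        simp [commLoop, ha, hb])

/-- `w : Σ(A ∧ B) → Z` represents the generalized Whitehead product `[f, g]` of `f : ΣA → Z` and
`g : ΣB → Z`: its adjoint `A ∧ B → ΩZ` is the Samelson product of the adjoints of `f` and `g`, that
is, it restricts along `A × B → A ∧ B` to their commutator, up to homotopy.  For CW complexes
`A`, `B` the homotopy class of `w` exists and is unique. -/
def IsWhitehead (f : PtdMap (Susp A) Z) (g : PtdMap (Susp B) Z)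
    (w : PtdMap (Susp (Smash A B)) Z) : Prop :=
  (w.comp (Susp.map (Smash.proj A B))).Homotopic (commMap f g)

end Whitehead

/-! ### The James construction and the second James-Hopf invariant -/

section James

variable (Z : PtdSpace.{u})

open Classical in
/-- Delete all letters that are equal to the base point. -/
def reduceWord (l : List Z) : List Z := l.filter fun z ↦ z ≠ Z.pt

/-- The James construction `J(Z)`, the free monoid on `Z` with the base point as unit: its points
are the words without the letter `*`, and it carries the quotient topology of `⨆ₙ Zⁿ`. -/
def James : PtdSpace.{u} :=
  let Q : Type u := {l : List Z // ∀ z ∈ l, z ≠ Z.pt}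
  let π : WithGeneratedByTopology (fun n ↦ Fin n → ℝ) (Σ n : ℕ, (Fin n → Z)) → Q :=
    fun w ↦ ⟨reduceWord Z (List.ofFn (WithGeneratedByTopology.equiv w).2), by
      simp [reduceWord]⟩
  { carrier := Q
    top := TopologicalSpace.coinduced π inferInstance
    dg := IsGeneratedBy.coinduced π
    pt := ⟨[], by simp⟩ }

variable {Z}

/-- The point `z₁ z₂ ⋯ zₖ` of `J(Z)`. -/
def James.mk (l : List Z) : James Z :=
  (⟨reduceWord Z l, by simp [reduceWord]⟩ : {l : List Z // ∀ z ∈ l, z ≠ Z.pt})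

/-- The letters of a point of `J(Z)`. -/
def James.letters (w : James Z) : List Z := Subtype.val (p := fun l : List Z ↦ ∀ z ∈ l, z ≠ Z.pt) w

/-- The list of all `zᵢ ∧ zⱼ` with `i < j`, ordered lexicographically. -/
def smashPairs : List Z → List (Smash Z Z)
  | [] => []
  | z :: l => l.map (fun z' ↦ Smash.mk z z') ++ smashPairs l

/-- The second James-Hopf invariant `J(Z) → J(Z ∧ Z)`, `z₁ ⋯ zₖ ↦ ∏_{i < j} zᵢ ∧ zⱼ`. -/
def jamesHopf (w : James Z) : James (Smash Z Z) := James.mk (smashPairs (James.letters w))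

/-- A length function: nonnegative, and zero exactly at the base point. -/
def IsLength (ℓ : C(Z, ℝ)) : Prop := (∀ z, 0 ≤ ℓ z) ∧ ∀ z, ℓ z = 0 ↔ z = Z.pt

/-- The Moore loop in `ΣZ` given by a word: it is the composite of the loops `t ↦ t ∧ z`, the loop
of the letter `z` being run through in time `ℓ z`. -/
def wordLoop (ℓ : C(Z, ℝ)) : List Z → ℝ → Susp Z
  | [], _ => (Susp Z).pt
  | z :: l, s =>
    if s ≤ ℓ z then Susp.mk (Set.projIcc 0 1 zero_le_one (s / ℓ z)) z
    else wordLoop ℓ l (s - ℓ z)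

/-- The natural map `ω : J(Z) → ΩΣZ`, written as a map of two variables. -/
def jamesOmega (ℓ : C(Z, ℝ)) (w : James Z) (t : I) : Susp Z :=
  wordLoop ℓ (James.letters w) (t * ((James.letters w).map ℓ).sum)

/-- `h : ΣW → Σ(Z ∧ Z)` represents the second James-Hopf invariant `H₂(f)` of `f : ΣW → ΣZ`:
the adjoint `W → ΩΣZ` of `f` is homotopic to `ω g` for a map `g : W → J(Z)`, and `h` is homotopic
to the adjoint of `ω H₂ g : W → ΩΣ(Z ∧ Z)`.  The choice of the length functions has no influence on
homotopy classes; for CW complexes `W`, `Z` with `Z` connected, `ω` is a weak equivalence and the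
homotopy class of `h` exists and is unique. -/
def IsJamesHopf {W : PtdSpace.{u}} (f : PtdMap (Susp W) (Susp Z))
    (h : PtdMap (Susp W) (Susp (Smash Z Z))) : Prop :=
  ∃ (ℓ : C(Z, ℝ)) (ℓ' : C(Smash Z Z, ℝ)) (g : PtdMap W (James Z))
    (f₀ : PtdMap (Susp W) (Susp Z)) (h₀ : PtdMap (Susp W) (Susp (Smash Z Z))),
    IsLength ℓ ∧ IsLength ℓ' ∧
    (∀ t w, f₀ (Susp.mk t w) = jamesOmega ℓ (g w) t) ∧ f₀.Homotopic f ∧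
    (∀ t w, h₀ (Susp.mk t w) = jamesOmega ℓ' (jamesHopf (g w)) t) ∧ h₀.Homotopic h

end James

/-! ### The relative James construction -/

section RelativeJames

variable {P A : PtdSpace.{u}}

/-- The identifications in `J₂(P, A)`. -/
inductive J2Rel (i : PtdMap A P) : DProd P A → DProd P A → Prop
  | swap (a : A) : J2Rel i (dpair (i a) A.pt) (dpair P.pt a)

/-- The second filtration `J₂(P, A) = (P × A)/((a, *) ∼ (*, a))` of the relative James construction
of the pair `(P, A)` with inclusion `i`. -/
def J2 (i : PtdMap A P) : PtdSpace.{u} where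
  carrier := Quot (J2Rel i)
  pt := Quot.mk _ (dpair P.pt A.pt)

/-- The word `x a` in `J₂(P, A)`. -/
def J2.mk (i : PtdMap A P) (x : P) (a : A) : J2 i := Quot.mk _ (dpair x a)

@[fun_prop] theorem J2.continuous_mk (i : PtdMap A P) {T : Type*} [TopologicalSpace T]
    [DeltaGeneratedSpace T] {f : T → P} {g : T → A} (hf : Continuous f) (hg : Continuous g) :
    Continuous (fun z ↦ J2.mk i (f z) (g z)) :=
  continuous_quot_mk.comp
    ((IsGeneratedBy.equiv_symm_comp_continuous_iff (X := fun n ↦ Fin n → ℝ)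
      (fun z ↦ (f z, g z))).2 (hf.prodMk hg))

/-- The inclusion `j_P : P = J₁(P, A) → J₂(P, A)`. -/
def J2.incl (i : PtdMap A P) : PtdMap P (J2 i) where
  toFun x := J2.mk i x A.pt
  continuous_toFun := by fun_prop
  map_pt := rfl

/-- The canonical projection `p_{P ∧ A} : J₂(P, A) → J₂(P, A)/P = P ∧ A`. -/
def J2.pinch (i : PtdMap A P) : PtdMap (J2 i) (Smash P A) where
  toFun := Quot.lift (fun p ↦ Smash.mk (dfst p) (dsnd p)) <| by
    rintro _ _ ⟨a⟩
    exact (Smash.mk_eq_pt (Or.inr rfl)).trans (Smash.mk_eq_pt (Or.inl rfl)).symm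
  continuous_toFun := continuous_quot_lift _ (by fun_prop)
  map_pt := rfl

/-- The identifications in `J₃(P, A)`. -/
inductive J3Rel (i : PtdMap A P) : DProd (DProd P A) A → DProd (DProd P A) A → Prop
  | right (x : P) (a : A) : J3Rel i (dpair (dpair x A.pt) a) (dpair (dpair x a) A.pt)
  | left (a a' : A) : J3Rel i (dpair (dpair (i a) a') A.pt) (dpair (dpair P.pt a) a')
  | mid (a a' : A) : J3Rel i (dpair (dpair P.pt a) a') (dpair (dpair (i a) A.pt) a')

/-- The third filtration
`J₃(P, A) = (P × A × A)/((x, *, a) ∼ (x, a, *); (a, a', *) ∼ (*, a, a') ∼ (a, *, a'))`. -/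
def J3 (i : PtdMap A P) : PtdSpace.{u} where
  carrier := Quot (J3Rel i)
  pt := Quot.mk _ (dpair (dpair P.pt A.pt) A.pt)

/-- The word `x a a'` in `J₃(P, A)`. -/
def J3.mk (i : PtdMap A P) (x : P) (a a' : A) : J3 i := Quot.mk _ (dpair (dpair x a) a')

/-- The inclusion `I₂ : J₂(P, A) → J₃(P, A)`. -/
def J3.incl (i : PtdMap A P) : PtdMap (J2 i) (J3 i) where
  toFun := Quot.lift (fun p ↦ J3.mk i (dfst p) (dsnd p) A.pt) <| by
    rintro _ _ ⟨a⟩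
    exact Quot.sound (J3Rel.left a A.pt)
  continuous_toFun := continuous_quot_lift _ (continuous_quot_mk.comp (by fun_prop))
  map_pt := rfl

end RelativeJames

/-! ### The attaching map of the third filtration -/

section Attaching

variable (X Y Z : PtdSpace.{u})

/-- The faces of the cube `[0, 1]³` on which some coordinate is `1`. -/
abbrev OuterFaces : Type := {s : I × I × I // s.1 = 1 ∨ s.2.1 = 1 ∨ s.2.2 = 1}

/-- A point of `X × Y × Z` together with three cone coordinates, one of which is `1`. -/
abbrev JoinData : Type u :=
  WithGeneratedByTopology (fun n ↦ Fin n → ℝ) (OuterFaces × DProd (DProd X Y) Z)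

variable {X Y Z}

/-- The first cone coordinate. -/
def JoinData.s₁ (p : JoinData X Y Z) : I := (WithGeneratedByTopology.equiv p).1.1.1
/-- The second cone coordinate. -/
def JoinData.s₂ (p : JoinData X Y Z) : I := (WithGeneratedByTopology.equiv p).1.1.2.1
/-- The third cone coordinate. -/
def JoinData.s₃ (p : JoinData X Y Z) : I := (WithGeneratedByTopology.equiv p).1.1.2.2
/-- The point of `X`. -/
def JoinData.x (p : JoinData X Y Z) : X := dfst (dfst (WithGeneratedByTopology.equiv p).2)
/-- The point of `Y`. -/
def JoinData.y (p : JoinData X Y Z) : Y := dsnd (dfst (WithGeneratedByTopology.equiv p).2)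
/-- The point of `Z`. -/
def JoinData.z (p : JoinData X Y Z) : Z := dsnd (WithGeneratedByTopology.equiv p).2

variable (X Y Z) in
/-- The join `X * Y * Z` as the boundary `X × CY × CZ ∪ CX × Y × CZ ∪ CX × CY × Z` of
`CX × CY × CZ`.  Each cone has its apex at the coordinate `0` and its base at the coordinate `1`. -/
def Join₃ : PtdSpace.{u} where
  carrier := Quot fun p q : JoinData X Y Z ↦
    p.s₁ = q.s₁ ∧ p.s₂ = q.s₂ ∧ p.s₃ = q.s₃ ∧
      (p.s₁ = 0 ∨ p.x = q.x) ∧ (p.s₂ = 0 ∨ p.y = q.y) ∧ (p.s₃ = 0 ∨ p.z = q.z)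
  pt := Quot.mk _ (WithGeneratedByTopology.equiv.symm
    (⟨(1, 1, 1), Or.inl rfl⟩, dpair (dpair X.pt Y.pt) Z.pt))


/-- The point with cone coordinates `s₁, s₂, s₃` over `x, y, z`. -/
def Join₃.mk (s : OuterFaces) (x : X) (y : Y) (z : Z) : Join₃ X Y Z :=
  Quot.mk _ (WithGeneratedByTopology.equiv.symm (s, dpair (dpair x y) z))

theorem JoinData.continuous_s₁ : Continuous (JoinData.s₁ : JoinData X Y Z → I) :=
  (continuous_fst.comp continuous_subtype_val).comp
    (continuous_fst.comp WithGeneratedByTopology.continuous_equiv)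

theorem JoinData.continuous_s₂ : Continuous (JoinData.s₂ : JoinData X Y Z → I) :=
  (continuous_fst.comp (continuous_snd.comp continuous_subtype_val)).comp
    (continuous_fst.comp WithGeneratedByTopology.continuous_equiv)

theorem JoinData.continuous_s₃ : Continuous (JoinData.s₃ : JoinData X Y Z → I) :=
  (continuous_snd.comp (continuous_snd.comp continuous_subtype_val)).comp
    (continuous_fst.comp WithGeneratedByTopology.continuous_equiv)

theorem JoinData.continuous_x : Continuous (JoinData.x : JoinData X Y Z → X) :=
  (continuous_dfst.comp continuous_dfst).comp
    (continuous_snd.comp WithGeneratedByTopology.continuous_equiv)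

theorem JoinData.continuous_y : Continuous (JoinData.y : JoinData X Y Z → Y) :=
  (continuous_dsnd.comp continuous_dfst).comp
    (continuous_snd.comp WithGeneratedByTopology.continuous_equiv)

theorem JoinData.continuous_z : Continuous (JoinData.z : JoinData X Y Z → Z) :=
  continuous_dsnd.comp (continuous_snd.comp WithGeneratedByTopology.continuous_equiv)

attribute [fun_prop] JoinData.continuous_s₁ JoinData.continuous_s₂ JoinData.continuous_s₃
  JoinData.continuous_x JoinData.continuous_y JoinData.continuous_z

theorem JoinData.outer (p : JoinData X Y Z) : p.s₁ = 1 ∨ p.s₂ = 1 ∨ p.s₃ = 1 :=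
  (WithGeneratedByTopology.equiv p).1.2

theorem JoinData.sum_pos (p : JoinData X Y Z) : 0 < (p.s₁ + p.s₂ + p.s₃ : ℝ) := by
  have h₁ := p.s₁.2.1
  have h₂ := p.s₂.2.1
  have h₃ := p.s₃.2.1
  rcases p.outer with h | h | h <;> rw [h] <;> norm_num <;> linarith

/-- The piecewise linear function that is `0` on `[0, 1/5]`, `1` on `[2/5, 1]`. -/
def cut (r : ℝ) : I := Set.projIcc 0 1 zero_le_one (5 * r - 1)

theorem cut_zero : cut 0 = 0 := Set.projIcc_of_le_left _ (by norm_num)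

theorem cut_one {r : ℝ} (h : 2 / 5 ≤ r) : cut r = 1 := Set.projIcc_of_right_le _ (by linarith)

@[fun_prop] theorem continuous_cut : Continuous cut := continuous_projIcc.comp (by fun_prop)

/-- The point `cut b₁ ∧ cut b₂ ∧ x ∧ y ∧ z`, where `b₁, b₂, b₃` are the barycentric coordinates
`sᵢ / (s₁ + s₂ + s₃)`. -/
def joinCollapseFun (p : JoinData X Y Z) : Susp (Susp (Smash (Smash X Y) Z)) :=
  Susp.mk (cut (p.s₁ / (p.s₁ + p.s₂ + p.s₃))) <|
    Susp.mk (cut (p.s₂ / (p.s₁ + p.s₂ + p.s₃))) (Smash.mk (Smash.mk p.x p.y) p.z)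

theorem joinCollapseFun_of_zero (p : JoinData X Y Z) (h : p.s₁ = 0 ∨ p.s₂ = 0 ∨ p.s₃ = 0) :
    joinCollapseFun p = (Susp (Susp (Smash (Smash X Y) Z))).pt := by
  have hs := p.sum_pos
  rcases h with h | h | h
  · refine Susp.mk_eq_pt (Or.inl ?_)
    simp [h, cut_zero]
  · refine Susp.mk_eq_pt (Or.inr (Or.inr (Susp.mk_eq_pt (Or.inl ?_))))
    simp [h, cut_zero]
  · rcases le_total (p.s₂ : ℝ) p.s₁ with h' | h'
    · refine Susp.mk_eq_pt (Or.inr (Or.inl (cut_one ?_)))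
      rw [le_div_iff₀ hs, h, Set.Icc.coe_zero]
      rw [h, Set.Icc.coe_zero] at hs
      linarith
    · refine Susp.mk_eq_pt (Or.inr (Or.inr (Susp.mk_eq_pt (Or.inr (Or.inl (cut_one ?_))))))
      rw [le_div_iff₀ hs, h, Set.Icc.coe_zero]
      rw [h, Set.Icc.coe_zero] at hs
      linarith

variable (X Y Z) in
/-- The comparison `X * Y * Z → Σ²(X ∧ Y ∧ Z)`.  It collapses the points with some cone coordinate
`0` or with a base point among `x, y, z`, and uses the map `(cut b₁, cut b₂)` of degree one from the
triangle of the barycentric coordinates modulo its boundary to `[0, 1]²` modulo its boundary; it is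
a homotopy equivalence for CW complexes. -/
def joinCollapse : PtdMap (Join₃ X Y Z) (Susp (Susp (Smash (Smash X Y) Z))) where
  toFun := Quot.lift joinCollapseFun <| by
    rintro p q ⟨h₁, h₂, h₃, hx, hy, hz⟩
    by_cases h : p.s₁ = 0 ∨ p.s₂ = 0 ∨ p.s₃ = 0
    · rw [joinCollapseFun_of_zero p h, joinCollapseFun_of_zero q (h₁ ▸ h₂ ▸ h₃ ▸ h)]
    · push Not at h
      have hx' := hx.resolve_left h.1
      have hy' := hy.resolve_left h.2.1
      have hz' := hz.resolve_left h.2.2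
      simp only [joinCollapseFun, h₁, h₂, h₃, hx', hy', hz']
  continuous_toFun := by
    refine continuous_quot_lift _ ?_
    unfold joinCollapseFun
    have hne : ∀ p : JoinData X Y Z, (p.s₁ + p.s₂ + p.s₃ : ℝ) ≠ 0 := fun p ↦ p.sum_pos.ne'
    refine Susp.continuous_mk (continuous_cut.comp ?_)
      (Susp.continuous_mk (continuous_cut.comp ?_) ?_)
    · exact Continuous.div (by fun_prop) (by fun_prop) hne
    · exact Continuous.div (by fun_prop) (by fun_prop) hne
    · fun_prop
  map_pt := Susp.mk_eq_pt (Or.inr (Or.inr (Susp.mk_eq_pt (Or.inr (Or.inr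
    (Smash.mk_eq_pt (Or.inr rfl)))))))

variable {P : PtdSpace.{u}}

open Classical in
/-- The value of `attachJoin` at a point of the join. -/
def attachFun (i : PtdMap (Susp Y) P) (ε : PtdMap (Susp X) P) (p : JoinData X Y Y) : J2 i :=
  if p.s₃ = 1 then J2.mk i (ε (Susp.mk p.s₁ p.x)) (Susp.mk p.s₂ p.y)
  else if p.s₂ = 1 then J2.mk i (ε (Susp.mk p.s₁ p.x)) (Susp.mk p.s₃ p.z)
  else J2.mk i (i (Susp.mk p.s₂ p.y)) (Susp.mk p.s₃ p.z)

theorem Susp.mk_one (x : X) : Susp.mk 1 x = (Susp X).pt := Susp.mk_eq_pt (Or.inr (Or.inl rfl))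

theorem Susp.mk_zero (x : X) : Susp.mk 0 x = (Susp X).pt := Susp.mk_eq_pt (Or.inl rfl)

theorem J2.swap (i : PtdMap (Susp Y) P) (a : Susp Y) :
    J2.mk i (i a) (Susp Y).pt = J2.mk i P.pt a := Quot.sound (J2Rel.swap a)

theorem map_pt' {X Y : PtdSpace.{u}} (f : PtdMap X Y) : f X.pt = Y.pt := f.map_pt

theorem attachFun_of_s₃ (i : PtdMap (Susp Y) P) (ε : PtdMap (Susp X) P) (p : JoinData X Y Y)
    (h : p.s₃ = 1) :
    attachFun i ε p = J2.mk i (ε (Susp.mk p.s₁ p.x)) (Susp.mk p.s₂ p.y) := by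
  simp only [attachFun, h, if_true]

theorem attachFun_of_s₂ (i : PtdMap (Susp Y) P) (ε : PtdMap (Susp X) P) (p : JoinData X Y Y)
    (h : p.s₂ = 1) :
    attachFun i ε p = J2.mk i (ε (Susp.mk p.s₁ p.x)) (Susp.mk p.s₃ p.z) := by
  by_cases h' : p.s₃ = 1
  · rw [attachFun_of_s₃ i ε p h', h, h', Susp.mk_one, Susp.mk_one]
  · simp only [attachFun, h, h', if_true, if_false]

theorem attachFun_of_s₁ (i : PtdMap (Susp Y) P) (ε : PtdMap (Susp X) P) (p : JoinData X Y Y)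
    (h : p.s₁ = 1) :
    attachFun i ε p = J2.mk i (i (Susp.mk p.s₂ p.y)) (Susp.mk p.s₃ p.z) := by
  by_cases h' : p.s₃ = 1
  · rw [attachFun_of_s₃ i ε p h', h, h', Susp.mk_one, Susp.mk_one, map_pt', J2.swap]
  · by_cases h'' : p.s₂ = 1
    · rw [attachFun_of_s₂ i ε p h'', h, h'', Susp.mk_one, Susp.mk_one, map_pt', map_pt']
    · simp only [attachFun, h', h'', if_false]

theorem Susp.mk_congr {s t : I} {x x' : X} (hs : s = t) (h : s = 0 ∨ x = x') :
    Susp.mk s x = Susp.mk t x' := by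
  subst hs
  rcases h with rfl | rfl
  · rw [Susp.mk_zero, Susp.mk_zero]
  · rfl

/-- The composite `X * Y * Y → T₁(ΣX, ΣY, ΣY) → T₁(P, ΣY, ΣY) → J₂(P, ΣY)` of the restriction to the
boundary of the quotient map `CX × CY × CY → ΣX × ΣY × ΣY`, of the map of fat wedges induced by
`ε : ΣX → P`, and of the restriction to the fat wedge of the projection `P × ΣY × ΣY → J₃(P, ΣY)`,
which takes its values in `J₂(P, ΣY)`. -/
def attachJoin (i : PtdMap (Susp Y) P) (ε : PtdMap (Susp X) P) :
    PtdMap (Join₃ X Y Y) (J2 i) where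
  toFun := Quot.lift (attachFun i ε) <| by
    rintro p q ⟨h₁, h₂, h₃, hx, hy, hz⟩
    simp only [attachFun]
    rw [← h₂, ← h₃, Susp.mk_congr h₁ hx, Susp.mk_congr rfl hy, Susp.mk_congr rfl hz]
  continuous_toFun := by
    refine continuous_quot_lift _ ?_
    rw [← continuousOn_univ]
    have hu : (Set.univ : Set (JoinData X Y Y)) =
        ({p | p.s₁ = 1} ∪ {p | p.s₂ = 1}) ∪ {p | p.s₃ = 1} := by
      ext p
      simp only [Set.mem_univ, Set.mem_union, Set.mem_ofPred_eq, true_iff, or_assoc]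
      exact p.outer
    have c₁ : IsClosed {p : JoinData X Y Y | p.s₁ = 1} :=
      isClosed_eq JoinData.continuous_s₁ continuous_const
    have c₂ : IsClosed {p : JoinData X Y Y | p.s₂ = 1} :=
      isClosed_eq JoinData.continuous_s₂ continuous_const
    have c₃ : IsClosed {p : JoinData X Y Y | p.s₃ = 1} :=
      isClosed_eq JoinData.continuous_s₃ continuous_const
    rw [hu]
    refine ContinuousOn.union_of_isClosed
      (ContinuousOn.union_of_isClosed ?_ ?_ c₁ c₂) ?_ (c₁.union c₂) c₃
    · refine ContinuousOn.congr (f := fun p : JoinData X Y Y ↦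
        J2.mk i (i (Susp.mk p.s₂ p.y)) (Susp.mk p.s₃ p.z)) ?_
        fun p hp ↦ attachFun_of_s₁ i ε p hp
      exact Continuous.continuousOn (by fun_prop)
    · refine ContinuousOn.congr (f := fun p : JoinData X Y Y ↦
        J2.mk i (ε (Susp.mk p.s₁ p.x)) (Susp.mk p.s₃ p.z)) ?_
        fun p hp ↦ attachFun_of_s₂ i ε p hp
      exact Continuous.continuousOn (by fun_prop)
    · refine ContinuousOn.congr (f := fun p : JoinData X Y Y ↦
        J2.mk i (ε (Susp.mk p.s₁ p.x)) (Susp.mk p.s₂ p.y)) ?_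
        fun p hp ↦ attachFun_of_s₃ i ε p hp
      exact Continuous.continuousOn (by fun_prop)
  map_pt := by
    refine (attachFun_of_s₃ i ε _ rfl).trans ?_
    change J2.mk i (ε (Susp.mk 1 X.pt)) (Susp.mk 1 Y.pt) = _
    rw [Susp.mk_one, Susp.mk_one, map_pt']
    rfl

/-- `attachJoin` is the restriction of the projection `P × ΣY × ΣY → J₃(P, ΣY)`. -/
theorem incl_attachJoin (i : PtdMap (Susp Y) P) (ε : PtdMap (Susp X) P) (s : OuterFaces)
    (x : X) (y z : Y) :
    J3.incl i (attachJoin i ε (Join₃.mk s x y z)) =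
      J3.mk i (ε (Susp.mk s.1.1 x)) (Susp.mk s.1.2.1 y) (Susp.mk s.1.2.2 z) := by
  set p : JoinData X Y Y := WithGeneratedByTopology.equiv.symm (s, dpair (dpair x y) z) with hp
  change J3.incl i (attachFun i ε p) = _
  rcases s.2 with h | h | h
  · rw [attachFun_of_s₁ i ε p h, h, Susp.mk_one, map_pt']
    exact Quot.sound (J3Rel.left _ _)
  · rw [attachFun_of_s₂ i ε p h, h, Susp.mk_one]
    exact (Quot.sound (J3Rel.right _ _)).symm
  · rw [attachFun_of_s₃ i ε p h, h, Susp.mk_one]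
    rfl

end Attaching

/-! ### The statement for a pair `(P, A)` with `P ≃ ΣX'` and `A = ΣA'`

In the following `i : ΣA' → P` is the inclusion, `ε : ΣX' → P` a homotopy equivalence and
`r : P → ΣX'` a homotopy inverse of it.  Both maps are the identity if `P = ΣX'`; they are the
inclusion of the target and the retraction if `P` is a mapping cylinder. -/

section Claim

variable {X' A' P : PtdSpace.{u}}

/-- `γ : Σ²(X' ∧ A' ∧ A') → J₂(P, A)` represents `γ₃`, the third order Whitehead product given by
the map of fat wedges `T₁(ΣX', A, A) → T₁(P, A, A) → J₂(P, A)`: it is the composite of this map with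
the universal map `Σ²(X' ∧ A' ∧ A') ≃ X' * A' * A' → T₁(ΣX', ΣA', ΣA')`. -/
def IsGamma₃ (i : PtdMap (Susp A') P) (ε : PtdMap (Susp X') P)
    (γ : PtdMap (Susp (Susp (Smash (Smash X' A') A'))) (J2 i)) : Prop :=
  (γ.comp (joinCollapse X' A' A')).Homotopic (attachJoin i ε)

/-- The projection `J₂(P, A) → J₂(P, A)/P = P ∧ A ≃ ΣX' ∧ A`. -/
def pinchTo (i : PtdMap (Susp A') P) (r : PtdMap P (Susp X')) :
    PtdMap (J2 i) (Smash (Susp X') (Susp A')) :=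
  (Smash.map r (PtdMap.id (Susp A'))).comp (J2.pinch i)

/-- `e : ΣX' ∨ (ΣX' ∧ A) → J₂(P, A)` is a homotopy equivalence under which the canonical inclusion
of `ΣX' ≃ P` becomes the inclusion of the first wedge summand and the projection to `ΣX' ∧ A` becomes
the projection to the second one. -/
def IsSplitting (i : PtdMap (Susp A') P) (ε : PtdMap (Susp X') P) (r : PtdMap P (Susp X'))
    (e : PtdMap (Wedge (Susp X') (Smash (Susp X') (Susp A'))) (J2 i)) : Prop :=
  e.IsHomotopyEquiv ∧
  (e.comp (Wedge.inl (Susp X') (Smash (Susp X') (Susp A')))).Homotopic ((J2.incl i).comp ε) ∧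
  ((pinchTo i r).comp e).Homotopic (Wedge.snd (Susp X') (Smash (Susp X') (Susp A')))

/-- The map `X → ΣX`, `x ↦ t ∧ x`. -/
def Susp.slice (X : PtdSpace.{u}) (t : I) : PtdMap X (Susp X) where
  toFun x := Susp.mk t x
  continuous_toFun := by fun_prop
  map_pt := Susp.mk_eq_pt (Or.inr (Or.inr rfl))

/-- The homeomorphism `Σ(X ∨ (X ∧ B)) → ΣX ∨ (ΣX ∧ B)` that sends `t ∧ x` to `t ∧ x` and
`t ∧ (x ∧ b)` to `(t ∧ x) ∧ b`. -/
def wedgeSusp (X B : PtdSpace.{u}) :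
    PtdMap (Susp (Wedge X (Smash X B))) (Wedge (Susp X) (Smash (Susp X) B)) :=
  Susp.lift
    (fun t z ↦ Wedge.desc ((Wedge.inl _ _).comp (Susp.slice X t))
      ((Wedge.inr _ _).comp (Smash.map (Susp.slice X t) (PtdMap.id B))) z)
    (by
      refine continuous_I_prod_quot (continuous_I_prod_sum ?_ ?_)
      · exact (Wedge.inl (Susp X) (Smash (Susp X) B)).cont.comp
          (Susp.continuous_mk continuous_fst continuous_snd)
      · refine (Wedge.inr (Susp X) (Smash (Susp X) B)).cont.comp
          (g := _) (f := fun p : I × Smash X B ↦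
            Smash.map (Susp.slice X p.1) (PtdMap.id B) p.2) (continuous_I_prod_quot ?_)
        change Continuous fun p : I × DProd X B ↦
          (Smash.mk (Susp.mk p.1 (dfst p.2)) (dsnd p.2) : Smash (Susp X) B)
        fun_prop)
    (by
      have key : ∀ (t : I) (z : Wedge X (Smash X B)), (t = 0 ∨ t = 1) →
          Wedge.desc ((Wedge.inl _ _).comp (Susp.slice X t))
            ((Wedge.inr _ _).comp (Smash.map (Susp.slice X t) (PtdMap.id B))) z =
            (Wedge (Susp X) (Smash (Susp X) B)).pt := by
        intro t z ht
        have hx : ∀ x, Susp.slice X t x = (Susp X).pt := fun x ↦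
          Susp.mk_eq_pt (ht.elim Or.inl fun h ↦ Or.inr (Or.inl h))
        induction z using Quot.ind with | mk z => ?_
        rcases z with x | z
        · exact (congrArg (Wedge.inl _ _) (hx x)).trans (map_pt' _)
        · induction z using Quot.ind with | mk z => ?_
          exact (congrArg (Wedge.inr _ _) (Smash.mk_eq_pt (Or.inl (hx (dfst z))))).trans
            (map_pt' _)
      rintro t z (h | h | rfl)
      · exact key t z (Or.inl h)
      · exact key t z (Or.inr h)
      · exact map_pt' _)

/-- The assertion on `γ₃`. -/
def Gamma₃Claim (i : PtdMap (Susp A') P) (ε : PtdMap (Susp X') P) (r : PtdMap P (Susp X')) :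
    Prop :=
  (∃ γ, IsGamma₃ i ε γ) ∧
  ∀ γ, IsGamma₃ i ε γ →
    -- `J₃ ≃ J₂ ∪_{γ₃} C(Σ²(X' ∧ A' ∧ A'))`, compatibly with the inclusions of `J₂`
    (∃ h : PtdMap (MapCone γ) (J3 i),
      h.IsHomotopyEquiv ∧ (h.comp (MapCone.incl γ)).Homotopic (J3.incl i)) ∧
    -- the projection of `γ₃` is null-homotopic
    ((pinchTo i r).comp γ).Homotopic (PtdMap.zero _ _) ∧
    -- if the Whitehead product of the identity of `ΣX'` and `r i` vanishes
    (IsWhitehead (PtdMap.id (Susp X')) (r.comp i) (PtdMap.zero _ _) →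
      -- then `J₂` splits,
      (∃ e, IsSplitting i ε r e) ∧
      -- and for every splitting `e`, with `δ` denoting `γ₃` regarded as a map to the wedge,
      ∀ e, IsSplitting i ε r e →
        (∃ δ, ((e.comp (wedgeSusp X' (Susp A'))).comp δ).Homotopic γ) ∧
        ∀ δ, ((e.comp (wedgeSusp X' (Susp A'))).comp δ).Homotopic γ →
          (∃ h : PtdMap (MapCone ((wedgeSusp X' (Susp A')).comp δ)) (J3 i),
            h.IsHomotopyEquiv ∧
            (h.comp (MapCone.incl ((wedgeSusp X' (Susp A')).comp δ))).Homotopic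
              ((J3.incl i).comp e)) ∧
          (ConnectedSpace X' →
            (∃ H, IsJamesHopf δ H) ∧
            ∀ H, IsJamesHopf δ H →
              ∃ (μ : PtdMap (Smash (Susp X') (Susp A')) (Susp X'))
                (w : PtdMap (Susp (Smash (Wedge X' (Smash X' (Susp A')))
                  (Wedge X' (Smash X' (Susp A'))))) (Susp X')),
                IsWhitehead ((Wedge.fst _ _).comp (wedgeSusp X' (Susp A')))
                  (μ.comp ((Wedge.snd _ _).comp (wedgeSusp X' (Susp A')))) w ∧
                (((Wedge.fst _ _).comp (wedgeSusp X' (Susp A'))).comp δ).Homotopic (w.comp H)))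

end Claim

end RelJames

end

noncomputable section

namespace RelJames

/-! ### Delta-generated spaces -/

theorem deltaGenerated_prod_of_locallyCompact {K : Type*} [TopologicalSpace K]
    [LocallyCompactSpace K] (hK : ∀ n, DeltaGeneratedSpace (K × (Fin n → ℝ)))
    {X : Type*} [TopologicalSpace X] [DeltaGeneratedSpace X] : DeltaGeneratedSpace (K × X) := by
  refine ⟨?_⟩
  have hs : ∀ x : X, Continuous (fun t : K ↦
      (WithGeneratedByTopology.equiv (X := fun n ↦ Fin n → ℝ)).symm (t, x)) := by
    intro x
    have h1 : Continuous (fun p : K × (Fin 0 → ℝ) ↦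
        (WithGeneratedByTopology.equiv (X := fun n ↦ Fin n → ℝ)).symm (p.1, x)) :=
      (IsGeneratedBy.equiv_symm_comp_continuous_iff (X := fun n ↦ Fin n → ℝ)
        (fun p : K × (Fin 0 → ℝ) ↦ (p.1, x))).2 (by fun_prop)
    exact h1.comp (g := _) (f := fun t : K ↦ (t, (0 : Fin 0 → ℝ))) (by fun_prop)
  let c : X → C(K, WithGeneratedByTopology (fun n ↦ Fin n → ℝ) (K × X)) :=
    fun x ↦ ⟨_, hs x⟩
  have hc : Continuous c := by
    rw [IsGeneratedBy.continuous_iff (fun n ↦ Fin n → ℝ)]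
    intro n f
    refine ContinuousMap.continuous_of_continuous_uncurry _ ?_
    have h2 : Continuous (fun p : K × (Fin n → ℝ) ↦
        (WithGeneratedByTopology.equiv (X := fun n ↦ Fin n → ℝ)).symm (p.1, f p.2)) :=
      (IsGeneratedBy.equiv_symm_comp_continuous_iff (X := fun n ↦ Fin n → ℝ)
        (fun p : K × (Fin n → ℝ) ↦ (p.1, f p.2))).2 (by fun_prop)
    exact h2.comp continuous_swap
  exact (ContinuousMap.continuous_uncurry_of_continuous ⟨c, hc⟩).comp continuous_swap

instance deltaGenerated_euclidean_prod (m : ℕ) {X : Type*} [TopologicalSpace X]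
    [DeltaGeneratedSpace X] : DeltaGeneratedSpace ((Fin m → ℝ) × X) := by
  refine deltaGenerated_prod_of_locallyCompact fun n ↦ ?_
  have hq : IsQuotientMap (fun v : Fin (m + n) → ℝ ↦
      ((fun i ↦ v (Fin.castAdd n i), fun i ↦ v (Fin.natAdd m i)) :
        (Fin m → ℝ) × (Fin n → ℝ))) := by
    refine IsQuotientMap.of_inverse
      (f := fun p : (Fin m → ℝ) × (Fin n → ℝ) ↦ Fin.append p.1 p.2) ?_ ?_ ?_
    · refine continuous_pi fun i ↦ ?_
      refine Fin.addCases (fun j ↦ ?_) (fun j ↦ ?_) i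
      · simp only [Fin.append_left]; fun_prop
      · simp only [Fin.append_right]; fun_prop
    · fun_prop
    · intro p
      simp
  exact hq.isGeneratedBy

instance deltaGenerated_prod_euclidean (m : ℕ) {X : Type*} [TopologicalSpace X]
    [DeltaGeneratedSpace X] : DeltaGeneratedSpace (X × (Fin m → ℝ)) :=
  (Homeomorph.prodComm (Fin m → ℝ) X).isQuotientMap.isGeneratedBy

instance deltaGenerated_real_prod {X : Type*} [TopologicalSpace X]
    [DeltaGeneratedSpace X] : DeltaGeneratedSpace (ℝ × X) := by
  have hq : IsQuotientMap (fun v : (Fin 1 → ℝ) × X ↦ (v.1 0, v.2)) :=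
    IsQuotientMap.of_inverse (f := fun x : ℝ × X ↦ (fun _ ↦ x.1, x.2)) (by fun_prop)
      (by fun_prop) (fun _ ↦ rfl)
  exact hq.isGeneratedBy

instance deltaGenerated_I : DeltaGeneratedSpace I := by
  have hq : IsQuotientMap (fun v : I × (Fin 0 → ℝ) ↦ v.1) :=
    IsQuotientMap.of_inverse (f := fun x : I ↦ (x, 0)) (by fun_prop) (by fun_prop) (fun _ ↦ rfl)
  exact hq.isGeneratedBy

/-- Clamping a real number to the unit interval. -/
def cI (t : ℝ) : I := Set.projIcc 0 1 zero_le_one t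

@[fun_prop] theorem continuous_cI : Continuous cI :=
  continuous_projIcc (h := zero_le_one)

@[fun_prop] theorem continuous_cI_comp {T : Type*} [TopologicalSpace T] {f : T → ℝ}
    (hf : Continuous f) : Continuous fun t ↦ cI (f t) := continuous_cI.comp hf

@[simp] theorem cI_coe (t : I) : cI t = t := Set.projIcc_val _ t

theorem coe_cI (t : ℝ) : (cI t : ℝ) = max 0 (min 1 t) := Set.coe_projIcc _ _ _ _

theorem coe_cI_of {t : ℝ} (h0 : 0 ≤ t) (h1 : t ≤ 1) : (cI t : ℝ) = t := by
  rw [coe_cI, min_eq_right h1, max_eq_right h0]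

theorem cI_of_le {t : ℝ} (h : t ≤ 0) : cI t = 0 := Set.projIcc_of_le_left _ h

theorem cI_of_ge {t : ℝ} (h : 1 ≤ t) : cI t = 1 := Set.projIcc_of_right_le _ h

@[simp] theorem cI_zero : cI 0 = 0 := cI_of_le le_rfl

@[simp] theorem cI_one : cI 1 = 1 := cI_of_ge le_rfl

section DG

variable {X Y Z S : Type u} [TopologicalSpace X] [TopologicalSpace Y] [TopologicalSpace Z]
  [TopologicalSpace S]

@[fun_prop] theorem continuous_dpair' {T : Type*} [TopologicalSpace T] [DeltaGeneratedSpace T]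
    {f : T → X} {g : T → Y}
    (hf : Continuous f) (hg : Continuous g) : Continuous (fun z ↦ dpair (f z) (g z)) :=
  (IsGeneratedBy.equiv_symm_comp_continuous_iff (X := fun n ↦ Fin n → ℝ)
    (fun z ↦ (f z, g z))).2 (hf.prodMk hg)

theorem dpair_eta (p : DProd X Y) : dpair (dfst p) (dsnd p) = p := rfl

theorem continuous_dprod_iff {T : Type*} [TopologicalSpace T] {f : DProd X Y → T} :
    Continuous f ↔ ∀ (n : ℕ) (g : (Fin n → ℝ) → X) (h : (Fin n → ℝ) → Y),
      Continuous g → Continuous h → Continuous fun v ↦ f (dpair (g v) (h v)) := by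
  constructor
  · intro hf n g h hg hh
    exact hf.comp (continuous_dpair' hg hh)
  · intro H
    rw [WithGeneratedByTopology.continuous_from_iff]
    intro n p
    exact H n (fun v ↦ (p v).1) (fun v ↦ (p v).2) (by fun_prop) (by fun_prop)

/-- In the delta-generated product, the product of a quotient map with an identity map is a
quotient map. -/
theorem continuous_dprod_left_of_isQuotientMap [DeltaGeneratedSpace Y] {π : Y → X}
    (hπ : IsQuotientMap π) {T : Type*} [TopologicalSpace T] {f : DProd X Z → T}
    (hf : Continuous fun p : DProd Y Z ↦ f (dpair (π (dfst p)) (dsnd p))) : Continuous f := by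
  rw [continuous_dprod_iff]
  intro n g h hg hh
  have h1 : Continuous fun p : Y × (Fin n → ℝ) ↦ f (dpair (π p.1) (h p.2)) :=
    hf.comp (f := fun p : Y × (Fin n → ℝ) ↦ dpair p.1 (h p.2)) (by fun_prop)
  have h2 : Continuous fun p : X × (Fin n → ℝ) ↦ f (dpair p.1 (h p.2)) :=
    hπ.continuous_lift_prod_left h1
  exact h2.comp (f := fun v ↦ (g v, v)) (by fun_prop)

theorem continuous_dprod_right_of_isQuotientMap [DeltaGeneratedSpace Y] {π : Y → X}
    (hπ : IsQuotientMap π) {T : Type*} [TopologicalSpace T] {f : DProd Z X → T}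
    (hf : Continuous fun p : DProd Z Y ↦ f (dpair (dfst p) (π (dsnd p)))) : Continuous f := by
  rw [continuous_dprod_iff]
  intro n g h hg hh
  have h1 : Continuous fun p : Y × (Fin n → ℝ) ↦ f (dpair (g p.2) (π p.1)) :=
    hf.comp (f := fun p : Y × (Fin n → ℝ) ↦ dpair (g p.2) p.1) (by fun_prop)
  have h2 : Continuous fun p : X × (Fin n → ℝ) ↦ f (dpair (g p.2) p.1) :=
    hπ.continuous_lift_prod_left h1
  exact h2.comp (f := fun v ↦ (h v, v)) (by fun_prop)

theorem isQuotientMap_dprod_left [DeltaGeneratedSpace Y] {π : Y → X} (hπ : IsQuotientMap π) :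
    IsQuotientMap fun p : DProd Y Z ↦ (dpair (π (dfst p)) (dsnd p) : DProd X Z) := by
  have hc := hπ.continuous
  refine ⟨isCoinducing_iff.2 fun V ↦ ⟨fun hV ↦ ?_, fun hV ↦ hV.preimage (by fun_prop)⟩,
    fun p ↦ ?_⟩
  · rw [isOpen_iff_continuous_mem] at hV ⊢
    exact continuous_dprod_left_of_isQuotientMap hπ hV
  · obtain ⟨y, hy⟩ := hπ.surjective (dfst p)
    exact ⟨dpair y (dsnd p), by simp only [dfst_dpair, dsnd_dpair, hy, dpair_eta]⟩

theorem isQuotientMap_dprod_right [DeltaGeneratedSpace Y] {π : Y → X} (hπ : IsQuotientMap π) :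
    IsQuotientMap fun p : DProd Z Y ↦ (dpair (dfst p) (π (dsnd p)) : DProd Z X) := by
  have hc := hπ.continuous
  refine ⟨isCoinducing_iff.2 fun V ↦ ⟨fun hV ↦ ?_, fun hV ↦ hV.preimage (by fun_prop)⟩,
    fun p ↦ ?_⟩
  · rw [isOpen_iff_continuous_mem] at hV ⊢
    exact continuous_dprod_right_of_isQuotientMap hπ hV
  · obtain ⟨y, hy⟩ := hπ.surjective (dsnd p)
    exact ⟨dpair (dfst p) y, by simp only [dfst_dpair, dsnd_dpair, hy, dpair_eta]⟩

end DG

theorem continuous_prod_quot {K T S : Type*} [TopologicalSpace K] [LocallyCompactSpace K]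
    [TopologicalSpace T] [TopologicalSpace S]
    {r : T → T → Prop} {f : K × Quot r → S}
    (h : Continuous (fun p : K × T ↦ f (p.1, Quot.mk r p.2))) : Continuous f :=
  isQuotientMap_quot_mk.continuous_lift_prod_right h

theorem continuous_prod_sum {K T₁ T₂ S : Type*} [TopologicalSpace K] [TopologicalSpace T₁]
    [TopologicalSpace T₂] [TopologicalSpace S] {f : K × (T₁ ⊕ T₂) → S}
    (h₁ : Continuous (fun p : K × T₁ ↦ f (p.1, Sum.inl p.2)))
    (h₂ : Continuous (fun p : K × T₂ ↦ f (p.1, Sum.inr p.2))) : Continuous f := by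
  have := (Homeomorph.prodSumDistrib (X := K) (Y := T₁) (Z := T₂)).symm.isQuotientMap
  rw [this.continuous_iff, continuous_sum_dom]
  exact ⟨h₁, h₂⟩

/-- A function on an open subset of a delta-generated space is continuous if it is so along all
maps from euclidean spaces into this subset. -/
theorem continuousOn_of_probes {X S : Type*} [TopologicalSpace X] [DeltaGeneratedSpace X]
    [TopologicalSpace S] {U : Set X} (hU : IsOpen U) {f : X → S}
    (h : ∀ (n : ℕ) (p : (Fin n → ℝ) → X), Continuous p → (∀ v, p v ∈ U) →
      Continuous fun v ↦ f (p v)) : ContinuousOn f U := by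
  rw [continuousOn_open_iff hU]
  intro V hV
  rw [IsGeneratedBy.isOpen_iff (fun n ↦ Fin n → ℝ)]
  intro n p
  rw [isOpen_iff_mem_nhds]
  intro v hv
  obtain ⟨ε, hε, hb⟩ := Metric.isOpen_iff.1 (hU.preimage p.continuous) v hv.1
  have hψ := OpenPartialHomeomorph.continuous_univBall v ε
  have hmem : ∀ w, OpenPartialHomeomorph.univBall v ε w ∈ Metric.ball v ε := fun w ↦ by
    rw [← OpenPartialHomeomorph.univBall_target v hε]
    exact (OpenPartialHomeomorph.univBall v ε).map_source
      (by rw [OpenPartialHomeomorph.univBall_source]; trivial)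
  have hc := h n (fun w ↦ p (OpenPartialHomeomorph.univBall v ε w)) (p.continuous.comp hψ)
    fun w ↦ hb (hmem w)
  have hO := (OpenPartialHomeomorph.univBall v ε).isOpen_image_of_subset_source
    (hV.preimage hc) (by rw [OpenPartialHomeomorph.univBall_source]; exact Set.subset_univ _)
  refine Filter.mem_of_superset (hO.mem_nhds ⟨0, ?_, ?_⟩) ?_
  · change f (p (OpenPartialHomeomorph.univBall v ε 0)) ∈ V
    rw [OpenPartialHomeomorph.univBall_apply_zero]
    exact hv.2
  · exact OpenPartialHomeomorph.univBall_apply_zero v ε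
  · rintro _ ⟨w, hw, rfl⟩
    exact ⟨hb (hmem w), hw⟩

/-- If `X` is delta-generated then pairs of continuous functions on open sets are continuous. -/
theorem ContinuousOn.dpair {T : Type*} {X Y : Type u} [TopologicalSpace T] [DeltaGeneratedSpace T]
    [TopologicalSpace X] [TopologicalSpace Y]
    {U : Set T} (hU : IsOpen U) {f : T → X} {g : T → Y} (hf : ContinuousOn f U)
    (hg : ContinuousOn g U) : ContinuousOn (fun z ↦ RelJames.dpair (f z) (g z)) U :=
  continuousOn_of_probes hU fun _ _ hp hpU ↦
    continuous_dpair' (hf.comp_continuous hp hpU) (hg.comp_continuous hp hpU)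

end RelJames

namespace RelJames

/-! ### Closed cofibrations -/

/-- A neighbourhood deformation of a space `Y` into a subspace `L`. -/
structure CofStr (Y : Type*) [TopologicalSpace Y] (L : Set Y) where
  /-- the distance from `L` -/
  u : Y → ℝ
  /-- the deformation -/
  k : ℝ → Y → Y
  cont_u : Continuous u
  cont_k : Continuous fun p : ℝ × Y ↦ k p.1 p.2
  u_nonneg : ∀ y, 0 ≤ u y
  u_rel : ∀ y ∈ L, u y = 0
  k_zero : ∀ y, k 0 y = y
  k_rel : ∀ t, ∀ y ∈ L, k t y = y
  k_mem : ∀ t y, u y ≤ t → t ≤ 1 → k t y ∈ L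

namespace CofStr

attribute [fun_prop] cont_u

variable {X Y Z : Type*} [TopologicalSpace X] [TopologicalSpace Y] [TopologicalSpace Z]
  {L : Set Y} {M : Set X} {M' : Set I}

@[fun_prop] theorem continuous_k (S : CofStr Y L) {T : Type*} [TopologicalSpace T] {f : T → ℝ}
    {g : T → Y} (hf : Continuous f) (hg : Continuous g) : Continuous fun t ↦ S.k (f t) (g t) :=
  S.cont_k.comp (hf.prodMk hg)

@[fun_prop] theorem continuous_u' (S : CofStr Y L) {T : Type*} [TopologicalSpace T]
    {g : T → Y} (hg : Continuous g) : Continuous fun t ↦ S.u (g t) :=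
  S.cont_u.comp hg

theorem mem_iff (S : CofStr Y L) (y : Y) : y ∈ L ↔ S.u y = 0 :=
  ⟨S.u_rel y, fun h ↦ S.k_zero y ▸ S.k_mem 0 y h.le zero_le_one⟩

theorem isClosed (S : CofStr Y L) : IsClosed L := by
  have : L = S.u ⁻¹' {0} := by ext y; exact S.mem_iff y
  rw [this]
  exact isClosed_singleton.preimage S.cont_u

/-- The structure on the product, in terms of a space `T` that maps to both factors. -/
def prodAux {T : Type*} [TopologicalSpace T] (S : CofStr X M) (S' : CofStr Y L)
    (f : T → X) (g : T → Y) (mk : X → Y → T) (hf : Continuous f) (hg : Continuous g)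
    (hmk : ∀ t, mk (f t) (g t) = t) (hfmk : ∀ x y, f (mk x y) = x) (hgmk : ∀ x y, g (mk x y) = y)
    (hcmk : ∀ (a : ℝ × T → X) (b : ℝ × T → Y), Continuous a → Continuous b →
      Continuous fun t ↦ mk (a t) (b t)) : CofStr T {t | f t ∈ M ∨ g t ∈ L} where
  u t := min (S.u (f t)) (S'.u (g t))
  k s t := mk (S.k (min (max 0 s) (S'.u (g t))) (f t)) (S'.k (min (max 0 s) (S.u (f t))) (g t))
  cont_u := by fun_prop
  cont_k := hcmk _ _ (by fun_prop) (by fun_prop)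
  u_nonneg t := le_min (S.u_nonneg _) (S'.u_nonneg _)
  u_rel t ht := by
    have h1 := S.u_nonneg (f t)
    have h2 := S'.u_nonneg (g t)
    rcases ht with h | h
    · rw [S.u_rel _ h, min_eq_left h2]
    · rw [S'.u_rel _ h, min_eq_right h1]
  k_zero t := by
    rw [max_self, min_eq_left (S'.u_nonneg _), min_eq_left (S.u_nonneg _), S.k_zero, S'.k_zero, hmk]
  k_rel s t ht := by
    have h0 : 0 ≤ max 0 s := le_max_left _ _
    rcases ht with h | h
    · rw [S.k_rel _ _ h, S.u_rel _ h, min_eq_right h0, S'.k_zero, hmk]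
    · rw [S'.k_rel _ _ h, S'.u_rel _ h, min_eq_right h0, S.k_zero, hmk]
  k_mem s t hs hs1 := by
    rw [max_eq_right ((le_min (S.u_nonneg _) (S'.u_nonneg _)).trans hs)]
    rcases le_total (S.u (f t)) (S'.u (g t)) with h | h
    · left
      rw [min_eq_left h] at hs
      rw [hfmk]
      rcases le_total s (S'.u (g t)) with h' | h'
      · rw [min_eq_left h']; exact S.k_mem _ _ hs hs1
      · rw [min_eq_right h']; exact S.k_mem _ _ h (h'.trans hs1)
    · right
      rw [min_eq_right h] at hs
      rw [hgmk]
      rcases le_total s (S.u (f t)) with h' | h'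
      · rw [min_eq_left h']; exact S'.k_mem _ _ hs hs1
      · rw [min_eq_right h']; exact S'.k_mem _ _ h (h'.trans hs1)

/-- The product structure for the ordinary product with a space of parameters. -/
def prodI (S : CofStr I M') (S' : CofStr Y L) : CofStr (I × Y) {p | p.1 ∈ M' ∨ p.2 ∈ L} :=
  prodAux S S' Prod.fst Prod.snd Prod.mk continuous_fst continuous_snd (fun _ ↦ rfl)
    (fun _ _ ↦ rfl) (fun _ _ ↦ rfl) fun _ _ ha hb ↦ ha.prodMk hb

/-- The product structure for the delta-generated product. -/
def dprod {X Y : Type u} [TopologicalSpace X] [TopologicalSpace Y] {M : Set X} {L : Set Y}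
    (S : CofStr X M) (S' : CofStr Y L) : CofStr (DProd X Y) {p | dfst p ∈ M ∨ dsnd p ∈ L} :=
  prodAux S S' dfst dsnd dpair continuous_dfst continuous_dsnd (fun _ ↦ rfl)
    (fun _ _ ↦ rfl) (fun _ _ ↦ rfl) fun _ _ ha hb ↦ continuous_dpair' ha hb

/-- The structure on a quotient by a relation that only relates points of the subspace. -/
def quot (S : CofStr Y L) {r : Y → Y → Prop} (hr : ∀ y y', r y y' → y ∈ L ∧ y' ∈ L) :
    CofStr (Quot r) (Quot.mk r '' L) where
  u := Quot.lift S.u fun y y' h ↦ by rw [S.u_rel _ (hr y y' h).1, S.u_rel _ (hr y y' h).2]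
  k t := Quot.map (S.k t) fun y y' h ↦ by
    rwa [S.k_rel _ _ (hr y y' h).1, S.k_rel _ _ (hr y y' h).2]
  cont_u := continuous_quot_lift _ S.cont_u
  cont_k := continuous_prod_quot (continuous_quot_mk.comp S.cont_k)
  u_nonneg := Quot.ind S.u_nonneg
  u_rel := by rintro _ ⟨y, hy, rfl⟩; exact S.u_rel y hy
  k_zero := Quot.ind fun y ↦ congrArg (Quot.mk r) (S.k_zero y)
  k_rel := by rintro t _ ⟨y, hy, rfl⟩; exact congrArg (Quot.mk r) (S.k_rel t y hy)
  k_mem t := Quot.ind fun y h h1 ↦ ⟨_, S.k_mem t y h h1, rfl⟩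

/-- Replace the subspace by an equal one. -/
def copy (S : CofStr Y L) (L' : Set Y) (h : L' = L) : CofStr Y L' where
  u := S.u
  k := S.k
  cont_u := S.cont_u
  cont_k := S.cont_k
  u_nonneg := S.u_nonneg
  u_rel := h ▸ S.u_rel
  k_zero := S.k_zero
  k_rel := h ▸ S.k_rel
  k_mem := h ▸ S.k_mem

/-- The structure on a disjoint union. -/
def sum (S : CofStr X M) (S' : CofStr Y L) : CofStr (X ⊕ Y) (Sum.inl '' M ∪ Sum.inr '' L) where
  u := Sum.elim S.u S'.u
  k t := Sum.map (S.k t) (S'.k t)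
  cont_u := S.cont_u.sumElim S'.cont_u
  cont_k := continuous_prod_sum (continuous_inl.comp S.cont_k) (continuous_inr.comp S'.cont_k)
  u_nonneg := by rintro (x | y); exacts [S.u_nonneg x, S'.u_nonneg y]
  u_rel := by rintro _ (⟨x, hx, rfl⟩ | ⟨y, hy, rfl⟩); exacts [S.u_rel x hx, S'.u_rel y hy]
  k_zero := by rintro (x | y); exacts [congrArg _ (S.k_zero x), congrArg _ (S'.k_zero y)]
  k_rel := by
    rintro t _ (⟨x, hx, rfl⟩ | ⟨y, hy, rfl⟩)
    exacts [congrArg _ (S.k_rel t x hx), congrArg _ (S'.k_rel t y hy)]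
  k_mem := by
    rintro t (x | y) h h1
    exacts [Or.inl ⟨_, S.k_mem t x h h1, rfl⟩, Or.inr ⟨_, S'.k_mem t y h h1, rfl⟩]

variable (X) in
/-- The whole space as a subspace. -/
def univ : CofStr X Set.univ where
  u _ := 0
  k _ x := x
  cont_u := continuous_const
  cont_k := continuous_snd
  u_nonneg _ := le_rfl
  u_rel _ _ := rfl
  k_zero _ := rfl
  k_rel _ _ _ := rfl
  k_mem _ _ _ _ := trivial

/-- The endpoints of the unit interval. -/
def ends : CofStr I {t | t = 0 ∨ t = 1} where
  u t := 3 * min (t : ℝ) (1 - t)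
  k s t := cI (1 / 2 + (1 + 2 * max 0 s) * (t - 1 / 2))
  cont_u := by fun_prop
  cont_k := by fun_prop
  u_nonneg t := mul_nonneg (by norm_num) (le_min t.2.1 (sub_nonneg.2 t.2.2))
  u_rel := by rintro t (rfl | rfl) <;> norm_num
  k_zero t := by
    rw [max_self, show (1 / 2 + (1 + 2 * 0) * ((t : ℝ) - 1 / 2)) = t by ring, cI_coe]
  k_rel s t h := by
    have := le_max_left 0 s
    rcases h with rfl | rfl
    · refine cI_of_le ?_
      rw [Set.Icc.coe_zero]
      linarith
    · refine cI_of_ge ?_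
      rw [Set.Icc.coe_one]
      linarith
  k_mem s t hs hs1 := by
    have h0 := t.2.1
    have h1 := t.2.2
    have h2 := le_max_right 0 s
    have h3 := le_max_left 0 s
    have h4 : max 0 s ≤ 1 := max_le zero_le_one hs1
    rcases le_total (t : ℝ) (1 - t) with h | h
    · rw [min_eq_left h] at hs
      exact Or.inl (cI_of_le (by nlinarith))
    · rw [min_eq_right h] at hs
      exact Or.inr (cI_of_ge (by nlinarith))

/-- The right endpoint of the unit interval. -/
def one : CofStr I {1} where
  u t := 1 - t
  k s t := cI (t + max 0 s)
  cont_u := by fun_prop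
  cont_k := by fun_prop
  u_nonneg t := sub_nonneg.2 t.2.2
  u_rel := by rintro t rfl; norm_num
  k_zero t := by simp
  k_rel := by rintro s _ rfl; exact cI_of_ge (by simp)
  k_mem s t hs hs1 := cI_of_ge (by have := le_max_right 0 s; linarith)

/-- The extension of a partial homotopy: `f` is extended along `G`, which is only used on `L`. -/
def ext (S : CofStr Y L) (f : Y → Z) (G : ℝ → Y → Z) (t : ℝ) (y : Y) : Z :=
  if S.u y ≤ t then G (t - S.u y) (S.k t y) else f (S.k t y)

theorem continuous_ext (S : CofStr Y L) {f : Y → Z} {G : ℝ → Y → Z} (hf : Continuous f)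
    (hG : ContinuousOn (fun p : ℝ × Y ↦ G p.1 p.2) (Set.univ ×ˢ L)) (h0 : ∀ y ∈ L, G 0 y = f y)
    {T : Type*} [TopologicalSpace T] {a : T → ℝ} {b : T → Y} (ha : Continuous a)
    (hb : Continuous b) (ha1 : ∀ t, a t ≤ 1) : Continuous fun t ↦ S.ext f G (a t) (b t) := by
  refine continuous_if_le (f := fun t ↦ S.u (b t)) (g := a) (by fun_prop) ha ?_
    (Continuous.continuousOn (by fun_prop)) ?_
  · exact hG.comp (f := fun t ↦ (a t - S.u (b t), S.k (a t) (b t)))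
      (Continuous.continuousOn (by fun_prop)) fun t ht ↦ ⟨trivial, S.k_mem _ _ ht (ha1 t)⟩
  · intro t ht
    rw [ht, sub_self, h0 _ (S.k_mem _ _ ht.le (ha1 t))]

omit [TopologicalSpace Z] in
theorem ext_zero (S : CofStr Y L) {f : Y → Z} {G : ℝ → Y → Z} (h0 : ∀ y ∈ L, G 0 y = f y)
    (y : Y) : S.ext f G 0 y = f y := by
  unfold ext
  split_ifs with h
  · have hy : S.u y = 0 := le_antisymm h (S.u_nonneg y)
    rw [hy, sub_self, S.k_zero, h0 _ ((S.mem_iff y).2 hy)]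
  · rw [S.k_zero]

omit [TopologicalSpace Z] in
theorem ext_rel (S : CofStr Y L) {f : Y → Z} {G : ℝ → Y → Z} {y : Y} (hy : y ∈ L) {t : ℝ}
    (ht : 0 ≤ t) : S.ext f G t y = G t y := by
  unfold ext
  rw [S.u_rel y hy, if_pos ht, sub_zero, S.k_rel _ _ hy]

end CofStr

/-! ### Pointed homotopies -/

namespace PtdMap

variable {X Y Z : PtdSpace.{u}}

theorem homotopic_of {f g : PtdMap X Y} (F : I → X → Y) (hF : Continuous fun p : I × X ↦ F p.1 p.2)
    (h0 : ∀ x, F 0 x = f x) (h1 : ∀ x, F 1 x = g x) (hp : ∀ t, F t X.pt = Y.pt) :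
    f.Homotopic g :=
  ⟨{ toFun := fun p ↦ F p.1 p.2
     continuous_toFun := hF
     map_zero_left := h0
     map_one_left := h1
     prop' := by
      rintro t x rfl
      exact (hp t).trans f.map_pt.symm }⟩

theorem Homotopic.exists {f g : PtdMap X Y} (h : f.Homotopic g) :
    ∃ F : I → X → Y, (Continuous fun p : I × X ↦ F p.1 p.2) ∧ (∀ x, F 0 x = f x) ∧
      (∀ x, F 1 x = g x) ∧ ∀ t, F t X.pt = Y.pt := by
  obtain ⟨H⟩ := h
  exact ⟨fun t x ↦ H (t, x), H.continuous, H.apply_zero, H.apply_one, fun t ↦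
    (H.prop t X.pt rfl).trans f.map_pt⟩

@[ext] theorem ext {f g : PtdMap X Y} (h : ∀ x, f x = g x) : f = g := by
  obtain ⟨f, hf⟩ := f
  obtain ⟨g, hg⟩ := g
  congr
  exact ContinuousMap.ext h

theorem Homotopic.refl (f : PtdMap X Y) : f.Homotopic f := ContinuousMap.HomotopicRel.refl _

theorem Homotopic.of_eq {f g : PtdMap X Y} (h : ∀ x, f x = g x) : f.Homotopic g := by
  rw [PtdMap.ext h]; exact Homotopic.refl g

theorem Homotopic.symm {f g : PtdMap X Y} (h : f.Homotopic g) : g.Homotopic f :=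
  ContinuousMap.HomotopicRel.symm h

theorem Homotopic.trans {f g h : PtdMap X Y} (h₁ : f.Homotopic g) (h₂ : g.Homotopic h) :
    f.Homotopic h := ContinuousMap.HomotopicRel.trans h₁ h₂

theorem Homotopic.comp_left {f g : PtdMap X Y} (h : f.Homotopic g) (k : PtdMap Y Z) :
    (k.comp f).Homotopic (k.comp g) := by
  obtain ⟨F, hF, h0, h1, hp⟩ := h.exists
  exact homotopic_of (fun t x ↦ k (F t x)) (by fun_prop) (fun x ↦ congrArg k (h0 x))
    (fun x ↦ congrArg k (h1 x)) fun t ↦ (congrArg k (hp t)).trans k.map_pt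

theorem Homotopic.comp_right {f g : PtdMap Y Z} (h : f.Homotopic g) (k : PtdMap X Y) :
    (f.comp k).Homotopic (g.comp k) := by
  obtain ⟨F, hF, h0, h1, hp⟩ := h.exists
  refine homotopic_of (fun t x ↦ F t (k x)) ?_ (fun x ↦ h0 _) (fun x ↦ h1 _) fun t ↦ ?_
  · exact hF.comp (f := fun p : I × X ↦ (p.1, k p.2)) (by fun_prop)
  · exact (congrArg (F t) k.map_pt).trans (hp t)

theorem IsHomotopyEquiv.of_inverse (f : PtdMap X Y) (g : PtdMap Y X) (h : ∀ x, g (f x) = x)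
    (h' : ∀ y, f (g y) = y) : f.IsHomotopyEquiv :=
  ⟨g, Homotopic.of_eq h, Homotopic.of_eq h'⟩

theorem IsHomotopyEquiv.comp {g : PtdMap Y Z} {f : PtdMap X Y} (hg : g.IsHomotopyEquiv)
    (hf : f.IsHomotopyEquiv) : (g.comp f).IsHomotopyEquiv := by
  obtain ⟨g', h1, h2⟩ := hg
  obtain ⟨f', h3, h4⟩ := hf
  exact ⟨f'.comp g', (((h1.comp_right f).comp_left f').trans h3 :),
    (((h4.comp_right g').comp_left g).trans h2 :)⟩

/-- A criterion for homotopy equivalences. -/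
theorem IsHomotopyEquiv.of_left_inverses {W : PtdSpace.{u}} {F : PtdMap X Y} {G : PtdMap Y W}
    {h : PtdMap W X} {L : PtdMap W Y} (hh : h.IsHomotopyEquiv)
    (h₁ : (h.comp (G.comp F)).Homotopic (PtdMap.id X)) (h₂ : (L.comp G).Homotopic (PtdMap.id Y)) :
    F.IsHomotopyEquiv := by
  obtain ⟨k, hk, hk'⟩ := hh
  have e1 : (G.comp F).Homotopic k :=
    ((hk.comp_right (G.comp F)).symm.trans (h₁.comp_left k) :)
  have e2 : (L.comp (G.comp (F.comp h))).Homotopic L :=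
    (((e1.comp_right h).trans hk).comp_left L :)
  have e3 : (L.comp (G.comp (F.comp h))).Homotopic (F.comp h) := (h₂.comp_right (F.comp h) :)
  exact ⟨h.comp G, h₁, (((e3.symm.trans e2).comp_right G).trans h₂ :)⟩

end PtdMap

end RelJames

namespace RelJames

/-! ### Adjunction spaces -/

section Adj

variable (B : PtdSpace.{u}) (Y : Type u) [TopologicalSpace Y] [DeltaGeneratedSpace Y]
  (L : Set Y) (a : Y → B)

/-- The identifications in the adjunction space. -/
inductive AdjRel : B ⊕ Y → B ⊕ Y → Prop
  | glue (y : Y) (hy : y ∈ L) : AdjRel (Sum.inr y) (Sum.inl (a y))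

/-- The adjunction space `B ∪ Y` with `y ∈ L` glued to `a y`. -/
def Adj : PtdSpace.{u} where
  carrier := Quot (AdjRel B Y L a)
  pt := Quot.mk _ (Sum.inl B.pt)

namespace Adj

/-- The inclusion of `B`. -/
def inl : PtdMap B (Adj B Y L a) where
  toFun b := Quot.mk _ (Sum.inl b)
  continuous_toFun := continuous_quot_mk.comp continuous_inl
  map_pt := rfl

variable {B Y L a}
variable {T : PtdSpace.{u}} {B' : PtdSpace.{u}}

/-- The canonical map from `Y`. -/
def inr (y : Y) : Adj B Y L a := Quot.mk _ (Sum.inr y)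

@[fun_prop] theorem continuous_inr' {T : Type*} [TopologicalSpace T] {f : T → Y}
    (hf : Continuous f) : Continuous fun t ↦ (inr (f t) : Adj B Y L a) :=
  continuous_quot_mk.comp (continuous_inr.comp hf)

theorem inr_eq {y : Y} (hy : y ∈ L) : (inr y : Adj B Y L a) = inl B Y L a (a y) :=
  Quot.sound (AdjRel.glue y hy)

/-- A map out of the adjunction space. -/
def desc (f : PtdMap B T) (g : Y → T) (hg : Continuous g) (h : ∀ y ∈ L, g y = f (a y)) :
    PtdMap (Adj B Y L a) T where
  toFun := Quot.lift (Sum.elim f g) <| by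
    rintro _ _ ⟨y, hy⟩
    exact h y hy
  continuous_toFun := continuous_quot_lift _ (f.cont.sumElim hg)
  map_pt := f.map_pt

theorem ind {p : Adj B Y L a → Prop} (hl : ∀ b, p (inl B Y L a b)) (hr : ∀ y, p (inr y)) :
    ∀ x, p x := by
  intro x
  induction x using Quot.ind with | mk x => ?_
  rcases x with b | y
  exacts [hl b, hr y]

theorem homotopic {f g : PtdMap (Adj B Y L a) T} (F : I → B → T) (G : I → Y → T)
    (hF : Continuous fun p : I × B ↦ F p.1 p.2) (hG : Continuous fun p : I × Y ↦ G p.1 p.2)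
    (hFG : ∀ t, ∀ y ∈ L, G t y = F t (a y)) (hp : ∀ t, F t B.pt = T.pt)
    (hF0 : ∀ b, F 0 b = f (inl B Y L a b)) (hF1 : ∀ b, F 1 b = g (inl B Y L a b))
    (hG0 : ∀ y, G 0 y = f (inr y)) (hG1 : ∀ y, G 1 y = g (inr y)) : f.Homotopic g := by
  refine PtdMap.homotopic_of (fun t ↦ Quot.lift (Sum.elim (F t) (G t)) ?_) ?_ ?_ ?_ hp
  · rintro _ _ ⟨y, hy⟩
    exact hFG t y hy
  · exact continuous_prod_quot (continuous_prod_sum hF hG)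
  · exact ind hF0 hG0
  · exact ind hF1 hG1

variable (S : CofStr Y L)

/-- Two attaching maps that are homotopic by the homotopy `A` from `a` to `a'`. -/
structure AttHomotopy (L : Set Y) (a a' : Y → B) (A : ℝ → Y → B) : Prop where
  cont : ContinuousOn (fun p : ℝ × Y ↦ A p.1 p.2) (Set.univ ×ˢ L)
  zero : ∀ y ∈ L, A 0 y = a y
  one : ∀ y ∈ L, A 1 y = a' y

omit [DeltaGeneratedSpace Y] in
theorem AttHomotopy.symm {a a' : Y → B} {A : ℝ → Y → B} (h : AttHomotopy L a a' A) :
    AttHomotopy L a' a (fun t ↦ A (1 - t)) where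
  cont := h.cont.comp (f := fun p : ℝ × Y ↦ (1 - p.1, p.2)) (Continuous.continuousOn (by fun_prop))
    fun _ hp ↦ ⟨trivial, hp.2⟩
  zero y hy := by rw [sub_zero]; exact h.one y hy
  one y hy := by rw [sub_self]; exact h.zero y hy

variable {S} {a' : Y → B} {A : ℝ → Y → B}

theorem AttHomotopy.continuous_ext (h : AttHomotopy L a a' A) {T : Type*} [TopologicalSpace T]
    {f : T → ℝ} {g : T → Y} (hf : Continuous f) (hg : Continuous g) (hf1 : ∀ t, f t ≤ 1) :
    Continuous fun t ↦ S.ext (inr : Y → Adj B Y L a) (fun s y ↦ inl B Y L a (A s y))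
      (f t) (g t) :=
  S.continuous_ext (by fun_prop) ((inl B Y L a).cont.comp_continuousOn h.cont)
    (fun y hy ↦ by rw [h.zero y hy, inr_eq hy]) hf hg hf1

variable (S) in
/-- The comparison of the adjunction spaces for homotopic attaching maps. -/
def push (h : AttHomotopy L a a' A) : PtdMap (Adj B Y L a') (Adj B Y L a) :=
  desc (inl B Y L a)
    (fun y ↦ S.ext (inr : Y → Adj B Y L a) (fun s y ↦ inl B Y L a (A s y)) 1 y)
    (h.continuous_ext continuous_const continuous_id fun _ ↦ le_rfl)
    fun y hy ↦ by rw [S.ext_rel hy zero_le_one, h.one y hy]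

theorem push_inr (h : AttHomotopy L a a' A) (y : Y) : push S h (inr y) =
    S.ext (inr : Y → Adj B Y L a) (fun s y ↦ inl B Y L a (A s y)) 1 y := rfl

theorem push_inl (h : AttHomotopy L a a' A) (b : B) :
    push S h (inl B Y L a' b) = inl B Y L a b := rfl

theorem push_push (h : AttHomotopy L a a' A) :
    ((push S h.symm).comp (push S h)).Homotopic (PtdMap.id _) := by
  refine PtdMap.Homotopic.symm <| homotopic (fun _ b ↦ inl B Y L a' b)
    (fun t y ↦ S.ext (inr : Y → Adj B Y L a') (fun s y ↦ inl B Y L a' (A (1 - s) y))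
      (t * min 1 (S.u y)) (S.k t y)) (by fun_prop) ?_ ?_ (fun _ ↦ rfl) (fun _ ↦ rfl)
      (fun _ ↦ rfl) ?_ ?_
  · exact h.symm.continuous_ext (by fun_prop) (by fun_prop)
      fun p ↦ mul_le_one₀ p.1.2.2 (le_min zero_le_one (S.u_nonneg _)) (min_le_left _ _)
  · intro t y hy
    rw [S.k_rel _ _ hy, S.ext_rel hy, S.u_rel _ hy, min_eq_right zero_le_one, mul_zero, sub_zero,
      h.one y hy]
    rw [S.u_rel _ hy, min_eq_right zero_le_one, mul_zero]
  · intro y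
    rw [Set.Icc.coe_zero, zero_mul, S.k_zero, S.ext_zero]
    · rfl
    · intro y hy
      rw [sub_zero, h.one y hy, inr_eq hy]
  · intro y
    rw [Set.Icc.coe_one, one_mul]
    change _ = push S h.symm (push S h (inr y))
    rw [push_inr]
    rcases le_or_gt (S.u y) 1 with hu | hu
    · have hk := S.k_mem 1 y hu le_rfl
      rw [min_eq_right hu, S.ext_rel hk (S.u_nonneg y), CofStr.ext, if_pos hu]
      rfl
    · rw [min_eq_left hu.le]
      conv_rhs => rw [CofStr.ext, if_neg hu.not_ge]
      rfl

theorem isHomotopyEquiv_push (h : AttHomotopy L a a' A) : (push S h).IsHomotopyEquiv := by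
  refine ⟨push S h.symm, push_push h, ?_⟩
  have := push_push (S := S) h.symm
  simpa only [sub_sub_cancel] using this

theorem desc_push (h : AttHomotopy L a a' A) (f : PtdMap (Adj B Y L a) T)
    (hf : ∀ b, f (inl B Y L a b) = T.pt) (f' : PtdMap (Adj B Y L a') T)
    (hf' : ∀ b, f' (inl B Y L a' b) = T.pt) (hff : ∀ y, f' (inr y) = f (inr y)) :
    (f.comp (push S h)).Homotopic f' := by
  refine PtdMap.Homotopic.symm <| homotopic (fun _ _ ↦ T.pt) (fun t y ↦ f (inr (S.k t y)))
    continuous_const (f.cont_comp (by fun_prop)) ?_ (fun _ ↦ rfl) (fun b ↦ (hf' b).symm)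
    (fun b ↦ (hf b).symm) ?_ ?_
  · intro t y hy
    rw [S.k_rel _ _ hy, inr_eq hy, hf]
  · intro y
    rw [hff, Set.Icc.coe_zero, S.k_zero]
  · intro y
    change _ = f (push S h (inr y))
    rw [push_inr]
    rcases le_or_gt (S.u y) 1 with hu | hu
    · have hk := S.k_mem 1 y hu le_rfl
      rw [CofStr.ext, if_pos hu, hf, Set.Icc.coe_one, inr_eq hk, hf]
    · rw [CofStr.ext, if_neg hu.not_ge]
      rfl

variable (a) in
/-- The map of adjunction spaces induced by a map of `B`. -/
def mapB (e : PtdMap B B') : PtdMap (Adj B Y L a) (Adj B' Y L fun y ↦ e (a y)) :=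
  desc ((inl B' Y L _).comp e) inr (by fun_prop) fun _ hy ↦ inr_eq hy

include S in
theorem exists_left_inverse_mapB (ha : ContinuousOn a L) (e : PtdMap B B') (e' : PtdMap B' B)
    (he : (e'.comp e).Homotopic (PtdMap.id B)) :
    ∃ h : PtdMap (Adj B Y L fun y ↦ e' (e (a y))) (Adj B Y L a), h.IsHomotopyEquiv ∧
      (h.comp ((mapB (fun y ↦ e (a y)) e').comp (mapB a e))).Homotopic (PtdMap.id _) := by
  obtain ⟨M, hM, hM0, hM1, hMp⟩ := he.symm.exists
  have hA : AttHomotopy L a (fun y ↦ e' (e (a y))) fun t y ↦ M (cI t) (a y) := by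
    refine ⟨?_, fun y _ ↦ ?_, fun y _ ↦ ?_⟩
    · exact hM.comp_continuousOn (f := fun p : ℝ × Y ↦ (cI p.1, a p.2))
        (ContinuousOn.prodMk (Continuous.continuousOn (by fun_prop))
          (ha.comp continuousOn_snd fun p hp ↦ hp.2))
    · rw [cI_zero]; exact hM0 _
    · rw [cI_one]; exact hM1 _
  refine ⟨push S hA, isHomotopyEquiv_push hA, PtdMap.Homotopic.symm <|
    homotopic (fun t b ↦ inl B Y L a (M t b))
      (fun t y ↦ S.ext inr (fun s y ↦ inl B Y L a (M (cI s) (a y))) t y)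
      (by fun_prop) ?_ ?_ ?_ ?_ ?_ ?_ ?_⟩
  · exact hA.continuous_ext (by fun_prop) (by fun_prop) fun p ↦ p.1.2.2
  · intro t y hy
    rw [S.ext_rel hy t.2.1, cI_coe]
  · intro t
    rw [hMp]; rfl
  · intro b
    rw [hM0]; rfl
  · intro b
    rw [hM1]; rfl
  · intro y
    rw [Set.Icc.coe_zero, S.ext_zero]
    · rfl
    · intro y hy
      rw [cI_zero, hM0, inr_eq hy]; rfl
  · intro y
    rfl

include S in
/-- Attaching along homotopy equivalent spaces. -/
theorem isHomotopyEquiv_mapB (ha : ContinuousOn a L) {e : PtdMap B B'} (he : e.IsHomotopyEquiv) :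
    (mapB a e : PtdMap (Adj B Y L a) _).IsHomotopyEquiv := by
  obtain ⟨e', h1, h2⟩ := he
  obtain ⟨h, hh, h3⟩ := exists_left_inverse_mapB (S := S) ha e e' h1
  obtain ⟨l, -, h4⟩ := exists_left_inverse_mapB (S := S) (e.cont.comp_continuousOn ha) e' e h2
  exact PtdMap.IsHomotopyEquiv.of_left_inverses (L := l.comp (mapB _ e)) hh h3 h4

include S in
theorem exists_equiv_mapB (ha : ContinuousOn a L) {e : PtdMap B B'} (he : e.IsHomotopyEquiv)
    {a₂ : Y → B'} (h : ∀ y, e (a y) = a₂ y) :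
    ∃ k : PtdMap (Adj B Y L a) (Adj B' Y L a₂), k.IsHomotopyEquiv ∧
      ∀ b, k (inl B Y L a b) = inl B' Y L a₂ (e b) := by
  obtain rfl : (fun y ↦ e (a y)) = a₂ := funext h
  exact ⟨_, isHomotopyEquiv_mapB (S := S) ha he, fun _ ↦ rfl⟩

end Adj
end Adj

end RelJames

namespace RelJames

theorem isQuotientMap_prodMk_left {K X Y : Type*} [TopologicalSpace K] [LocallyCompactSpace K]
    [TopologicalSpace X] [TopologicalSpace Y] {π : Y → X} (hπ : IsQuotientMap π) :
    IsQuotientMap fun p : K × Y ↦ (p.1, π p.2) := by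
  have hc := hπ.continuous
  refine ⟨isCoinducing_iff.2 fun V ↦ ⟨fun hV ↦ ?_, fun hV ↦ hV.preimage (by fun_prop)⟩,
    fun p ↦ ?_⟩
  · rw [isOpen_iff_continuous_mem] at hV ⊢
    exact hπ.continuous_lift_prod_right hV
  · obtain ⟨y, hy⟩ := hπ.surjective p.2
    exact ⟨(p.1, y), by rw [hy]⟩

namespace Adj

variable {B : PtdSpace.{u}} {Y Y₂ : Type u} [TopologicalSpace Y] [DeltaGeneratedSpace Y]
  [TopologicalSpace Y₂] [DeltaGeneratedSpace Y₂] {L : Set Y} {L₂ : Set Y₂} {a : Y → B}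
  {a₂ : Y₂ → B}

/-- Adjunction spaces do not change under relative homeomorphisms. -/
theorem exists_equiv_of_isQuotientMap {q : Y → Y₂} (hq : IsQuotientMap q)
    (hL : ∀ y, q y ∈ L₂ ↔ y ∈ L) (hinj : ∀ y y', q y = q y' → y = y' ∨ y ∈ L)
    (ha : ∀ y ∈ L, a y = a₂ (q y)) :
    ∃ h : PtdMap (Adj B Y L a) (Adj B Y₂ L₂ a₂), h.IsHomotopyEquiv ∧
      (∀ b, h (inl B Y L a b) = inl B Y₂ L₂ a₂ b) ∧ ∀ y, h (inr y) = inr (q y) := by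
  have hc := hq.continuous
  have hwd : ∀ y y', q y = q y' → (inr y : Adj B Y L a) = inr y' := by
    intro y y' h
    rcases hinj y y' h with rfl | hy
    · rfl
    · have hy' : y' ∈ L := by rw [← hL, ← h, hL]; exact hy
      rw [inr_eq hy, inr_eq hy', ha y hy, ha y' hy', h]
  let s : Y₂ → Y := Function.surjInv hq.surjective
  have hs : ∀ y, (inr (s (q y)) : Adj B Y L a) = inr y := fun y ↦
    hwd _ _ (Function.surjInv_eq hq.surjective _)
  have hs' : ∀ y, q (s y) = y := Function.surjInv_eq hq.surjective
  let h : PtdMap (Adj B Y L a) (Adj B Y₂ L₂ a₂) :=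
    desc (inl B Y₂ L₂ a₂) (fun y ↦ inr (q y)) (by fun_prop) fun y hy ↦ by
      rw [inr_eq ((hL y).2 hy), ha y hy]
  let h' : PtdMap (Adj B Y₂ L₂ a₂) (Adj B Y L a) :=
    desc (inl B Y L a) (fun y ↦ inr (s y)) (by
      rw [hq.continuous_iff]
      have : (fun y ↦ (inr (s y) : Adj B Y L a)) ∘ q = inr := funext hs
      rw [this]
      fun_prop) fun y hy ↦ by
      have : s y ∈ L := by rw [← hL, hs']; exact hy
      rw [inr_eq this, ha _ this, hs']
  refine ⟨h, PtdMap.IsHomotopyEquiv.of_inverse h h' ?_ ?_, fun _ ↦ rfl, fun _ ↦ rfl⟩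
  · exact ind (fun _ ↦ rfl) hs
  · exact ind (fun _ ↦ rfl) fun y ↦ congrArg inr (hs' y)

end Adj

/-! ### Mapping cones -/

section Cone

variable {V B B' : PtdSpace.{u}}

/-- The points of `I × V` that are glued in the mapping cone. -/
def coneSet (V : PtdSpace.{u}) : Set (I × V) := {p | p.1 ∈ {t : I | t = 0 ∨ t = 1} ∨ p.2 ∈ ({V.pt} : Set V)}

open Classical in
/-- The attaching map of the mapping cone, on `{0, 1} × V ∪ I × *`. -/
def coneAtt (γ : V → B) (p : I × V) : B := if p.1 = 1 then γ p.2 else B.pt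

theorem coneAtt_of_mem {γ : V → B} (hγ : γ V.pt = B.pt) {p : I × V} (h : p.1 = 0 ∨ p.2 = V.pt) :
    coneAtt γ p = B.pt := by
  unfold coneAtt
  split_ifs with h1
  · rcases h with h | h
    · exact absurd (h1.symm.trans h) one_ne_zero
    · rw [h, hγ]
  · rfl

theorem continuousOn_coneAtt (hV : IsClosed ({V.pt} : Set V)) {T : Type*} [TopologicalSpace T]
    (F : T → V → B)
    (hF : Continuous fun p : T × V ↦ F p.1 p.2) (hp : ∀ t, F t V.pt = B.pt) :
    ContinuousOn (fun p : T × (I × V) ↦ coneAtt (F p.1) p.2) {p | p.2 ∈ coneSet V} := by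
  have hset : {p : T × (I × V) | p.2 ∈ coneSet V} =
      {p | p.2.1 = 1} ∪ {p | p.2.1 = 0 ∨ p.2.2 ∈ ({V.pt} : Set V)} := by
    ext p
    simp only [coneSet, Set.mem_ofPred_eq, Set.mem_union]
    tauto
  rw [hset]
  have c1 : IsClosed {p : T × (I × V) | p.2.1 = 1} :=
    isClosed_eq (by fun_prop) continuous_const
  have c2 : IsClosed {p : T × (I × V) | p.2.1 = 0 ∨ p.2.2 ∈ ({V.pt} : Set V)} :=
    (isClosed_eq (f := fun p : T × (I × V) ↦ p.2.1) (by fun_prop) continuous_const).union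
      (hV.preimage (by fun_prop))
  refine ContinuousOn.union_of_isClosed ?_ ?_ c1 c2
  · refine ContinuousOn.congr (f := fun p ↦ F p.1 p.2.2) (Continuous.continuousOn ?_) ?_
    · exact hF.comp (f := fun p : T × (I × V) ↦ (p.1, p.2.2)) (by fun_prop)
    · intro p hp
      exact if_pos hp
  · exact continuousOn_const.congr fun p h ↦ coneAtt_of_mem (hp p.1) h

/-- The mapping cone as an adjunction space. -/
abbrev ConeAdj (γ : V → B) : PtdSpace.{u} := Adj B (I × V) (coneSet V) (coneAtt γ)

/-- The homeomorphism from the adjunction space to the mapping cone. -/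
def coneOfAdj (γ : PtdMap V B) : PtdMap (ConeAdj γ) (MapCone γ) :=
  Adj.desc (MapCone.incl γ) (fun p ↦ Quot.mk _ (Sum.inr p))
    (continuous_quot_mk.comp continuous_inr) <| by
    rintro ⟨t, v⟩ h
    by_cases h1 : t = 1
    · subst h1
      rw [coneAtt, if_pos rfl]
      exact Quot.sound (ConeRel.glue v)
    · have h2 : t = 0 ∨ v = V.pt := by
        rcases h with h | h
        exacts [Or.inl (h.resolve_right h1), Or.inr h]
      rw [coneAtt_of_mem γ.map_pt h2]
      rcases h2 with h | h
      · obtain rfl : t = 0 := h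
        exact Quot.sound (ConeRel.apex v)
      · obtain rfl : v = V.pt := h
        exact Quot.sound (ConeRel.base t)

theorem isHomotopyEquiv_coneOfAdj (γ : PtdMap V B) : (coneOfAdj γ).IsHomotopyEquiv := by
  let g : PtdMap (MapCone γ) (ConeAdj γ) :=
    { toFun := Quot.lift (Sum.elim (Adj.inl B _ _ _) Adj.inr) <| by
        rintro _ _ (x | x | t)
        · have h : ((1 : I), x) ∈ coneSet V := Or.inl (Or.inr rfl)
          refine (Adj.inr_eq h).trans ?_
          rw [coneAtt, if_pos rfl]; rfl
        · have h : ((0 : I), x) ∈ coneSet V := Or.inl (Or.inl rfl)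
          refine (Adj.inr_eq h).trans ?_
          rw [coneAtt_of_mem γ.map_pt (Or.inl rfl)]; rfl
        · have h : (t, V.pt) ∈ coneSet V := Or.inr rfl
          refine (Adj.inr_eq h).trans ?_
          rw [coneAtt_of_mem γ.map_pt (Or.inr rfl)]; rfl
      continuous_toFun := continuous_quot_lift _
        ((Adj.inl B _ _ _).cont.sumElim (by fun_prop))
      map_pt := rfl }
  refine PtdMap.IsHomotopyEquiv.of_inverse _ g (Adj.ind (fun _ ↦ rfl) fun _ ↦ rfl) ?_
  intro x
  induction x using Quot.ind with | mk x => ?_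
  rcases x with b | y <;> rfl

/-- The structure on `I × V` that is used for mapping cones. -/
def coneCof (S : CofStr V {V.pt}) : CofStr (I × V) (coneSet V) := CofStr.ends.prodI S

theorem exists_coneAdj_equiv_of_homotopic (S : CofStr V {V.pt}) {γ γ' : PtdMap V B}
    (h : γ.Homotopic γ') : ∃ h : PtdMap (ConeAdj γ) (ConeAdj γ'), h.IsHomotopyEquiv ∧
      ∀ b, h (Adj.inl B _ _ _ b) = Adj.inl B _ _ _ b := by
  obtain ⟨F, hF, h0, h1, hp⟩ := h.symm.exists
  have hA : Adj.AttHomotopy (coneSet V) (coneAtt γ') (coneAtt γ)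
      fun t p ↦ coneAtt (F (cI t)) p := by
    refine ⟨?_, fun y _ ↦ ?_, fun y _ ↦ ?_⟩
    · refine (continuousOn_coneAtt S.isClosed (fun t : ℝ ↦ F (cI t)) ?_ fun t ↦ hp _).mono
        fun p hp ↦ hp.2
      exact hF.comp (f := fun p : ℝ × V ↦ (cI p.1, p.2)) (by fun_prop)
    · simp only [coneAtt, cI_zero, h0]
    · simp only [coneAtt, cI_one, h1]
  exact ⟨_, Adj.isHomotopyEquiv_push (S := coneCof S) hA, fun b ↦ rfl⟩

/-- Homotopic maps have homotopy equivalent mapping cones. -/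
theorem MapCone.exists_equiv_of_homotopic (S : CofStr V {V.pt}) {γ γ' : PtdMap V B}
    (h : γ.Homotopic γ') : ∃ h : PtdMap (MapCone γ) (MapCone γ'), h.IsHomotopyEquiv ∧
      (h.comp (MapCone.incl γ)).Homotopic (MapCone.incl γ') := by
  obtain ⟨k, hk, hk'⟩ := exists_coneAdj_equiv_of_homotopic S h
  obtain ⟨c, hc, hc'⟩ := isHomotopyEquiv_coneOfAdj γ
  refine ⟨(coneOfAdj γ').comp (k.comp c), (isHomotopyEquiv_coneOfAdj γ').comp (hk.comp ⟨_, hc', hc⟩),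
    ?_⟩
  have e1 : (c.comp (MapCone.incl γ)).Homotopic (Adj.inl B _ _ _) := 
    (hc.comp_right (Adj.inl B _ _ _) :)
  refine (e1.comp_left ((coneOfAdj γ').comp k) :).trans (PtdMap.Homotopic.of_eq fun b ↦ ?_)
  exact congrArg (coneOfAdj γ') (hk' b)

/-- Mapping cones of maps to homotopy equivalent spaces. -/
theorem MapCone.exists_equiv_of_comp (S : CofStr V {V.pt}) (γ : PtdMap V B) {e : PtdMap B B'}
    (he : e.IsHomotopyEquiv) : ∃ h : PtdMap (MapCone γ) (MapCone (e.comp γ)), h.IsHomotopyEquiv ∧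
      (h.comp (MapCone.incl γ)).Homotopic ((MapCone.incl (e.comp γ)).comp e) := by
  have hco : ContinuousOn (coneAtt γ) (coneSet V) :=
    (continuousOn_coneAtt S.isClosed (fun _ : I ↦ (γ : V → B)) (by fun_prop) fun _ ↦ γ.map_pt).comp
      (f := fun p : I × V ↦ ((0 : I), p)) (Continuous.continuousOn (by fun_prop)) fun _ h ↦ h
  obtain ⟨k, hk, hk'⟩ := Adj.exists_equiv_mapB (S := coneCof S) (a₂ := coneAtt (e.comp γ)) hco he
    fun p ↦ by
      unfold coneAtt
      split_ifs
      exacts [rfl, e.map_pt]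
  obtain ⟨c, hc, hc'⟩ := isHomotopyEquiv_coneOfAdj γ
  refine ⟨(coneOfAdj (e.comp γ)).comp (k.comp c),
    (isHomotopyEquiv_coneOfAdj (e.comp γ)).comp (hk.comp ⟨_, hc', hc⟩), ?_⟩
  have e1 : (c.comp (MapCone.incl γ)).Homotopic (Adj.inl B _ _ _) :=
    (hc.comp_right (Adj.inl B _ _ _) :)
  refine (e1.comp_left ((coneOfAdj (e.comp γ)).comp k) :).trans (PtdMap.Homotopic.of_eq fun b ↦ ?_)
  exact congrArg (coneOfAdj (e.comp γ)) (hk' b)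

end Cone

/-! ### Cofibration structures at the base points -/

section Base

variable {X Y : PtdSpace.{u}}

/-- The structure on a suspension. -/
def CofStr.susp (S : CofStr X {X.pt}) : CofStr (Susp X) {(Susp X).pt} :=
  ((CofStr.ends.prodI S).quot (r := fun p q : I × X ↦ SuspCollapsed X p ∧ SuspCollapsed X q)
    (fun p q h ↦ ⟨by simpa [SuspCollapsed, or_assoc] using h.1,
      by simpa [SuspCollapsed, or_assoc] using h.2⟩)).copy _ <| by
    refine Set.Subset.antisymm ?_ ?_
    · rintro _ rfl
      exact ⟨(0, X.pt), Or.inr rfl, rfl⟩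
    · rintro _ ⟨p, hp, rfl⟩
      exact Susp.mk_eq_pt (or_assoc.1 hp)

/-- The structure on a smash product. -/
def CofStr.smash (S : CofStr X {X.pt}) (S' : CofStr Y {Y.pt}) :
    CofStr (Smash X Y) {(Smash X Y).pt} :=
  ((S.dprod S').quot (r := fun p q : DProd X Y ↦ OnAxes X Y p ∧ OnAxes X Y q)
    (fun p q h ↦ h)).copy _ <| by
    refine Set.Subset.antisymm ?_ ?_
    · rintro _ rfl
      exact ⟨dpair X.pt Y.pt, Or.inl rfl, rfl⟩
    · rintro _ ⟨p, hp, rfl⟩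
      exact Smash.mk_eq_pt hp

/-- The structure on a wedge. -/
def CofStr.wedge (S : CofStr X {X.pt}) (S' : CofStr Y {Y.pt}) :
    CofStr (Wedge X Y) {(Wedge X Y).pt} :=
  ((S.sum S').quot (r := fun p q : X ⊕ Y ↦ p = Sum.inl X.pt ∧ q = Sum.inr Y.pt)
    (by rintro p q ⟨rfl, rfl⟩; exact ⟨Or.inl ⟨_, rfl, rfl⟩, Or.inr ⟨_, rfl, rfl⟩⟩)).copy _ <| by
    refine Set.Subset.antisymm ?_ ?_
    · rintro _ rfl
      exact ⟨Sum.inl X.pt, Or.inl ⟨_, rfl, rfl⟩, rfl⟩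
    · rintro _ ⟨p, ⟨x, hp, rfl⟩ | ⟨y, hp, rfl⟩, rfl⟩
      · obtain rfl : x = X.pt := hp
        rfl
      · obtain rfl : y = Y.pt := hp
        exact (Wedge.inr X Y).map_pt

/-- The structure on a mapping cylinder and the inclusion of the target. -/
def CofStr.mapCyl (S : CofStr X {X.pt}) (f : PtdMap X Y) :
    CofStr (MapCyl f) (Set.range (MapCyl.target f)) :=
  (((CofStr.univ Y).sum (CofStr.one.prodI S)).quot (r := CylRel f) (by
    rintro _ _ (x | t)
    · exact ⟨Or.inr ⟨(1, x), Or.inl (Set.mem_singleton _), rfl⟩, Or.inl ⟨_, trivial, rfl⟩⟩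
    · exact ⟨Or.inr ⟨(t, X.pt), Or.inr (Set.mem_singleton _), rfl⟩,
        Or.inl ⟨_, trivial, rfl⟩⟩)).copy _ <| by
    refine Set.Subset.antisymm ?_ ?_
    · rintro _ ⟨y, rfl⟩
      exact ⟨Sum.inl y, Or.inl ⟨_, trivial, rfl⟩, rfl⟩
    · rintro _ ⟨p, ⟨y, hp, rfl⟩ | ⟨⟨t, x⟩, hp, rfl⟩, rfl⟩
      · exact ⟨y, rfl⟩
      · rcases hp with h | h
        · obtain rfl : t = 1 := h
          exact ⟨f x, (Quot.sound (CylRel.glue x)).symm⟩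
        · obtain rfl : x = X.pt := h
          exact ⟨Y.pt, (Quot.sound (CylRel.base t)).symm⟩

theorem CofStr.mapCyl_u_le (S : CofStr X {X.pt}) (f : PtdMap X Y) (p : MapCyl f) :
    (CofStr.mapCyl S f).u p ≤ 1 := by
  induction p using Quot.ind with | mk p => ?_
  rcases p with y | p
  · exact zero_le_one
  · exact (min_le_left _ _).trans (sub_le_self _ p.1.2.1)

end Base

end RelJames

namespace RelJames

/-! ### Sections over CW complexes -/

section CWSection

open Metric

variable {X : Type*} [TopologicalSpace X] [T2Space X] [CWComplex (Set.univ : Set X)]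
  {E : Type*} [TopologicalSpace E]

theorem continuousOn_closedCell {n : ℕ} {j : RelCWComplex.cell (Set.univ : Set X) n} {g : X → E}
    (h : ContinuousOn (fun y ↦ g (RelCWComplex.map n j y)) (closedBall 0 1)) :
    ContinuousOn g (RelCWComplex.closedCell n j) := by
  rw [continuousOn_iff_isClosed]
  intro t ht
  rw [continuousOn_iff_isClosed] at h
  obtain ⟨w, hw, hw'⟩ := h t ht
  refine ⟨RelCWComplex.map n j '' (w ∩ closedBall 0 1), ?_, ?_⟩
  · exact (((isCompact_closedBall _ _).inter_left hw).image_of_continuousOn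
      ((RelCWComplex.continuousOn n j).mono Set.inter_subset_right)).isClosed
  · rw [← hw']
    ext x
    constructor
    · rintro ⟨hx, y, hy, rfl⟩
      exact ⟨⟨y, ⟨hx, hy⟩, rfl⟩, y, hy, rfl⟩
    · rintro ⟨⟨y, ⟨hy, hy'⟩, rfl⟩, -⟩
      exact ⟨hy, y, hy', rfl⟩

theorem continuous_of_closedCells {g : X → E}
    (h : ∀ (n : ℕ) (j : RelCWComplex.cell (Set.univ : Set X) n),
      ContinuousOn (fun y ↦ g (RelCWComplex.map n j y)) (closedBall 0 1)) : Continuous g := by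
  rw [continuous_iff_isClosed]
  intro t ht
  rw [CWComplex.closed (Set.univ : Set X) _ (Set.subset_univ _)]
  intro n j
  rw [Set.inter_comm]
  exact (continuousOn_closedCell (h n j)).preimage_isClosed_of_isClosed
    RelCWComplex.isClosed_closedCell ht

/-- The property of a partial section over the cells of dimension less than `n`. -/
structure IsPartialSection (p : E → X) (v : RelCWComplex.cell (Set.univ : Set X) 0) (e₀ : E)
    (n : ℕ) (g : X → E) : Prop where
  cont : ∀ m < n, ∀ j : RelCWComplex.cell (Set.univ : Set X) m,
    ContinuousOn (fun y ↦ g (RelCWComplex.map m j y)) (closedBall 0 1)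
  sec : ∀ m < n, ∀ j : RelCWComplex.cell (Set.univ : Set X) m, ∀ x ∈ RelCWComplex.closedCell m j,
    p (g x) = x
  base : 0 < n → g (RelCWComplex.map 0 v ![]) = e₀

/-- Sections extend over cells. -/
def ExtendsOverCells (p : E → X) : Prop :=
  ∀ (n : ℕ) (χ : (Fin n → ℝ) → X), ContinuousOn χ (closedBall 0 1) → ∀ s : (Fin n → ℝ) → E,
    ContinuousOn s (sphere 0 1) → (∀ y ∈ sphere (0 : Fin n → ℝ) 1, p (s y) = χ y) →
    ∃ s' : (Fin n → ℝ) → E, ContinuousOn s' (closedBall 0 1) ∧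
      (∀ y ∈ closedBall (0 : Fin n → ℝ) 1, p (s' y) = χ y) ∧
      ∀ y ∈ sphere (0 : Fin n → ℝ) 1, s' y = s y

open Classical in
theorem IsPartialSection.step {p : E → X} (hp : ExtendsOverCells p)
    {v : RelCWComplex.cell (Set.univ : Set X) 0} {e₀ : E}
    (he : p e₀ = RelCWComplex.map 0 v ![]) {n : ℕ} {g : X → E} (h : IsPartialSection p v e₀ n g) :
    ∃ g', IsPartialSection p v e₀ (n + 1) g' ∧
      ∀ m < n, ∀ j : RelCWComplex.cell (Set.univ : Set X) m,
        ∀ x ∈ RelCWComplex.closedCell m j, g' x = g x := by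
  have hlift : ∀ j : RelCWComplex.cell (Set.univ : Set X) n, ∃ s' : (Fin n → ℝ) → E,
      ContinuousOn s' (closedBall 0 1) ∧
      (∀ y ∈ closedBall (0 : Fin n → ℝ) 1, p (s' y) = RelCWComplex.map n j y) ∧
      (∀ y ∈ sphere (0 : Fin n → ℝ) 1, s' y = g (RelCWComplex.map n j y)) ∧
      (n = 0 → ∀ y, RelCWComplex.map n j y = RelCWComplex.map 0 v ![] → s' y = e₀) := by
    intro j
    obtain ⟨F, hF⟩ := CWComplex.cellFrontier_subset_finite_closedCell n j
    have hsph : ∀ y ∈ sphere (0 : Fin n → ℝ) 1, ∃ m < n,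
        ∃ j' : RelCWComplex.cell (Set.univ : Set X) m,
        RelCWComplex.map n j y ∈ RelCWComplex.closedCell m j' := by
      intro y hy
      have := hF ⟨y, hy, rfl⟩
      simp only [Set.mem_iUnion] at this
      obtain ⟨m, hm, j', -, h'⟩ := this
      exact ⟨m, hm, j', h'⟩
    have hcont : ContinuousOn (fun y ↦ g (RelCWComplex.map n j y)) (sphere 0 1) := by
      have hU : ContinuousOn g (⋃ (m : Fin n) (j' : F m), RelCWComplex.closedCell m.1 j'.1) := by
        refine LocallyFinite.continuousOn_iUnion (locallyFinite_of_finite _) (fun m ↦ ?_) fun m ↦ ?_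
        · exact isClosed_iUnion_of_finite fun j' ↦ RelCWComplex.isClosed_closedCell
        · refine LocallyFinite.continuousOn_iUnion (locallyFinite_of_finite _) (fun m ↦ ?_)
            fun j' ↦ ?_
          · exact RelCWComplex.isClosed_closedCell
          · exact continuousOn_closedCell (h.cont m m.2 j'.1)
      refine hU.comp ((RelCWComplex.continuousOn n j).mono sphere_subset_closedBall) ?_
      intro y hy
      have := hF ⟨y, hy, rfl⟩
      simp only [Set.mem_iUnion] at this ⊢
      obtain ⟨m, hm, j', hj', h'⟩ := this
      exact ⟨⟨m, hm⟩, ⟨j', hj'⟩, h'⟩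
    by_cases hbase : n = 0 ∧ RelCWComplex.map n j 0 = RelCWComplex.map 0 v ![]
    · obtain ⟨rfl, hb⟩ := hbase
      refine ⟨fun _ ↦ e₀, continuousOn_const, fun y _ ↦ ?_, ?_, fun _ _ _ ↦ rfl⟩
      · rw [he, ← hb, Subsingleton.elim y 0]
      · rw [sphere_eq_empty_of_subsingleton one_ne_zero]
        simp
    · obtain ⟨s', h1, h2, h3⟩ := hp n _ (RelCWComplex.continuousOn n j) _ hcont fun y hy ↦ by
        obtain ⟨m, hm, j', h'⟩ := hsph y hy
        exact h.sec m hm j' _ h'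
      refine ⟨s', h1, h2, h3, ?_⟩
      rintro rfl y hy
      exact absurd ⟨rfl, by rwa [Subsingleton.elim y 0] at hy⟩ hbase
  choose l hl1 hl2 hl3 hl4 using hlift
  let g' : X → E := fun x ↦ if hx : ∃ j, x ∈ RelCWComplex.openCell n j then
    l hx.choose ((RelCWComplex.map n hx.choose).symm x) else g x
  have f1 : ∀ j, ∀ y ∈ ball (0 : Fin n → ℝ) 1, g' (RelCWComplex.map n j y) = l j y := by
    intro j y hy
    have hx : ∃ j', RelCWComplex.map n j y ∈ RelCWComplex.openCell n j' := ⟨j, y, hy, rfl⟩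
    have hj : hx.choose = j := by
      have := RelCWComplex.eq_of_not_disjoint_openCell (C := (Set.univ : Set X)) (n := n) (m := n)
        (j := hx.choose) (i := j)
        (Set.not_disjoint_iff.2 ⟨_, hx.choose_spec, ⟨y, hy, rfl⟩⟩)
      simpa using this
    change dite _ _ _ = _
    rw [dif_pos hx, hj, (RelCWComplex.map n j).left_inv]
    rw [RelCWComplex.source_eq]
    exact hy
  have f2 : ∀ m < n, ∀ j : RelCWComplex.cell (Set.univ : Set X) m,
        ∀ x ∈ RelCWComplex.closedCell m j, g' x = g x := by
    intro m hm j x hx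
    refine dif_neg ?_
    rintro ⟨j', hj'⟩
    have h1 := RelCWComplex.closedCell_subset_skeletonLT (C := (Set.univ : Set X)) m j hx
    have h2 := RelCWComplex.disjoint_skeletonLT_openCell (C := (Set.univ : Set X)) (n := (m : ℕ∞) + 1)
      (m := n) (j := j') (by exact_mod_cast hm)
    exact Set.disjoint_left.1 h2 h1 hj'
  have f3 : ∀ j, ∀ y ∈ closedBall (0 : Fin n → ℝ) 1, g' (RelCWComplex.map n j y) = l j y := by
    intro j y hy
    rw [← ball_union_sphere] at hy
    rcases hy with hy | hy
    · exact f1 j y hy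
    · rw [hl3 j y hy]
      obtain ⟨F, hF⟩ := CWComplex.cellFrontier_subset_finite_closedCell n j
      have := hF ⟨y, hy, rfl⟩
      simp only [Set.mem_iUnion] at this
      obtain ⟨m, hm, j', -, h'⟩ := this
      exact f2 m hm j' _ h'
  refine ⟨g', ⟨?_, ?_, ?_⟩, f2⟩
  · intro m hm j
    rcases (Nat.lt_succ_iff.1 hm).lt_or_eq with hm | rfl
    · exact (h.cont m hm j).congr fun y hy ↦ f2 m hm j _ ⟨y, hy, rfl⟩
    · exact (hl1 j).congr fun y hy ↦ f3 j y hy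
  · intro m hm j x hx
    rcases (Nat.lt_succ_iff.1 hm).lt_or_eq with hm | rfl
    · rw [f2 m hm j x hx]
      exact h.sec m hm j x hx
    · obtain ⟨y, hy, rfl⟩ := hx
      rw [f3 j y hy, hl2 j y hy]
  · intro _
    rcases Nat.eq_zero_or_pos n with rfl | hn
    · rw [f3 v _ (by simp)]
      exact hl4 v rfl _ rfl
    · rw [f2 0 hn v _ (by rw [RelCWComplex.closedCell_zero_eq_singleton]; rfl)]
      exact h.base hn

theorem exists_section {p : E → X} (hp : ExtendsOverCells p)
    {v : RelCWComplex.cell (Set.univ : Set X) 0} {e₀ : E}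
    (he : p e₀ = RelCWComplex.map 0 v ![]) :
    ∃ g : X → E, Continuous g ∧ (∀ x, p (g x) = x) ∧ g (RelCWComplex.map 0 v ![]) = e₀ := by
  choose! nxt hn1 hn2 using fun (n : ℕ) (g : X → E) (h : IsPartialSection p v e₀ n g) ↦
    h.step hp he
  let τ : ℕ → X → E := fun n ↦ Nat.rec (fun _ ↦ e₀) (fun n g ↦ nxt n g) n
  have hτ : ∀ n, IsPartialSection p v e₀ n (τ n) := by
    intro n
    induction n with
    | zero => exact ⟨fun m hm ↦ absurd hm m.not_lt_zero, fun m hm ↦ absurd hm m.not_lt_zero,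
        fun h ↦ absurd h (lt_irrefl _)⟩
    | succ n ih => exact hn1 n _ ih
  have hst : ∀ m, ∀ j : RelCWComplex.cell (Set.univ : Set X) m,
      ∀ x ∈ RelCWComplex.closedCell m j, ∀ k, m < k → τ k x = τ (m + 1) x := by
    intro m j x hx k hk
    induction k, hk using Nat.le_induction with
    | base => rfl
    | succ k hk ih => rw [← ih]; exact hn2 k _ (hτ k) m hk j x hx
  have hmem : ∀ x : X, ∃ m, ∃ j : RelCWComplex.cell (Set.univ : Set X) m,
      x ∈ RelCWComplex.closedCell m j := by
    intro x
    have := CWComplex.union (C := (Set.univ : Set X)) ▸ Set.mem_univ x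
    simpa only [Set.mem_iUnion] using this
  choose d j hd using hmem
  have key : ∀ m, ∀ j' : RelCWComplex.cell (Set.univ : Set X) m,
      ∀ x ∈ RelCWComplex.closedCell m j', τ (d x + 1) x = τ (m + 1) x := by
    intro m j' x hx
    rw [← hst m j' x hx (max m (d x) + 1) (by omega),
      ← hst (d x) (j x) x (hd x) (max m (d x) + 1) (by omega)]
  refine ⟨fun x ↦ τ (d x + 1) x, continuous_of_closedCells fun n j' ↦ ?_, fun x ↦ ?_, ?_⟩
  · exact ((hτ (n + 1)).cont n (Nat.lt_succ_self n) j').congr fun y hy ↦ key n j' _ ⟨y, hy, rfl⟩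
  · exact (hτ _).sec _ (Nat.lt_succ_self _) (j x) x (hd x)
  · refine (key 0 v _ ?_).trans ((hτ 1).base Nat.one_pos)
    rw [RelCWComplex.closedCell_zero_eq_singleton]
    rfl

end CWSection

end RelJames

namespace RelJames

section CWCof

open Metric

/-- The closed unit ball. -/
abbrev Ball (n : ℕ) : Type := closedBall (0 : Fin n → ℝ) 1

theorem Ball.norm_le {n : ℕ} (y : Ball n) : ‖y.1‖ ≤ 1 := mem_closedBall_zero_iff.1 y.2

theorem Ball.max_pos {n : ℕ} (t : ℝ) (y : Ball n) : 0 < max ‖y.1‖ (1 / (1 + max 0 t)) :=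
  lt_max_of_lt_right (by positivity)

/-- The structure on the ball and its boundary sphere. -/
def CofStr.ball (n : ℕ) : CofStr (Ball n) {y | ‖y.1‖ = 1} where
  u y := 2 * (1 - ‖y.1‖)
  k t y := ⟨(max ‖y.1‖ (1 / (1 + max 0 t)))⁻¹ • y.1, by
    rw [mem_closedBall_zero_iff, norm_smul, norm_inv, Real.norm_of_nonneg (y.max_pos t).le,
      inv_mul_le_iff₀ (y.max_pos t), mul_one]
    exact le_max_left _ _⟩
  cont_u := by fun_prop
  cont_k := by
    have h1 : Continuous fun p : ℝ × Ball n ↦ max ‖p.2.1‖ (1 / (1 + max 0 p.1)) := by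
      refine Continuous.max (by fun_prop) (Continuous.div continuous_const (by fun_prop) ?_)
      intro p
      positivity
    have h2 : Continuous fun p : ℝ × Ball n ↦ (max ‖p.2.1‖ (1 / (1 + max 0 p.1)))⁻¹ • p.2.1 :=
      (h1.inv₀ fun p ↦ (p.2.max_pos p.1).ne').smul (by fun_prop)
    exact h2.subtype_mk _
  u_nonneg y := mul_nonneg (by norm_num) (sub_nonneg.2 y.norm_le)
  u_rel y hy := by rw [Set.mem_ofPred_eq] at hy; rw [hy]; norm_num
  k_zero y := by
    refine Subtype.ext ?_
    have : max ‖y.1‖ 1 = 1 := max_eq_right y.norm_le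
    simp [this]
  k_rel t y hy := by
    refine Subtype.ext ?_
    rw [Set.mem_ofPred_eq] at hy
    have : max ‖y.1‖ (1 / (1 + max 0 t)) = 1 := by
      rw [hy, max_eq_left]
      rw [div_le_one (by positivity)]
      have := le_max_left 0 t
      linarith
    simp only [this, inv_one, one_smul]
  k_mem t y h h1 := by
    have h0 : 0 ≤ t := (mul_nonneg (by norm_num) (sub_nonneg.2 y.norm_le)).trans h
    have h2 : 1 / (1 + max 0 t) ≤ ‖y.1‖ := by
      rw [max_eq_right h0, div_le_iff₀ (by linarith)]
      nlinarith [y.norm_le]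
    have h3 : 0 < ‖y.1‖ := lt_of_lt_of_le (by positivity) h2
    rw [Set.mem_ofPred_eq]
    simp only [max_eq_left h2, norm_smul, norm_inv, norm_norm]
    exact inv_mul_cancel₀ h3.ne'

theorem extendsOverCells_of {X E : Type*} [TopologicalSpace X] [TopologicalSpace E] {p : E → X}
    (h : ∀ (n : ℕ) (χ : Ball n → X), Continuous χ → ∀ s : Ball n → E,
      ContinuousOn s {y | ‖y.1‖ = 1} → (∀ y, ‖y.1‖ = 1 → p (s y) = χ y) →
      ∃ s' : Ball n → E, Continuous s' ∧ (∀ y, p (s' y) = χ y) ∧ ∀ y, ‖y.1‖ = 1 → s' y = s y) :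
    ExtendsOverCells p := by
  classical
  intro n χ hχ s hs hps
  obtain ⟨s', h1, h2, h3⟩ := h n (fun y ↦ χ y) hχ.domRestrict (fun y ↦ s y)
    (hs.comp continuous_subtype_val.continuousOn fun y hy ↦ mem_sphere_zero_iff_norm.2 hy)
    fun y hy ↦ hps y (mem_sphere_zero_iff_norm.2 hy)
  refine ⟨fun y ↦ if hy : y ∈ closedBall 0 1 then s' ⟨y, hy⟩ else s y, ?_, ?_, ?_⟩
  · rw [continuousOn_iff_continuous_domRestrict]
    convert h1 using 1
    funext y
    exact dif_pos y.2
  · intro y hy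
    simp only [dif_pos hy]
    exact h2 _
  · intro y hy
    simp only [dif_pos (sphere_subset_closedBall hy)]
    exact h3 _ (mem_sphere_zero_iff_norm.1 hy)

variable {X : Type u} [TopologicalSpace X]

/-- The subspace `0 × X ∪ I × *` of `I × X`. -/
abbrev HepBase (x₀ : X) : Type u := {p : I × X // p.1 = 0 ∨ p.2 = x₀}

/-- A retraction onto `0 × X ∪ I × *` gives a cofibration structure. -/
def CofStr.ofRetraction [T1Space X] (x₀ : X) (R : I → X → HepBase x₀)
    (hR : Continuous fun p : I × X ↦ R p.1 p.2) (hR0 : ∀ x, (R 0 x).1 = (0, x))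
    (hR1 : ∀ t, (R t x₀).1 = (t, x₀)) : CofStr X {x₀} :=
  let g : C(X, C(I, ℝ)) := ContinuousMap.curry
    ⟨fun p : X × I ↦ max 0 ((p.2 : ℝ) - (R p.2 p.1).1.1), by
      have : Continuous fun p : X × I ↦ R p.2 p.1 := hR.comp continuous_swap
      fun_prop⟩
  have hg : ∀ x (t : I), (t : ℝ) - (R t x).1.1 ≤ ‖g x‖ := fun x t ↦
    (le_max_right 0 _).trans ((le_abs_self _).trans ((g x).norm_coe_le_norm t))
  { u := fun x ↦ 2 * ‖g x‖
    k := fun t x ↦ (R (cI t) x).1.2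
    cont_u := by fun_prop
    cont_k := by
      have : Continuous fun p : ℝ × X ↦ R (cI p.1) p.2 :=
        hR.comp (f := fun p : ℝ × X ↦ (cI p.1, p.2)) (by fun_prop)
      fun_prop
    u_nonneg := fun x ↦ by positivity
    u_rel := by
      rintro x rfl
      have : g x = 0 := by
        ext t
        change max 0 ((t : ℝ) - (R t x).1.1) = 0
        rw [hR1, sub_self, max_self]
      rw [this, norm_zero, mul_zero]
    k_zero := fun x ↦ by rw [cI_zero, hR0]
    k_rel := by
      rintro t x rfl
      rw [hR1]
    k_mem := fun t x h h1 ↦ by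
      have h0 : 0 ≤ t := le_trans (by positivity) h
      have key : ∀ s : I, 2 * ‖g x‖ ≤ s → (0 : ℝ) < s → (R s x).1.2 = x₀ := by
        intro s hs hs0
        refine (R s x).2.resolve_left fun h' ↦ ?_
        have := hg x s
        rw [h', Set.Icc.coe_zero] at this
        linarith
      rcases h0.eq_or_lt with rfl | h0
      · have hcl : IsClosed {s : I | (R s x).1.2 = x₀} := by
          have : Continuous fun s : I ↦ R s x := hR.comp (f := fun s : I ↦ (s, x)) (by fun_prop)
          exact isClosed_singleton.preimage (f := fun s : I ↦ (R s x).1.2) (by fun_prop)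
        have hmem : (0 : I) ∈ closure {s : I | (R s x).1.2 = x₀} := by
          refine closure_mono (s := Set.Ioi 0) ?_ ?_
          · intro s hs
            exact key s (h.trans s.2.1) (by exact_mod_cast hs)
          · rw [closure_Ioi' ⟨1, by simp⟩]
            simp
        rw [hcl.closure_eq] at hmem
        rw [cI_zero]
        exact hmem
      · exact key (cI t) (by rwa [coe_cI_of h0.le h1]) (by rwa [coe_cI_of h0.le h1]) }

theorem exists_cofStr_of_cw {X : PtdSpace.{u}} (hX : X.IsCW) :
    Nonempty (CofStr X {X.pt}) := by
  obtain ⟨_, _, v, hv⟩ := hX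
  rw [RelCWComplex.closedCell_zero_eq_singleton] at hv
  have hv' : X.pt = RelCWComplex.map 0 v ![] := hv
  let E := {ω : C(I, HepBase X.pt) // (ω 0).1.1 = 0}
  let p : E → X := fun ω ↦ (ω.1 0).1.2
  have hp : ExtendsOverCells p := by
    refine extendsOverCells_of fun n χ hχ s hs hps ↦ ?_
    let f : Ball n → HepBase X.pt := fun y ↦ ⟨(0, χ y), Or.inl rfl⟩
    have hf : Continuous f := by fun_prop
    let G : ℝ → Ball n → HepBase X.pt := fun t y ↦ (s y).1 (cI t)
    have hG : ContinuousOn (fun p : ℝ × Ball n ↦ G p.1 p.2) (Set.univ ×ˢ {y | ‖y.1‖ = 1}) := by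
      have h1 : ContinuousOn (fun p : ℝ × Ball n ↦ (s p.2).1)
          (Set.univ ×ˢ {y : Ball n | ‖y.1‖ = 1}) :=
        continuous_subtype_val.comp_continuousOn (hs.comp continuousOn_snd fun p hp ↦ hp.2)
      exact ContinuousEval.continuous_eval.comp_continuousOn
        (h1.prodMk (Continuous.continuousOn (by fun_prop)))
    have hG0 : ∀ y ∈ {y : Ball n | ‖y.1‖ = 1}, G 0 y = f y := by
      intro y hy
      refine Subtype.ext (Prod.ext ?_ ?_)
      · simp only [G, f, cI_zero]; exact (s y).2
      · simp only [G, f, cI_zero]; exact hps y hy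
    have hc : Continuous fun q : Ball n × I ↦ (CofStr.ball n).ext f G q.2 q.1 :=
      (CofStr.ball n).continuous_ext hf hG hG0 (by fun_prop) (by fun_prop) fun q ↦ q.2.2.2
    let F : C(Ball n, C(I, HepBase X.pt)) := ContinuousMap.curry ⟨_, hc⟩
    have hF : ∀ y t, F y t = (CofStr.ball n).ext f G t y := fun _ _ ↦ rfl
    have hF0 : ∀ y, F y 0 = f y := fun y ↦ by
      rw [hF, Set.Icc.coe_zero, CofStr.ext_zero _ hG0]
    refine ⟨fun y ↦ ⟨F y, by rw [hF0]⟩, by fun_prop, fun y ↦ ?_, fun y hy ↦ ?_⟩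
    · change (F y 0).1.2 = _
      rw [hF0]
    · refine Subtype.ext (ContinuousMap.ext fun t ↦ ?_)
      rw [hF, CofStr.ext_rel (CofStr.ball n) (G := G) (f := f) hy t.2.1]
      simp [G]
  let e₀ : E := ⟨⟨fun t ↦ ⟨(t, X.pt), Or.inr rfl⟩, by fun_prop⟩, rfl⟩
  obtain ⟨g, hg, hpg, hg0⟩ := exists_section hp (v := v) (e₀ := e₀) hv'
  rw [← hv'] at hg0
  have h0 : ∀ x, ((g x).1 0).1 = (0, x) := fun x ↦ Prod.ext (g x).2 (hpg x)
  refine ⟨CofStr.ofRetraction X.pt (fun t x ↦ (g x).1 t) ?_ h0 fun t ↦ ?_⟩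
  · have hg' : Continuous fun x ↦ (g x).1 := continuous_subtype_val.comp hg
    exact ContinuousEval.continuous_eval.comp ((hg'.comp continuous_snd).prodMk continuous_fst)
  · rw [hg0]
    rfl

end CWCof

end RelJames

namespace RelJames

/-! ### Double suspensions of smash products as quotients of products -/

theorem quot_collapse_eq {T : Type*} {A : T → Prop} {p q : T}
    (h : Quot.mk (fun p q ↦ A p ∧ A q) p = Quot.mk (fun p q ↦ A p ∧ A q) q) :
    p = q ∨ (A p ∧ A q) := by
  have h' := Quot.eqvGen_exact h
  clear h
  induction h' with
  | rel x y h => exact Or.inr h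
  | refl x => exact Or.inl rfl
  | symm x y h ih => exact ih.imp Eq.symm And.symm
  | trans x y z h1 h2 ih1 ih2 =>
    rcases ih1 with rfl | h3
    · exact ih2
    · rcases ih2 with rfl | h4
      · exact Or.inr h3
      · exact Or.inr ⟨h3.1, h4.2⟩

section SS

variable {X Y Z S : PtdSpace.{u}}

theorem Susp.mk_eq_mk {t t' : I} {x x' : X} (h : Susp.mk t x = Susp.mk t' x') :
    (t = t' ∧ x = x') ∨ ((t = 0 ∨ t = 1 ∨ x = X.pt) ∧ (t' = 0 ∨ t' = 1 ∨ x' = X.pt)) := by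
  rcases quot_collapse_eq (A := SuspCollapsed X) h with h | h
  · exact Or.inl ⟨congrArg Prod.fst h, congrArg Prod.snd h⟩
  · exact Or.inr h

theorem Susp.mk_eq_pt_iff {t : I} {x : X} :
    Susp.mk t x = (Susp X).pt ↔ t = 0 ∨ t = 1 ∨ x = X.pt := by
  refine ⟨fun h ↦ ?_, Susp.mk_eq_pt⟩
  rcases Susp.mk_eq_mk (h : Susp.mk t x = Susp.mk 0 X.pt) with ⟨rfl, -⟩ | h
  exacts [Or.inl rfl, h.1]

theorem Smash.mk_eq_mk {x x' : X} {y y' : Y} (h : Smash.mk x y = Smash.mk x' y') :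
    (x = x' ∧ y = y') ∨ ((x = X.pt ∨ y = Y.pt) ∧ (x' = X.pt ∨ y' = Y.pt)) := by
  rcases quot_collapse_eq (A := OnAxes X Y) h with h | h
  · exact Or.inl ⟨congrArg dfst h, congrArg dsnd h⟩
  · exact Or.inr h

theorem Smash.mk_eq_pt_iff {x : X} {y : Y} :
    Smash.mk x y = (Smash X Y).pt ↔ x = X.pt ∨ y = Y.pt := by
  refine ⟨fun h ↦ ?_, Smash.mk_eq_pt⟩
  rcases Smash.mk_eq_mk (h : Smash.mk x y = Smash.mk X.pt Y.pt) with ⟨rfl, -⟩ | h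
  exacts [Or.inl rfl, h.1]

theorem Susp.isQuotientMap_mk : IsQuotientMap fun p : I × X ↦ Susp.mk p.1 p.2 :=
  isQuotientMap_quot_mk

theorem Smash.isQuotientMap_mk : IsQuotientMap fun p : DProd X Y ↦ Smash.mk (dfst p) (dsnd p) :=
  isQuotientMap_quot_mk

/-- The triple product. -/
abbrev Q₃ (X Y Z : PtdSpace.{u}) : Type u := DProd (DProd X Y) Z

/-- The points of `X × Y × Z` with a coordinate equal to the base point. -/
def Q₃.Deg (q : Q₃ X Y Z) : Prop :=
  dfst (dfst q) = X.pt ∨ dsnd (dfst q) = Y.pt ∨ dsnd q = Z.pt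

variable (X Y Z) in
/-- The double suspension of the triple smash product. -/
abbrev SS : PtdSpace.{u} := Susp (Susp (Smash (Smash X Y) Z))

/-- The points of `I² × X × Y × Z` that are collapsed in the double suspension. -/
def SSCollapsed (p : I × (I × Q₃ X Y Z)) : Prop :=
  (p.1 = 0 ∨ p.1 = 1) ∨ (p.2.1 = 0 ∨ p.2.1 = 1) ∨ p.2.2.Deg

/-- The quotient map to the double suspension. -/
def ssMk (p : I × (I × Q₃ X Y Z)) : SS X Y Z :=
  Susp.mk p.1 (Susp.mk p.2.1 (Smash.mk (Smash.mk (dfst (dfst p.2.2)) (dsnd (dfst p.2.2)))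
    (dsnd p.2.2)))

theorem isQuotientMap_ssMk : IsQuotientMap (ssMk : I × (I × Q₃ X Y Z) → SS X Y Z) := by
  have h1 : IsQuotientMap fun q : Q₃ X Y Z ↦
      Smash.mk (Smash.mk (dfst (dfst q)) (dsnd (dfst q))) (dsnd q) :=
    Smash.isQuotientMap_mk.comp (isQuotientMap_dprod_left Smash.isQuotientMap_mk)
  have h2 := Susp.isQuotientMap_mk.comp (isQuotientMap_prodMk_left (K := I) h1)
  exact Susp.isQuotientMap_mk.comp (isQuotientMap_prodMk_left (K := I) h2)

theorem ssMk_eq_pt_iff {p : I × (I × Q₃ X Y Z)} : ssMk p = (SS X Y Z).pt ↔ SSCollapsed p := by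
  unfold ssMk SSCollapsed Q₃.Deg
  rw [Susp.mk_eq_pt_iff, Susp.mk_eq_pt_iff, Smash.mk_eq_pt_iff, Smash.mk_eq_pt_iff]
  tauto

theorem ssMk_eq_ssMk {p p' : I × (I × Q₃ X Y Z)} (h : ssMk p = ssMk p') :
    p = p' ∨ (SSCollapsed p ∧ SSCollapsed p') := by
  by_cases hp : SSCollapsed p
  · exact Or.inr ⟨hp, ssMk_eq_pt_iff.1 (h ▸ ssMk_eq_pt_iff.2 hp)⟩
  · left
    simp only [SSCollapsed, Q₃.Deg, not_or] at hp
    obtain ⟨⟨h0, h1⟩, ⟨h2, h3⟩, h4, h5, h6⟩ := hp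
    rcases Susp.mk_eq_mk h with ⟨e1, e2⟩ | ⟨e, -⟩
    · rcases Susp.mk_eq_mk e2 with ⟨e3, e4⟩ | ⟨e, -⟩
      · rcases Smash.mk_eq_mk e4 with ⟨e5, e6⟩ | ⟨e, -⟩
        · rcases Smash.mk_eq_mk e5 with ⟨e7, e8⟩ | ⟨e, -⟩
          · refine Prod.ext e1 (Prod.ext e3 ?_)
            rw [← dpair_eta p.2.2, ← dpair_eta p'.2.2, ← dpair_eta (dfst p.2.2),
              ← dpair_eta (dfst p'.2.2), e6, e7, e8]
          · rcases e with e | e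
            exacts [absurd e h4, absurd e h5]
        · rcases e with e | e
          · rcases Smash.mk_eq_pt_iff.1 e with e | e
            exacts [absurd e h4, absurd e h5]
          · exact absurd e h6
      · rcases e with e | e | e
        · exact absurd e h2
        · exact absurd e h3
        · rcases Smash.mk_eq_pt_iff.1 e with e | e
          · rcases Smash.mk_eq_pt_iff.1 e with e | e
            exacts [absurd e h4, absurd e h5]
          · exact absurd e h6
    · rw [Susp.mk_eq_pt_iff, Smash.mk_eq_pt_iff, Smash.mk_eq_pt_iff] at e
      tauto

/-- A pointed map out of the double suspension. -/
def ssLift (f : I × (I × Q₃ X Y Z) → S) (hf : Continuous f)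
    (h : ∀ p, SSCollapsed p → f p = S.pt) : PtdMap (SS X Y Z) S where
  toFun v := f (Function.surjInv isQuotientMap_ssMk.surjective v)
  continuous_toFun := by
    rw [isQuotientMap_ssMk.continuous_iff]
    convert hf using 1
    funext p
    change f (Function.surjInv isQuotientMap_ssMk.surjective (ssMk p)) = f p
    rcases ssMk_eq_ssMk (Function.surjInv_eq isQuotientMap_ssMk.surjective (ssMk p)) with h' | h'
    · rw [h']
    · rw [h _ h'.1, h _ h'.2]
  map_pt := h _ (ssMk_eq_pt_iff.1 (Function.surjInv_eq isQuotientMap_ssMk.surjective _))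

@[simp] theorem ssLift_mk (f : I × (I × Q₃ X Y Z) → S) (hf : Continuous f)
    (h : ∀ p, SSCollapsed p → f p = S.pt) (p : I × (I × Q₃ X Y Z)) :
    ssLift f hf h (ssMk p) = f p := by
  change f (Function.surjInv isQuotientMap_ssMk.surjective (ssMk p)) = f p
  rcases ssMk_eq_ssMk (Function.surjInv_eq isQuotientMap_ssMk.surjective (ssMk p)) with h' | h'
  · rw [h']
  · rw [h _ h'.1, h _ h'.2]

theorem ss_homotopic {f g : PtdMap (SS X Y Z) S} (F : I × (I × (I × Q₃ X Y Z)) → S)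
    (hF : Continuous F) (h : ∀ t p, SSCollapsed p → F (t, p) = S.pt)
    (h0 : ∀ p, F (0, p) = f (ssMk p)) (h1 : ∀ p, F (1, p) = g (ssMk p)) : f.Homotopic g := by
  have hl : ∀ t : I, Continuous fun p ↦ F (t, p) := fun t ↦ by fun_prop
  refine PtdMap.homotopic_of (fun t ↦ ssLift (fun p ↦ F (t, p)) (hl t) (h t)) ?_ ?_ ?_ ?_
  · have := isQuotientMap_prodMk_left (K := I) (isQuotientMap_ssMk (X := X) (Y := Y) (Z := Z))
    rw [this.continuous_iff]
    convert hF using 1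
    funext p
    exact ssLift_mk _ (hl p.1) (h p.1) p.2
  · intro x
    obtain ⟨p, rfl⟩ := isQuotientMap_ssMk.surjective x
    rw [ssLift_mk, h0]
  · intro x
    obtain ⟨p, rfl⟩ := isQuotientMap_ssMk.surjective x
    rw [ssLift_mk, h1]
  · exact fun t ↦ map_pt' _

end SS

/-! ### The join -/

section Join

variable {X Y Z : PtdSpace.{u}}

/-- Weights that are nonnegative, but not all zero. -/
def Weights (w₁ w₂ w₃ : ℝ) : Prop := 0 ≤ w₁ ∧ 0 ≤ w₂ ∧ 0 ≤ w₃ ∧ 0 < max w₁ (max w₂ w₃)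

open Classical in
/-- The point of the outer faces of the cube proportional to the weights. -/
def outer (w₁ w₂ w₃ : ℝ) : OuterFaces :=
  if h : Weights w₁ w₂ w₃ then
    ⟨(cI (w₁ / max w₁ (max w₂ w₃)), cI (w₂ / max w₁ (max w₂ w₃)), cI (w₃ / max w₁ (max w₂ w₃))), by
      obtain ⟨-, -, -, h⟩ := h
      rcases max_choice w₁ (max w₂ w₃) with e | e
      · left
        refine cI_of_ge ?_
        conv_rhs => rw [e]
        rw [e] at h
        exact (div_self h.ne').ge
      · right
        rcases max_choice w₂ w₃ with e' | e'
        · left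
          refine cI_of_ge ?_
          conv_rhs => rw [e, e']
          rw [e, e'] at h
          exact (div_self h.ne').ge
        · right
          refine cI_of_ge ?_
          conv_rhs => rw [e, e']
          rw [e, e'] at h
          exact (div_self h.ne').ge⟩
  else ⟨(1, 1, 1), Or.inl rfl⟩

variable {w₁ w₂ w₃ : ℝ}

theorem Weights.coe_outer (h : Weights w₁ w₂ w₃) :
    ((outer w₁ w₂ w₃).1.1 : ℝ) = w₁ / max w₁ (max w₂ w₃) ∧
    ((outer w₁ w₂ w₃).1.2.1 : ℝ) = w₂ / max w₁ (max w₂ w₃) ∧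
    ((outer w₁ w₂ w₃).1.2.2 : ℝ) = w₃ / max w₁ (max w₂ w₃) := by
  unfold outer
  rw [dif_pos h]
  obtain ⟨h1, h2, h3, h⟩ := h
  refine ⟨coe_cI_of (by positivity) ?_, coe_cI_of (by positivity) ?_,
    coe_cI_of (by positivity) ?_⟩ <;> rw [div_le_one h]
  · exact le_max_left _ _
  · exact (le_max_left _ _).trans (le_max_right _ _)
  · exact (le_max_right _ _).trans (le_max_right _ _)

theorem continuous_outer {T : Type*} [TopologicalSpace T] {f₁ f₂ f₃ : T → ℝ} (h₁ : Continuous f₁)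
    (h₂ : Continuous f₂) (h₃ : Continuous f₃) (h : ∀ t, Weights (f₁ t) (f₂ t) (f₃ t)) :
    Continuous fun t ↦ outer (f₁ t) (f₂ t) (f₃ t) := by
  refine continuous_induced_rng.2 ?_
  have hm : Continuous fun t ↦ max (f₁ t) (max (f₂ t) (f₃ t)) := by fun_prop
  have hne : ∀ t, max (f₁ t) (max (f₂ t) (f₃ t)) ≠ 0 := fun t ↦ (h t).2.2.2.ne'
  have : (Subtype.val ∘ fun t ↦ outer (f₁ t) (f₂ t) (f₃ t)) = fun t ↦
      (cI (f₁ t / max (f₁ t) (max (f₂ t) (f₃ t))), cI (f₂ t / max (f₁ t) (max (f₂ t) (f₃ t))),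
        cI (f₃ t / max (f₁ t) (max (f₂ t) (f₃ t)))) := by
    funext t
    simp only [Function.comp, outer, dif_pos (h t)]
  rw [this]
  have e1 := h₁.div hm hne
  have e2 := h₂.div hm hne
  have e3 := h₃.div hm hne
  exact (continuous_cI.comp e1).prodMk ((continuous_cI.comp e2).prodMk (continuous_cI.comp e3))

theorem continuous_joinMk {T : Type*} [TopologicalSpace T] [DeltaGeneratedSpace T]
    {s : T → OuterFaces} {x : T → X} {y : T → Y} {z : T → Z} (hs : Continuous s)
    (hx : Continuous x) (hy : Continuous y) (hz : Continuous z) :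
    Continuous fun t ↦ Join₃.mk (s t) (x t) (y t) (z t) := by
  refine continuous_quot_mk.comp ?_
  exact (IsGeneratedBy.equiv_symm_comp_continuous_iff (X := fun n ↦ Fin n → ℝ)
    (fun t ↦ (s t, dpair (dpair (x t) (y t)) (z t)))).2 (hs.prodMk (by fun_prop))

theorem joinMk_congr {s : OuterFaces} {x x' : X} {y y' : Y} {z z' : Z}
    (hx : s.1.1 = 0 ∨ x = x') (hy : s.1.2.1 = 0 ∨ y = y') (hz : s.1.2.2 = 0 ∨ z = z') :
    Join₃.mk s x y z = Join₃.mk s x' y' z' :=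
  Quot.sound ⟨rfl, rfl, rfl, hx, hy, hz⟩

/-- The point of the join with given weights. -/
def jw (w₁ w₂ w₃ : ℝ) (x : X) (y : Y) (z : Z) : Join₃ X Y Z := Join₃.mk (outer w₁ w₂ w₃) x y z

theorem continuous_jw {T : Type*} [TopologicalSpace T] [DeltaGeneratedSpace T]
    {f₁ f₂ f₃ : T → ℝ} {x : T → X} {y : T → Y} {z : T → Z} (h₁ : Continuous f₁)
    (h₂ : Continuous f₂) (h₃ : Continuous f₃) (h : ∀ t, Weights (f₁ t) (f₂ t) (f₃ t))
    (hx : Continuous x) (hy : Continuous y) (hz : Continuous z) :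
    Continuous fun t ↦ jw (f₁ t) (f₂ t) (f₃ t) (x t) (y t) (z t) :=
  continuous_joinMk (continuous_outer h₁ h₂ h₃ h) hx hy hz

theorem jw_congr {x x' : X} {y y' : Y} {z z' : Z} (hw : Weights w₁ w₂ w₃)
    (hx : w₁ = 0 ∨ x = x') (hy : w₂ = 0 ∨ y = y') (hz : w₃ = 0 ∨ z = z') :
    jw w₁ w₂ w₃ x y z = jw w₁ w₂ w₃ x' y' z' := by
  obtain ⟨e1, e2, e3⟩ := hw.coe_outer
  refine joinMk_congr (hx.imp_left fun h ↦ ?_) (hy.imp_left fun h ↦ ?_) (hz.imp_left fun h ↦ ?_)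
  · refine Subtype.ext ?_
    rw [e1, h]; simp
  · refine Subtype.ext ?_
    rw [e2, h]; simp
  · refine Subtype.ext ?_
    rw [e3, h]; simp

theorem outer_coe (s : OuterFaces) : outer s.1.1 s.1.2.1 s.1.2.2 = s := by
  have hm : max (s.1.1 : ℝ) (max s.1.2.1 s.1.2.2) = 1 := by
    have h1 := s.1.1.2.2
    have h2 := s.1.2.1.2.2
    have h3 := s.1.2.2.2.2
    refine le_antisymm (max_le h1 (max_le h2 h3)) ?_
    rcases s.2 with h | h | h <;> simp [h]
  have hw : Weights s.1.1 s.1.2.1 s.1.2.2 :=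
    ⟨s.1.1.2.1, s.1.2.1.2.1, s.1.2.2.2.1, hm ▸ one_pos⟩
  obtain ⟨e1, e2, e3⟩ := hw.coe_outer
  rw [hm, div_one] at e1 e2 e3
  exact Subtype.ext (Prod.ext (Subtype.ext e1) (Prod.ext (Subtype.ext e2) (Subtype.ext e3)))

theorem weights_coe (s : OuterFaces) : Weights s.1.1 s.1.2.1 s.1.2.2 := by
  refine ⟨s.1.1.2.1, s.1.2.1.2.1, s.1.2.2.2.1, ?_⟩
  rcases s.2 with h | h | h <;> simp [h]

/-- Join points whose `x`-, `y`- and `z`-coordinates are given by case distinctions. -/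
theorem continuous_jw_ite {T : Type*} [TopologicalSpace T] [DeltaGeneratedSpace T]
    {f₁ f₂ f₃ : T → ℝ} {g₁ g₂ g₃ : T → ℝ} {x x' : T → X} {y y' : T → Y} {z z' : T → Z}
    (h₁ : Continuous f₁) (h₂ : Continuous f₂) (h₃ : Continuous f₃)
    (hg₁ : Continuous g₁) (hg₂ : Continuous g₂) (hg₃ : Continuous g₃)
    (h : ∀ t, Weights (f₁ t) (f₂ t) (f₃ t))
    (hx : Continuous x) (hy : Continuous y) (hz : Continuous z)
    (hx' : Continuous x') (hy' : Continuous y') (hz' : Continuous z')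
    (e₁ : ∀ t, g₁ t = 0 → f₁ t = 0 ∨ x t = x' t) (e₂ : ∀ t, g₂ t = 0 → f₂ t = 0 ∨ y t = y' t)
    (e₃ : ∀ t, g₃ t = 0 → f₃ t = 0 ∨ z t = z' t) :
    Continuous fun t ↦ jw (f₁ t) (f₂ t) (f₃ t) (if g₁ t ≤ 0 then x t else x' t)
      (if g₂ t ≤ 0 then y t else y' t) (if g₃ t ≤ 0 then z t else z' t) := by
  have c3 : ∀ (a : T → X) (b : T → Y), Continuous a → Continuous b → Continuous fun t ↦
      jw (f₁ t) (f₂ t) (f₃ t) (a t) (b t) (if g₃ t ≤ 0 then z t else z' t) := by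
    intro a b ha hb
    have := Continuous.if_le (continuous_jw h₁ h₂ h₃ h ha hb hz)
      (continuous_jw h₁ h₂ h₃ h ha hb hz') hg₃ continuous_const fun t ht ↦
      jw_congr (h t) (Or.inr rfl) (Or.inr rfl) (e₃ t ht)
    convert this using 2 with t
    split_ifs <;> rfl
  have c2 : ∀ (a : T → X), Continuous a → Continuous fun t ↦
      jw (f₁ t) (f₂ t) (f₃ t) (a t) (if g₂ t ≤ 0 then y t else y' t)
        (if g₃ t ≤ 0 then z t else z' t) := by
    intro a ha
    have := Continuous.if_le (c3 a y ha hy) (c3 a y' ha hy') hg₂ continuous_const fun t ht ↦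
      jw_congr (h t) (Or.inr rfl) (e₂ t ht) (Or.inr rfl)
    convert this using 2 with t
    split_ifs <;> rfl
  have := Continuous.if_le (c2 x hx) (c2 x' hx') hg₁ continuous_const fun t ht ↦
      jw_congr (h t) (e₁ t ht) (Or.inr rfl) (Or.inr rfl)
  convert this using 2 with t
  split_ifs <;> rfl

end Join

end RelJames

namespace RelJames

section Stage

variable {X Y Z : PtdSpace.{u}}

/-- The nearness of a coordinate to being degenerate. -/
def lam (s u : ℝ) : ℝ := max (max 0 (1 - 2 * s)) (max 0 (1 - u))

theorem lam_nonneg (s u : ℝ) : 0 ≤ lam s u := (le_max_left _ _).trans (le_max_left _ _)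

theorem lam_zero_left {u : ℝ} (hu : 0 ≤ u) : lam 0 u = 1 := by
  unfold lam
  rw [mul_zero, sub_zero, max_eq_right zero_le_one, max_eq_left]
  exact max_le zero_le_one (by linarith)

theorem lam_zero_right {s : ℝ} (hs : 0 ≤ s) : lam s 0 = 1 := by
  unfold lam
  rw [sub_zero, max_eq_right zero_le_one, max_eq_right]
  exact max_le zero_le_one (by linarith)

theorem lam_le_one {s u : ℝ} (hs : 0 ≤ s) (hu : 0 ≤ u) : lam s u ≤ 1 :=
  max_le (max_le zero_le_one (by linarith)) (max_le zero_le_one (by linarith))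

theorem lam_pos {s u : ℝ} (h : 0 < lam s u) (hs : 1 ≤ 2 * s) : u ≤ 1 := by
  unfold lam at h
  by_contra hu
  rw [max_eq_left (by linarith : 1 - 2 * s ≤ 0), max_eq_left (by linarith : 1 - u ≤ 0),
    max_self] at h
  exact lt_irrefl _ h

/-- A direction of motion in the join, in terms of the nearness of the three coordinates to being
degenerate. -/
structure Mover where
  /-- the first component -/
  v₁ : ℝ × ℝ × ℝ → ℝ
  /-- the second component -/
  v₂ : ℝ × ℝ × ℝ → ℝ
  /-- the third component -/
  v₃ : ℝ × ℝ × ℝ → ℝ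
  c₁ : Continuous v₁
  c₂ : Continuous v₂
  c₃ : Continuous v₃
  n : ∀ l : ℝ × ℝ × ℝ, 0 ≤ l.1 → 0 ≤ l.2.1 → 0 ≤ l.2.2 → (0 ≤ v₁ l ∧ v₁ l ≤ l.1) ∧
    (0 ≤ v₂ l ∧ v₂ l ≤ l.2.1) ∧ (0 ≤ v₃ l ∧ v₃ l ≤ l.2.2)

/-- The length of the motion. -/
def Mover.m (v : Mover) (l : ℝ × ℝ × ℝ) : ℝ := max (v.v₁ l) (max (v.v₂ l) (v.v₃ l))

/-- The weights during the motion. -/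
def stageW (τ m s v : ℝ) : ℝ :=
  (1 - max 0 (2 * τ - 1) * m) * max 0 (s - min 1 (2 * τ) / 2) + max 0 (2 * τ - 1) * v

theorem weights_stageW (v : Mover) (τ : I) (s : OuterFaces) {l : ℝ × ℝ × ℝ}
    (h₁ : 0 ≤ l.1) (h₂ : 0 ≤ l.2.1) (h₃ : 0 ≤ l.2.2) (h₁' : l.1 ≤ 1) (h₂' : l.2.1 ≤ 1)
    (h₃' : l.2.2 ≤ 1) : Weights (stageW τ (v.m l) s.1.1 (v.v₁ l))
      (stageW τ (v.m l) s.1.2.1 (v.v₂ l)) (stageW τ (v.m l) s.1.2.2 (v.v₃ l)) := by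
  obtain ⟨⟨n1, b1⟩, ⟨n2, b2⟩, n3, b3⟩ := v.n l h₁ h₂ h₃
  have hτ : max 0 (2 * (τ : ℝ) - 1) ≤ 1 := max_le zero_le_one (by linarith [τ.2.2])
  have hτ0 : 0 ≤ max 0 (2 * (τ : ℝ) - 1) := le_max_left _ _
  have hm1 : v.m l ≤ 1 := max_le (b1.trans h₁') (max_le (b2.trans h₂') (b3.trans h₃'))
  have hm0 : 0 ≤ v.m l := n1.trans (le_max_left _ _)
  have hp : 0 ≤ 1 - max 0 (2 * (τ : ℝ) - 1) * v.m l := sub_nonneg.2 (mul_le_one₀ hτ hm0 hm1)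
  have key : ∀ a b : ℝ, 0 ≤ b → max 0 (2 * (τ : ℝ) - 1) * b ≤ stageW τ (v.m l) a b ∧
      0 ≤ stageW τ (v.m l) a b := by
    intro a b hb
    have h1 : 0 ≤ (1 - max 0 (2 * (τ : ℝ) - 1) * v.m l) * max 0 (a - min 1 (2 * (τ : ℝ)) / 2) :=
      mul_nonneg hp (le_max_left _ _)
    have h2 : 0 ≤ max 0 (2 * (τ : ℝ) - 1) * b := mul_nonneg hτ0 hb
    unfold stageW
    constructor <;> linarith
  refine ⟨(key _ _ n1).2, (key _ _ n2).2, (key _ _ n3).2, ?_⟩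
  rw [lt_max_iff, lt_max_iff]
  rcases (mul_nonneg hτ0 hm0).eq_or_lt with h0 | h0
  · have hk : ∀ a b : ℝ, 0 ≤ b → a = 1 → 0 < stageW τ (v.m l) a b := by
      rintro a b hb rfl
      have h1 : 0 < max 0 (1 - min 1 (2 * (τ : ℝ)) / 2) :=
        lt_max_of_lt_right (by have := min_le_left 1 (2 * (τ : ℝ)); linarith)
      have h2 : 0 ≤ max 0 (2 * (τ : ℝ) - 1) * b := mul_nonneg hτ0 hb
      unfold stageW
      rw [← h0]
      linarith
    rcases s.2 with h | h | h
    · exact Or.inl (hk _ _ n1 (by rw [h]; rfl))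
    · exact Or.inr (Or.inl (hk _ _ n2 (by rw [h]; rfl)))
    · exact Or.inr (Or.inr (hk _ _ n3 (by rw [h]; rfl)))
  · have : v.m l = v.v₁ l ∨ v.m l = v.v₂ l ∨ v.m l = v.v₃ l := by
      unfold Mover.m
      rcases max_choice (v.v₁ l) (max (v.v₂ l) (v.v₃ l)) with e | e
      · exact Or.inl e
      · rcases max_choice (v.v₂ l) (v.v₃ l) with e' | e' <;> rw [e, e']
        exacts [Or.inr (Or.inl rfl), Or.inr (Or.inr rfl)]
    rcases this with e | e | e
    · exact Or.inl ((e ▸ h0).trans_le (key _ _ n1).1)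
    · exact Or.inr (Or.inl ((e ▸ h0).trans_le (key _ _ n2).1))
    · exact Or.inr (Or.inr ((e ▸ h0).trans_le (key _ _ n3).1))

/-- Cofibration structures at the base points of the three factors. -/
structure TripleCof (X Y Z : PtdSpace.{u}) where
  /-- the structure on the first factor -/
  SX : CofStr X {X.pt}
  /-- the structure on the second factor -/
  SY : CofStr Y {Y.pt}
  /-- the structure on the third factor -/
  SZ : CofStr Z {Z.pt}

variable (C : TripleCof X Y Z) (v : Mover)

/-- The nearness of the coordinates of a point of the join to being degenerate. -/
def TripleCof.l (p : JoinData X Y Z) : ℝ × ℝ × ℝ :=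
  (lam p.s₁ (C.SX.u p.x), lam p.s₂ (C.SY.u p.y), lam p.s₃ (C.SZ.u p.z))

theorem TripleCof.continuous_l : Continuous C.l := by
  unfold TripleCof.l lam
  have h1 := C.SX.continuous_u' (JoinData.continuous_x (X := X) (Y := Y) (Z := Z))
  have h2 := C.SY.continuous_u' (JoinData.continuous_y (X := X) (Y := Y) (Z := Z))
  have h3 := C.SZ.continuous_u' (JoinData.continuous_z (X := X) (Y := Y) (Z := Z))
  fun_prop

open Classical in
/-- A coordinate during the motion. -/
def stageC {X : PtdSpace.{u}} (S : CofStr X {X.pt}) (τ s : ℝ) (x : X) : X :=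
  if s - min 1 (2 * τ) / 2 ≤ 0 then X.pt else S.k (min 1 (2 * τ)) x

theorem stageC_pt {X : PtdSpace.{u}} (S : CofStr X {X.pt}) (τ s : ℝ) :
    stageC S τ s X.pt = X.pt := by
  unfold stageC
  split_ifs
  exacts [rfl, S.k_rel _ _ rfl]

theorem stageC_zero {X : PtdSpace.{u}} (S : CofStr X {X.pt}) {τ : ℝ} (hτ : 0 ≤ τ) (x : X) :
    stageC S τ 0 x = X.pt := by
  refine if_pos ?_
  have : 0 ≤ min 1 (2 * τ) := le_min zero_le_one (by linarith)
  linarith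

/-- The motion of the points of the join. -/
def stageFun (τ : I) (p : JoinData X Y Z) : Join₃ X Y Z :=
  jw (stageW τ (v.m (C.l p)) p.s₁ (v.v₁ (C.l p))) (stageW τ (v.m (C.l p)) p.s₂ (v.v₂ (C.l p)))
    (stageW τ (v.m (C.l p)) p.s₃ (v.v₃ (C.l p))) (stageC C.SX τ p.s₁ p.x)
    (stageC C.SY τ p.s₂ p.y) (stageC C.SZ τ p.s₃ p.z)

theorem stageW_edge {X : PtdSpace.{u}} (S : CofStr X {X.pt}) {τ m s v : ℝ} {x : X}
    (hv : 0 ≤ v) (hvl : v ≤ lam s (S.u x)) (h : s - min 1 (2 * τ) / 2 = 0) :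
    stageW τ m s v = 0 ∨ X.pt = S.k (min 1 (2 * τ)) x := by
  unfold stageW
  rw [h, max_self, mul_zero, zero_add]
  rcases le_or_gt (2 * τ - 1) 0 with h1 | h1
  · left; rw [max_eq_left h1, zero_mul]
  rcases hv.eq_or_lt with h2 | h2
  · left; rw [← h2, mul_zero]
  right
  rw [min_eq_left (by linarith)] at h ⊢
  exact (S.k_mem 1 x (lam_pos (h2.trans_le hvl) (by linarith)) le_rfl).symm

theorem TripleCof.l_mem (p : JoinData X Y Z) : (0 ≤ (C.l p).1 ∧ (C.l p).1 ≤ 1) ∧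
    (0 ≤ (C.l p).2.1 ∧ (C.l p).2.1 ≤ 1) ∧ 0 ≤ (C.l p).2.2 ∧ (C.l p).2.2 ≤ 1 :=
  ⟨⟨lam_nonneg _ _, lam_le_one p.s₁.2.1 (C.SX.u_nonneg _)⟩,
    ⟨lam_nonneg _ _, lam_le_one p.s₂.2.1 (C.SY.u_nonneg _)⟩,
    lam_nonneg _ _, lam_le_one p.s₃.2.1 (C.SZ.u_nonneg _)⟩

theorem weights_stage (τ : I) (p : JoinData X Y Z) :
    Weights (stageW τ (v.m (C.l p)) p.s₁ (v.v₁ (C.l p)))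
      (stageW τ (v.m (C.l p)) p.s₂ (v.v₂ (C.l p)))
      (stageW τ (v.m (C.l p)) p.s₃ (v.v₃ (C.l p))) :=
  have h := C.l_mem p
  weights_stageW v τ ⟨(p.s₁, p.s₂, p.s₃), p.outer⟩ h.1.1 h.2.1.1 h.2.2.1 h.1.2 h.2.1.2 h.2.2.2

theorem continuous_stageFun :
    Continuous fun q : I × JoinData X Y Z ↦ stageFun C v q.1 q.2 := by
  have hl : Continuous fun q : I × JoinData X Y Z ↦ C.l q.2 := C.continuous_l.comp continuous_snd
  have v1 := v.c₁.comp hl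
  have v2 := v.c₂.comp hl
  have v3 := v.c₃.comp hl
  have hm : Continuous fun q : I × JoinData X Y Z ↦ v.m (C.l q.2) := by
    unfold Mover.m
    exact v1.max (v2.max v3)
  have hW : ∀ (s w : I × JoinData X Y Z → ℝ), Continuous s → Continuous w →
      Continuous fun q : I × JoinData X Y Z ↦ stageW q.1 (v.m (C.l q.2)) (s q) (w q) := by
    intro s w hs hw
    unfold stageW
    fun_prop
  have hn := fun q : I × JoinData X Y Z ↦
    v.n (C.l q.2) (C.l_mem q.2).1.1 (C.l_mem q.2).2.1.1 (C.l_mem q.2).2.2.1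
  refine continuous_jw_ite (f₁ := fun q ↦ _) (f₂ := fun q ↦ _) (f₃ := fun q ↦ _)
    (hW _ _ (by fun_prop) v1) (hW _ _ (by fun_prop) v2) (hW _ _ (by fun_prop) v3)
    (by fun_prop) (by fun_prop) (by fun_prop) (fun q ↦ weights_stage C v q.1 q.2)
    continuous_const continuous_const continuous_const
    (C.SX.continuous_k (by fun_prop) (by fun_prop)) (C.SY.continuous_k (by fun_prop) (by fun_prop))
    (C.SZ.continuous_k (by fun_prop) (by fun_prop)) ?_ ?_ ?_
  · exact fun q hq ↦ stageW_edge C.SX (hn q).1.1 (hn q).1.2 hq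
  · exact fun q hq ↦ stageW_edge C.SY (hn q).2.1.1 (hn q).2.1.2 hq
  · exact fun q hq ↦ stageW_edge C.SZ (hn q).2.2.1 (hn q).2.2.2 hq

theorem lam_congr {X : PtdSpace.{u}} (S : CofStr X {X.pt}) {s : I} {x x' : X}
    (h : s = 0 ∨ x = x') : lam s (S.u x) = lam s (S.u x') := by
  rcases h with rfl | rfl
  · rw [Set.Icc.coe_zero, lam_zero_left (S.u_nonneg _), lam_zero_left (S.u_nonneg _)]
  · rfl

theorem stageC_congr {X : PtdSpace.{u}} (S : CofStr X {X.pt}) (τ : I) {s : I} {x x' : X}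
    (h : s = 0 ∨ x = x') : stageC S τ s x = stageC S τ s x' := by
  rcases h with rfl | rfl
  · rw [Set.Icc.coe_zero, stageC_zero _ τ.2.1, stageC_zero _ τ.2.1]
  · rfl

/-- The motion of the join. -/
def stage (τ : I) : Join₃ X Y Z → Join₃ X Y Z := Quot.lift (stageFun C v τ) <| by
  rintro p q ⟨h₁, h₂, h₃, hx, hy, hz⟩
  have hl : C.l p = C.l q := by
    unfold TripleCof.l
    rw [← h₁, ← h₂, ← h₃, lam_congr C.SX hx, lam_congr C.SY hy, lam_congr C.SZ hz]
  unfold stageFun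
  rw [hl, ← h₁, ← h₂, ← h₃, stageC_congr C.SX τ hx, stageC_congr C.SY τ hy,
    stageC_congr C.SZ τ hz]

theorem continuous_stage : Continuous fun q : I × Join₃ X Y Z ↦ stage C v q.1 q.2 :=
  continuous_I_prod_quot (continuous_stageFun C v)

/-- The point of `JoinData` with given coordinates. -/
def joinDatum (s : OuterFaces) (x : X) (y : Y) (z : Z) : JoinData X Y Z :=
  WithGeneratedByTopology.equiv.symm (s, dpair (dpair x y) z)

theorem stage_mk (τ : I) (s : OuterFaces) (x : X) (y : Y) (z : Z) :
    stage C v τ (Join₃.mk s x y z) = stageFun C v τ (joinDatum s x y z) := rfl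

theorem Join₃.exists_mk (j : Join₃ X Y Z) : ∃ s x y z, j = Join₃.mk s x y z := by
  induction j using Quot.ind with | mk p => ?_
  exact ⟨⟨(p.s₁, p.s₂, p.s₃), p.outer⟩, p.x, p.y, p.z, rfl⟩

theorem stage_zero (j : Join₃ X Y Z) : stage C v 0 j = j := by
  obtain ⟨s, x, y, z, rfl⟩ := Join₃.exists_mk j
  rw [stage_mk]
  have hW : ∀ m (t : I) w, stageW ((0 : I) : ℝ) m t w = t := by
    intro m t w
    unfold stageW
    rw [Set.Icc.coe_zero, mul_zero, zero_sub, max_eq_left (by norm_num), zero_mul, zero_mul,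
      sub_zero, one_mul, add_zero, min_eq_right zero_le_one, zero_div, sub_zero, max_eq_right t.2.1]
  have hC : ∀ {X : PtdSpace.{u}} (S : CofStr X {X.pt}) (t : I) (x : X),
      (t : ℝ) = 0 ∨ stageC S ((0 : I) : ℝ) t x = x := by
    intro X S t x
    rcases t.2.1.eq_or_lt with h | h
    · exact Or.inl h.symm
    · right
      unfold stageC
      rw [Set.Icc.coe_zero, mul_zero, min_eq_right zero_le_one, zero_div, sub_zero, if_neg h.not_ge,
        S.k_zero]
  unfold stageFun
  rw [hW, hW, hW]
  refine (jw_congr (weights_coe s) (hC C.SX s.1.1 x) (hC C.SY s.1.2.1 y) (hC C.SZ s.1.2.2 z)).trans ?_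
  unfold jw
  rw [outer_coe]

/-- The points of the join with a vanishing cone coordinate or a base point among the
coordinates. -/
def InK (j : Join₃ X Y Z) : Prop :=
  ∃ s x y z, j = Join₃.mk s x y z ∧ (s.1.1 = 0 ∨ s.1.2.1 = 0 ∨ s.1.2.2 = 0 ∨ x = X.pt ∨ y = Y.pt ∨
    z = Z.pt)

/-- The points of the join all of whose coordinates are base points. -/
def InΔ (j : Join₃ X Y Z) : Prop := ∃ s, j = Join₃.mk s X.pt Y.pt Z.pt

theorem InK.stage {j : Join₃ X Y Z} (h : InK j) (τ : I) : InK (RelJames.stage C v τ j) := by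
  obtain ⟨s, x, y, z, rfl, h⟩ := h
  rw [stage_mk]
  refine ⟨_, _, _, _, rfl, ?_⟩
  have hk : ∀ {X : PtdSpace.{u}} (S : CofStr X {X.pt}) {t : I} {x : X}, t = 0 ∨ x = X.pt →
      stageC S τ t x = X.pt := by
    intro X S t x h
    rcases h with rfl | rfl
    · exact stageC_zero S τ.2.1 x
    · exact stageC_pt S τ t
  rcases h with h | h | h | h | h | h
  · exact Or.inr (Or.inr (Or.inr (Or.inl (hk C.SX (Or.inl h)))))
  · exact Or.inr (Or.inr (Or.inr (Or.inr (Or.inl (hk C.SY (Or.inl h))))))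
  · exact Or.inr (Or.inr (Or.inr (Or.inr (Or.inr (hk C.SZ (Or.inl h))))))
  · exact Or.inr (Or.inr (Or.inr (Or.inl (hk C.SX (Or.inr h)))))
  · exact Or.inr (Or.inr (Or.inr (Or.inr (Or.inl (hk C.SY (Or.inr h))))))
  · exact Or.inr (Or.inr (Or.inr (Or.inr (Or.inr (hk C.SZ (Or.inr h))))))

theorem InΔ.stage {j : Join₃ X Y Z} (h : InΔ j) (τ : I) : InΔ (RelJames.stage C v τ j) := by
  obtain ⟨s, rfl⟩ := h
  rw [stage_mk]
  unfold stageFun jw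
  have e1 : stageC C.SX τ (joinDatum s X.pt Y.pt Z.pt).s₁ (joinDatum s X.pt Y.pt Z.pt).x = X.pt :=
    stageC_pt _ _ _
  have e2 : stageC C.SY τ (joinDatum s X.pt Y.pt Z.pt).s₂ (joinDatum s X.pt Y.pt Z.pt).y = Y.pt :=
    stageC_pt _ _ _
  have e3 : stageC C.SZ τ (joinDatum s X.pt Y.pt Z.pt).s₃ (joinDatum s X.pt Y.pt Z.pt).z = Z.pt :=
    stageC_pt _ _ _
  rw [e1, e2, e3]
  exact ⟨_, rfl⟩

/-- The motion towards the degenerate coordinates. -/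
def Mover.proj : Mover where
  v₁ l := l.1
  v₂ l := l.2.1
  v₃ l := l.2.2
  c₁ := by fun_prop
  c₂ := by fun_prop
  c₃ := by fun_prop
  n l h₁ h₂ h₃ := ⟨⟨h₁, le_rfl⟩, ⟨h₂, le_rfl⟩, h₃, le_rfl⟩

/-- The motion towards the centre. -/
def Mover.centre : Mover where
  v₁ l := min l.1 (min l.2.1 l.2.2)
  v₂ l := min l.1 (min l.2.1 l.2.2)
  v₃ l := min l.1 (min l.2.1 l.2.2)
  c₁ := by fun_prop
  c₂ := by fun_prop
  c₃ := by fun_prop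
  n l h₁ h₂ h₃ := by
    have h := le_min h₁ (le_min h₂ h₃)
    exact ⟨⟨h, min_le_left _ _⟩, ⟨h, (min_le_right _ _).trans (min_le_left _ _)⟩, h,
      (min_le_right _ _).trans (min_le_right _ _)⟩

theorem stageW_one {s v : ℝ} : stageW ((1 : I) : ℝ) 1 s v = v := by
  unfold stageW
  norm_num

theorem stageC_one {X : PtdSpace.{u}} (S : CofStr X {X.pt}) {s : ℝ} {x : X}
    (h : 0 < lam s (S.u x)) : stageC S ((1 : I) : ℝ) s x = X.pt := by
  unfold stageC
  have : min 1 (2 * ((1 : I) : ℝ)) = 1 := by norm_num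
  rw [this]
  split_ifs with h1
  · rfl
  · exact S.k_mem 1 x (lam_pos h (by linarith)) le_rfl

theorem InK.stage_proj {j : Join₃ X Y Z} (h : InK j) : InΔ (RelJames.stage C .proj 1 j) := by
  obtain ⟨s, x, y, z, rfl, h⟩ := h
  rw [stage_mk]
  have hm : Mover.proj.m (C.l (joinDatum s x y z)) = 1 := by
    obtain ⟨⟨-, l1⟩, ⟨-, l2⟩, -, l3⟩ := C.l_mem (joinDatum s x y z)
    refine le_antisymm (max_le l1 (max_le l2 l3)) ?_
    have k1 : s.1.1 = 0 ∨ x = X.pt → (C.l (joinDatum s x y z)).1 = 1 := by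
      rintro (h | rfl)
      · change lam s.1.1 _ = 1
        rw [h]; exact lam_zero_left (C.SX.u_nonneg _)
      · change lam _ (C.SX.u X.pt) = 1
        rw [C.SX.u_rel _ rfl]; exact lam_zero_right s.1.1.2.1
    have k2 : s.1.2.1 = 0 ∨ y = Y.pt → (C.l (joinDatum s x y z)).2.1 = 1 := by
      rintro (h | rfl)
      · change lam s.1.2.1 _ = 1
        rw [h]; exact lam_zero_left (C.SY.u_nonneg _)
      · change lam _ (C.SY.u Y.pt) = 1
        rw [C.SY.u_rel _ rfl]; exact lam_zero_right s.1.2.1.2.1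
    have k3 : s.1.2.2 = 0 ∨ z = Z.pt → (C.l (joinDatum s x y z)).2.2 = 1 := by
      rintro (h | rfl)
      · change lam s.1.2.2 _ = 1
        rw [h]; exact lam_zero_left (C.SZ.u_nonneg _)
      · change lam _ (C.SZ.u Z.pt) = 1
        rw [C.SZ.u_rel _ rfl]; exact lam_zero_right s.1.2.2.2.1
    unfold Mover.m Mover.proj
    rw [le_max_iff, le_max_iff]
    rcases h with h | h | h | h | h | h
    · exact Or.inl (k1 (Or.inl h)).ge
    · exact Or.inr (Or.inl (k2 (Or.inl h)).ge)
    · exact Or.inr (Or.inr (k3 (Or.inl h)).ge)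
    · exact Or.inl (k1 (Or.inr h)).ge
    · exact Or.inr (Or.inl (k2 (Or.inr h)).ge)
    · exact Or.inr (Or.inr (k3 (Or.inr h)).ge)
  have hw := weights_stage C .proj 1 (joinDatum s x y z)
  refine ⟨_, jw_congr hw ?_ ?_ ?_⟩
  · rw [hm, stageW_one]
    exact (lam_nonneg _ _).eq_or_lt.imp Eq.symm (stageC_one C.SX)
  · rw [hm, stageW_one]
    exact (lam_nonneg _ _).eq_or_lt.imp Eq.symm (stageC_one C.SY)
  · rw [hm, stageW_one]
    exact (lam_nonneg _ _).eq_or_lt.imp Eq.symm (stageC_one C.SZ)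

theorem InΔ.stage_centre {j : Join₃ X Y Z} (h : InΔ j) :
    RelJames.stage C .centre 1 j = (Join₃ X Y Z).pt := by
  obtain ⟨s, rfl⟩ := h
  rw [stage_mk]
  have hl : C.l (joinDatum s X.pt Y.pt Z.pt) = (1, 1, 1) := by
    refine Prod.ext ?_ (Prod.ext ?_ ?_)
    · change lam _ (C.SX.u X.pt) = 1
      rw [C.SX.u_rel _ rfl]; exact lam_zero_right s.1.1.2.1
    · change lam _ (C.SY.u Y.pt) = 1
      rw [C.SY.u_rel _ rfl]; exact lam_zero_right s.1.2.1.2.1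
    · change lam _ (C.SZ.u Z.pt) = 1
      rw [C.SZ.u_rel _ rfl]; exact lam_zero_right s.1.2.2.2.1
  have e1 : stageC C.SX ((1 : I) : ℝ) (joinDatum s X.pt Y.pt Z.pt).s₁
    (joinDatum s X.pt Y.pt Z.pt).x = X.pt := stageC_pt _ _ _
  have e2 : stageC C.SY ((1 : I) : ℝ) (joinDatum s X.pt Y.pt Z.pt).s₂
    (joinDatum s X.pt Y.pt Z.pt).y = Y.pt := stageC_pt _ _ _
  have e3 : stageC C.SZ ((1 : I) : ℝ) (joinDatum s X.pt Y.pt Z.pt).s₃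
    (joinDatum s X.pt Y.pt Z.pt).z = Z.pt := stageC_pt _ _ _
  unfold stageFun
  rw [hl, e1, e2, e3]
  have hm : Mover.centre.m (1, 1, 1) = 1 := by simp [Mover.m, Mover.centre]
  have hv : Mover.centre.v₁ (1, 1, 1) = 1 ∧ Mover.centre.v₂ (1, 1, 1) = 1 ∧
    Mover.centre.v₃ (1, 1, 1) = 1 := by simp [Mover.centre]
  rw [hm, hv.1, hv.2.1, hv.2.2, stageW_one, stageW_one, stageW_one]
  have := outer_coe ⟨(1, 1, 1), Or.inl rfl⟩
  unfold jw
  simp only [Set.Icc.coe_one] at this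
  rw [this]
  rfl

/-- The homotopy of the join that contracts the degenerate part. -/
def contr (τ : I) (j : Join₃ X Y Z) : Join₃ X Y Z := stage C .centre τ (stage C .proj τ j)

theorem continuous_contr : Continuous fun q : I × Join₃ X Y Z ↦ contr C q.1 q.2 :=
  (continuous_stage C .centre).comp (f := fun q : I × Join₃ X Y Z ↦ (q.1, stage C .proj q.1 q.2))
    (continuous_fst.prodMk (continuous_stage C .proj))

theorem contr_zero (j : Join₃ X Y Z) : contr C 0 j = j := by
  unfold contr
  rw [stage_zero, stage_zero]

theorem InK.contr {j : Join₃ X Y Z} (h : InK j) (τ : I) : InK (RelJames.contr C τ j) :=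
  (h.stage C .proj τ).stage C .centre τ

theorem InΔ.contr {j : Join₃ X Y Z} (h : InΔ j) (τ : I) : InΔ (RelJames.contr C τ j) :=
  (h.stage C .proj τ).stage C .centre τ

theorem InK.contr_one {j : Join₃ X Y Z} (h : InK j) :
    RelJames.contr C 1 j = (Join₃ X Y Z).pt := (h.stage_proj C).stage_centre C

end Stage

end RelJames

namespace RelJames

section GammaStd

variable {X Y Z P : PtdSpace.{u}}

theorem Weights.inK {w₁ w₂ w₃ : ℝ} (h : Weights w₁ w₂ w₃) {x : X} {y : Y} {z : Z}
    (hz : w₁ = 0 ∨ w₂ = 0 ∨ w₃ = 0 ∨ x = X.pt ∨ y = Y.pt ∨ z = Z.pt) : InK (jw w₁ w₂ w₃ x y z) := by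
  refine ⟨outer w₁ w₂ w₃, x, y, z, rfl, ?_⟩
  obtain ⟨e1, e2, e3⟩ := h.coe_outer
  rcases hz with h | h | h | h
  · left; refine Subtype.ext ?_; rw [e1, h]; simp
  · right; left; refine Subtype.ext ?_; rw [e2, h]; simp
  · right; right; left; refine Subtype.ext ?_; rw [e3, h]; simp
  · tauto

theorem weights_square (u v : I) : Weights u v (min (1 - u) (1 - v)) := by
  refine ⟨u.2.1, v.2.1, le_min (sub_nonneg.2 u.2.2) (sub_nonneg.2 v.2.2), ?_⟩
  by_contra h
  rw [not_lt, max_le_iff, max_le_iff, min_le_iff] at h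
  obtain ⟨h1, h2, h3 | h3⟩ := h <;> linarith

/-- The map from `I² × X × Y × Z` to the join. -/
def squareJoin (p : I × (I × Q₃ X Y Z)) : Join₃ X Y Z :=
  jw p.1 p.2.1 (min (1 - (p.1 : ℝ)) (1 - p.2.1)) (dfst (dfst p.2.2)) (dsnd (dfst p.2.2))
    (dsnd p.2.2)

theorem continuous_squareJoin : Continuous (squareJoin : I × (I × Q₃ X Y Z) → _) :=
  continuous_jw (by fun_prop) (by fun_prop) (by fun_prop) (fun p ↦ weights_square p.1 p.2.1)
    (by fun_prop) (by fun_prop) (by fun_prop)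

theorem SSCollapsed.inK {p : I × (I × Q₃ X Y Z)} (h : SSCollapsed p) : InK (squareJoin p) := by
  refine (weights_square p.1 p.2.1).inK ?_
  have h1 := p.1.2.2
  have h2 := p.2.1.2.2
  rcases h with (h | h) | (h | h) | h
  · left; rw [h]; rfl
  · right; right; left
    rw [h, Set.Icc.coe_one, sub_self, min_eq_left]
    linarith
  · right; left; rw [h]; rfl
  · right; right; left
    rw [h, Set.Icc.coe_one, sub_self, min_eq_right]
    linarith
  · exact Or.inr (Or.inr (Or.inr h))

theorem InK.joinCollapse {j : Join₃ X Y Z} (h : InK j) :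
    joinCollapse X Y Z j = (SS X Y Z).pt := by
  obtain ⟨s, x, y, z, rfl, h⟩ := h
  change joinCollapseFun (joinDatum s x y z) = _
  have key : x = X.pt ∨ y = Y.pt ∨ z = Z.pt →
      joinCollapseFun (joinDatum s x y z) = (SS X Y Z).pt := fun h ↦ by
    refine Susp.mk_eq_pt (Or.inr (Or.inr (Susp.mk_eq_pt (Or.inr (Or.inr ?_)))))
    refine Smash.mk_eq_pt ?_
    rcases h with h | h | h
    exacts [Or.inl (Smash.mk_eq_pt (Or.inl h)), Or.inl (Smash.mk_eq_pt (Or.inr h)), Or.inr h]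
  rcases h with h | h | h | h
  · exact joinCollapseFun_of_zero _ (Or.inl h)
  · exact joinCollapseFun_of_zero _ (Or.inr (Or.inl h))
  · exact joinCollapseFun_of_zero _ (Or.inr (Or.inr h))
  · exact key h

theorem Weights.joinCollapse {w₁ w₂ w₃ : ℝ} (h : Weights w₁ w₂ w₃) (x : X) (y : Y) (z : Z) :
    joinCollapse X Y Z (jw w₁ w₂ w₃ x y z) = Susp.mk (cut (w₁ / (w₁ + w₂ + w₃)))
      (Susp.mk (cut (w₂ / (w₁ + w₂ + w₃))) (Smash.mk (Smash.mk x y) z)) := by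
  change joinCollapseFun (joinDatum (outer w₁ w₂ w₃) x y z) = _
  obtain ⟨e1, e2, e3⟩ := h.coe_outer
  have hm := h.2.2.2.ne'
  have d1 : ((joinDatum (outer w₁ w₂ w₃) x y z).s₁ : ℝ) = w₁ / max w₁ (max w₂ w₃) := e1
  have d2 : ((joinDatum (outer w₁ w₂ w₃) x y z).s₂ : ℝ) = w₂ / max w₁ (max w₂ w₃) := e2
  have d3 : ((joinDatum (outer w₁ w₂ w₃) x y z).s₃ : ℝ) = w₃ / max w₁ (max w₂ w₃) := e3
  unfold joinCollapseFun
  rw [d1, d2, d3, ← add_div, ← add_div, div_div_div_cancel_right₀ hm,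
    div_div_div_cancel_right₀ hm]
  rfl

theorem InΔ.attachJoin {i : PtdMap (Susp Y) P} {ε : PtdMap (Susp X) P} {j : Join₃ X Y Y}
    (h : InΔ j) : attachJoin i ε j = (J2 i).pt := by
  obtain ⟨s, rfl⟩ := h
  change attachFun i ε (joinDatum s X.pt Y.pt Y.pt) = _
  have h1 : ∀ t, Susp.mk t X.pt = (Susp X).pt := fun t ↦ Susp.mk_eq_pt (Or.inr (Or.inr rfl))
  have h2 : ∀ t, Susp.mk t Y.pt = (Susp Y).pt := fun t ↦ Susp.mk_eq_pt (Or.inr (Or.inr rfl))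
  have d1 : (joinDatum s X.pt Y.pt Y.pt).x = X.pt := rfl
  have d2 : (joinDatum s X.pt Y.pt Y.pt).y = Y.pt := rfl
  have d3 : (joinDatum s X.pt Y.pt Y.pt).z = Y.pt := rfl
  unfold attachFun
  rw [d1, d2, d3, h1, h2, h2, map_pt', map_pt']
  split_ifs <;> rfl

variable (C : TripleCof X Y Z)

/-- A homotopy right inverse of the map from the join to the double suspension. -/
def joinSection : PtdMap (SS X Y Z) (Join₃ X Y Z) :=
  ssLift (fun p ↦ contr C 1 (squareJoin p))
    ((continuous_contr C).comp (f := fun p ↦ ((1 : I), squareJoin p))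
      (continuous_const.prodMk continuous_squareJoin)) fun _ hp ↦ hp.inK.contr_one C

theorem joinSection_mk (p : I × (I × Q₃ X Y Z)) :
    joinSection C (ssMk p) = contr C 1 (squareJoin p) := ssLift_mk _ _ _ p

/-- The cut of the first coordinate of the square, interpolated with the coordinate. -/
def cutHom (t : I) (a b : ℝ) : I := cI ((1 - t) * cut (a / b) + t * a)

theorem joinCollapse_joinSection :
    ((joinCollapse X Y Z).comp (joinSection C)).Homotopic (PtdMap.id _) := by
  let m : PtdMap (SS X Y Z) (SS X Y Z) :=
    ssLift (fun p ↦ joinCollapse X Y Z (squareJoin p))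
      ((joinCollapse X Y Z).cont.comp continuous_squareJoin) fun _ hp ↦ hp.inK.joinCollapse
  have h1 : m.Homotopic ((joinCollapse X Y Z).comp (joinSection C)) := by
    refine ss_homotopic (fun q ↦ joinCollapse X Y Z (contr C q.1 (squareJoin q.2))) ?_ ?_ ?_ ?_
    · exact (joinCollapse X Y Z).cont.comp ((continuous_contr C).comp
        (f := fun q : I × (I × (I × Q₃ X Y Z)) ↦ (q.1, squareJoin q.2))
        (continuous_fst.prodMk (continuous_squareJoin.comp continuous_snd)))
    · exact fun t p hp ↦ (hp.inK.contr C t).joinCollapse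
    · intro p
      rw [contr_zero, ssLift_mk]
    · intro p
      exact congrArg (joinCollapse X Y Z) (joinSection_mk C p).symm
  refine h1.symm.trans ?_
  have hS : ∀ u v : I, 0 < (u : ℝ) + v + min (1 - (u : ℝ)) (1 - v) := by
    intro u v
    have h1 := u.2.1
    have h2 := u.2.2
    have h3 := v.2.1
    have h4 := v.2.2
    rcases min_choice (1 - (u : ℝ)) (1 - v) with h | h <;> rw [h] <;> linarith
  have hS2 : ∀ u v : I, (u : ℝ) = 1 ∨ (v : ℝ) = 1 → min (1 - (u : ℝ)) (1 - v) = 0 := by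
    rintro u v (h | h) <;> rw [h, sub_self]
    · exact min_eq_left (sub_nonneg.2 v.2.2)
    · exact min_eq_right (sub_nonneg.2 u.2.2)
  refine ss_homotopic (fun q ↦ Susp.mk
    (cutHom q.1 q.2.1 (q.2.1 + q.2.2.1 + min (1 - (q.2.1 : ℝ)) (1 - q.2.2.1)))
    (Susp.mk (cutHom q.1 q.2.2.1 (q.2.1 + q.2.2.1 + min (1 - (q.2.1 : ℝ)) (1 - q.2.2.1)))
    (Smash.mk (Smash.mk (dfst (dfst q.2.2.2)) (dsnd (dfst q.2.2.2))) (dsnd q.2.2.2)))) ?_ ?_ ?_ ?_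
  · have hc : ∀ f : I × (I × (I × Q₃ X Y Z)) → ℝ, Continuous f → Continuous fun q ↦
        cutHom q.1 (f q) (q.2.1 + q.2.2.1 + min (1 - (q.2.1 : ℝ)) (1 - q.2.2.1)) := by
      intro f hf
      have hd : Continuous fun q : I × (I × (I × Q₃ X Y Z)) ↦
        f q / (q.2.1 + q.2.2.1 + min (1 - (q.2.1 : ℝ)) (1 - q.2.2.1)) :=
          hf.div (by fun_prop) fun q ↦ (hS _ _).ne'
      have he := continuous_cut.comp hd
      exact continuous_cI.comp (Continuous.add (Continuous.mul (by fun_prop)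
        (continuous_subtype_val.comp he)) (by fun_prop))
    exact Susp.continuous_mk (hc _ (by fun_prop)) (Susp.continuous_mk (hc _ (by fun_prop))
      (by fun_prop))
  · have e0 : ∀ (t : I) (b : ℝ), cutHom t 0 b = 0 := fun t b ↦ by
      unfold cutHom
      rw [zero_div, cut_zero, Set.Icc.coe_zero, mul_zero, mul_zero, add_zero, cI_zero]
    have e1 : ∀ (t : I) (b : ℝ), 2 / 5 ≤ 1 / b → cutHom t 1 b = 1 := fun t b h ↦ by
      unfold cutHom
      rw [cut_one h, Set.Icc.coe_one, mul_one, mul_one, sub_add_cancel, cI_one]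
    have e2 : ∀ v : I, 2 / 5 ≤ 1 / (1 + (v : ℝ) + 0) := fun v ↦ by
      rw [div_le_div_iff₀ (by norm_num) (by linarith [v.2.1])]
      linarith [v.2.2]
    intro t p hp
    rcases hp with (h | h) | (h | h) | h
    · refine Susp.mk_eq_pt (Or.inl ?_)
      simp only [h, Set.Icc.coe_zero]
      exact e0 t _
    · refine Susp.mk_eq_pt (Or.inr (Or.inl ?_))
      simp only [h]
      rw [hS2 1 p.2.1 (Or.inl rfl), Set.Icc.coe_one]
      exact e1 t _ (e2 _)
    · refine Susp.mk_eq_pt (Or.inr (Or.inr (Susp.mk_eq_pt (Or.inl ?_))))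
      simp only [h, Set.Icc.coe_zero]
      exact e0 t _
    · refine Susp.mk_eq_pt (Or.inr (Or.inr (Susp.mk_eq_pt (Or.inr (Or.inl ?_)))))
      simp only [h]
      rw [hS2 p.1 1 (Or.inr rfl), Set.Icc.coe_one, add_comm (p.1 : ℝ) 1]
      exact e1 t _ (e2 _)
    · refine Susp.mk_eq_pt (Or.inr (Or.inr (Susp.mk_eq_pt (Or.inr (Or.inr ?_)))))
      rcases h with h | h | h
      · exact Smash.mk_eq_pt (Or.inl (Smash.mk_eq_pt (Or.inl h)))
      · exact Smash.mk_eq_pt (Or.inl (Smash.mk_eq_pt (Or.inr h)))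
      · exact Smash.mk_eq_pt (Or.inr h)
  · intro p
    rw [ssLift_mk]
    unfold squareJoin
    rw [(weights_square p.1 p.2.1).joinCollapse]
    have : ∀ a b : ℝ, cutHom 0 a b = cut (a / b) := fun a b ↦ by
      unfold cutHom
      rw [Set.Icc.coe_zero, sub_zero, one_mul, zero_mul, add_zero, cI_coe]
    rw [this, this]
  · intro p
    have : ∀ (a : I) (b : ℝ), cutHom 1 a b = a := fun a b ↦ by
      unfold cutHom
      rw [Set.Icc.coe_one, sub_self, zero_mul, one_mul, zero_add, cI_coe]
    simp only [this]
    rfl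

/-- The weights of the interpolation of the identity of the join with a map that factors through
the double suspension. -/
def spreadFun (t : I) (p : JoinData X Y Z) : Join₃ X Y Z :=
  jw ((1 - t) * cut (p.s₁ / (p.s₁ + p.s₂ + p.s₃)) + t * p.s₁)
    ((1 - t) * cut (p.s₂ / (p.s₁ + p.s₂ + p.s₃)) + t * p.s₂)
    ((1 - t) * min (1 - (cut (p.s₁ / (p.s₁ + p.s₂ + p.s₃)) : ℝ))
      (1 - cut (p.s₂ / (p.s₁ + p.s₂ + p.s₃))) + t * p.s₃) p.x p.y p.z

theorem Weights.interpolate {a b c a' b' c' : ℝ} (h : Weights a b c) (h' : Weights a' b' c')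
    (t : I) : Weights ((1 - t) * a + t * a') ((1 - t) * b + t * b') ((1 - t) * c + t * c') := by
  obtain ⟨h1, h2, h3, h4⟩ := h
  obtain ⟨h1', h2', h3', h4'⟩ := h'
  have t0 := t.2.1
  have t1 : (0 : ℝ) ≤ 1 - t := sub_nonneg.2 t.2.2
  refine ⟨by positivity, by positivity, by positivity, ?_⟩
  rw [lt_max_iff, lt_max_iff] at h4 h4' ⊢
  have key : ∀ x y : ℝ, 0 ≤ x → 0 ≤ y → (0 < x ∧ 0 < 1 - (t : ℝ)) ∨ (0 < y ∧ (0 : ℝ) < t) →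
      0 < (1 - t) * x + t * y := by
    rintro x y hx hy (⟨h, h'⟩ | ⟨h, h'⟩)
    · have := mul_pos h' h
      have := mul_nonneg t0 hy
      linarith
    · have := mul_pos h' h
      have := mul_nonneg t1 hx
      linarith
  rcases t0.eq_or_lt with ht | ht
  · have ht' : 0 < 1 - (t : ℝ) := by rw [← ht]; norm_num
    exact h4.imp (fun h ↦ key _ _ h1 h1' (Or.inl ⟨h, ht'⟩))
      (Or.imp (fun h ↦ key _ _ h2 h2' (Or.inl ⟨h, ht'⟩)) fun h ↦ key _ _ h3 h3' (Or.inl ⟨h, ht'⟩))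
  · exact h4'.imp (fun h ↦ key _ _ h1 h1' (Or.inr ⟨h, ht⟩))
      (Or.imp (fun h ↦ key _ _ h2 h2' (Or.inr ⟨h, ht⟩)) fun h ↦ key _ _ h3 h3' (Or.inr ⟨h, ht⟩))

theorem weights_spread (t : I) (p : JoinData X Y Z) :
    Weights ((1 - t) * cut (p.s₁ / (p.s₁ + p.s₂ + p.s₃)) + t * p.s₁)
    ((1 - t) * cut (p.s₂ / (p.s₁ + p.s₂ + p.s₃)) + t * p.s₂)
    ((1 - t) * min (1 - (cut (p.s₁ / (p.s₁ + p.s₂ + p.s₃)) : ℝ))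
      (1 - cut (p.s₂ / (p.s₁ + p.s₂ + p.s₃))) + t * p.s₃) :=
  (weights_square _ _).interpolate (weights_coe ⟨(p.s₁, p.s₂, p.s₃), p.outer⟩) t

theorem continuous_spreadFun :
    Continuous fun q : I × JoinData X Y Z ↦ spreadFun q.1 q.2 := by
  have hS : Continuous fun q : I × JoinData X Y Z ↦ (q.2.s₁ + q.2.s₂ + q.2.s₃ : ℝ) := by fun_prop
  have hne : ∀ q : I × JoinData X Y Z, (q.2.s₁ + q.2.s₂ + q.2.s₃ : ℝ) ≠ 0 := fun q ↦
    q.2.sum_pos.ne'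
  have d1 : Continuous fun q : I × JoinData X Y Z ↦
      (cut (q.2.s₁ / (q.2.s₁ + q.2.s₂ + q.2.s₃)) : ℝ) :=
    continuous_subtype_val.comp (continuous_cut.comp (Continuous.div (by fun_prop) hS hne))
  have d2 : Continuous fun q : I × JoinData X Y Z ↦
      (cut (q.2.s₂ / (q.2.s₁ + q.2.s₂ + q.2.s₃)) : ℝ) :=
    continuous_subtype_val.comp (continuous_cut.comp (Continuous.div (by fun_prop) hS hne))
  exact continuous_jw (by fun_prop) (by fun_prop) (by fun_prop) (fun q ↦ weights_spread q.1 q.2)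
    (by fun_prop) (by fun_prop) (by fun_prop)

theorem cut_eq_zero_of {a b : ℝ} (h : a = 0) : (cut (a / b) : ℝ) = 0 := by
  rw [h, zero_div, cut_zero, Set.Icc.coe_zero]

/-- The interpolation on the join. -/
def spread (t : I) : Join₃ X Y Z → Join₃ X Y Z := Quot.lift (spreadFun t) <| by
  rintro p q ⟨h₁, h₂, h₃, hx, hy, hz⟩
  have hw := weights_spread t p
  unfold spreadFun
  rw [← h₁, ← h₂, ← h₃]
  refine jw_congr hw (hx.imp_left fun h ↦ ?_) (hy.imp_left fun h ↦ ?_) (hz.imp_left fun h ↦ ?_)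
  · have : (p.s₁ : ℝ) = 0 := by rw [h]; rfl
    rw [cut_eq_zero_of this, this]; ring
  · have : (p.s₂ : ℝ) = 0 := by rw [h]; rfl
    rw [cut_eq_zero_of this, this]; ring
  · have h0 : (p.s₃ : ℝ) = 0 := by rw [h]; rfl
    have hs := p.sum_pos
    have h1 := p.s₁.2.1
    have h2 := p.s₂.2.1
    have hmin : min (1 - (cut (p.s₁ / (p.s₁ + p.s₂ + p.s₃)) : ℝ))
        (1 - cut (p.s₂ / (p.s₁ + p.s₂ + p.s₃))) = 0 := by
      rcases le_total (p.s₂ : ℝ) p.s₁ with h' | h'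
      · have : cut (p.s₁ / (p.s₁ + p.s₂ + p.s₃)) = 1 := by
          refine cut_one ?_
          rw [le_div_iff₀ hs, h0]
          linarith
        rw [this, Set.Icc.coe_one, sub_self]
        exact min_eq_left (sub_nonneg.2 (cut _).2.2)
      · have : cut (p.s₂ / (p.s₁ + p.s₂ + p.s₃)) = 1 := by
          refine cut_one ?_
          rw [le_div_iff₀ hs, h0]
          linarith
        rw [this, Set.Icc.coe_one, sub_self]
        exact min_eq_right (sub_nonneg.2 (cut _).2.2)
    rw [hmin, h0]; ring

theorem continuous_spread : Continuous fun q : I × Join₃ X Y Z ↦ spread q.1 q.2 :=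
  continuous_I_prod_quot continuous_spreadFun

theorem spread_one (j : Join₃ X Y Z) : spread 1 j = j := by
  obtain ⟨s, x, y, z, rfl⟩ := Join₃.exists_mk j
  change spreadFun 1 (joinDatum s x y z) = _
  unfold spreadFun
  have : ∀ a b : ℝ, (1 - ((1 : I) : ℝ)) * a + ((1 : I) : ℝ) * b = b := fun a b ↦ by
    rw [Set.Icc.coe_one]; ring
  rw [this, this, this]
  change jw s.1.1 s.1.2.1 s.1.2.2 x y z = _
  unfold jw
  rw [outer_coe]

theorem InΔ.spread {j : Join₃ X Y Z} (h : InΔ j) (t : I) : InΔ (RelJames.spread t j) := by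
  obtain ⟨s, rfl⟩ := h
  exact ⟨_, rfl⟩

theorem joinSection_joinCollapse (j : Join₃ X Y Z) :
    joinSection C (joinCollapse X Y Z j) = contr C 1 (spread 0 j) := by
  obtain ⟨s, x, y, z, rfl⟩ := Join₃.exists_mk j
  refine (joinSection_mk C (cut (s.1.1 / (s.1.1 + s.1.2.1 + s.1.2.2)),
    (cut (s.1.2.1 / (s.1.1 + s.1.2.1 + s.1.2.2)), dpair (dpair x y) z))).trans ?_
  congr 1
  change _ = spreadFun 0 (joinDatum s x y z)
  unfold spreadFun squareJoin
  have : ∀ a b : ℝ, (1 - ((0 : I) : ℝ)) * a + ((0 : I) : ℝ) * b = a := fun a b ↦ by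
    rw [Set.Icc.coe_zero]; ring
  rw [this, this, this]
  rfl

/-- The standard representative of the third order Whitehead product. -/
def gammaStd (C : TripleCof X Y Y) (i : PtdMap (Susp Y) P) (ε : PtdMap (Susp X) P) :
    PtdMap (SS X Y Y) (J2 i) := (attachJoin i ε).comp (joinSection C)

theorem isGamma₃_gammaStd (C : TripleCof X Y Y) (i : PtdMap (Susp Y) P) (ε : PtdMap (Susp X) P) :
    IsGamma₃ i ε (gammaStd C i ε) := by
  have hpt : InΔ (Join₃ X Y Y).pt := ⟨⟨(1, 1, 1), Or.inl rfl⟩, rfl⟩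
  have hΔ : ∀ j : Join₃ X Y Y, InΔ j → ∀ t s, attachJoin i ε (contr C t (spread s j)) = (J2 i).pt :=
    fun j hj t s ↦ ((hj.spread s).contr C t).attachJoin
  let c : PtdMap (Join₃ X Y Y) (J2 i) :=
    ⟨⟨fun j ↦ attachJoin i ε (contr C 1 j), (attachJoin i ε).cont.comp
      ((continuous_contr C).comp (f := fun j ↦ ((1 : I), j)) (by fun_prop))⟩,
      (hpt.contr C 1).attachJoin⟩
  have h1 : ((gammaStd C i ε).comp (joinCollapse X Y Y)).Homotopic c := by
    refine PtdMap.homotopic_of (fun t j ↦ attachJoin i ε (contr C 1 (spread t j))) ?_ ?_ ?_ ?_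
    · exact (attachJoin i ε).cont.comp ((continuous_contr C).comp
        (f := fun q : I × Join₃ X Y Y ↦ ((1 : I), spread q.1 q.2))
        (continuous_const.prodMk continuous_spread))
    · intro j
      exact congrArg (attachJoin i ε) (joinSection_joinCollapse C j).symm
    · intro j
      rw [spread_one]
    · exact fun t ↦ hΔ _ hpt 1 t
  refine h1.trans (PtdMap.Homotopic.symm ?_)
  refine PtdMap.homotopic_of (fun t j ↦ attachJoin i ε (contr C t j)) ?_ ?_ ?_ ?_
  · exact (attachJoin i ε).cont.comp (continuous_contr C)
  · intro j
    rw [contr_zero]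
  · exact fun j ↦ rfl
  · exact fun t ↦ (hpt.contr C t).attachJoin

theorem IsGamma₃.homotopic_gammaStd (C : TripleCof X Y Y) {i : PtdMap (Susp Y) P}
    {ε : PtdMap (Susp X) P} {γ : PtdMap (SS X Y Y) (J2 i)} (h : IsGamma₃ i ε γ) :
    γ.Homotopic (gammaStd C i ε) :=
  (((joinCollapse_joinSection C).comp_left γ).symm.trans (h.comp_right (joinSection C)) :)

end GammaStd

end RelJames

namespace RelJames

/-! ### The fat wedge -/

section FatWedge

variable {P A : PtdSpace.{u}}

/-- The points of the fat wedge. -/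
def IsFat (t : DProd (DProd P A) A) : Prop :=
  (dfst (dfst t) = P.pt ∨ dsnd (dfst t) = A.pt) ∨ dsnd t = A.pt

open Classical in
/-- The map from the fat wedge to the second filtration. -/
def fatFold (i : PtdMap A P) (t : DProd (DProd P A) A) : J2 i :=
  if dsnd t = A.pt then J2.mk i (dfst (dfst t)) (dsnd (dfst t))
  else if dsnd (dfst t) = A.pt then J2.mk i (dfst (dfst t)) (dsnd t)
  else J2.mk i (i (dsnd (dfst t))) (dsnd t)

theorem J2.swap' (i : PtdMap A P) (a : A) :
    J2.mk i (i a) A.pt = J2.mk i P.pt a := Quot.sound (J2Rel.swap a)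

theorem fatFold_right (i : PtdMap A P) {t : DProd (DProd P A) A} (h : dsnd t = A.pt) :
    fatFold i t = J2.mk i (dfst (dfst t)) (dsnd (dfst t)) := if_pos h

theorem fatFold_mid (i : PtdMap A P) {t : DProd (DProd P A) A} (h : dsnd (dfst t) = A.pt) :
    fatFold i t = J2.mk i (dfst (dfst t)) (dsnd t) := by
  unfold fatFold
  split_ifs with h1
  · rw [h, h1]
  · rfl

theorem fatFold_left (i : PtdMap A P) {t : DProd (DProd P A) A} (h : dfst (dfst t) = P.pt) :
    fatFold i t = J2.mk i (i (dsnd (dfst t))) (dsnd t) := by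
  unfold fatFold
  split_ifs with h1 h2
  · rw [h, h1, J2.swap']
  · rw [h, h2, map_pt']
  · rfl

/-- The projection to the third filtration. -/
def J3.proj (i : PtdMap A P) (t : DProd (DProd P A) A) : J3 i := Quot.mk _ t

theorem J3.incl_mk (i : PtdMap A P) (p : P) (a : A) :
    J3.incl i (J2.mk i p a) = J3.proj i (dpair (dpair p a) A.pt) := rfl

theorem incl_fatFold (i : PtdMap A P) {t : DProd (DProd P A) A} (h : IsFat t) :
    J3.incl i (fatFold i t) = J3.proj i t := by
  obtain ⟨p, a', rfl⟩ : ∃ p a', t = dpair p a' := ⟨_, _, rfl⟩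
  obtain ⟨p, a, rfl⟩ : ∃ x a, p = dpair x a := ⟨_, _, rfl⟩
  rcases h with (h | h) | h
  · rw [fatFold_left i h, J3.incl_mk]
    obtain rfl : p = P.pt := h
    exact Quot.sound (J3Rel.left a a')
  · rw [fatFold_mid i h, J3.incl_mk]
    obtain rfl : a = A.pt := h
    exact (Quot.sound (J3Rel.right p a')).symm
  · rw [fatFold_right i h, J3.incl_mk]
    obtain rfl : a' = A.pt := h
    rfl

theorem continuousOn_fatFold (i : PtdMap A P) (hP : IsClosed ({P.pt} : Set P))
    (hA : IsClosed ({A.pt} : Set A)) : ContinuousOn (fatFold i) {t | IsFat t} := by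
  have c1 : IsClosed {t : DProd (DProd P A) A | dfst (dfst t) = P.pt} :=
    hP.preimage (f := fun t : DProd (DProd P A) A ↦ dfst (dfst t)) (by fun_prop)
  have c2 : IsClosed {t : DProd (DProd P A) A | dsnd (dfst t) = A.pt} :=
    hA.preimage (f := fun t : DProd (DProd P A) A ↦ dsnd (dfst t)) (by fun_prop)
  have c3 : IsClosed {t : DProd (DProd P A) A | dsnd t = A.pt} :=
    hA.preimage (f := fun t : DProd (DProd P A) A ↦ dsnd t) (by fun_prop)
  change ContinuousOn _ (({t | dfst (dfst t) = P.pt} ∪ {t | dsnd (dfst t) = A.pt}) ∪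
    {t | dsnd t = A.pt})
  refine ContinuousOn.union_of_isClosed
      (ContinuousOn.union_of_isClosed ?_ ?_ c1 c2) ?_ (c1.union c2) c3
  · exact ContinuousOn.congr (f := fun t ↦ J2.mk i (i (dsnd (dfst t))) (dsnd t))
      (Continuous.continuousOn (by fun_prop)) fun t h ↦ fatFold_left i h
  · exact ContinuousOn.congr (f := fun t ↦ J2.mk i (dfst (dfst t)) (dsnd t))
      (Continuous.continuousOn (by fun_prop)) fun t h ↦ fatFold_mid i h
  · exact ContinuousOn.congr (f := fun t ↦ J2.mk i (dfst (dfst t)) (dsnd (dfst t)))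
      (Continuous.continuousOn (by fun_prop)) fun t h ↦ fatFold_right i h

end FatWedge

/-! ### The cube as a cone on its outer faces -/

section Cube

variable {X Y Z : PtdSpace.{u}}

variable (X Y Z) in
/-- The product of three suspensions. -/
abbrev SSS : Type u := DProd (DProd (Susp X) (Susp Y)) (Susp Z)

/-- The map from the cone on the join to the product of the suspensions. -/
def cubeMap (r : I) : Join₃ X Y Z → SSS X Y Z :=
  Quot.lift (fun p ↦ dpair (dpair (Susp.mk (r * p.s₁) p.x) (Susp.mk (r * p.s₂) p.y))
    (Susp.mk (r * p.s₃) p.z)) <| by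
  rintro p q ⟨h₁, h₂, h₃, hx, hy, hz⟩
  have key : ∀ {X : PtdSpace.{u}} {s : I} {x x' : X}, s = 0 ∨ x = x' →
      Susp.mk (r * s) x = Susp.mk (r * s) x' := by
    rintro X s x x' (rfl | rfl)
    · rw [mul_zero, Susp.mk_zero, Susp.mk_zero]
    · rfl
  change dpair (dpair (Susp.mk (r * p.s₁) p.x) (Susp.mk (r * p.s₂) p.y))
    (Susp.mk (r * p.s₃) p.z) = dpair (dpair (Susp.mk (r * q.s₁) q.x) (Susp.mk (r * q.s₂) q.y))
    (Susp.mk (r * q.s₃) q.z)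
  rw [← h₁, ← h₂, ← h₃, key hx, key hy, key hz]

theorem cubeMap_mk (r : I) (s : OuterFaces) (x : X) (y : Y) (z : Z) :
    cubeMap r (Join₃.mk s x y z) = dpair (dpair (Susp.mk (r * s.1.1) x) (Susp.mk (r * s.1.2.1) y))
      (Susp.mk (r * s.1.2.2) z) := rfl

theorem continuous_cubeMap : Continuous fun q : I × Join₃ X Y Z ↦ cubeMap q.1 q.2 := by
  refine continuous_I_prod_quot ?_
  change Continuous fun q : I × JoinData X Y Z ↦ (dpair (dpair (Susp.mk (q.1 * q.2.s₁) q.2.x)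
    (Susp.mk (q.1 * q.2.s₂) q.2.y)) (Susp.mk (q.1 * q.2.s₃) q.2.z) : SSS X Y Z)
  fun_prop

/-- The parametrization of the product of three suspensions. -/
def cubeQuot (y : I × (I × (I × Q₃ X Y Z))) : SSS X Y Z := cubeMap y.1 (squareJoin y.2)

/-- The polar coordinates on the cube. -/
def polar (c : I × (I × I)) : I × (I × I) :=
  let s := outer c.2.1 c.2.2 (min (1 - (c.2.1 : ℝ)) (1 - c.2.2))
  (c.1 * s.1.1, (c.1 * s.1.2.1, c.1 * s.1.2.2))

theorem continuous_polar : Continuous polar := by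
  have : Continuous fun c : I × (I × I) ↦ outer c.2.1 c.2.2 (min (1 - (c.2.1 : ℝ)) (1 - c.2.2)) :=
    continuous_outer (by fun_prop) (by fun_prop) (by fun_prop) fun c ↦ weights_square _ _
  unfold polar
  fun_prop

theorem Weights.outer_eq {a b c a' b' c' k : ℝ} (h : Weights a b c) (hk : 0 < k)
    (ha : a' = k * a) (hb : b' = k * b) (hc : c' = k * c) : outer a' b' c' = outer a b c := by
  subst ha hb hc
  have hm : max (k * a) (max (k * b) (k * c)) = k * max a (max b c) := by
    rw [mul_max_of_nonneg _ _ hk.le, mul_max_of_nonneg _ _ hk.le]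
  have h' : Weights (k * a) (k * b) (k * c) := by
    obtain ⟨h1, h2, h3, h4⟩ := h
    exact ⟨by positivity, by positivity, by positivity, hm ▸ mul_pos hk h4⟩
  obtain ⟨e1, e2, e3⟩ := h.coe_outer
  obtain ⟨d1, d2, d3⟩ := h'.coe_outer
  rw [hm, mul_div_mul_left _ _ hk.ne'] at d1 d2 d3
  exact Subtype.ext (Prod.ext (Subtype.ext (d1.trans e1.symm))
    (Prod.ext (Subtype.ext (d2.trans e2.symm)) (Subtype.ext (d3.trans e3.symm))))

theorem exists_square (s : OuterFaces) :
    ∃ u v : I, outer u v (min (1 - (u : ℝ)) (1 - v)) = s := by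
  have h1 := s.1.1.2.1
  have h2 := s.1.2.1.2.1
  have h3 := s.1.2.2.2.1
  have hpos : 0 < (s.1.2.2 : ℝ) + max (s.1.1 : ℝ) (s.1.2.1 : ℝ) := by
    have hm : (0 : ℝ) ≤ max (s.1.1 : ℝ) (s.1.2.1 : ℝ) := h1.trans (le_max_left _ _)
    rcases s.2 with h | h | h
    · have : (1 : ℝ) ≤ max (s.1.1 : ℝ) (s.1.2.1 : ℝ) := le_max_of_le_left (by rw [h]; rfl)
      linarith
    · have : (1 : ℝ) ≤ max (s.1.1 : ℝ) (s.1.2.1 : ℝ) := le_max_of_le_right (by rw [h]; rfl)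
      linarith
    · have : (s.1.2.2 : ℝ) = 1 := by rw [h]; rfl
      linarith
  set d := (s.1.2.2 : ℝ) + max (s.1.1 : ℝ) (s.1.2.1 : ℝ) with hd
  have m1 : (s.1.1 : ℝ) ≤ max (s.1.1 : ℝ) (s.1.2.1 : ℝ) := le_max_left _ _
  have m2 : (s.1.2.1 : ℝ) ≤ max (s.1.1 : ℝ) (s.1.2.1 : ℝ) := le_max_right _ _
  let u : I := ⟨d⁻¹ * s.1.1, by positivity, by
    rw [inv_mul_le_iff₀ hpos]; linarith⟩
  let v : I := ⟨d⁻¹ * s.1.2.1, by positivity, by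
    rw [inv_mul_le_iff₀ hpos]; linarith⟩
  refine ⟨u, v, ?_⟩
  refine ((weights_coe s).outer_eq (inv_pos.2 hpos) rfl rfl ?_).trans (outer_coe s)
  rw [min_sub_sub_left]
  change 1 - max (d⁻¹ * (s.1.1 : ℝ)) (d⁻¹ * s.1.2.1) = _
  rw [← mul_max_of_nonneg _ _ (inv_pos.2 hpos).le]
  field_simp
  linarith

theorem polar_surjective : Function.Surjective polar := by
  intro t
  by_cases h : t = (0, (0, 0))
  · subst h
    refine ⟨(0, (0, 0)), ?_⟩
    unfold polar
    simp
  · have h1 := t.1.2.1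
    have h2 := t.2.1.2.1
    have h3 := t.2.2.2.1
    have hw : Weights t.1 t.2.1 t.2.2 := by
      refine ⟨h1, h2, h3, ?_⟩
      by_contra h'
      rw [not_lt, max_le_iff, max_le_iff] at h'
      refine h (Prod.ext (Subtype.ext ?_) (Prod.ext (Subtype.ext ?_) (Subtype.ext ?_)))
      · exact le_antisymm h'.1 h1
      · exact le_antisymm h'.2.1 h2
      · exact le_antisymm h'.2.2 h3
    obtain ⟨u, v, huv⟩ := exists_square (outer t.1 t.2.1 t.2.2)
    have hm := hw.2.2.2
    refine ⟨(⟨max t.1 (max t.2.1 t.2.2), hm.le,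
      max_le t.1.2.2 (max_le t.2.1.2.2 t.2.2.2.2)⟩, (u, v)), ?_⟩
    obtain ⟨e1, e2, e3⟩ := hw.coe_outer
    unfold polar
    simp only [huv]
    refine Prod.ext (Subtype.ext ?_) (Prod.ext (Subtype.ext ?_) (Subtype.ext ?_))
    · rw [Set.Icc.coe_mul, e1, mul_div_cancel₀ _ hm.ne']
    · rw [Set.Icc.coe_mul, e2, mul_div_cancel₀ _ hm.ne']
    · rw [Set.Icc.coe_mul, e3, mul_div_cancel₀ _ hm.ne']

theorem isQuotientMap_polar_prod (Q : Type*) [TopologicalSpace Q] :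
    IsQuotientMap fun p : (I × (I × I)) × Q ↦ (polar p.1, p.2) := by
  have h1 : IsProperMap polar := continuous_polar.isProperMap
  have h2 : IsProperMap (Prod.map polar (id : Q → Q)) := h1.prodMap isProperMap_id
  exact h2.isClosedMap.isQuotientMap h2.continuous (polar_surjective.prodMap Function.surjective_id)

theorem isQuotientMap_cubeQuot : IsQuotientMap (cubeQuot (X := X) (Y := Y) (Z := Z)) := by
  let e₁ : I × (I × (I × Q₃ X Y Z)) → (I × (I × I)) × Q₃ X Y Z :=
    fun y ↦ ((y.1, (y.2.1, y.2.2.1)), y.2.2.2)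
  have h1 : IsQuotientMap e₁ := IsQuotientMap.of_inverse
    (f := fun p ↦ (p.1.1, (p.1.2.1, (p.1.2.2, p.2)))) (by fun_prop) (by fun_prop) fun _ ↦ rfl
  let e₂ : (I × (I × I)) × Q₃ X Y Z → DProd (DProd (I × X) (I × Y)) (I × Z) :=
    fun p ↦ dpair (dpair (p.1.1, dfst (dfst p.2)) (p.1.2.1, dsnd (dfst p.2))) (p.1.2.2, dsnd p.2)
  have h2 : IsQuotientMap e₂ := by
    have hdg : DeltaGeneratedSpace ((I × (I × I)) × Q₃ X Y Z) := h1.isGeneratedBy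
    refine IsQuotientMap.of_inverse (f := fun p : DProd (DProd (I × X) (I × Y)) (I × Z) ↦
      (((dfst (dfst p)).1, ((dsnd (dfst p)).1, (dsnd p).1)),
        dpair (dpair (dfst (dfst p)).2 (dsnd (dfst p)).2) (dsnd p).2)) ?_ ?_ fun _ ↦ rfl
    · fun_prop
    · fun_prop
  have h3 := isQuotientMap_dprod_left (Z := Z) (isQuotientMap_dprod_left (Z := Y)
    (Susp.isQuotientMap_mk (X := X)))
  have h4 : IsQuotientMap fun p : DProd (DProd (I × X) (I × Y)) (I × Z) ↦
      (dpair (dpair (Susp.mk (dfst (dfst p)).1 (dfst (dfst p)).2)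
        (Susp.mk (dsnd (dfst p)).1 (dsnd (dfst p)).2)) (Susp.mk (dsnd p).1 (dsnd p).2) :
          SSS X Y Z) := by
    have a1 := isQuotientMap_dprod_left (Z := I × Y) (Susp.isQuotientMap_mk (X := X))
    have a2 := isQuotientMap_dprod_right (Z := Susp X) (Susp.isQuotientMap_mk (X := Y))
    have a3 := isQuotientMap_dprod_left (Z := I × Z) (a2.comp a1)
    have a4 := isQuotientMap_dprod_right (Z := DProd (Susp X) (Susp Y))
      (Susp.isQuotientMap_mk (X := Z))
    exact a4.comp a3
  exact h4.comp (h2.comp ((isQuotientMap_polar_prod (Q₃ X Y Z)).comp h1))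

/-- The points that are mapped to the fat wedge. -/
def cubeSet (X Y Z : PtdSpace.{u}) : Set (I × (I × (I × Q₃ X Y Z))) :=
  {y | (y.1 = 0 ∨ y.1 = 1) ∨ SSCollapsed y.2}

/-- The structure that is used for attaching the cube. -/
def TripleCof.cube (C : TripleCof X Y Z) :
    CofStr (I × (I × (I × Q₃ X Y Z))) (cubeSet X Y Z) :=
  (CofStr.ends.prodI (CofStr.ends.prodI (CofStr.ends.prodI
    ((C.SX.dprod C.SY).dprod C.SZ)))).copy _ <| by
    ext y
    simp only [cubeSet, SSCollapsed, Q₃.Deg, Set.mem_ofPred_eq, or_assoc, Set.mem_singleton_iff]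

/-- The points of the product of suspensions with a coordinate equal to the base point. -/
def SSS.Fat (t : SSS X Y Z) : Prop :=
  (dfst (dfst t) = (Susp X).pt ∨ dsnd (dfst t) = (Susp Y).pt) ∨ dsnd t = (Susp Z).pt

theorem cubeMap_zero (j : Join₃ X Y Z) :
    cubeMap 0 j = dpair (dpair (Susp X).pt (Susp Y).pt) (Susp Z).pt := by
  obtain ⟨s, x, y, z, rfl⟩ := Join₃.exists_mk j
  rw [cubeMap_mk]
  simp only [zero_mul, Susp.mk_zero]

theorem cubeMap_one_fat (j : Join₃ X Y Z) : (cubeMap 1 j).Fat := by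
  obtain ⟨s, x, y, z, rfl⟩ := Join₃.exists_mk j
  rw [cubeMap_mk]
  simp only [one_mul]
  rcases s.2 with h | h | h
  · exact Or.inl (Or.inl (by rw [h]; exact Susp.mk_one _))
  · exact Or.inl (Or.inr (by rw [h]; exact Susp.mk_one _))
  · exact Or.inr (by rw [h]; exact Susp.mk_one _)

theorem InK.cubeMap_fat {j : Join₃ X Y Z} (h : InK j) (r : I) : (cubeMap r j).Fat := by
  obtain ⟨s, x, y, z, rfl, h⟩ := h
  rw [cubeMap_mk]
  have key : ∀ {X : PtdSpace.{u}} {s : I} {x : X}, s = 0 ∨ x = X.pt →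
      Susp.mk (r * s) x = (Susp X).pt := by
    rintro X s x (rfl | rfl)
    · rw [mul_zero, Susp.mk_zero]
    · exact Susp.mk_eq_pt (Or.inr (Or.inr rfl))
  rcases h with h | h | h | h | h | h
  · exact Or.inl (Or.inl (key (Or.inl h)))
  · exact Or.inl (Or.inr (key (Or.inl h)))
  · exact Or.inr (key (Or.inl h))
  · exact Or.inl (Or.inl (key (Or.inr h)))
  · exact Or.inl (Or.inr (key (Or.inr h)))
  · exact Or.inr (key (Or.inr h))

theorem cubeMap_fat {y : I × (I × (I × Q₃ X Y Z))} (hy : y ∈ cubeSet X Y Z)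
    {j : Join₃ X Y Z} (hj : SSCollapsed y.2 → InK j) : (cubeMap y.1 j).Fat := by
  rcases hy with (h | h) | h
  · rw [h, cubeMap_zero]
    exact Or.inr rfl
  · rw [h]
    exact cubeMap_one_fat _
  · exact (hj h).cubeMap_fat _

theorem square_injective {u v u' v' : I}
    (h : outer u v (min (1 - (u : ℝ)) (1 - v)) = outer u' v' (min (1 - (u' : ℝ)) (1 - v'))) :
    u = u' ∧ v = v' := by
  have hw := weights_square u v
  have hw' := weights_square u' v'
  obtain ⟨e1, e2, e3⟩ := hw.coe_outer
  obtain ⟨d1, d2, d3⟩ := hw'.coe_outer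
  rw [h] at e1 e2 e3
  rw [e1] at d1
  rw [e2] at d2
  rw [e3] at d3
  have hm := hw.2.2.2
  have hm' := hw'.2.2.2
  set m := max (u : ℝ) (max v (min (1 - (u : ℝ)) (1 - v)))
  set m' := max (u' : ℝ) (max v' (min (1 - (u' : ℝ)) (1 - v')))
  rw [div_eq_div_iff hm.ne' hm'.ne'] at d1 d2 d3
  rw [min_sub_sub_left, min_sub_sub_left] at d3
  have h4 : max (u : ℝ) v * m' = max (u' : ℝ) v' * m := by
    rw [max_mul_of_nonneg _ _ hm'.le, max_mul_of_nonneg _ _ hm.le, d1, d2]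
  have h5 : m = m' := by nlinarith
  rw [h5] at d1 d2
  exact ⟨Subtype.ext (mul_right_cancel₀ hm'.ne' d1), Subtype.ext (mul_right_cancel₀ hm'.ne' d2)⟩

theorem OuterFaces.max_eq (s : OuterFaces) : max (s.1.1 : ℝ) (max s.1.2.1 s.1.2.2) = 1 := by
  refine le_antisymm (max_le s.1.1.2.2 (max_le s.1.2.1.2.2 s.1.2.2.2.2)) ?_
  rcases s.2 with h | h | h
  · exact le_max_of_le_left (by rw [h]; rfl)
  · exact le_max_of_le_right (le_max_of_le_left (by rw [h]; rfl))
  · exact le_max_of_le_right (le_max_of_le_right (by rw [h]; rfl))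

theorem outer_square_pos {u v : I} (hu : u ≠ 0 ∧ u ≠ 1) (hv : v ≠ 0 ∧ v ≠ 1) :
    0 < (outer u v (min (1 - (u : ℝ)) (1 - v))).1.1 ∧
    0 < (outer u v (min (1 - (u : ℝ)) (1 - v))).1.2.1 ∧
    0 < (outer u v (min (1 - (u : ℝ)) (1 - v))).1.2.2 := by
  have hw := weights_square u v
  obtain ⟨e1, e2, e3⟩ := hw.coe_outer
  have hm := hw.2.2.2
  have hu0 : (0 : ℝ) < u := unitInterval.pos_iff_ne_zero.2 hu.1
  have hv0 : (0 : ℝ) < v := unitInterval.pos_iff_ne_zero.2 hv.1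
  have hu1 : (u : ℝ) < 1 := unitInterval.lt_one_iff_ne_one.2 hu.2
  have hv1 : (v : ℝ) < 1 := unitInterval.lt_one_iff_ne_one.2 hv.2
  refine ⟨?_, ?_, ?_⟩ <;> rw [← Subtype.coe_lt_coe]
  · rw [e1]; exact div_pos hu0 hm
  · rw [e2]; exact div_pos hv0 hm
  · rw [e3]; exact div_pos (lt_min (by linarith) (by linarith)) hm

theorem cubeQuot_not_fat {y : I × (I × (I × Q₃ X Y Z))} (hy : y ∉ cubeSet X Y Z) :
    ¬ (cubeQuot y).Fat := by
  obtain ⟨c, u, v, q⟩ := y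
  simp only [cubeSet, SSCollapsed, Q₃.Deg, Set.mem_ofPred_eq, not_or] at hy
  obtain ⟨⟨hc0, hc1⟩, hu, hv, hx, hy, hz⟩ := hy
  obtain ⟨p1, p2, p3⟩ := outer_square_pos hu hv
  have key : ∀ {X : PtdSpace.{u}} {s : I} {x : X}, 0 < s → x ≠ X.pt →
      Susp.mk (c * s) x ≠ (Susp X).pt := by
    intro X s x hs hx h
    rcases Susp.mk_eq_pt_iff.1 h with h | h | h
    · exact (mul_pos (unitInterval.pos_iff_ne_zero.2 hc0) hs).ne' h
    · have h1 : (c * s : I) < 1 :=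
        lt_of_le_of_lt unitInterval.mul_le_left (unitInterval.lt_one_iff_ne_one.2 hc1)
      exact h1.ne h
    · exact hx h
  rintro ((h | h) | h)
  · exact key p1 hx h
  · exact key p2 hy h
  · exact key p3 hz h

theorem cubeQuot_injOn {y y' : I × (I × (I × Q₃ X Y Z))} (h : cubeQuot y = cubeQuot y')
    (hy : y ∉ cubeSet X Y Z) : y = y' := by
  have hnf := cubeQuot_not_fat hy
  obtain ⟨c, u, v, q⟩ := y
  obtain ⟨c', u', v', q'⟩ := y'
  unfold SSS.Fat at hnf
  simp only [not_or] at hnf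
  obtain ⟨⟨n1, n2⟩, n3⟩ := hnf
  have key : ∀ {X : PtdSpace.{u}} {s s' : I} {x x' : X}, Susp.mk s x = Susp.mk s' x' →
      Susp.mk s x ≠ (Susp X).pt → s = s' ∧ x = x' := fun e n ↦
    (Susp.mk_eq_mk e).resolve_right fun e' ↦ n (Susp.mk_eq_pt e'.1)
  obtain ⟨s1, x1⟩ := key (congrArg (fun t ↦ dfst (dfst t)) h) n1
  obtain ⟨s2, x2⟩ := key (congrArg (fun t ↦ dsnd (dfst t)) h) n2
  obtain ⟨s3, x3⟩ := key (congrArg (fun t ↦ dsnd t) h) n3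
  have hq : q = q' := by
    rw [← dpair_eta q, ← dpair_eta (dfst q), ← dpair_eta q', ← dpair_eta (dfst q')]
    exact congrArg₂ dpair (congrArg₂ dpair x1 x2) x3
  set s := outer u v (min (1 - (u : ℝ)) (1 - v)) with hs
  set s' := outer u' v' (min (1 - (u' : ℝ)) (1 - v')) with hs'
  have e1 : (c : ℝ) * s.1.1 = c' * s'.1.1 := congrArg Subtype.val s1
  have e2 : (c : ℝ) * s.1.2.1 = c' * s'.1.2.1 := congrArg Subtype.val s2
  have e3 : (c : ℝ) * s.1.2.2 = c' * s'.1.2.2 := congrArg Subtype.val s3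
  have hmax : ∀ (c : I) (s : OuterFaces),
      max ((c : ℝ) * s.1.1) (max (c * s.1.2.1) (c * s.1.2.2)) = c := by
    intro c s
    rw [← mul_max_of_nonneg _ _ c.2.1, ← mul_max_of_nonneg _ _ c.2.1, s.max_eq, mul_one]
  have hc : (c : ℝ) = c' := by
    rw [← hmax c s, ← hmax c' s', e1, e2, e3]
  have hc0 : (c : ℝ) ≠ 0 := by
    intro h0
    refine n1 (Susp.mk_eq_pt (Or.inl (Subtype.ext ?_)))
    change (c : ℝ) * _ = 0
    rw [h0, zero_mul]
  rw [← hc] at e1 e2 e3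
  have hss : s = s' := Subtype.ext (Prod.ext (Subtype.ext (mul_left_cancel₀ hc0 e1))
    (Prod.ext (Subtype.ext (mul_left_cancel₀ hc0 e2)) (Subtype.ext (mul_left_cancel₀ hc0 e3))))
  obtain ⟨rfl, rfl⟩ := square_injective hss
  exact Prod.ext (Subtype.ext hc) (Prod.ext rfl (Prod.ext rfl hq))

end Cube

end RelJames

namespace RelJames

/-! ### Filtrations of the relative James construction as adjunction spaces -/

/-- A quotient of `T` that is obtained from a subspace `fat` by the map `fold` to `B` is an adjunction
space, up to homotopy, if `T` deforms into the union of `fat` and a relative cell structure. -/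
theorem Adj.exists_equiv_of_fold {B B' : PtdSpace.{u}} {T T₀ Y : Type u} [TopologicalSpace T]
    [TopologicalSpace T₀] [TopologicalSpace Y] [DeltaGeneratedSpace Y] {L : Set Y} {c : Y → T₀}
    {E : T₀ → T} {R : T → T₀} {fat M : Set T} {fold : T → B} {proj : T → B'} (S : CofStr T M)
    (hM : M = Set.range E ∪ fat) (hErange : IsClosed (Set.range E)) (hfat : IsClosed fat)
    (hu : ∀ t, S.u t ≤ 1) (hc : IsQuotientMap c) (hE : Continuous E) (hR : Continuous R)
    (hRE : ∀ t, R (E t) = t) (hcL : ∀ y, E (c y) ∈ fat ↔ y ∈ L)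
    (hcinj : ∀ y y', c y = c y' → y = y' ∨ y ∈ L) (hfold : ContinuousOn fold fat)
    (hproj : IsQuotientMap proj) (incl : PtdMap B B') (hincl : ∀ t ∈ fat, incl (fold t) = proj t)
    (hsurj : ∀ b, ∃ t ∈ fat, fold t = b)
    (hinj : ∀ t t', proj t = proj t' → t = t' ∨ (t ∈ fat ∧ t' ∈ fat ∧ fold t = fold t')) :
    ∃ (φ : PtdMap (Adj B Y L fun y ↦ fold (E (c y))) B') (ν : PtdMap B' (Adj B Y L _)),
      (∀ b, φ (Adj.inl B Y L _ b) = incl b) ∧ (∀ y, φ (Adj.inr y) = proj (E (c y))) ∧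
      (∀ z, ν (φ z) = z) ∧ (φ.comp ν).Homotopic (PtdMap.id B') := by
  classical
  have hcc := hc.continuous
  have hpc := hproj.continuous
  set a : Y → B := fun y ↦ fold (E (c y)) with ha
  let φ : PtdMap (Adj B Y L a) B' := Adj.desc incl (fun y ↦ proj (E (c y))) (by fun_prop)
    fun y hy ↦ (hincl _ ((hcL y).2 hy)).symm
  have hwd : ∀ y y', c y = c y' → (Adj.inr y : Adj B Y L a) = Adj.inr y' := by
    intro y y' h
    rcases hcinj y y' h with rfl | hy
    · rfl
    · have hy' : y' ∈ L := by rw [← hcL, ← h, hcL]; exact hy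
      rw [Adj.inr_eq hy, Adj.inr_eq hy', show a y = a y' from congrArg (fun t ↦ fold (E t)) h]
  let ψ : T₀ → Adj B Y L a := fun t ↦ Adj.inr (Function.surjInv hc.surjective t)
  have hψ : ∀ y, ψ (c y) = Adj.inr y := fun y ↦ hwd _ _ (Function.surjInv_eq hc.surjective _)
  have hψc : Continuous ψ := by
    rw [hc.continuous_iff, show ψ ∘ c = Adj.inr from funext hψ]
    fun_prop
  let ν₀ : T → Adj B Y L a := fun t ↦
    if t ∈ Set.range E then ψ (R t) else Adj.inl B Y L a (fold t)
  have hν₀fat : ∀ t ∈ fat, ν₀ t = Adj.inl B Y L a (fold t) := by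
    intro t ht
    change ite _ _ _ = _
    split_ifs with h
    · obtain ⟨t, rfl⟩ := h
      obtain ⟨y, rfl⟩ := hc.surjective t
      rw [hRE, hψ, Adj.inr_eq ((hcL y).1 ht)]
    · rfl
  have hν₀c : ContinuousOn ν₀ M := by
    rw [hM]
    refine ContinuousOn.union_of_isClosed ?_ ?_ hErange hfat
    · exact (hψc.comp hR).continuousOn.congr fun t ht ↦ if_pos ht
    · exact ((Adj.inl B Y L a).cont.comp_continuousOn hfold).congr hν₀fat
  have hφν₀ : ∀ t ∈ M, φ (ν₀ t) = proj t := by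
    intro t ht
    by_cases h : t ∈ fat
    · rw [hν₀fat t h]
      exact hincl t h
    · rw [hM] at ht
      have h' := ht.resolve_right h
      change φ (ite _ _ _) = _
      rw [if_pos h']
      obtain ⟨t, rfl⟩ := h'
      obtain ⟨y, rfl⟩ := hc.surjective t
      rw [hRE, hψ]
      rfl
  have hk1 : ∀ t, S.k 1 t ∈ M := fun t ↦ S.k_mem 1 t (hu t) le_rfl
  have hfM : ∀ t ∈ fat, t ∈ M := fun t ht ↦ hM ▸ Or.inr ht
  let s : B' → T := Function.surjInv hproj.surjective
  have hs : ∀ t, s (proj t) = t ∨ (s (proj t) ∈ fat ∧ t ∈ fat ∧ fold (s (proj t)) = fold t) :=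
    fun t ↦ hinj _ _ (Function.surjInv_eq hproj.surjective _)
  have hνs : ∀ t, ν₀ (S.k 1 (s (proj t))) = ν₀ (S.k 1 t) := by
    intro t
    rcases hs t with h | ⟨h1, h2, h3⟩
    · rw [h]
    · rw [S.k_rel _ _ (hfM _ h1), S.k_rel _ _ (hfM _ h2), hν₀fat _ h1, hν₀fat _ h2, h3]
  have hνincl : ∀ b, ν₀ (S.k 1 (s (incl b))) = Adj.inl B Y L a b := by
    intro b
    obtain ⟨t, ht, rfl⟩ := hsurj b
    rw [hincl t ht, hνs, S.k_rel _ _ (hfM _ ht), hν₀fat _ ht]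
  let ν : PtdMap B' (Adj B Y L a) :=
    { toFun := fun z ↦ ν₀ (S.k 1 (s z))
      continuous_toFun := by
        rw [hproj.continuous_iff]
        refine Continuous.congr (f := fun t ↦ ν₀ (S.k 1 t)) ?_ fun t ↦ (hνs t).symm
        exact hν₀c.comp_continuous (by fun_prop) hk1
      map_pt := by
        rw [← incl.map_pt]
        exact hνincl B.pt }
  refine ⟨φ, ν, fun _ ↦ rfl, fun _ ↦ rfl, ?_, PtdMap.Homotopic.symm ?_⟩
  · refine Adj.ind hνincl fun y ↦ ?_
    change ν₀ (S.k 1 (s (proj (E (c y))))) = _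
    have hy : E (c y) ∈ Set.range E := ⟨_, rfl⟩
    rw [hνs, S.k_rel _ _ (hM ▸ Or.inl hy)]
    change ite _ _ _ = _
    rw [if_pos hy, hRE, hψ]
  · have hps : ∀ (τ : I) t, proj (S.k τ (s (proj t))) = proj (S.k τ t) := by
      intro τ t
      rcases hs t with h | ⟨h1, h2, h3⟩
      · rw [h]
      · rw [S.k_rel _ _ (hfM _ h1), S.k_rel _ _ (hfM _ h2)]
        exact (hincl _ h1).symm.trans ((congrArg incl h3).trans (hincl _ h2))
    refine PtdMap.homotopic_of (fun τ z ↦ proj (S.k τ (s z))) ?_ ?_ ?_ ?_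
    · rw [(isQuotientMap_prodMk_left (K := I) hproj).continuous_iff]
      refine Continuous.congr (f := fun p : I × T ↦ proj (S.k p.1 p.2)) (by fun_prop)
        fun p ↦ (hps p.1 p.2).symm
    · intro z
      rw [Set.Icc.coe_zero, S.k_zero]
      exact Function.surjInv_eq hproj.surjective z
    · intro z
      exact (hφν₀ _ (hk1 _)).symm
    · intro τ
      obtain ⟨t, ht, h⟩ := hsurj B.pt
      have h' : B'.pt = proj t := by rw [← hincl t ht, h, map_pt']
      rw [h', hps, S.k_rel _ _ (hfM _ ht)]

/-- A space `P` that deforms to `ΣX'` relative to an inclusion `ε` of `ΣX'`, together with a map from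
`ΣA'`; the base points of `X'` and `A'` are nondegenerate. -/
structure CylData {X' A' P : PtdSpace.{u}} (i : PtdMap (Susp A') P) (ε : PtdMap (Susp X') P)
    (r : PtdMap P (Susp X')) where
  /-- the structure at the base point of `X'` -/
  SX : CofStr X' {X'.pt}
  /-- the structure at the base point of `A'` -/
  SA : CofStr A' {A'.pt}
  /-- the deformation -/
  H : I → P → P
  r_ε : ∀ x, r (ε x) = x
  cont_H : Continuous fun p : I × P ↦ H p.1 p.2
  H_zero : ∀ p, H 0 p = p
  H_one : ∀ p, H 1 p = ε (r p)
  H_ε : ∀ t x, H t (ε x) = ε x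
  r_H : ∀ t p, r (H t p) = r p
  /-- the structure at the image of `ε` -/
  SP : CofStr P (Set.range ε)
  u_le : ∀ p, SP.u p ≤ 1

section Filtration

variable {X' A' P : PtdSpace.{u}} {i : PtdMap (Susp A') P} {ε : PtdMap (Susp X') P}
  {r : PtdMap P (Susp X')} (D : CylData i ε r)

namespace CylData

theorem injective_ε (D : CylData i ε r) : Function.Injective ε := fun x y h ↦ by
  rw [← D.r_ε x, h, D.r_ε]

theorem ε_eq_pt (D : CylData i ε r) {x : Susp X'} : ε x = P.pt ↔ x = (Susp X').pt := by
  rw [← map_pt' ε, D.injective_ε.eq_iff]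

theorem isClosed_pt (D : CylData i ε r) : IsClosed ({P.pt} : Set P) := by
  have : ({P.pt} : Set P) = Set.range ε ∩ r ⁻¹' {(Susp X').pt} := by
    ext p
    simp only [Set.mem_singleton_iff, Set.mem_inter_iff, Set.mem_preimage]
    constructor
    · rintro rfl
      exact ⟨⟨_, ε.map_pt⟩, r.map_pt⟩
    · rintro ⟨⟨x, rfl⟩, h⟩
      rw [D.r_ε] at h
      exact D.ε_eq_pt.2 h
  rw [this]
  exact D.SP.isClosed.inter (D.SX.susp.isClosed.preimage r.cont)

/-- The structures on the three factors. -/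
def triple : TripleCof X' A' A' := ⟨D.SX, D.SA, D.SA⟩

end CylData

theorem J3.proj_eq_proj (i : PtdMap A' P) {t t' : DProd (DProd P A') A'}
    (h : J3.proj i t = J3.proj i t') :
    t = t' ∨ (IsFat t ∧ IsFat t' ∧ fatFold i t = fatFold i t') := by
  let f : DProd (DProd P A') A' → Set (DProd (DProd P A') A') := fun t ↦
    {s | s = t ∨ (IsFat s ∧ IsFat t ∧ fatFold i s = fatFold i t)}
  have key : ∀ t t', IsFat t → IsFat t' → fatFold i t = fatFold i t' → f t = f t' := by
    intro t t' h h' hf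
    ext s
    constructor
    · rintro (rfl | ⟨h1, h2, h3⟩)
      exacts [Or.inr ⟨h, h', hf⟩, Or.inr ⟨h1, h', h3.trans hf⟩]
    · rintro (rfl | ⟨h1, h2, h3⟩)
      exacts [Or.inr ⟨h', h, hf.symm⟩, Or.inr ⟨h1, h, h3.trans hf.symm⟩]
  have hf : ∀ t t', J3Rel i t t' → f t = f t' := by
    rintro _ _ (⟨x, a⟩ | ⟨a, a'⟩ | ⟨a, a'⟩)
    · refine key _ _ (Or.inl (Or.inr rfl)) (Or.inr rfl) ?_
      rw [fatFold_mid i rfl, fatFold_right i rfl]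
      rfl
    · refine key _ _ (Or.inr rfl) (Or.inl (Or.inl rfl)) ?_
      rw [fatFold_right i rfl, fatFold_left i rfl]
      rfl
    · refine key _ _ (Or.inl (Or.inl rfl)) (Or.inl (Or.inr rfl)) ?_
      rw [fatFold_left i rfl, fatFold_mid i rfl]
      rfl
  have h' : f t = f t' := congrArg (Quot.lift f hf) h
  have ht : t ∈ f t := Or.inl rfl
  rw [h'] at ht
  exact ht

/-- The map of triple products induced by a map of the first factor. -/
def onFirst (ε : PtdMap (Susp X') P) (t : SSS X' A' A') : DProd (DProd P (Susp A')) (Susp A') :=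
  dpair (dpair (ε (dfst (dfst t))) (dsnd (dfst t))) (dsnd t)

@[fun_prop] theorem continuous_onFirst (ε : PtdMap (Susp X') P) :
    Continuous (onFirst (A' := A') ε) := by unfold onFirst; fun_prop

theorem isFat_onFirst (D : CylData i ε r) (t : SSS X' A' A') : IsFat (onFirst ε t) ↔ t.Fat := by
  unfold IsFat onFirst SSS.Fat
  rw [dfst_dpair, dfst_dpair, dsnd_dpair, dsnd_dpair, D.ε_eq_pt]

/-- The attaching map of the cube. -/
def cubeAtt (i : PtdMap (Susp A') P) (ε : PtdMap (Susp X') P) (y : I × (I × (I × Q₃ X' A' A'))) :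
    J2 i := fatFold i (onFirst ε (cubeQuot y))

theorem isClosed_isFat (hP : IsClosed ({P.pt} : Set P)) (hA : IsClosed ({A'.pt} : Set A')) :
    IsClosed {t : DProd (DProd P A') A' | IsFat t} :=
  ((hP.preimage (f := fun t : DProd (DProd P A') A' ↦ dfst (dfst t)) (by fun_prop)).union
    (hA.preimage (f := fun t : DProd (DProd P A') A' ↦ dsnd (dfst t)) (by fun_prop))).union
    (hA.preimage (f := fun t : DProd (DProd P A') A' ↦ dsnd t) (by fun_prop))

theorem cubeQuot_fat_iff (_ : TripleCof X' A' A') {y : I × (I × (I × Q₃ X' A' A'))} :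
    (cubeQuot y).Fat ↔ y ∈ cubeSet X' A' A' :=
  ⟨fun h ↦ by_contra fun h' ↦ cubeQuot_not_fat h' h, fun h ↦ cubeMap_fat h fun h' ↦ h'.inK⟩

/-- The third filtration is obtained from the second one by attaching a cube, up to homotopy. -/
theorem exists_equiv_J3 (D : CylData i ε r) :
    ∃ φ : PtdMap (Adj (J2 i) (I × (I × (I × Q₃ X' A' A'))) (cubeSet X' A' A') (cubeAtt i ε)) (J3 i),
      φ.IsHomotopyEquiv ∧ ∀ b, φ (Adj.inl _ _ _ _ b) = J3.incl i b := by
  have hA := D.SA.susp.isClosed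
  have hE : Set.range (onFirst (A' := A') ε) = (fun t ↦ dfst (dfst t)) ⁻¹' Set.range ε := by
    ext t
    constructor
    · rintro ⟨x, rfl⟩
      exact ⟨_, rfl⟩
    · rintro ⟨x, hx⟩
      refine ⟨dpair (dpair x (dsnd (dfst t))) (dsnd t), ?_⟩
      unfold onFirst
      rw [dfst_dpair, dfst_dpair, dsnd_dpair, dsnd_dpair, hx, dpair_eta, dpair_eta]
  have hM : {t : DProd (DProd P (Susp A')) (Susp A') | dfst t ∈ {t : DProd P (Susp A') |
      dfst t ∈ Set.range ε ∨ dsnd t ∈ ({(Susp A').pt} : Set (Susp A'))} ∨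
      dsnd t ∈ ({(Susp A').pt} : Set (Susp A'))} =
      Set.range (onFirst ε) ∪ {t | IsFat t} := by
    rw [hE]
    ext t
    simp only [Set.mem_ofPred_eq, Set.mem_union, IsFat, Set.mem_singleton_iff, Set.mem_preimage]
    constructor
    · rintro ((h | h) | h)
      · exact Or.inl h
      · exact Or.inr (Or.inl (Or.inr h))
      · exact Or.inr (Or.inr h)
    · rintro (h | (h | h) | h)
      · exact Or.inl (Or.inl h)
      · exact Or.inl (Or.inl ⟨_, (map_pt' ε).trans h.symm⟩)
      · exact Or.inl (Or.inr h)
      · exact Or.inr h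
  have hEc : IsClosed (Set.range (onFirst (A' := A') ε)) :=
    hE ▸ D.SP.isClosed.preimage (by fun_prop)
  have hR : Continuous fun t : DProd (DProd P (Susp A')) (Susp A') ↦
      (dpair (dpair (r (dfst (dfst t))) (dsnd (dfst t))) (dsnd t) : SSS X' A' A') := by fun_prop
  have hRE : ∀ t : SSS X' A' A', (fun t : DProd (DProd P (Susp A')) (Susp A') ↦
      (dpair (dpair (r (dfst (dfst t))) (dsnd (dfst t))) (dsnd t) : SSS X' A' A')) (onFirst ε t)
        = t := by
    intro t
    unfold onFirst
    simp only [dfst_dpair, dsnd_dpair, D.r_ε, dpair_eta]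
  have hsurj : ∀ b : J2 i, ∃ t ∈ {t | IsFat t}, fatFold i t = b := by
    intro b
    induction b using Quot.ind with | mk b => ?_
    refine ⟨dpair b (Susp A').pt, Or.inr rfl, ?_⟩
    rw [fatFold_right i rfl]
    rfl
  obtain ⟨φ, ν, h1, -, h3, h4⟩ := Adj.exists_equiv_of_fold (B := J2 i) (B' := J3 i)
    (L := cubeSet X' A' A') (c := cubeQuot) (proj := J3.proj i)
    ((D.SP.dprod D.SA.susp).dprod D.SA.susp) hM hEc (isClosed_isFat D.isClosed_pt hA)
    (fun t ↦ (min_le_left _ _).trans ((min_le_left _ _).trans (D.u_le _)))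
    isQuotientMap_cubeQuot (continuous_onFirst ε) hR hRE
    (fun y ↦ by rw [Set.mem_ofPred_eq, isFat_onFirst D, cubeQuot_fat_iff D.triple])
    (fun y y' h ↦ (em (y ∈ cubeSet X' A' A')).elim Or.inr fun hy ↦ Or.inl (cubeQuot_injOn h hy))
    (continuousOn_fatFold i D.isClosed_pt hA) isQuotientMap_quot_mk (J3.incl i)
    (fun t ht ↦ incl_fatFold i ht) hsurj fun t t' h ↦ J3.proj_eq_proj i h
  exact ⟨φ, ⟨ν, PtdMap.Homotopic.of_eq h3, h4⟩, h1⟩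

/-- The attaching map of the cube is homotopic to the one of the cone on the standard
representative of the third order Whitehead product. -/
theorem cubeAtt_homotopy (D : CylData i ε r) : Adj.AttHomotopy (cubeSet X' A' A') (cubeAtt i ε)
    (fun y ↦ coneAtt (gammaStd D.triple i ε) (y.1, ssMk y.2))
    fun τ y ↦ fatFold i (onFirst ε (cubeMap y.1 (contr D.triple (cI τ) (squareJoin y.2)))) := by
  have hA := D.SA.susp.isClosed
  refine ⟨?_, fun y hy ↦ ?_, fun y hy ↦ ?_⟩
  · have h1 : Continuous fun p : ℝ × (I × (I × (I × Q₃ X' A' A'))) ↦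
        contr D.triple (cI p.1) (squareJoin p.2.2) := (continuous_contr D.triple).comp
      (f := fun p : ℝ × (I × (I × (I × Q₃ X' A' A'))) ↦ (cI p.1, squareJoin p.2.2))
        (Continuous.prodMk (by fun_prop) (continuous_squareJoin.comp (by fun_prop)))
    have h2 : Continuous fun p : ℝ × (I × (I × (I × Q₃ X' A' A'))) ↦
        cubeMap p.2.1 (contr D.triple (cI p.1) (squareJoin p.2.2)) :=
      continuous_cubeMap.comp (Continuous.prodMk (by fun_prop) h1)
    have h3 := ((continuous_onFirst ε).comp h2).continuousOn (s := Set.univ ×ˢ cubeSet X' A' A')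
    refine (continuousOn_fatFold i D.isClosed_pt hA).comp h3 ?_
    · intro p hp
      exact (isFat_onFirst D _).2 (cubeMap_fat hp.2 fun h ↦ h.inK.contr D.triple _)
  · rw [cI_zero, contr_zero]
    rfl
  · rw [cI_one]
    have hface : ∀ j : Join₃ X' A' A', fatFold i (onFirst ε (cubeMap 1 j)) = attachJoin i ε j := by
      intro j
      obtain ⟨s, x, y, z, rfl⟩ := Join₃.exists_mk j
      rw [cubeMap_mk]
      change _ = attachFun i ε (joinDatum s x y z)
      unfold onFirst
      simp only [one_mul, dfst_dpair, dsnd_dpair]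
      rcases s.2 with h | h | h
      · rw [attachFun_of_s₁ i ε (joinDatum s x y z) h, fatFold_left]
        · rfl
        · rw [dfst_dpair, dfst_dpair, h, Susp.mk_one, map_pt']
      · rw [attachFun_of_s₂ i ε (joinDatum s x y z) h, fatFold_mid]
        · rfl
        · rw [dfst_dpair, dsnd_dpair, h, Susp.mk_one]
      · rw [attachFun_of_s₃ i ε (joinDatum s x y z) h, fatFold_right]
        · rfl
        · rw [dsnd_dpair, h, Susp.mk_one]
    by_cases h1 : y.1 = 1
    · rw [h1, hface]
      unfold coneAtt
      rw [if_pos rfl]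
      exact congrArg (attachJoin i ε) (joinSection_mk D.triple y.2).symm
    · have hb : onFirst ε (dpair (dpair (Susp X').pt (Susp A').pt) (Susp A').pt) =
          dpair (dpair P.pt (Susp A').pt) (Susp A').pt := by
        unfold onFirst
        rw [dfst_dpair, dfst_dpair, dsnd_dpair, dsnd_dpair, map_pt']
      have hb' : fatFold i (dpair (dpair P.pt (Susp A').pt) (Susp A').pt) = (J2 i).pt := by
        rw [fatFold_right i rfl]; rfl
      have h2 : cubeMap y.1 (contr D.triple 1 (squareJoin y.2)) =
          dpair (dpair (Susp X').pt (Susp A').pt) (Susp A').pt ∧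
          (y.1 = 0 ∨ ssMk y.2 = (SS X' A' A').pt) := by
        rcases hy with (h | h) | h
        · rw [h, cubeMap_zero]
          exact ⟨rfl, Or.inl rfl⟩
        · exact absurd h h1
        · rw [h.inK.contr_one]
          refine ⟨?_, Or.inr (ssMk_eq_pt_iff.2 h)⟩
          change cubeMap y.1 (Join₃.mk _ X'.pt A'.pt A'.pt) = _
          rw [cubeMap_mk]
          have : ∀ {Z : PtdSpace.{u}} (s : I), Susp.mk s Z.pt = (Susp Z).pt := fun s ↦
            Susp.mk_eq_pt (Or.inr (Or.inr rfl))
          rw [this, this]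
      rw [h2.1, hb, hb', coneAtt_of_mem (gammaStd D.triple i ε).map_pt h2.2]

/-- The third filtration is the mapping cone of the third order Whitehead product. -/
theorem exists_cone_equiv_J3 (D : CylData i ε r) {γ : PtdMap (SS X' A' A') (J2 i)}
    (hγ : IsGamma₃ i ε γ) : ∃ h : PtdMap (MapCone γ) (J3 i),
      h.IsHomotopyEquiv ∧ (h.comp (MapCone.incl γ)).Homotopic (J3.incl i) := by
  have SV : CofStr (SS X' A' A') {(SS X' A' A').pt} := ((D.SX.smash D.SA).smash D.SA).susp.susp
  obtain ⟨h₁, h₁e, h₁i⟩ := MapCone.exists_equiv_of_homotopic SV (hγ.homotopic_gammaStd D.triple)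
  obtain ⟨c, hc, hc'⟩ := isHomotopyEquiv_coneOfAdj (gammaStd D.triple i ε)
  obtain ⟨h₂, h₂e, h₂i, -⟩ := Adj.exists_equiv_of_isQuotientMap (B := J2 i)
    (L := cubeSet X' A' A') (L₂ := coneSet (SS X' A' A'))
    (a := fun y ↦ coneAtt (gammaStd D.triple i ε) (y.1, ssMk y.2))
    (a₂ := coneAtt (gammaStd D.triple i ε))
    (isQuotientMap_prodMk_left (K := I) isQuotientMap_ssMk)
    (fun y ↦ by
      change (_ ∨ ssMk y.2 = (SS X' A' A').pt) ↔ _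
      rw [ssMk_eq_pt_iff]
      exact Iff.rfl)
    (fun y y' h ↦ by
      have e1 := congrArg Prod.fst h
      rcases ssMk_eq_ssMk (congrArg Prod.snd h) with e2 | e2
      · exact Or.inl (Prod.ext e1 e2)
      · exact Or.inr (Or.inr e2.1))
    fun y hy ↦ rfl
  obtain ⟨k₂, hk, hk'⟩ := h₂e
  have h₃e := Adj.isHomotopyEquiv_push (S := D.triple.cube) (cubeAtt_homotopy D)
  obtain ⟨φ, hφ, hφi⟩ := exists_equiv_J3 D
  set p := Adj.push D.triple.cube (cubeAtt_homotopy D) with hp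
  refine ⟨(φ.comp p).comp ((k₂.comp c).comp h₁),
    (hφ.comp h₃e).comp (PtdMap.IsHomotopyEquiv.comp ⟨_, hk', hk⟩ ⟨_, hc', hc⟩ |>.comp h₁e), ?_⟩
  have e1 : (((φ.comp p).comp ((k₂.comp c).comp h₁)).comp (MapCone.incl γ)).Homotopic
      (((φ.comp p).comp k₂).comp (c.comp (MapCone.incl (gammaStd D.triple i ε)))) :=
    (h₁i.comp_left ((φ.comp p).comp (k₂.comp c)) :)
  have e2 : (c.comp (MapCone.incl (gammaStd D.triple i ε))).Homotopic (Adj.inl _ _ _ _) :=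
    (hc.comp_right (Adj.inl (J2 i) _ _ _) :)
  have e3 : (k₂.comp (Adj.inl (J2 i) _ _ _)).Homotopic (Adj.inl (J2 i) _ _ _) := by
    have := hk.comp_right (Adj.inl (J2 i) _ _ _)
    refine PtdMap.Homotopic.trans (PtdMap.Homotopic.of_eq fun b ↦ ?_) this
    exact congrArg k₂ (h₂i b).symm
  refine e1.trans ((e2.comp_left ((φ.comp p).comp k₂)).trans ?_)
  refine PtdMap.Homotopic.trans (e3.comp_left (φ.comp p) :) (PtdMap.Homotopic.of_eq fun b ↦ ?_)
  exact (congrArg φ (Adj.push_inl (cubeAtt_homotopy D) b)).trans (hφi b)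

end Filtration

end RelJames

namespace RelJames

/-! ### The projection of the third order Whitehead product is null-homotopic -/

section Pinch

variable {X Y P : PtdSpace.{u}}

/-- The suspension coordinate, moved to the first half of the interval. -/
def firstHalf (τ s : ℝ) : I := cI ((1 + τ) * s)

/-- The suspension coordinate, moved to the second half of the interval. -/
def secondHalf (τ s : ℝ) : I := cI ((1 + τ) * s - τ)

theorem continuous_firstHalf {T : Type*} [TopologicalSpace T] {f g : T → ℝ} (hf : Continuous f)
    (hg : Continuous g) : Continuous fun t ↦ firstHalf (f t) (g t) := by unfold firstHalf; fun_prop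

theorem continuous_secondHalf {T : Type*} [TopologicalSpace T] {f g : T → ℝ} (hf : Continuous f)
    (hg : Continuous g) : Continuous fun t ↦ secondHalf (f t) (g t) := by
  unfold secondHalf; fun_prop

attribute [fun_prop] continuous_firstHalf continuous_secondHalf

theorem firstHalf_zero (τ : ℝ) : firstHalf τ 0 = 0 := by unfold firstHalf; rw [mul_zero, cI_zero]

theorem secondHalf_zero {τ : ℝ} (h : 0 ≤ τ) : secondHalf τ 0 = 0 := cI_of_le (by linarith)

theorem firstHalf_one {τ : ℝ} (h : 0 ≤ τ) : firstHalf τ 1 = 1 := cI_of_ge (by linarith)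

theorem secondHalf_one (τ : ℝ) : secondHalf τ 1 = 1 := by
  unfold secondHalf; rw [mul_one, add_sub_cancel_right, cI_one]

theorem firstHalf_of_ge {s : ℝ} (h : 1 / 2 ≤ s) : firstHalf 1 s = 1 := cI_of_ge (by linarith)

theorem secondHalf_of_le {s : ℝ} (h : s ≤ 1 / 2) : secondHalf 1 s = 0 := cI_of_le (by linarith)

theorem firstHalf_id (s : I) : firstHalf 0 s = s := by
  unfold firstHalf; rw [add_zero, one_mul, cI_coe]

theorem secondHalf_id (s : I) : secondHalf 0 s = s := by
  unfold secondHalf; rw [add_zero, one_mul, sub_zero, cI_coe]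

variable (k : PtdMap (Susp Y) (Susp X))

/-- The value on the face `s₃ = 1`. -/
def prismA (τ : ℝ) (s₁ s₂ : ℝ) (x : X) (y : Y) : Smash (Susp X) (Susp Y) :=
  Smash.mk (Susp.mk (firstHalf τ s₁) x) (Susp.mk (firstHalf τ s₂) y)

/-- The value on the face `s₂ = 1`. -/
def prismB (τ : ℝ) (s₁ s₃ : ℝ) (x : X) (z : Y) : Smash (Susp X) (Susp Y) :=
  Smash.mk (Susp.mk (secondHalf τ s₁) x) (Susp.mk (firstHalf τ s₃) z)

/-- The value on the face `s₁ = 1`. -/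
def prismC (τ : ℝ) (s₂ s₃ : ℝ) (y z : Y) : Smash (Susp X) (Susp Y) :=
  Smash.mk (k (Susp.mk (secondHalf τ s₂) y)) (Susp.mk (secondHalf τ s₃) z)

theorem Smash.mk_susp_eq_pt {s t : I} {x : X} {y : Y}
    (h : s = 0 ∨ s = 1 ∨ t = 0 ∨ t = 1) :
    Smash.mk (Susp.mk s x) (Susp.mk t y) = (Smash (Susp X) (Susp Y)).pt := by
  rcases h with h | h | h | h
  · exact Smash.mk_eq_pt (Or.inl (Susp.mk_eq_pt (Or.inl h)))
  · exact Smash.mk_eq_pt (Or.inl (Susp.mk_eq_pt (Or.inr (Or.inl h))))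
  · exact Smash.mk_eq_pt (Or.inr (Susp.mk_eq_pt (Or.inl h)))
  · exact Smash.mk_eq_pt (Or.inr (Susp.mk_eq_pt (Or.inr (Or.inl h))))

theorem prismC_eq_pt {τ s₂ s₃ : ℝ} {y z : Y} (h : secondHalf τ s₂ = 0 ∨ secondHalf τ s₂ = 1 ∨
    secondHalf τ s₃ = 0 ∨ secondHalf τ s₃ = 1) :
    prismC k τ s₂ s₃ y z = (Smash (Susp X) (Susp Y)).pt := by
  unfold prismC
  rcases h with h | h | h | h
  · exact Smash.mk_eq_pt (Or.inl (by rw [h, Susp.mk_zero, map_pt']))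
  · exact Smash.mk_eq_pt (Or.inl (by rw [h, Susp.mk_one, map_pt']))
  · exact Smash.mk_eq_pt (Or.inr (by rw [h, Susp.mk_zero]))
  · exact Smash.mk_eq_pt (Or.inr (by rw [h, Susp.mk_one]))

open Classical in
/-- The deformation of the composite of the attaching map and the projection. -/
def prismFun (τ : ℝ) (p : JoinData X Y Y) : Smash (Susp X) (Susp Y) :=
  if p.s₃ = 1 then prismA τ p.s₁ p.s₂ p.x p.y
  else if p.s₂ = 1 then prismB τ p.s₁ p.s₃ p.x p.z
  else prismC k τ p.s₂ p.s₃ p.y p.z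

theorem prismFun_of_s₃ (τ : ℝ) {p : JoinData X Y Y} (h : p.s₃ = 1) :
    prismFun k τ p = prismA τ p.s₁ p.s₂ p.x p.y := if_pos h

theorem prismFun_of_s₂ {τ : ℝ} (hτ : 0 ≤ τ) {p : JoinData X Y Y} (h : p.s₂ = 1) :
    prismFun k τ p = prismB τ p.s₁ p.s₃ p.x p.z := by
  unfold prismFun
  split_ifs with h'
  · have e : firstHalf τ 1 = 1 := firstHalf_one hτ
    rw [prismA, prismB, h, h', Set.Icc.coe_one, e]
    rw [Smash.mk_susp_eq_pt (Or.inr (Or.inr (Or.inr rfl))),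
      Smash.mk_susp_eq_pt (Or.inr (Or.inr (Or.inr rfl)))]
  · rfl

theorem prismFun_of_s₁ {τ : ℝ} (hτ : 0 ≤ τ) {p : JoinData X Y Y} (h : p.s₁ = 1) :
    prismFun k τ p = prismC k τ p.s₂ p.s₃ p.y p.z := by
  have e : firstHalf τ 1 = 1 := firstHalf_one hτ
  have e' : secondHalf τ 1 = 1 := secondHalf_one τ
  by_cases h3 : p.s₃ = 1
  · rw [prismFun_of_s₃ k τ h3, prismA, h, Set.Icc.coe_one, e,
      Smash.mk_susp_eq_pt (Or.inr (Or.inl rfl)), prismC_eq_pt]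
    rw [h3]
    exact Or.inr (Or.inr (Or.inr e'))
  · by_cases h2 : p.s₂ = 1
    · rw [prismFun_of_s₂ k hτ h2, prismB, h, Set.Icc.coe_one, e',
        Smash.mk_susp_eq_pt (Or.inr (Or.inl rfl)), prismC_eq_pt]
      rw [h2]
      exact Or.inr (Or.inl e')
    · unfold prismFun
      rw [if_neg h3, if_neg h2]

theorem continuous_prismFun :
    Continuous fun q : I × JoinData X Y Y ↦ prismFun k q.1 q.2 := by
  rw [← continuousOn_univ]
  have hu : (Set.univ : Set (I × JoinData X Y Y)) =
      ({p | p.2.s₁ = 1} ∪ {p | p.2.s₂ = 1}) ∪ {p | p.2.s₃ = 1} := by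
    ext p
    simp only [Set.mem_univ, Set.mem_union, Set.mem_ofPred_eq, true_iff, or_assoc]
    exact p.2.outer
  have c₁ : IsClosed {p : I × JoinData X Y Y | p.2.s₁ = 1} :=
    isClosed_eq (by fun_prop) continuous_const
  have c₂ : IsClosed {p : I × JoinData X Y Y | p.2.s₂ = 1} :=
    isClosed_eq (by fun_prop) continuous_const
  have c₃ : IsClosed {p : I × JoinData X Y Y | p.2.s₃ = 1} :=
    isClosed_eq (by fun_prop) continuous_const
  rw [hu]
  refine ContinuousOn.union_of_isClosed
    (ContinuousOn.union_of_isClosed ?_ ?_ c₁ c₂) ?_ (c₁.union c₂) c₃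
  · refine ContinuousOn.congr (f := fun p : I × JoinData X Y Y ↦
      prismC k p.1 p.2.s₂ p.2.s₃ p.2.y p.2.z) ?_ fun p hp ↦ prismFun_of_s₁ k p.1.2.1 hp
    unfold prismC
    exact Continuous.continuousOn (by fun_prop)
  · refine ContinuousOn.congr (f := fun p : I × JoinData X Y Y ↦
      prismB p.1 p.2.s₁ p.2.s₃ p.2.x p.2.z) ?_ fun p hp ↦ prismFun_of_s₂ k p.1.2.1 hp
    unfold prismB
    exact Continuous.continuousOn (by fun_prop)
  · refine ContinuousOn.congr (f := fun p : I × JoinData X Y Y ↦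
      prismA p.1 p.2.s₁ p.2.s₂ p.2.x p.2.y) ?_ fun p hp ↦ prismFun_of_s₃ k p.1 hp
    unfold prismA
    exact Continuous.continuousOn (by fun_prop)

open Classical in
/-- The extension over the cube. -/
def prismCube (s₁ s₂ s₃ : ℝ) (x : X) (y z : Y) : Smash (Susp X) (Susp Y) :=
  if s₂ ≤ 1 / 2 then if s₁ ≤ 1 / 2 then prismA 1 s₁ s₂ x y else prismB 1 s₁ s₃ x z
  else if s₃ ≤ 1 / 2 then prismB 1 s₁ s₃ x z else prismC k 1 s₂ s₃ y z

theorem continuous_prismCube : Continuous fun q : I × JoinData X Y Y ↦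
    prismCube k (q.1 * q.2.s₁) (q.1 * q.2.s₂) (q.1 * q.2.s₃) q.2.x q.2.y q.2.z := by
  have cA : Continuous fun q : I × JoinData X Y Y ↦
      prismA 1 (q.1 * q.2.s₁) (q.1 * q.2.s₂) q.2.x q.2.y := by unfold prismA; fun_prop
  have cB : Continuous fun q : I × JoinData X Y Y ↦
      prismB 1 (q.1 * q.2.s₁) (q.1 * q.2.s₃) q.2.x q.2.z := by unfold prismB; fun_prop
  have cC : Continuous fun q : I × JoinData X Y Y ↦
      prismC k 1 (q.1 * q.2.s₂) (q.1 * q.2.s₃) q.2.y q.2.z := by unfold prismC; fun_prop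
  unfold prismCube
  refine Continuous.if_le (Continuous.if_le cA cB (by fun_prop) continuous_const ?_)
    (Continuous.if_le cB cC (by fun_prop) continuous_const ?_) (by fun_prop) continuous_const ?_
  · intro q h
    rw [prismA, prismB, Smash.mk_susp_eq_pt (Or.inr (Or.inl (firstHalf_of_ge h.ge))),
      Smash.mk_susp_eq_pt (Or.inl (secondHalf_of_le h.le))]
  · intro q h
    rw [prismB, Smash.mk_susp_eq_pt (Or.inr (Or.inr (Or.inr (firstHalf_of_ge h.ge)))),
      prismC_eq_pt k (Or.inr (Or.inr (Or.inl (secondHalf_of_le h.le))))]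
  · intro q h
    have e1 : prismA 1 (q.1 * q.2.s₁) (q.1 * q.2.s₂) q.2.x q.2.y =
      (Smash (Susp X) (Susp Y)).pt :=
        Smash.mk_susp_eq_pt (Or.inr (Or.inr (Or.inr (firstHalf_of_ge h.ge))))
    have e2 : prismC k 1 (q.1 * q.2.s₂) (q.1 * q.2.s₃) q.2.y q.2.z =
      (Smash (Susp X) (Susp Y)).pt := prismC_eq_pt k (Or.inl (secondHalf_of_le h.le))
    rw [e1, e2]
    have e3 : (q.1 * q.2.s₁ : ℝ) ≤ 1 / 2 →
        prismB 1 (q.1 * q.2.s₁) (q.1 * q.2.s₃) q.2.x q.2.z = (Smash (Susp X) (Susp Y)).pt :=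
      fun h ↦ Smash.mk_susp_eq_pt (Or.inl (secondHalf_of_le h))
    have e4 : ¬ (q.1 * q.2.s₃ : ℝ) ≤ 1 / 2 →
        prismB 1 (q.1 * q.2.s₁) (q.1 * q.2.s₃) q.2.x q.2.z = (Smash (Susp X) (Susp Y)).pt :=
      fun h ↦ Smash.mk_susp_eq_pt (Or.inr (Or.inr (Or.inr (firstHalf_of_ge (not_le.1 h).le))))
    split_ifs with h1 h3 h3
    · exact (e3 h1).symm
    · rfl
    · rfl
    · exact e4 h3

theorem prismCube_outer (p : JoinData X Y Y) :
    prismCube k p.s₁ p.s₂ p.s₃ p.x p.y p.z = prismFun k 1 p := by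
  have h2 : ¬ (1 : ℝ) ≤ 1 / 2 := by norm_num
  have hh : (1 / 2 : ℝ) ≤ 1 := by norm_num
  have f1 : firstHalf 1 1 = 1 := firstHalf_of_ge hh
  have g1 : secondHalf 1 1 = 1 := secondHalf_one 1
  unfold prismCube
  rcases p.outer with h | h | h
  · rw [prismFun_of_s₁ k zero_le_one h, h, Set.Icc.coe_one, if_neg h2]
    have e1 : prismB 1 1 p.s₃ p.x p.z = (Smash (Susp X) (Susp Y)).pt :=
      Smash.mk_susp_eq_pt (Or.inr (Or.inl g1))
    split_ifs with h3 h4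
    · rw [e1, prismC_eq_pt k (Or.inl (secondHalf_of_le h3))]
    · rw [e1, prismC_eq_pt k (Or.inr (Or.inr (Or.inl (secondHalf_of_le h4))))]
    · rfl
  · rw [prismFun_of_s₂ k zero_le_one h, h, Set.Icc.coe_one, if_neg h2]
    split_ifs with h3
    · rfl
    · rw [prismC_eq_pt k (Or.inr (Or.inl g1)), prismB,
        Smash.mk_susp_eq_pt (Or.inr (Or.inr (Or.inr (firstHalf_of_ge (not_le.1 h3).le))))]
  · rw [prismFun_of_s₃ k 1 h, h, Set.Icc.coe_one, if_neg h2]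
    have e1 : prismB 1 p.s₁ 1 p.x p.z = (Smash (Susp X) (Susp Y)).pt :=
      Smash.mk_susp_eq_pt (Or.inr (Or.inr (Or.inr f1)))
    split_ifs with h3 h4
    · rfl
    · rw [e1, prismA, Smash.mk_susp_eq_pt (Or.inr (Or.inl (firstHalf_of_ge (not_le.1 h4).le)))]
    · rw [prismC_eq_pt k (Or.inr (Or.inr (Or.inr g1))), prismA,
        Smash.mk_susp_eq_pt (Or.inr (Or.inr (Or.inr (firstHalf_of_ge (not_le.1 h3).le))))]

theorem Susp.mk_congr' {X : PtdSpace.{u}} {s : I} {x x' : X} {a : I} (h : s = 0 ∨ x = x')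
    (ha : s = 0 → a = 0) : Susp.mk a x = Susp.mk a x' := Susp.mk_congr rfl (h.imp_left ha)

theorem prism_congr {X Y : PtdSpace.{u}} (k : PtdMap (Susp Y) (Susp X)) {τ : ℝ} (hτ : 0 ≤ τ) {c : ℝ}
    {p q : JoinData X Y Y} (h₁ : p.s₁ = q.s₁) (h₂ : p.s₂ = q.s₂) (h₃ : p.s₃ = q.s₃)
    (hx : p.s₁ = 0 ∨ p.x = q.x) (hy : p.s₂ = 0 ∨ p.y = q.y) (hz : p.s₃ = 0 ∨ p.z = q.z) :
    prismA τ (c * p.s₁) (c * p.s₂) p.x p.y = prismA τ (c * q.s₁) (c * q.s₂) q.x q.y ∧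
    prismB τ (c * p.s₁) (c * p.s₃) p.x p.z = prismB τ (c * q.s₁) (c * q.s₃) q.x q.z ∧
    prismC k τ (c * p.s₂) (c * p.s₃) p.y p.z = prismC k τ (c * q.s₂) (c * q.s₃) q.y q.z := by
  have f0 : ∀ s : I, s = 0 → firstHalf τ (c * s) = 0 := fun s h ↦ by
    rw [h, Set.Icc.coe_zero, mul_zero, firstHalf_zero]
  have g0 : ∀ s : I, s = 0 → secondHalf τ (c * s) = 0 := fun s h ↦ by
    rw [h, Set.Icc.coe_zero, mul_zero, secondHalf_zero hτ]
  unfold prismA prismB prismC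
  rw [← h₁, ← h₂, ← h₃, Susp.mk_congr' hx (f0 _), Susp.mk_congr' hx (g0 _),
    Susp.mk_congr' hy (f0 _), Susp.mk_congr' hy (g0 _), Susp.mk_congr' hz (f0 _),
    Susp.mk_congr' hz (g0 _)]
  exact ⟨rfl, rfl, rfl⟩

/-- The composite of the attaching map and the projection is null-homotopic. -/
theorem pinchTo_attachJoin {i : PtdMap (Susp Y) P} {ε : PtdMap (Susp X) P} {r : PtdMap P (Susp X)}
    (D : CylData i ε r) :
    ((pinchTo i r).comp (attachJoin i ε)).Homotopic (PtdMap.zero _ _) := by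
  let k := r.comp i
  have hb : ∀ (s : I) {X : PtdSpace.{u}}, Susp.mk s X.pt = (Susp X).pt := fun s X ↦
    Susp.mk_eq_pt (Or.inr (Or.inr rfl))
  have hA : ∀ (τ a b : ℝ), prismA τ a b X.pt Y.pt = (Smash (Susp X) (Susp Y)).pt := fun τ a b ↦
    Smash.mk_eq_pt (Or.inr (hb _))
  have hB : ∀ (τ a b : ℝ), prismB τ a b X.pt Y.pt = (Smash (Susp X) (Susp Y)).pt := fun τ a b ↦
    Smash.mk_eq_pt (Or.inr (hb _))
  have hC : ∀ (τ a b : ℝ), prismC k τ a b Y.pt Y.pt = (Smash (Susp X) (Susp Y)).pt := fun τ a b ↦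
    Smash.mk_eq_pt (Or.inr (hb _))
  let F : I → Join₃ X Y Y → Smash (Susp X) (Susp Y) := fun τ ↦ Quot.lift (prismFun k τ) <| by
    rintro p q ⟨h₁, h₂, h₃, hx, hy, hz⟩
    obtain ⟨e1, e2, e3⟩ := prism_congr k τ.2.1 (c := 1) h₁ h₂ h₃ hx hy hz
    simp only [one_mul] at e1 e2 e3
    unfold prismFun
    rw [e1, e2, e3, h₂, h₃]
  let G : I → Join₃ X Y Y → Smash (Susp X) (Susp Y) := fun c ↦ Quot.lift (fun p ↦
      prismCube k (c * p.s₁) (c * p.s₂) (c * p.s₃) p.x p.y p.z) <| by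
    rintro p q ⟨h₁, h₂, h₃, hx, hy, hz⟩
    obtain ⟨e1, e2, e3⟩ := prism_congr k zero_le_one (c := c) h₁ h₂ h₃ hx hy hz
    simp only [prismCube]
    rw [e1, e2, e3, h₁, h₂, h₃]
  have hF : Continuous fun q : I × Join₃ X Y Y ↦ F q.1 q.2 :=
    continuous_I_prod_quot (continuous_prismFun k)
  have hG : Continuous fun q : I × Join₃ X Y Y ↦ G q.1 q.2 :=
    continuous_I_prod_quot (continuous_prismCube k)
  have hFpt : ∀ τ, F τ (Join₃ X Y Y).pt = (Smash (Susp X) (Susp Y)).pt := fun τ ↦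
    (prismFun_of_s₃ k τ rfl).trans (hA _ _ _)
  have hGpt : ∀ c, G c (Join₃ X Y Y).pt = (Smash (Susp X) (Susp Y)).pt := by
    intro c
    change prismCube k _ _ _ X.pt Y.pt Y.pt = _
    unfold prismCube
    rw [hA, hB, hC]
    simp only [ite_self]
  let m : PtdMap (Join₃ X Y Y) (Smash (Susp X) (Susp Y)) :=
    ⟨⟨F 1, hF.comp (f := fun j ↦ ((1 : I), j)) (by fun_prop)⟩, hFpt 1⟩
  have h1 : ((pinchTo i r).comp (attachJoin i ε)).Homotopic m := by
    refine PtdMap.homotopic_of F hF (fun j ↦ ?_) (fun j ↦ rfl) hFpt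
    induction j using Quot.ind with | mk p => ?_
    change prismFun k ((0 : I) : ℝ) p = pinchTo i r (attachFun i ε p)
    rw [Set.Icc.coe_zero]
    rcases p.outer with h | h | h
    · rw [prismFun_of_s₁ k le_rfl h, attachFun_of_s₁ i ε p h, prismC, secondHalf_id, secondHalf_id]
      rfl
    · rw [prismFun_of_s₂ k le_rfl h, attachFun_of_s₂ i ε p h, prismB, secondHalf_id, firstHalf_id]
      change _ = Smash.mk (r (ε _)) _
      rw [D.r_ε]
      rfl
    · rw [prismFun_of_s₃ k 0 h, attachFun_of_s₃ i ε p h, prismA, firstHalf_id, firstHalf_id]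
      change _ = Smash.mk (r (ε _)) _
      rw [D.r_ε]
      rfl
  refine h1.trans (PtdMap.Homotopic.symm (PtdMap.homotopic_of G hG (fun j ↦ ?_) (fun j ↦ ?_) hGpt))
  · induction j using Quot.ind with | mk p => ?_
    change prismCube k _ _ _ _ _ _ = (Smash (Susp X) (Susp Y)).pt
    have hh : (0 : ℝ) ≤ 1 / 2 := by norm_num
    unfold prismCube
    rw [Set.Icc.coe_zero, zero_mul, zero_mul, zero_mul, if_pos hh, if_pos hh]
    exact Smash.mk_susp_eq_pt (Or.inl (firstHalf_zero 1))
  · induction j using Quot.ind with | mk p => ?_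
    change prismCube k _ _ _ _ _ _ = prismFun k ((1 : I) : ℝ) p
    rw [Set.Icc.coe_one, one_mul, one_mul, one_mul, prismCube_outer]

/-- The projection of the third order Whitehead product is null-homotopic. -/
theorem IsGamma₃.pinchTo_homotopic_zero {i : PtdMap (Susp Y) P} {ε : PtdMap (Susp X) P}
    {r : PtdMap P (Susp X)} (D : CylData i ε r) {γ : PtdMap (SS X Y Y) (J2 i)}
    (h : IsGamma₃ i ε γ) : ((pinchTo i r).comp γ).Homotopic (PtdMap.zero _ _) :=
  ((h.homotopic_gammaStd D.triple).comp_left (pinchTo i r)).trans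
    ((pinchTo_attachJoin D).comp_right (joinSection D.triple) :)

end Pinch

end RelJames

namespace RelJames

/-! ### The second filtration as an adjunction space -/

section Square

variable {X A P : PtdSpace.{u}}

open Classical in
/-- The map from the axes to the first filtration. -/
def axFold (i : PtdMap A P) (t : DProd P A) : P := if dsnd t = A.pt then dfst t else i (dsnd t)

theorem axFold_right (i : PtdMap A P) {t : DProd P A} (h : dsnd t = A.pt) :
    axFold i t = dfst t := if_pos h

theorem axFold_left (i : PtdMap A P) {t : DProd P A} (h : dfst t = P.pt) :
    axFold i t = i (dsnd t) := by
  unfold axFold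
  split_ifs with h'
  · rw [h, h', map_pt']
  · rfl

/-- The projection to the second filtration. -/
def J2.proj (i : PtdMap A P) (t : DProd P A) : J2 i := Quot.mk _ t

theorem incl_axFold (i : PtdMap A P) {t : DProd P A} (h : OnAxes P A t) :
    J2.incl i (axFold i t) = J2.proj i t := by
  obtain ⟨p, a, rfl⟩ : ∃ p a, t = dpair p a := ⟨_, _, rfl⟩
  rcases h with h | h
  · rw [axFold_left i h]
    obtain rfl : p = P.pt := h
    exact Quot.sound (J2Rel.swap a)
  · rw [axFold_right i h]
    obtain rfl : a = A.pt := h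
    rfl

theorem isClosed_onAxes (hP : IsClosed ({P.pt} : Set P)) (hA : IsClosed ({A.pt} : Set A)) :
    IsClosed {t | OnAxes P A t} :=
  (hP.preimage (f := fun t : DProd P A ↦ dfst t) (by fun_prop)).union
    (hA.preimage (f := fun t : DProd P A ↦ dsnd t) (by fun_prop))

theorem continuousOn_axFold (i : PtdMap A P) (hP : IsClosed ({P.pt} : Set P))
    (hA : IsClosed ({A.pt} : Set A)) : ContinuousOn (axFold i) {t | OnAxes P A t} := by
  have c1 : IsClosed {t : DProd P A | dfst t = P.pt} :=
    hP.preimage (f := fun t : DProd P A ↦ dfst t) (by fun_prop)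
  have c2 : IsClosed {t : DProd P A | dsnd t = A.pt} :=
    hA.preimage (f := fun t : DProd P A ↦ dsnd t) (by fun_prop)
  refine ContinuousOn.union_of_isClosed (s := {t : DProd P A | dfst t = P.pt})
    (t := {t : DProd P A | dsnd t = A.pt}) ?_ ?_ c1 c2
  · exact ContinuousOn.congr (f := fun t ↦ i (dsnd t)) (Continuous.continuousOn (by fun_prop))
      fun t h ↦ axFold_left i h
  · exact ContinuousOn.congr (f := fun t ↦ dfst t) (Continuous.continuousOn (by fun_prop))
      fun t h ↦ axFold_right i h

theorem J2.proj_eq_proj (i : PtdMap A P) {t t' : DProd P A} (h : J2.proj i t = J2.proj i t') :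
    t = t' ∨ (OnAxes P A t ∧ OnAxes P A t' ∧ axFold i t = axFold i t') := by
  let f : DProd P A → Set (DProd P A) := fun t ↦
    {s | s = t ∨ (OnAxes P A s ∧ OnAxes P A t ∧ axFold i s = axFold i t)}
  have hf : ∀ t t', J2Rel i t t' → f t = f t' := by
    rintro _ _ ⟨a⟩
    have h : OnAxes P A (dpair (i a) A.pt) := Or.inr rfl
    have h' : OnAxes P A (dpair P.pt a) := Or.inl rfl
    have hf : axFold i (dpair (i a) A.pt) = axFold i (dpair P.pt a) := by
      rw [axFold_right i rfl, axFold_left i rfl]; rfl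
    ext s
    constructor
    · rintro (rfl | ⟨h1, h2, h3⟩)
      exacts [Or.inr ⟨h, h', hf⟩, Or.inr ⟨h1, h', h3.trans hf⟩]
    · rintro (rfl | ⟨h1, h2, h3⟩)
      exacts [Or.inr ⟨h', h, hf.symm⟩, Or.inr ⟨h1, h, h3.trans hf.symm⟩]
  have h' : f t = f t' := congrArg (Quot.lift f hf) h
  have ht : t ∈ f t := Or.inl rfl
  rw [h'] at ht
  exact ht

/-- The points of the square that are mapped to the axes. -/
def squareSet (X A : PtdSpace.{u}) : Set (I × (I × DProd X A)) :=
  {y | (y.1 = 0 ∨ y.1 = 1) ∨ (y.2.1 = 0 ∨ y.2.1 = 1) ∨ OnAxes X A y.2.2}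

/-- The structure that is used for attaching the square. -/
def squareCof (SX : CofStr X {X.pt}) (SA : CofStr A {A.pt}) :
    CofStr (I × (I × DProd X A)) (squareSet X A) :=
  (CofStr.ends.prodI (CofStr.ends.prodI (SX.dprod SA))).copy _ <| by
    ext y
    simp only [squareSet, OnAxes, Set.mem_ofPred_eq, Set.mem_singleton_iff]

/-- The parametrization of the product of two suspensions. -/
def squareQuot (y : I × (I × DProd X A)) : DProd (Susp X) (Susp A) :=
  dpair (Susp.mk y.1 (dfst y.2.2)) (Susp.mk y.2.1 (dsnd y.2.2))

theorem isQuotientMap_squareQuot : IsQuotientMap (squareQuot (X := X) (A := A)) := by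
  let e : I × (I × DProd X A) → DProd (I × X) (I × A) :=
    fun p ↦ dpair (p.1, dfst p.2.2) (p.2.1, dsnd p.2.2)
  have h2 : IsQuotientMap e := by
    refine IsQuotientMap.of_inverse (f := fun p : DProd (I × X) (I × A) ↦
      ((dfst p).1, ((dsnd p).1, dpair (dfst p).2 (dsnd p).2))) ?_ ?_ fun _ ↦ rfl
    · fun_prop
    · fun_prop
  have a1 := isQuotientMap_dprod_left (Z := I × A) (Susp.isQuotientMap_mk (X := X))
  have a2 := isQuotientMap_dprod_right (Z := Susp X) (Susp.isQuotientMap_mk (X := A))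
  exact (a2.comp a1).comp h2

theorem onAxes_squareQuot {y : I × (I × DProd X A)} :
    OnAxes (Susp X) (Susp A) (squareQuot y) ↔ y ∈ squareSet X A := by
  unfold OnAxes squareQuot squareSet OnAxes
  rw [dfst_dpair, dsnd_dpair, Susp.mk_eq_pt_iff, Susp.mk_eq_pt_iff, Set.mem_ofPred_eq]
  tauto

theorem squareQuot_injOn {y y' : I × (I × DProd X A)} (h : squareQuot y = squareQuot y') :
    y = y' ∨ y ∈ squareSet X A := by
  rcases Susp.mk_eq_mk (congrArg dfst h) with ⟨e1, e2⟩ | ⟨e, -⟩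
  · rcases Susp.mk_eq_mk (congrArg dsnd h) with ⟨e3, e4⟩ | ⟨e, -⟩
    · left
      refine Prod.ext e1 (Prod.ext e3 ?_)
      rw [← dpair_eta y.2.2, ← dpair_eta y'.2.2, e2, e4]
    · exact Or.inr (onAxes_squareQuot.1 (Or.inr (Susp.mk_eq_pt e)))
  · exact Or.inr (onAxes_squareQuot.1 (Or.inl (Susp.mk_eq_pt e)))

variable {i : PtdMap (Susp A) P} {ε : PtdMap (Susp X) P} {r : PtdMap P (Susp X)}

/-- The map of products induced by a map of the first factor. -/
def onFirst₂ (ε : PtdMap (Susp X) P) (t : DProd (Susp X) (Susp A)) : DProd P (Susp A) :=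
  dpair (ε (dfst t)) (dsnd t)

@[fun_prop] theorem continuous_onFirst₂ (ε : PtdMap (Susp X) P) :
    Continuous (onFirst₂ (A := A) ε) := by unfold onFirst₂; fun_prop

/-- The attaching map of the square. -/
def squareAtt (i : PtdMap (Susp A) P) (ε : PtdMap (Susp X) P) (y : I × (I × DProd X A)) : P :=
  axFold i (onFirst₂ ε (squareQuot y))

theorem onAxes_onFirst₂ (D : CylData i ε r) {t : DProd (Susp X) (Susp A)} :
    OnAxes P (Susp A) (onFirst₂ ε t) ↔ OnAxes (Susp X) (Susp A) t := by
  unfold OnAxes onFirst₂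
  rw [dfst_dpair, dsnd_dpair, D.ε_eq_pt]

/-- The second filtration is obtained from the first one by attaching a square, up to homotopy. -/
theorem exists_equiv_J2 (D : CylData i ε r) :
    ∃ (φ : PtdMap (Adj P (I × (I × DProd X A)) (squareSet X A) (squareAtt i ε)) (J2 i))
      (ν : PtdMap (J2 i) (Adj P (I × (I × DProd X A)) (squareSet X A) (squareAtt i ε))),
      (∀ b, φ (Adj.inl _ _ _ _ b) = J2.incl i b) ∧
      (∀ y, φ (Adj.inr y) = J2.proj i (onFirst₂ ε (squareQuot y))) ∧
      (∀ z, ν (φ z) = z) ∧ (φ.comp ν).Homotopic (PtdMap.id _) := by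
  have hA := D.SA.susp.isClosed
  have hE : Set.range (onFirst₂ (A := A) ε) = dfst ⁻¹' Set.range ε := by
    ext t
    constructor
    · rintro ⟨x, rfl⟩
      exact ⟨_, rfl⟩
    · rintro ⟨x, hx⟩
      refine ⟨dpair x (dsnd t), ?_⟩
      unfold onFirst₂
      rw [dfst_dpair, dsnd_dpair, hx, dpair_eta]
  have hM : {t : DProd P (Susp A) | dfst t ∈ Set.range ε ∨
      dsnd t ∈ ({(Susp A).pt} : Set (Susp A))} = Set.range (onFirst₂ ε) ∪ {t | OnAxes _ _ t} := by
    rw [hE]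
    ext t
    simp only [Set.mem_ofPred_eq, Set.mem_union, OnAxes, Set.mem_singleton_iff, Set.mem_preimage]
    constructor
    · rintro (h | h)
      · exact Or.inl h
      · exact Or.inr (Or.inr h)
    · rintro (h | h | h)
      · exact Or.inl h
      · exact Or.inl ⟨_, (map_pt' ε).trans h.symm⟩
      · exact Or.inr h
  have hEc : IsClosed (Set.range (onFirst₂ (A := A) ε)) :=
    hE ▸ D.SP.isClosed.preimage (by fun_prop)
  have hR : Continuous fun t : DProd P (Susp A) ↦
      (dpair (r (dfst t)) (dsnd t) : DProd (Susp X) (Susp A)) := by fun_prop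
  have hRE : ∀ t : DProd (Susp X) (Susp A), (fun t : DProd P (Susp A) ↦
      (dpair (r (dfst t)) (dsnd t) : DProd (Susp X) (Susp A))) (onFirst₂ ε t) = t := by
    intro t
    unfold onFirst₂
    simp only [dfst_dpair, dsnd_dpair, D.r_ε, dpair_eta]
  exact Adj.exists_equiv_of_fold (B := P) (B' := J2 i)
    (L := squareSet X A) (c := squareQuot) (proj := J2.proj i)
    (D.SP.dprod D.SA.susp) hM hEc (isClosed_onAxes D.isClosed_pt hA)
    (fun t ↦ (min_le_left _ _).trans (D.u_le _))
    isQuotientMap_squareQuot (continuous_onFirst₂ ε) hR hRE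
    (fun y ↦ by rw [Set.mem_ofPred_eq, onAxes_onFirst₂ D, onAxes_squareQuot])
    (fun y y' h ↦ squareQuot_injOn h)
    (continuousOn_axFold i D.isClosed_pt hA) isQuotientMap_quot_mk (J2.incl i)
    (fun t ht ↦ incl_axFold i ht) (fun b ↦ ⟨dpair b (Susp A).pt, Or.inr rfl, axFold_right i rfl⟩)
    fun t t' h ↦ J2.proj_eq_proj i h

end Square

/-! ### Commutators -/

section Commutator

/-- The first coordinate of the loop around the square. -/
def edgeX (t : ℝ) : I := cI (min (4 * t) (3 - 4 * t))

/-- The second coordinate of the loop around the square. -/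
def edgeY (t : ℝ) : I := cI (min (4 * t - 1) (4 - 4 * t))

@[fun_prop] theorem continuous_edgeX {T : Type*} [TopologicalSpace T] {f : T → ℝ}
    (hf : Continuous f) : Continuous fun t ↦ edgeX (f t) := by unfold edgeX; fun_prop

@[fun_prop] theorem continuous_edgeY {T : Type*} [TopologicalSpace T] {f : T → ℝ}
    (hf : Continuous f) : Continuous fun t ↦ edgeY (f t) := by unfold edgeY; fun_prop

variable {A B Z : PtdSpace.{u}} (f : PtdMap (Susp A) Z) (g : PtdMap (Susp B) Z) (a : A) (b : B)

theorem edgeX_of_le {t : ℝ} (h : t ≤ 1 / 4) : edgeX t = cI (4 * t) := by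
  unfold edgeX; rw [min_eq_left (by linarith)]

theorem edgeX_eq_one {t : ℝ} (h : 1 / 4 ≤ t) (h' : t ≤ 1 / 2) : edgeX t = 1 :=
  cI_of_ge (le_min (by linarith) (by linarith))

theorem edgeX_of_ge {t : ℝ} (h : 1 / 2 ≤ t) : edgeX t = cI (3 - 4 * t) := by
  unfold edgeX; rw [min_eq_right (by linarith)]

theorem edgeX_eq_zero {t : ℝ} (h : 3 / 4 ≤ t) : edgeX t = 0 :=
  cI_of_le ((min_le_right _ _).trans (by linarith))

theorem edgeY_eq_zero {t : ℝ} (h : t ≤ 1 / 4) : edgeY t = 0 :=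
  cI_of_le ((min_le_left _ _).trans (by linarith))

theorem edgeY_of_le {t : ℝ} (h : t ≤ 1 / 2) : edgeY t = cI (4 * t - 1) := by
  unfold edgeY; rw [min_eq_left (by linarith)]

theorem edgeY_eq_one {t : ℝ} (h : 1 / 2 ≤ t) (h' : t ≤ 3 / 4) : edgeY t = 1 :=
  cI_of_ge (le_min (by linarith) (by linarith))

theorem edgeY_of_ge {t : ℝ} (h : 3 / 4 ≤ t) : edgeY t = cI (4 - 4 * t) := by
  unfold edgeY; rw [min_eq_right (by linarith)]

theorem commLoop_eq (t : I) :
    ((t : ℝ) ≤ 1 / 4 → commLoop f g a b t = f (Susp.mk (edgeX t) a)) ∧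
    (1 / 4 ≤ (t : ℝ) → (t : ℝ) ≤ 1 / 2 → commLoop f g a b t = g (Susp.mk (edgeY t) b)) ∧
    (1 / 2 ≤ (t : ℝ) → (t : ℝ) ≤ 3 / 4 → commLoop f g a b t = f (Susp.mk (edgeX t) a)) ∧
    (3 / 4 ≤ (t : ℝ) → commLoop f g a b t = g (Susp.mk (edgeY t) b)) := by
  have hf : ∀ s : I, adjLoop f a s = f (Susp.mk s a) := fun _ ↦ rfl
  have hg : ∀ s : I, adjLoop g b s = g (Susp.mk s b) := fun _ ↦ rfl
  have f1 : f (Susp.mk 1 a) = Z.pt := by rw [Susp.mk_one, map_pt']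
  have g1 : g (Susp.mk 1 b) = Z.pt := by rw [Susp.mk_one, map_pt']
  have f0 : f (Susp.mk 0 a) = Z.pt := by rw [Susp.mk_zero, map_pt']
  have g0 : g (Susp.mk 0 b) = Z.pt := by rw [Susp.mk_zero, map_pt']
  have t0 := t.2.1
  have t1 := t.2.2
  have p1 : (t : ℝ) ≤ 1 / 4 → commLoop f g a b t = f (Susp.mk (edgeX t) a) := by
    intro h
    rw [edgeX_of_le h, commLoop, Path.trans_apply, dif_pos (by linarith), Path.trans_apply,
      dif_pos (by change 2 * (t : ℝ) ≤ 1 / 2; linarith), hf]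
    congr 2
    refine Subtype.ext ?_
    rw [coe_cI_of (by linarith) (by linarith)]
    change 2 * (2 * (t : ℝ)) = _
    ring
  have p2 : 1 / 4 < (t : ℝ) → (t : ℝ) ≤ 1 / 2 → commLoop f g a b t = g (Susp.mk (edgeY t) b) := by
    intro h h'
    rw [edgeY_of_le h', commLoop, Path.trans_apply, dif_pos h', Path.trans_apply,
      dif_neg (by change ¬ (2 * (t : ℝ) ≤ 1 / 2); linarith), hg]
    congr 2
    refine Subtype.ext ?_
    rw [coe_cI_of (by linarith) (by linarith)]
    change 2 * (2 * (t : ℝ)) - 1 = _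
    ring
  have p3 : 1 / 2 < (t : ℝ) → (t : ℝ) ≤ 3 / 4 → commLoop f g a b t = f (Susp.mk (edgeX t) a) := by
    intro h h'
    rw [edgeX_of_ge h.le, commLoop, Path.trans_apply, dif_neg (by linarith), Path.trans_apply,
      dif_pos (by change 2 * (t : ℝ) - 1 ≤ 1 / 2; linarith), Path.symm_apply, Function.comp_apply, hf]
    congr 2
    refine Subtype.ext ?_
    rw [coe_cI_of (by linarith) (by linarith)]
    change 1 - 2 * (2 * (t : ℝ) - 1) = _
    ring
  have p4 : 3 / 4 < (t : ℝ) → commLoop f g a b t = g (Susp.mk (edgeY t) b) := by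
    intro h
    rw [edgeY_of_ge h.le, commLoop, Path.trans_apply, dif_neg (by linarith), Path.trans_apply,
      dif_neg (by change ¬ (2 * (t : ℝ) - 1 ≤ 1 / 2); linarith), Path.symm_apply, Function.comp_apply, hg]
    congr 2
    refine Subtype.ext ?_
    rw [coe_cI_of (by linarith) (by linarith)]
    change 1 - (2 * (2 * (t : ℝ) - 1) - 1) = _
    ring
  refine ⟨p1, fun h h' ↦ ?_, fun h h' ↦ ?_, fun h ↦ ?_⟩
  · rcases h.eq_or_lt with h | h
    · rw [p1 h.ge, edgeX_eq_one h.le h', edgeY_eq_zero h.ge, f1, g0]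
    · exact p2 h h'
  · rcases h.eq_or_lt with h | h
    · rw [p2 (by linarith) h.ge, edgeX_eq_one (by linarith) h.ge, edgeY_eq_one h.le h', f1, g1]
    · exact p3 h h'
  · rcases h.eq_or_lt with h | h
    · rw [p3 (by linarith) h.ge, edgeX_eq_zero h.le, edgeY_eq_one (by linarith) h.ge, f0, g1]
    · exact p4 h

theorem commLoop_of_edgeY {t : I} (h : g (Susp.mk (edgeY t) b) = Z.pt) :
    commLoop f g a b t = f (Susp.mk (edgeX t) a) := by
  obtain ⟨p1, p2, p3, p4⟩ := commLoop_eq f g a b t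
  rcases le_total (t : ℝ) (1 / 4) with h1 | h1
  · exact p1 h1
  rcases le_total (t : ℝ) (1 / 2) with h2 | h2
  · rw [p2 h1 h2, h, edgeX_eq_one h1 h2, Susp.mk_one, map_pt']
  rcases le_total (t : ℝ) (3 / 4) with h3 | h3
  · exact p3 h2 h3
  · rw [p4 h3, h, edgeX_eq_zero h3, Susp.mk_zero, map_pt']

theorem commLoop_of_edgeX {t : I} (h : f (Susp.mk (edgeX t) a) = Z.pt) :
    commLoop f g a b t = g (Susp.mk (edgeY t) b) := by
  obtain ⟨p1, p2, p3, p4⟩ := commLoop_eq f g a b t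
  rcases le_total (t : ℝ) (1 / 4) with h1 | h1
  · rw [p1 h1, h, edgeY_eq_zero h1, Susp.mk_zero, map_pt']
  rcases le_total (t : ℝ) (1 / 2) with h2 | h2
  · exact p2 h1 h2
  rcases le_total (t : ℝ) (3 / 4) with h3 | h3
  · rw [p3 h2 h3, h, edgeY_eq_one h2 h3, Susp.mk_one, map_pt']
  · exact p4 h3

/-- The commutator with the constant map is null-homotopic. -/
theorem commMap_zero_homotopic : (commMap f (PtdMap.zero (Susp B) Z)).Homotopic (PtdMap.zero _ _) := by
  refine PtdMap.Homotopic.symm (PtdMap.homotopic_of (fun τ ↦ Quot.lift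
    (fun q ↦ f (Susp.mk (τ * edgeX q.1) (dfst q.2))) ?_) ?_ ?_ ?_ ?_)
  · have key : ∀ q, SuspCollapsed (PProd A B) q →
        f (Susp.mk (τ * edgeX q.1) (dfst q.2)) = Z.pt := by
      rintro ⟨t, q⟩ (h | h | h)
      · obtain rfl : t = 0 := h
        rw [← map_pt' f]
        refine congrArg f (Susp.mk_eq_pt (Or.inl ?_))
        change τ * edgeX 0 = 0
        rw [edgeX_of_le (by norm_num), mul_zero, cI_zero, mul_zero]
      · obtain rfl : t = 1 := h
        rw [← map_pt' f]
        refine congrArg f (Susp.mk_eq_pt (Or.inl ?_))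
        change τ * edgeX 1 = 0
        rw [edgeX_eq_zero (by norm_num), mul_zero]
      · obtain rfl : q = _ := h
        rw [← map_pt' f]
        exact congrArg f (Susp.mk_eq_pt (Or.inr (Or.inr rfl)))
    exact fun p q h ↦ (key p h.1).trans (key q h.2).symm
  · refine continuous_I_prod_quot ?_
    change Continuous fun p : I × (I × DProd A B) ↦ f (Susp.mk (p.1 * edgeX p.2.1) (dfst p.2.2))
    fun_prop
  · intro x
    induction x using Quot.ind with | mk x => ?_
    change f (Susp.mk (0 * _) _) = Z.pt
    rw [zero_mul, Susp.mk_zero, map_pt']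
  · intro x
    induction x using Quot.ind with | mk x => ?_
    change f (Susp.mk (1 * _) _) = commLoop f (PtdMap.zero (Susp B) Z) (dfst x.2) (dsnd x.2) x.1
    rw [one_mul, commLoop_of_edgeY]
    rfl
  · intro τ
    change f (Susp.mk _ A.pt) = Z.pt
    rw [Susp.mk_eq_pt (Or.inr (Or.inr rfl)), map_pt']

theorem isWhitehead_zero : IsWhitehead f (PtdMap.zero (Susp B) Z) (PtdMap.zero _ _) :=
  (commMap_zero_homotopic f).symm

end Commutator

end RelJames

namespace RelJames

/-! ### The null homotopy of the attaching map of the second filtration -/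

section Commuting

variable {X A Z : PtdSpace.{u}}

/-- A null homotopy of the commutator of `f` and `g`, as a function on the square. -/
structure CommNull (f : PtdMap (Susp X) Z) (g : PtdMap (Susp A) Z) (N : I → I → DProd X A → Z) :
    Prop where
  cont : Continuous fun p : I × (I × DProd X A) ↦ N p.1 p.2.1 p.2.2
  zero : ∀ t q, N 0 t q = Z.pt
  one : ∀ t q, N 1 t q = commLoop f g (dfst q) (dsnd q) t
  left : ∀ τ q, N τ 0 q = Z.pt
  right : ∀ τ q, N τ 1 q = Z.pt
  base : ∀ τ t, N τ t (dpair X.pt A.pt) = Z.pt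

theorem IsWhitehead.exists_commNull {f : PtdMap (Susp X) Z} {g : PtdMap (Susp A) Z}
    (h : IsWhitehead f g (PtdMap.zero _ _)) : ∃ N, CommNull f g N := by
  obtain ⟨F, hF, h0, h1, hp⟩ := PtdMap.Homotopic.exists h
  have hb : ∀ τ t q, (t = 0 ∨ t = 1 ∨ q = (PProd X A).pt) → F τ (Susp.mk t q) = Z.pt :=
    fun τ t q h ↦ by rw [Susp.mk_eq_pt h, hp]
  exact ⟨fun τ t q ↦ F τ (Susp.mk (X := PProd X A) t q),
    hF.comp (f := fun p : I × (I × DProd X A) ↦ (p.1, Susp.mk (X := PProd X A) p.2.1 p.2.2))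
      (by fun_prop), fun t q ↦ h0 _, fun t q ↦ h1 _, fun τ q ↦ hb _ _ _ (Or.inl rfl),
    fun τ q ↦ hb _ _ _ (Or.inr (Or.inl rfl)), fun τ t ↦ hb _ _ _ (Or.inr (Or.inr rfl))⟩

variable {f : PtdMap (Susp X) Z} {g : PtdMap (Susp A) Z} {N : I → I → DProd X A → Z}

open Classical in
/-- The null homotopy, corrected on the axes. -/
def corrected (f : PtdMap (Susp X) Z) (g : PtdMap (Susp A) Z) (N : I → I → DProd X A → Z)
    (y : I × (I × DProd X A)) : Z :=
  if 5 * (y.1 : ℝ) ≤ 1 then f (Susp.mk (cI (5 * y.1) * edgeX y.2.1) (dfst y.2.2))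
  else if 5 * (y.1 : ℝ) ≤ 2 then N (cI (2 - 5 * y.1)) y.2.1 (dpair (dfst y.2.2) A.pt)
  else if 5 * (y.1 : ℝ) ≤ 3 then g (Susp.mk (cI (5 * y.1 - 2) * edgeY y.2.1) (dsnd y.2.2))
  else if 5 * (y.1 : ℝ) ≤ 4 then N (cI (4 - 5 * y.1)) y.2.1 (dpair X.pt (dsnd y.2.2))
  else N (cI (5 * y.1 - 4)) y.2.1 y.2.2

theorem CommNull.comp (h : CommNull f g N) {T : Type*} [TopologicalSpace T] {a b : T → I}
    {q : T → DProd X A} (ha : Continuous a) (hb : Continuous b) (hq : Continuous q) :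
    Continuous fun t ↦ N (a t) (b t) (q t) :=
  h.cont.comp (f := fun t ↦ (a t, (b t, q t))) (by fun_prop)

theorem commLoop_pt_right (f : PtdMap (Susp X) Z) (g : PtdMap (Susp A) Z) (x : X) (t : I) :
    commLoop f g x A.pt t = f (Susp.mk (edgeX t) x) :=
  commLoop_of_edgeY f g x A.pt (by rw [Susp.mk_eq_pt (Or.inr (Or.inr rfl)), map_pt'])

theorem commLoop_pt_left (f : PtdMap (Susp X) Z) (g : PtdMap (Susp A) Z) (a : A) (t : I) :
    commLoop f g X.pt a t = g (Susp.mk (edgeY t) a) :=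
  commLoop_of_edgeX f g X.pt a (by rw [Susp.mk_eq_pt (Or.inr (Or.inr rfl)), map_pt'])

theorem CommNull.one_left (h : CommNull f g N) (t : I) (a : A) :
    N 1 t (dpair X.pt a) = g (Susp.mk (edgeY t) a) := (h.one _ _).trans (commLoop_pt_left f g a t)

theorem CommNull.one_right (h : CommNull f g N) (t : I) (x : X) :
    N 1 t (dpair x A.pt) = f (Susp.mk (edgeX t) x) := (h.one _ _).trans (commLoop_pt_right f g x t)

theorem CommNull.continuous_corrected (h : CommNull f g N) : Continuous (corrected f g N) := by
  unfold corrected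
  refine Continuous.if_le (by fun_prop) (Continuous.if_le ?_ (Continuous.if_le (by fun_prop)
    (Continuous.if_le ?_ ?_ (by fun_prop) continuous_const ?_)
    (by fun_prop) continuous_const ?_) (by fun_prop) continuous_const ?_) (by fun_prop)
    continuous_const ?_
  · exact h.comp (by fun_prop) (by fun_prop) (by fun_prop)
  · exact h.comp (by fun_prop) (by fun_prop) (by fun_prop)
  · exact h.comp (by fun_prop) (by fun_prop) (by fun_prop)
  · intro y hy
    rw [hy, sub_self, cI_zero, h.zero, h.zero]
  · intro y hy
    rw [hy, if_pos (by norm_num), show (3 : ℝ) - 2 = 1 by norm_num, show (4 : ℝ) - 3 = 1 by norm_num,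
      cI_one, one_mul, h.one_left]
  · intro y hy
    rw [hy, if_pos (by norm_num), sub_self, cI_zero, h.zero, zero_mul, Susp.mk_zero, map_pt']
  · intro y hy
    rw [hy, if_pos (by norm_num), show (2 : ℝ) - 1 = 1 by norm_num, cI_one, one_mul, h.one_right]

open Classical in
/-- The homotopy of the corrected null homotopy on the boundary. -/
def cancelHom (f : PtdMap (Susp X) Z) (g : PtdMap (Susp A) Z) (N : I → I → DProd X A → Z)
    (s : ℝ) (y : I × (I × DProd X A)) : Z :=
  if dsnd y.2.2 = A.pt then
    if 5 * (y.1 : ℝ) ≤ 1 then f (Susp.mk (cI (5 * y.1) * edgeX y.2.1) (dfst y.2.2))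
    else N (cI (max s (max (2 - 5 * y.1) (5 * y.1 - 4)))) y.2.1 y.2.2
  else if dfst y.2.2 = X.pt then
    if 5 * (y.1 : ℝ) ≤ 3 then g (Susp.mk (cI (5 * y.1 - 2) * edgeY y.2.1) (dsnd y.2.2))
    else N (cI (max s (max (4 - 5 * y.1) (5 * y.1 - 4)))) y.2.1 y.2.2
  else corrected f g N y

theorem cancelHom_right (s : ℝ) {y : I × (I × DProd X A)} (hy : dsnd y.2.2 = A.pt) :
    cancelHom f g N s y = if 5 * (y.1 : ℝ) ≤ 1 then
      f (Susp.mk (cI (5 * y.1) * edgeX y.2.1) (dfst y.2.2))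
    else N (cI (max s (max (2 - 5 * y.1) (5 * y.1 - 4)))) y.2.1 y.2.2 := if_pos hy

theorem mk_axis {s : I} : f (Susp.mk s X.pt) = Z.pt := by
  rw [Susp.mk_eq_pt (Or.inr (Or.inr rfl)), map_pt']

theorem CommNull.cancelHom_left (h : CommNull f g N) (s : ℝ) {y : I × (I × DProd X A)}
    (hy : dfst y.2.2 = X.pt) :
    cancelHom f g N s y = if 5 * (y.1 : ℝ) ≤ 3 then
      g (Susp.mk (cI (5 * y.1 - 2) * edgeY y.2.1) (dsnd y.2.2))
    else N (cI (max s (max (4 - 5 * y.1) (5 * y.1 - 4)))) y.2.1 y.2.2 := by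
  by_cases h' : dsnd y.2.2 = A.pt
  · have hq : y.2.2 = dpair X.pt A.pt := by rw [← dpair_eta y.2.2, hy, h']
    rw [cancelHom_right s h', hq, dfst_dpair, dsnd_dpair, mk_axis, mk_axis, h.base, h.base, ite_self,
      ite_self]
  · unfold cancelHom
    rw [if_neg h', if_pos hy]

/-- On the ends the homotopy is constant. -/
theorem CommNull.cancelHom_ends (h : CommNull f g N) {s : ℝ}
    {y : I × (I × DProd X A)} (hy : (y.1 = 0 ∨ y.1 = 1) ∨ (y.2.1 = 0 ∨ y.2.1 = 1)) :
    cancelHom f g N s y = corrected f g N y := by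
  have x0 : edgeX ((0 : I) : ℝ) = 0 := by
    rw [Set.Icc.coe_zero, edgeX_of_le (by norm_num), mul_zero, cI_zero]
  have x1 : edgeX ((1 : I) : ℝ) = 0 := by rw [Set.Icc.coe_one, edgeX_eq_zero (by norm_num)]
  have y0 : edgeY ((0 : I) : ℝ) = 0 := by rw [Set.Icc.coe_zero, edgeY_eq_zero (by norm_num)]
  have y1 : edgeY ((1 : I) : ℝ) = 0 := by
    rw [Set.Icc.coe_one, edgeY_of_ge (by norm_num)]; norm_num
  have hm : ∀ a : ℝ, a ≤ 1 → cI (max s (max a (5 * ((1 : I) : ℝ) - 4))) = 1 := by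
    intro a ha
    refine cI_of_ge (le_max_of_le_right (le_max_of_le_right ?_))
    rw [Set.Icc.coe_one]; norm_num
  rcases hy with (hy | hy) | hy
  · unfold cancelHom corrected
    have c0 : 5 * ((0 : I) : ℝ) = 0 := by rw [Set.Icc.coe_zero, mul_zero]
    have c3 : (0 : ℝ) ≤ 3 := by norm_num
    have c2 : cI ((0 : ℝ) - 2) = 0 := cI_of_le (by norm_num)
    simp only [hy, c0, c2, c3, zero_le_one, if_true, cI_zero, zero_mul, Susp.mk_zero, map_pt']
    split_ifs <;> rfl
  · unfold cancelHom corrected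
    have e : cI (max s (max (2 - 5 * ((1 : I) : ℝ)) (5 * ((1 : I) : ℝ) - 4))) = 1 :=
      hm _ (by rw [Set.Icc.coe_one]; norm_num)
    have e' : cI (max s (max (4 - 5 * ((1 : I) : ℝ)) (5 * ((1 : I) : ℝ) - 4))) = 1 :=
      hm _ (by rw [Set.Icc.coe_one]; norm_num)
    have n1 : ∀ c : ℝ, c < 5 → ¬ (5 * ((1 : I) : ℝ) ≤ c) := fun c hc h ↦ by
      rw [Set.Icc.coe_one] at h; linarith
    rw [hy, e, e']
    simp only [n1 1 (by norm_num), n1 2 (by norm_num), n1 3 (by norm_num), n1 4 (by norm_num),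
      if_false]
    rw [Set.Icc.coe_one, cI_of_ge (by norm_num)]
    split_ifs <;> rfl
  · have hx : edgeX y.2.1 = 0 := by rcases hy with hy | hy <;> rw [hy] <;> assumption
    have hyy : edgeY y.2.1 = 0 := by rcases hy with hy | hy <;> rw [hy] <;> assumption
    have hN : ∀ a q, N a y.2.1 q = Z.pt := by
      rcases hy with hy | hy <;> rw [hy]
      exacts [h.left, h.right]
    unfold cancelHom corrected
    rw [hx, hyy]
    simp only [hN, mul_zero, Susp.mk_zero, map_pt', ite_self]

theorem CommNull.cancelHom_zero (h : CommNull f g N) {y : I × (I × DProd X A)} :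
    cancelHom f g N 0 y = corrected f g N y := by
  by_cases h1 : dsnd y.2.2 = A.pt
  · have hq : dpair (dfst y.2.2) A.pt = y.2.2 := by rw [← h1, dpair_eta]
    rw [cancelHom_right 0 h1]
    unfold corrected
    rw [hq, h1, mk_axis, h.base]
    split_ifs with a1 a2 a3 a4
    · rfl
    · rw [max_eq_left (b := 5 * (y.1 : ℝ) - 4) (by linarith), max_eq_right (by linarith)]
    · rw [max_eq_left (a := (0 : ℝ)) (max_le (by linarith) (by linarith)), cI_zero, h.zero]
    · rw [max_eq_left (a := (0 : ℝ)) (max_le (by linarith) (by linarith)), cI_zero, h.zero]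
    · rw [max_eq_right (b := 5 * (y.1 : ℝ) - 4) (by linarith), max_eq_right (by linarith)]
  · by_cases h2 : dfst y.2.2 = X.pt
    · have hq : dpair X.pt (dsnd y.2.2) = y.2.2 := by rw [← h2, dpair_eta]
      rw [h.cancelHom_left 0 h2]
      unfold corrected
      rw [hq, h2, mk_axis, h.base]
      split_ifs with a1 a2 a3 a4 a5
      · rw [cI_of_le (by linarith), zero_mul, Susp.mk_zero, map_pt']
      · rw [cI_of_le (by linarith), zero_mul, Susp.mk_zero, map_pt']
      · rfl
      · exact absurd ‹_› (by linarith : ¬ (5 * (y.1 : ℝ) ≤ 1))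
      · linarith
      · rw [max_eq_left (b := 5 * (y.1 : ℝ) - 4) (by linarith), max_eq_right (by linarith)]
      · rw [max_eq_right (b := 5 * (y.1 : ℝ) - 4) (by linarith), max_eq_right (by linarith)]
    · unfold cancelHom
      rw [if_neg h1, if_neg h2]

end Commuting

end RelJames

namespace RelJames

section Fill

variable {X A Z : PtdSpace.{u}} {f : PtdMap (Susp X) Z} {g : PtdMap (Susp A) Z}
  {N : I → I → DProd X A → Z}

theorem CommNull.continuousOn_cancelHom (h : CommNull f g N) (hX : IsClosed ({X.pt} : Set X))
    (hA : IsClosed ({A.pt} : Set A)) : ContinuousOn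
      (fun p : ℝ × (I × (I × DProd X A)) ↦ cancelHom f g N p.1 p.2)
      (Set.univ ×ˢ squareSet X A) := by
  have hset : (Set.univ ×ˢ squareSet X A : Set (ℝ × (I × (I × DProd X A)))) =
      ({p | dfst p.2.2.2 = X.pt} ∪ {p | dsnd p.2.2.2 = A.pt}) ∪
        {p | (p.2.1 = 0 ∨ p.2.1 = 1) ∨ (p.2.2.1 = 0 ∨ p.2.2.1 = 1)} := by
    ext p
    simp only [squareSet, OnAxes, Set.mem_prod, Set.mem_univ, true_and, Set.mem_ofPred_eq,
      Set.mem_union]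
    tauto
  have c1 : IsClosed {p : ℝ × (I × (I × DProd X A)) | dfst p.2.2.2 = X.pt} :=
    hX.preimage (f := fun p : ℝ × (I × (I × DProd X A)) ↦ dfst p.2.2.2) (by fun_prop)
  have c2 : IsClosed {p : ℝ × (I × (I × DProd X A)) | dsnd p.2.2.2 = A.pt} :=
    hA.preimage (f := fun p : ℝ × (I × (I × DProd X A)) ↦ dsnd p.2.2.2) (by fun_prop)
  have c3 : IsClosed {p : ℝ × (I × (I × DProd X A)) |
      (p.2.1 = 0 ∨ p.2.1 = 1) ∨ (p.2.2.1 = 0 ∨ p.2.2.1 = 1)} :=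
    ((isClosed_eq (by fun_prop) (by fun_prop)).union
      (isClosed_eq (by fun_prop) (by fun_prop))).union
    ((isClosed_eq (by fun_prop) (by fun_prop)).union
      (isClosed_eq (by fun_prop) (by fun_prop)))
  rw [hset]
  refine ContinuousOn.union_of_isClosed (ContinuousOn.union_of_isClosed ?_ ?_ c1 c2) ?_
    (c1.union c2) c3
  · refine ContinuousOn.congr (f := fun p : ℝ × (I × (I × DProd X A)) ↦
      if 5 * (p.2.1 : ℝ) ≤ 3 then g (Susp.mk (cI (5 * p.2.1 - 2) * edgeY p.2.2.1) (dsnd p.2.2.2))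
      else N (cI (max p.1 (max (4 - 5 * p.2.1) (5 * p.2.1 - 4)))) p.2.2.1
        (dpair X.pt (dsnd p.2.2.2))) (Continuous.continuousOn ?_) ?_
    · refine Continuous.if_le (by fun_prop) (h.comp (by fun_prop) (by fun_prop) (by fun_prop))
        (by fun_prop) continuous_const ?_
      intro p hp
      rw [hp, cI_of_ge (le_max_of_le_right (le_max_of_le_left (by norm_num))), h.one_left,
        cI_of_ge (by norm_num), one_mul]
    · intro p hp
      have hp : dfst p.2.2.2 = X.pt := hp
      have hq : dpair X.pt (dsnd p.2.2.2) = p.2.2.2 := by rw [← hp, dpair_eta]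
      simp only [hq]
      exact h.cancelHom_left p.1 hp
  · refine ContinuousOn.congr (f := fun p : ℝ × (I × (I × DProd X A)) ↦
      if 5 * (p.2.1 : ℝ) ≤ 1 then f (Susp.mk (cI (5 * p.2.1) * edgeX p.2.2.1) (dfst p.2.2.2))
      else N (cI (max p.1 (max (2 - 5 * p.2.1) (5 * p.2.1 - 4)))) p.2.2.1
        (dpair (dfst p.2.2.2) A.pt)) (Continuous.continuousOn ?_) ?_
    · refine Continuous.if_le (by fun_prop) (h.comp (by fun_prop) (by fun_prop) (by fun_prop))
        (by fun_prop) continuous_const ?_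
      intro p hp
      rw [hp, cI_of_ge (le_max_of_le_right (le_max_of_le_left (by norm_num))), h.one_right,
        cI_one, one_mul]
    · intro p hp
      have hp : dsnd p.2.2.2 = A.pt := hp
      have hq : dpair (dfst p.2.2.2) A.pt = p.2.2.2 := by rw [← hp, dpair_eta]
      simp only [hq]
      exact cancelHom_right p.1 hp
  · exact (h.continuous_corrected.comp continuous_snd).continuousOn.congr
      fun p hp ↦ h.cancelHom_ends hp

/-- A null homotopy of the commutator that is standard on the axes. -/
structure StrictNull (f : PtdMap (Susp X) Z) (g : PtdMap (Susp A) Z) (K : I → I → DProd X A → Z) :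
    Prop extends CommNull f g K where
  axis_right : ∀ u t x, K u t (dpair x A.pt) = f (Susp.mk (cI (5 * u) * edgeX t) x)
  axis_left : ∀ u t a, K u t (dpair X.pt a) = g (Susp.mk (cI (5 * u - 2) * edgeY t) a)

theorem CommNull.exists_strictNull (h : CommNull f g N) (SX : CofStr X {X.pt})
    (SA : CofStr A {A.pt}) : ∃ K, StrictNull f g K := by
  let S := squareCof SX SA
  have hco := h.continuousOn_cancelHom SX.isClosed SA.isClosed
  let K : I × (I × DProd X A) → Z := S.ext (corrected f g N) (cancelHom f g N) 1
  have hK : Continuous K := S.continuous_ext h.continuous_corrected hco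
    (fun y _ ↦ h.cancelHom_zero) continuous_const continuous_id fun _ ↦ le_rfl
  have hends : ∀ y : I × (I × DProd X A), (y.1 = 0 ∨ y.1 = 1) ∨ (y.2.1 = 0 ∨ y.2.1 = 1) →
      K y = corrected f g N y := by
    intro y hy
    have hy' : y ∈ squareSet X A := hy.imp id Or.inl
    exact (S.ext_rel hy' zero_le_one).trans (h.cancelHom_ends hy)
  have htends : ∀ y : I × (I × DProd X A), (y.2.1 = 0 ∨ y.2.1 = 1) → K y = Z.pt := by
    intro y hy
    have hx : edgeX y.2.1 = 0 := by
      rcases hy with hy | hy <;> rw [hy]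
      · rw [Set.Icc.coe_zero, edgeX_of_le (by norm_num), mul_zero, cI_zero]
      · rw [Set.Icc.coe_one, edgeX_eq_zero (by norm_num)]
    have hyy : edgeY y.2.1 = 0 := by
      rcases hy with hy | hy <;> rw [hy]
      · rw [Set.Icc.coe_zero, edgeY_eq_zero (by norm_num)]
      · rw [Set.Icc.coe_one, edgeY_of_ge (by norm_num)]; norm_num
    have hN : ∀ a q, N a y.2.1 q = Z.pt := by
      rcases hy with hy | hy <;> rw [hy]
      exacts [h.left, h.right]
    rw [hends y (Or.inr hy)]
    unfold corrected
    rw [hx, hyy]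
    simp only [hN, mul_zero, Susp.mk_zero, map_pt', ite_self]
  have hR : ∀ u t x, K (u, t, dpair x A.pt) = f (Susp.mk (cI (5 * u) * edgeX t) x) := by
    intro u t x
    refine (S.ext_rel (Or.inr (Or.inr (Or.inr rfl))) zero_le_one).trans ?_
    rw [cancelHom_right _ rfl]
    split_ifs with h5
    · rfl
    · rw [cI_of_ge (le_max_left _ _), h.one_right, cI_of_ge (not_le.1 h5).le, one_mul]
  have hL : ∀ u t a, K (u, t, dpair X.pt a) = g (Susp.mk (cI (5 * u - 2) * edgeY t) a) := by
    intro u t x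
    refine (S.ext_rel (Or.inr (Or.inr (Or.inl rfl))) zero_le_one).trans ?_
    rw [h.cancelHom_left _ rfl]
    split_ifs with h5
    · rfl
    · rw [cI_of_ge (le_max_left _ _), h.one_left,
        cI_of_ge (by have := (not_le.1 h5).le; dsimp only at this; linarith), one_mul]
  refine ⟨fun u t q ↦ K (u, t, q), ⟨hK, ?_, ?_, ?_, ?_, ?_⟩, hR, hL⟩
  · intro t q
    rw [hends _ (Or.inl (Or.inl rfl))]
    unfold corrected
    rw [Set.Icc.coe_zero, mul_zero, if_pos zero_le_one, cI_zero, zero_mul, Susp.mk_zero, map_pt']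
  · intro t q
    rw [hends _ (Or.inl (Or.inr rfl)), ← h.one]
    have n1 : ∀ c : ℝ, c < 5 → ¬ (5 * ((1 : I) : ℝ) ≤ c) := fun c hc h ↦ by
      rw [Set.Icc.coe_one] at h; linarith
    unfold corrected
    simp only [n1 1 (by norm_num), n1 2 (by norm_num), n1 3 (by norm_num), n1 4 (by norm_num),
      if_false]
    rw [Set.Icc.coe_one, cI_of_ge (by norm_num)]
  · exact fun u q ↦ htends _ (Or.inl rfl)
  · exact fun u q ↦ htends _ (Or.inr rfl)
  · intro u t
    exact (hR u t X.pt).trans mk_axis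

open Classical in
/-- The null homotopy on the boundary of the square. -/
def edgeHom (f : PtdMap (Susp X) Z) (g : PtdMap (Susp A) Z) (K : I → I → DProd X A → Z) (τ : ℝ)
    (y : I × (I × DProd X A)) : Z :=
  if dsnd y.2.2 = A.pt then f (Susp.mk (cI (5 * cI (1 - τ)) * y.1) (dfst y.2.2))
  else if dfst y.2.2 = X.pt then g (Susp.mk (cI (5 * cI (1 - τ) - 2) * y.2.1) (dsnd y.2.2))
  else if y.2.1 ≤ y.1 then K (cI (1 - τ)) (cI ((y.1 + y.2.1) / 4)) y.2.2
  else K (cI (1 - τ)) (cI (1 - (y.1 + y.2.1) / 4)) y.2.2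

theorem edge_lower {s t : I} (h : (s = 0 ∨ s = 1) ∨ (t = 0 ∨ t = 1)) (hst : t ≤ s) :
    edgeX (cI ((s + t) / 4)) = s ∧ edgeY (cI ((s + t) / 4)) = t := by
  have hs0 := s.2.1
  have hs1 := s.2.2
  have ht0 := t.2.1
  have ht1 := t.2.2
  have hst' : (t : ℝ) ≤ s := hst
  have h' : t = 0 ∨ s = 1 := by
    rcases h with (h | h) | h | h
    · exact Or.inl (le_antisymm (h ▸ hst) ht0)
    · exact Or.inr h
    · exact Or.inl h
    · exact Or.inr (le_antisymm hs1 (h ▸ hst))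
  rw [coe_cI_of (by linarith) (by linarith)]
  rcases h' with rfl | rfl
  · rw [Set.Icc.coe_zero, add_zero, edgeX_of_le (by linarith), edgeY_eq_zero (by linarith),
      mul_div_cancel₀ _ four_ne_zero, cI_coe]
    exact ⟨rfl, rfl⟩
  · rw [Set.Icc.coe_one, edgeX_eq_one (by linarith) (by linarith), edgeY_of_le (by linarith),
      mul_div_cancel₀ _ four_ne_zero, add_sub_cancel_left, cI_coe]
    exact ⟨rfl, rfl⟩

theorem edge_upper {s t : I} (h : (s = 0 ∨ s = 1) ∨ (t = 0 ∨ t = 1)) (hst : s ≤ t) :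
    edgeX (cI (1 - (s + t) / 4)) = s ∧ edgeY (cI (1 - (s + t) / 4)) = t := by
  have hs0 := s.2.1
  have hs1 := s.2.2
  have ht0 := t.2.1
  have ht1 := t.2.2
  have hst' : (s : ℝ) ≤ t := hst
  have h' : s = 0 ∨ t = 1 := by
    rcases h with (h | h) | h | h
    · exact Or.inl h
    · exact Or.inr (le_antisymm ht1 (h ▸ hst))
    · exact Or.inl (le_antisymm (h ▸ hst) hs0)
    · exact Or.inr h
  rw [coe_cI_of (by linarith) (by linarith)]
  rcases h' with rfl | rfl
  · rw [Set.Icc.coe_zero, zero_add, edgeX_eq_zero (by linarith), edgeY_of_ge (by linarith),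
      show (4 : ℝ) - 4 * (1 - t / 4) = t by ring, cI_coe]
    exact ⟨rfl, rfl⟩
  · rw [Set.Icc.coe_one, edgeX_of_ge (by linarith), edgeY_eq_one (by linarith) (by linarith),
      show (3 : ℝ) - 4 * (1 - (s + 1) / 4) = s by ring, cI_coe]
    exact ⟨rfl, rfl⟩

variable {K : I → I → DProd X A → Z}

theorem edgeHom_right (τ : ℝ) {y : I × (I × DProd X A)} (hy : dsnd y.2.2 = A.pt) :
    edgeHom f g K τ y = f (Susp.mk (cI (5 * cI (1 - τ)) * y.1) (dfst y.2.2)) := if_pos hy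

theorem edgeHom_left (τ : ℝ) {y : I × (I × DProd X A)} (hy : dfst y.2.2 = X.pt) :
    edgeHom f g K τ y = g (Susp.mk (cI (5 * cI (1 - τ) - 2) * y.2.1) (dsnd y.2.2)) := by
  by_cases h' : dsnd y.2.2 = A.pt
  · rw [edgeHom_right τ h', hy, h', mk_axis, mk_axis]
  · unfold edgeHom
    rw [if_neg h', if_pos hy]

theorem StrictNull.edgeHom_lower (h : StrictNull f g K) (τ : ℝ) {y : I × (I × DProd X A)}
    (hy : (y.1 = 0 ∨ y.1 = 1) ∨ (y.2.1 = 0 ∨ y.2.1 = 1)) (hle : y.2.1 ≤ y.1) :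
    edgeHom f g K τ y = K (cI (1 - τ)) (cI ((y.1 + y.2.1) / 4)) y.2.2 := by
  obtain ⟨e1, e2⟩ := edge_lower hy hle
  by_cases h1 : dsnd y.2.2 = A.pt
  · have hq : y.2.2 = dpair (dfst y.2.2) A.pt := by rw [← h1, dpair_eta]
    rw [edgeHom_right τ h1, hq, h.axis_right, e1, dfst_dpair]
  · by_cases h2 : dfst y.2.2 = X.pt
    · have hq : y.2.2 = dpair X.pt (dsnd y.2.2) := by rw [← h2, dpair_eta]
      rw [edgeHom_left τ h2, hq, h.axis_left, e2, dsnd_dpair]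
    · unfold edgeHom
      rw [if_neg h1, if_neg h2, if_pos hle]

theorem StrictNull.edgeHom_upper (h : StrictNull f g K) (τ : ℝ) {y : I × (I × DProd X A)}
    (hy : (y.1 = 0 ∨ y.1 = 1) ∨ (y.2.1 = 0 ∨ y.2.1 = 1)) (hle : y.1 ≤ y.2.1) :
    edgeHom f g K τ y = K (cI (1 - τ)) (cI (1 - (y.1 + y.2.1) / 4)) y.2.2 := by
  by_cases hle' : y.2.1 ≤ y.1
  · rw [h.edgeHom_lower τ hy hle']
    have heq : y.1 = y.2.1 := le_antisymm hle hle'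
    have : y.2.1 = 0 ∨ y.2.1 = 1 := by
      rw [heq] at hy
      exact hy.elim id id
    rw [heq]
    rcases this with h0 | h0 <;> rw [h0]
    · rw [Set.Icc.coe_zero, add_zero, zero_div, cI_zero, sub_zero, cI_one, h.left, h.right]
    · norm_num
  · obtain ⟨e1, e2⟩ := edge_upper hy hle
    by_cases h1 : dsnd y.2.2 = A.pt
    · have hq : y.2.2 = dpair (dfst y.2.2) A.pt := by rw [← h1, dpair_eta]
      rw [edgeHom_right τ h1, hq, h.axis_right, e1, dfst_dpair]
    · by_cases h2 : dfst y.2.2 = X.pt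
      · have hq : y.2.2 = dpair X.pt (dsnd y.2.2) := by rw [← h2, dpair_eta]
        rw [edgeHom_left τ h2, hq, h.axis_left, e2, dsnd_dpair]
      · unfold edgeHom
        rw [if_neg h1, if_neg h2, if_neg hle']

theorem StrictNull.continuousOn_edgeHom (h : StrictNull f g K) (hX : IsClosed ({X.pt} : Set X))
    (hA : IsClosed ({A.pt} : Set A)) : ContinuousOn
      (fun p : ℝ × (I × (I × DProd X A)) ↦ edgeHom f g K p.1 p.2)
      (Set.univ ×ˢ squareSet X A) := by
  let Ends : Set (ℝ × (I × (I × DProd X A))) :=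
    {p | (p.2.1 = 0 ∨ p.2.1 = 1) ∨ (p.2.2.1 = 0 ∨ p.2.2.1 = 1)}
  have hset : (Set.univ ×ˢ squareSet X A : Set (ℝ × (I × (I × DProd X A)))) =
      ({p | dfst p.2.2.2 = X.pt} ∪ {p | dsnd p.2.2.2 = A.pt}) ∪
        ((Ends ∩ {p | p.2.2.1 ≤ p.2.1}) ∪ (Ends ∩ {p | p.2.1 ≤ p.2.2.1})) := by
    ext p
    have := le_total p.2.1 p.2.2.1
    simp only [squareSet, OnAxes, Set.mem_prod, Set.mem_univ, true_and, Set.mem_ofPred_eq,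
      Set.mem_union, Set.mem_inter_iff, Ends]
    tauto
  have c1 : IsClosed {p : ℝ × (I × (I × DProd X A)) | dfst p.2.2.2 = X.pt} :=
    hX.preimage (f := fun p : ℝ × (I × (I × DProd X A)) ↦ dfst p.2.2.2) (by fun_prop)
  have c2 : IsClosed {p : ℝ × (I × (I × DProd X A)) | dsnd p.2.2.2 = A.pt} :=
    hA.preimage (f := fun p : ℝ × (I × (I × DProd X A)) ↦ dsnd p.2.2.2) (by fun_prop)
  have c3 : IsClosed Ends :=
    ((isClosed_eq (by fun_prop) (by fun_prop)).union
      (isClosed_eq (by fun_prop) (by fun_prop))).union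
    ((isClosed_eq (by fun_prop) (by fun_prop)).union
      (isClosed_eq (by fun_prop) (by fun_prop)))
  have c4 : IsClosed (Ends ∩ {p | p.2.2.1 ≤ p.2.1}) :=
    c3.inter (isClosed_le (by fun_prop) (by fun_prop))
  have c5 : IsClosed (Ends ∩ {p | p.2.1 ≤ p.2.2.1}) :=
    c3.inter (isClosed_le (by fun_prop) (by fun_prop))
  rw [hset]
  refine ContinuousOn.union_of_isClosed (ContinuousOn.union_of_isClosed ?_ ?_ c1 c2)
    (ContinuousOn.union_of_isClosed ?_ ?_ c4 c5) (c1.union c2) (c4.union c5)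
  · exact ContinuousOn.congr (f := fun p : ℝ × (I × (I × DProd X A)) ↦
      g (Susp.mk (cI (5 * cI (1 - p.1) - 2) * p.2.2.1) (dsnd p.2.2.2)))
      (Continuous.continuousOn (by fun_prop)) fun p hp ↦ edgeHom_left p.1 hp
  · exact ContinuousOn.congr (f := fun p : ℝ × (I × (I × DProd X A)) ↦
      f (Susp.mk (cI (5 * cI (1 - p.1)) * p.2.1) (dfst p.2.2.2)))
      (Continuous.continuousOn (by fun_prop)) fun p hp ↦ edgeHom_right p.1 hp
  · exact ContinuousOn.congr (Continuous.continuousOn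
      (h.comp (a := fun p : ℝ × (I × (I × DProd X A)) ↦ cI (1 - p.1))
        (b := fun p ↦ cI ((p.2.1 + p.2.2.1) / 4)) (q := fun p ↦ p.2.2.2)
        (by fun_prop) (by fun_prop) (by fun_prop))) fun p hp ↦ h.edgeHom_lower p.1 hp.1 hp.2
  · exact ContinuousOn.congr (Continuous.continuousOn
      (h.comp (a := fun p : ℝ × (I × (I × DProd X A)) ↦ cI (1 - p.1))
        (b := fun p ↦ cI (1 - (p.2.1 + p.2.2.1) / 4)) (q := fun p ↦ p.2.2.2)
        (by fun_prop) (by fun_prop) (by fun_prop))) fun p hp ↦ h.edgeHom_upper p.1 hp.1 hp.2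

theorem StrictNull.edgeHom_one (h : StrictNull f g K) (y : I × (I × DProd X A)) : edgeHom f g K 1 y = Z.pt := by
  have e1 : cI (5 * (cI (1 - 1) : ℝ)) = 0 := by
    rw [sub_self, cI_zero, Set.Icc.coe_zero, mul_zero, cI_zero]
  have e2 : cI (5 * (cI (1 - 1) : ℝ) - 2) = 0 := by
    rw [sub_self, cI_zero, Set.Icc.coe_zero, mul_zero]
    exact cI_of_le (by norm_num)
  unfold edgeHom
  rw [e1, e2, zero_mul, zero_mul, Susp.mk_zero, Susp.mk_zero, sub_self, cI_zero, h.zero, h.zero,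
    map_pt', map_pt']
  split_ifs <;> rfl

theorem StrictNull.edgeHom_zero (h : StrictNull f g K) {y : I × (I × DProd X A)} :
    ((y.2.1 = 0 ∨ y.2.1 = 1) ∨ dsnd y.2.2 = A.pt →
      edgeHom f g K 0 y = f (Susp.mk y.1 (dfst y.2.2))) ∧
    ((y.1 = 0 ∨ y.1 = 1) ∨ dfst y.2.2 = X.pt →
      edgeHom f g K 0 y = g (Susp.mk y.2.1 (dsnd y.2.2))) := by
  have e1 : cI (5 * (cI (1 - 0) : ℝ)) = 1 := by
    rw [sub_zero, cI_one, Set.Icc.coe_one]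
    exact cI_of_ge (by norm_num)
  have e2 : cI (5 * (cI (1 - 0) : ℝ) - 2) = 1 := by
    rw [sub_zero, cI_one, Set.Icc.coe_one]
    exact cI_of_ge (by norm_num)
  have e0 : cI (1 - 0) = 1 := by rw [sub_zero, cI_one]
  have key : (y.1 = 0 ∨ y.1 = 1) ∨ (y.2.1 = 0 ∨ y.2.1 = 1) → ∃ t : I, edgeX t = y.1 ∧
      edgeY t = y.2.1 ∧ edgeHom f g K 0 y = commLoop f g (dfst y.2.2) (dsnd y.2.2) t := by
    intro hy
    rcases le_total y.2.1 y.1 with hle | hle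
    · obtain ⟨a1, a2⟩ := edge_lower hy hle
      exact ⟨_, a1, a2, by rw [h.edgeHom_lower 0 hy hle, e0, h.one]⟩
    · obtain ⟨a1, a2⟩ := edge_upper hy hle
      exact ⟨_, a1, a2, by rw [h.edgeHom_upper 0 hy hle, e0, h.one]⟩
  constructor
  · rintro (hy | hy)
    · obtain ⟨t, a1, a2, a3⟩ := key (Or.inr hy)
      rw [a3, commLoop_of_edgeY, a1]
      rw [a2, Susp.mk_eq_pt (hy.elim Or.inl fun h ↦ Or.inr (Or.inl h)), map_pt']
    · rw [edgeHom_right 0 hy, e1, one_mul]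
  · rintro (hy | hy)
    · obtain ⟨t, a1, a2, a3⟩ := key (Or.inl hy)
      rw [a3, commLoop_of_edgeX, a2]
      rw [a1, Susp.mk_eq_pt (hy.elim Or.inl fun h ↦ Or.inr (Or.inl h)), map_pt']
    · rw [edgeHom_left 0 hy, e2, one_mul]

end Fill

end RelJames

namespace RelJames

/-! ### The splitting of the second filtration -/

section Splitting

variable {X A P : PtdSpace.{u}} {i : PtdMap (Susp A) P} {ε : PtdMap (Susp X) P}
  {r : PtdMap P (Susp X)}

theorem continuousOn_squareAtt (D : CylData i ε r) :
    ContinuousOn (squareAtt i ε) (squareSet X A) :=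
  (continuousOn_axFold i D.isClosed_pt D.SA.susp.isClosed).comp
    ((continuous_onFirst₂ ε).comp isQuotientMap_squareQuot.continuous).continuousOn
    fun _ hy ↦ (onAxes_onFirst₂ D).2 (onAxes_squareQuot.2 hy)

theorem squareAtt_right {y : I × (I × DProd X A)}
    (hy : (y.2.1 = 0 ∨ y.2.1 = 1) ∨ dsnd y.2.2 = A.pt) :
    squareAtt i ε y = ε (Susp.mk y.1 (dfst y.2.2)) :=
  axFold_right i (t := onFirst₂ ε (squareQuot y)) (Susp.mk_eq_pt (by tauto))

theorem squareAtt_left {y : I × (I × DProd X A)}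
    (hy : (y.1 = 0 ∨ y.1 = 1) ∨ dfst y.2.2 = X.pt) :
    squareAtt i ε y = i (Susp.mk y.2.1 (dsnd y.2.2)) :=
  axFold_left i (t := onFirst₂ ε (squareQuot y))
    ((congrArg ε (Susp.mk_eq_pt (by tauto))).trans ε.map_pt)

open Classical in
/-- The null homotopy of the attaching map. -/
def squareNull (D : CylData i ε r) (K : I → I → DProd X A → Susp X) (τ : ℝ)
    (y : I × (I × DProd X A)) : P :=
  if τ ≤ 1 / 2 then D.H (cI (2 * τ)) (squareAtt i ε y)
  else ε (edgeHom (PtdMap.id _) (r.comp i) K (2 * τ - 1) y)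

theorem squareNull_homotopy (D : CylData i ε r) {K : I → I → DProd X A → Susp X}
    (hK : StrictNull (PtdMap.id (Susp X)) (r.comp i) K) :
    Adj.AttHomotopy (squareSet X A) (squareAtt i ε) (fun _ ↦ P.pt) (squareNull D K) := by
  have h0 : ∀ y ∈ squareSet X A,
      edgeHom (PtdMap.id _) (r.comp i) K 0 y = r (squareAtt i ε y) := by
    intro y hy
    by_cases h : (y.2.1 = 0 ∨ y.2.1 = 1) ∨ dsnd y.2.2 = A.pt
    · rw [squareAtt_right h, D.r_ε, hK.edgeHom_zero.1 h]
      rfl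
    · have h' : (y.1 = 0 ∨ y.1 = 1) ∨ dfst y.2.2 = X.pt := by
        unfold squareSet OnAxes at hy
        simp only [Set.mem_ofPred_eq] at hy
        tauto
      rw [squareAtt_left h', hK.edgeHom_zero.2 h']
      rfl
  have hL := (squareCof D.SX D.SA).isClosed
  have e1 : ∀ {p : ℝ × (I × (I × DProd X A))}, p.1 ≤ 1 / 2 → p.2 ∈ squareSet X A →
      squareNull D K p.1 p.2 = D.H (cI (2 * p.1)) (squareAtt i ε p.2) := fun h _ ↦ if_pos h
  have e2 : ∀ {p : ℝ × (I × (I × DProd X A))}, 1 / 2 ≤ p.1 → p.2 ∈ squareSet X A →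
      squareNull D K p.1 p.2 = ε (edgeHom (PtdMap.id _) (r.comp i) K (2 * p.1 - 1) p.2) := by
    intro p h hy
    rcases h.eq_or_lt with h | h
    · rw [e1 h.ge hy, ← h, mul_one_div_cancel two_ne_zero, cI_one, D.H_one, sub_self, h0 _ hy]
    · exact if_neg (not_le.2 h)
  refine ⟨?_, fun y hy ↦ ?_, fun y hy ↦ ?_⟩
  · have hset : (Set.univ ×ˢ squareSet X A : Set (ℝ × (I × (I × DProd X A)))) =
        {p | p.1 ≤ 1 / 2 ∧ p.2 ∈ squareSet X A} ∪ {p | 1 / 2 ≤ p.1 ∧ p.2 ∈ squareSet X A} := by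
      ext p
      have := le_total p.1 (1 / 2)
      simp only [Set.mem_prod, Set.mem_univ, true_and, Set.mem_union, Set.mem_ofPred_eq,
        ← or_and_right, this]
    rw [hset]
    refine ContinuousOn.union_of_isClosed ?_ ?_
      ((isClosed_le continuous_fst continuous_const).inter (hL.preimage continuous_snd))
      ((isClosed_le continuous_const continuous_fst).inter (hL.preimage continuous_snd))
    · refine ContinuousOn.congr ?_ fun p hp ↦ e1 hp.1 hp.2
      exact D.cont_H.comp_continuousOn
        (f := fun p : ℝ × (I × (I × DProd X A)) ↦ (cI (2 * p.1), squareAtt i ε p.2))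
        (ContinuousOn.prodMk (Continuous.continuousOn (by fun_prop))
          ((continuousOn_squareAtt D).comp continuousOn_snd fun p hp ↦ hp.2))
    · refine ContinuousOn.congr ?_ fun p hp ↦ e2 hp.1 hp.2
      exact ε.cont.comp_continuousOn
        ((hK.continuousOn_edgeHom D.SX.isClosed D.SA.isClosed).comp
          (f := fun p : ℝ × (I × (I × DProd X A)) ↦ (2 * p.1 - 1, p.2))
          (Continuous.continuousOn (by fun_prop)) fun p hp ↦ ⟨trivial, hp.2⟩)
  · rw [e1 (p := (0, y)) (by norm_num) hy, mul_zero, cI_zero, D.H_zero]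
  · rw [e2 (p := (1, y)) (by norm_num) hy]
    rw [show (2 : ℝ) * ((1 : ℝ), y).1 - 1 = 1 by norm_num, hK.edgeHom_one, map_pt']

/-- The parametrization of the smash product of two suspensions. -/
def squareSmash (y : I × (I × DProd X A)) : Smash (Susp X) (Susp A) := Quot.mk _ (squareQuot y)

theorem isQuotientMap_squareSmash : IsQuotientMap (squareSmash (X := X) (A := A)) :=
  isQuotientMap_quot_mk.comp isQuotientMap_squareQuot

theorem squareSmash_eq_pt {y : I × (I × DProd X A)} (hy : y ∈ squareSet X A) :
    squareSmash y = (Smash (Susp X) (Susp A)).pt :=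
  Smash.mk_eq_pt (onAxes_squareQuot.2 hy)

theorem squareSmash_injOn {y y' : I × (I × DProd X A)} (h : squareSmash y = squareSmash y') :
    y = y' ∨ (y ∈ squareSet X A ∧ y' ∈ squareSet X A) := by
  rcases quot_collapse_eq (A := OnAxes (Susp X) (Susp A)) h with h | ⟨h1, h2⟩
  · rcases squareQuot_injOn h with h' | h'
    · exact Or.inl h'
    · refine Or.inr ⟨h', ?_⟩
      rw [← onAxes_squareQuot, ← h, onAxes_squareQuot]
      exact h'
  · exact Or.inr ⟨onAxes_squareQuot.1 h1, onAxes_squareQuot.1 h2⟩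

/-- The splitting of the adjunction space for the constant attaching map. -/
theorem exists_wedge_equiv (D : CylData i ε r) :
    ∃ e : PtdMap (Wedge (Susp X) (Smash (Susp X) (Susp A)))
      (Adj P (I × (I × DProd X A)) (squareSet X A) fun _ ↦ P.pt), e.IsHomotopyEquiv ∧
      (∀ x, e (Wedge.inl _ _ x) = Adj.inl _ _ _ _ (ε x)) ∧
      ∀ y, e (Wedge.inr _ _ (squareSmash y)) = Adj.inr y := by
  let a : I × (I × DProd X A) → P := fun _ ↦ P.pt
  have hq := isQuotientMap_squareSmash (X := X) (A := A)
  have hpt : ∀ y ∈ squareSet X A, (Adj.inr y : Adj P _ (squareSet X A) a) = PtdSpace.pt _ :=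
    fun y hy ↦ Adj.inr_eq hy
  let j : Smash (Susp X) (Susp A) → Adj P _ (squareSet X A) a :=
    fun z ↦ Adj.inr (Function.surjInv hq.surjective z)
  have hj : ∀ y, j (squareSmash y) = Adj.inr y := by
    intro y
    rcases squareSmash_injOn (Function.surjInv_eq hq.surjective (squareSmash y)) with h | ⟨h1, h2⟩
    · exact congrArg Adj.inr h
    · exact (hpt _ h1).trans (hpt _ h2).symm
  let j' : PtdMap (Smash (Susp X) (Susp A)) (Adj P _ (squareSet X A) a) :=
    { toFun := j
      continuous_toFun := by
        rw [hq.continuous_iff, show j ∘ squareSmash = Adj.inr from funext hj]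
        fun_prop
      map_pt := by
        have hy : ((0, (0, dpair X.pt A.pt)) : I × (I × DProd X A)) ∈ squareSet X A :=
          Or.inl (Or.inl rfl)
        rw [← squareSmash_eq_pt hy, hj, hpt _ hy] }
  let e : PtdMap (Wedge (Susp X) (Smash (Susp X) (Susp A))) (Adj P _ (squareSet X A) a) :=
    Wedge.desc ((Adj.inl _ _ _ _).comp ε) j'
  let k : PtdMap (Adj P _ (squareSet X A) a) (Wedge (Susp X) (Smash (Susp X) (Susp A))) :=
    Adj.desc ((Wedge.inl _ _).comp r) (fun y ↦ Wedge.inr _ _ (squareSmash y))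
      ((Wedge.inr _ _).cont.comp hq.continuous) <| by
      intro y hy
      rw [squareSmash_eq_pt hy, map_pt']
      exact (map_pt' ((Wedge.inl _ _).comp r)).symm
  refine ⟨e, ⟨k, PtdMap.Homotopic.of_eq fun w ↦ ?_, PtdMap.Homotopic.symm ?_⟩, fun _ ↦ rfl, hj⟩
  · induction w using Quot.ind with | mk w => ?_
    rcases w with x | z
    · exact congrArg (Wedge.inl _ _) (D.r_ε x)
    · obtain ⟨y, rfl⟩ := hq.surjective z
      exact congrArg k (hj y)
  · refine Adj.homotopic (fun t b ↦ Adj.inl _ _ _ _ (D.H t b)) (fun t y ↦ Adj.inr y)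
      ((Adj.inl _ _ _ _).cont.comp D.cont_H) (by fun_prop) ?_ ?_ ?_ ?_ ?_ ?_
    · intro t y hy
      rw [Adj.inr_eq hy]
      refine congrArg (Adj.inl _ _ _ _) ?_
      rw [← map_pt' ε, D.H_ε]
    · intro t
      rw [← map_pt' ε, D.H_ε, map_pt']
      rfl
    · intro b
      rw [D.H_zero]; rfl
    · intro b
      rw [D.H_one]; rfl
    · exact fun y ↦ rfl
    · exact fun y ↦ (hj y).symm

/-- The second filtration splits if the Whitehead product vanishes. -/
theorem exists_isSplitting (D : CylData i ε r)
    (hW : IsWhitehead (PtdMap.id (Susp X)) (r.comp i) (PtdMap.zero _ _)) :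
    ∃ e, IsSplitting i ε r e := by
  obtain ⟨N, hN⟩ := hW.exists_commNull
  obtain ⟨K, hK⟩ := hN.exists_strictNull D.SX D.SA
  have hA := squareNull_homotopy D hK
  obtain ⟨φ, ν, φ1, φ2, φ3, φ4⟩ := exists_equiv_J2 D
  obtain ⟨e, he, e1, e2⟩ := exists_wedge_equiv D
  have hφ : φ.IsHomotopyEquiv := ⟨ν, PtdMap.Homotopic.of_eq φ3, φ4⟩
  have hq := isQuotientMap_squareSmash (X := X) (A := A)
  let p := Adj.push (squareCof D.SX D.SA) hA
  let f' : PtdMap (Adj P _ (squareSet X A) fun _ ↦ P.pt) (Smash (Susp X) (Susp A)) :=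
    Adj.desc (PtdMap.zero _ _) squareSmash hq.continuous fun y hy ↦ squareSmash_eq_pt hy
  have hp : (((pinchTo i r).comp φ).comp p).Homotopic f' := by
    refine Adj.desc_push hA _ (fun b ↦ ?_) f' (fun b ↦ rfl) fun y ↦ ?_
    · refine (congrArg (pinchTo i r) (φ1 b)).trans ?_
      exact Smash.mk_eq_pt (Or.inr rfl)
    · refine Eq.trans ?_ (congrArg (pinchTo i r) (φ2 y)).symm
      change Smash.mk (Susp.mk _ _) (Susp.mk _ _) = Smash.mk (r (ε (Susp.mk _ _))) (Susp.mk _ _)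
      rw [D.r_ε]
  refine ⟨φ.comp (p.comp e), hφ.comp ((Adj.isHomotopyEquiv_push hA).comp he),
    PtdMap.Homotopic.of_eq fun x ↦ ?_, ?_⟩
  · refine (congrArg (fun z ↦ φ (p z)) (e1 x)).trans ?_
    exact (congrArg φ (Adj.push_inl hA (ε x))).trans (φ1 (ε x))
  · refine (hp.comp_right e :).trans (PtdMap.Homotopic.of_eq fun w ↦ ?_)
    induction w using Quot.ind with | mk w => ?_
    rcases w with x | z
    · exact congrArg f' (e1 x)
    · obtain ⟨y, rfl⟩ := hq.surjective z
      exact congrArg f' (e2 y)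

theorem wedgeSusp_right_inverse (X B : PtdSpace.{u}) :
    ∃ v : PtdMap (Wedge (Susp X) (Smash (Susp X) B)) (Susp (Wedge X (Smash X B))),
      ∀ w, wedgeSusp X B (v w) = w := by
  let W := Wedge X (Smash X B)
  let g₀ : DProd (Susp X) B → Susp W := fun p ↦ Susp.lift (Y := Susp W)
    (fun t x ↦ Susp.mk t (Wedge.inr _ _ (Smash.mk x (dsnd p)))) (by fun_prop)
    (fun t x h ↦ Susp.mk_eq_pt <| by
      rcases h with h | h | h
      · exact Or.inl h
      · exact Or.inr (Or.inl h)
      · exact Or.inr (Or.inr (by rw [Smash.mk_eq_pt (Or.inl h), map_pt']))) (dfst p)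
  have hg₀ : Continuous g₀ := by
    refine continuous_dprod_left_of_isQuotientMap (Susp.isQuotientMap_mk (X := X)) ?_
    change Continuous fun p : DProd (I × X) B ↦
      (Susp.mk (dfst p).1 (Wedge.inr X (Smash X B) (Smash.mk (dfst p).2 (dsnd p))) : Susp W)
    fun_prop
  have hpt : ∀ p, OnAxes (Susp X) B p → g₀ p = (Susp W).pt := by
    intro p hp
    obtain ⟨s, b, rfl⟩ : ∃ s b, p = dpair s b := ⟨_, _, rfl⟩
    rcases hp with h | h
    · obtain rfl : s = (Susp X).pt := h
      exact Susp.mk_eq_pt (Or.inl rfl)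
    · obtain rfl : b = B.pt := h
      induction s using Quot.ind with | mk s => ?_
      exact Susp.mk_eq_pt (Or.inr (Or.inr
        ((congrArg (Wedge.inr _ _) (Smash.mk_eq_pt (Or.inr rfl))).trans (map_pt' _))))
  let g : PtdMap (Smash (Susp X) B) (Susp W) :=
    ⟨⟨Quot.lift g₀ fun p q h ↦ (hpt p h.1).trans (hpt q h.2).symm, continuous_quot_lift _ hg₀⟩,
      hpt (dpair (Susp X).pt B.pt) (Or.inl rfl)⟩
  refine ⟨Wedge.desc (Susp.map (Wedge.inl _ _)) g, fun w ↦ ?_⟩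
  induction w using Quot.ind with | mk w => ?_
  rcases w with s | z
  · induction s using Quot.ind with | mk s => ?_
    rfl
  · induction z using Quot.ind with | mk z => ?_
    obtain ⟨s, b, rfl⟩ : ∃ s b, z = dpair s b := ⟨_, _, rfl⟩
    induction s using Quot.ind with | mk s => ?_
    rfl

end Splitting

end RelJames

namespace RelJames

/-! ### The first component of the third order Whitehead product -/

/-- The homotopy extension property of an adjunction space. -/
theorem Adj.exists_extension {B T : PtdSpace.{u}} {Y : Type u} [TopologicalSpace Y]
    [DeltaGeneratedSpace Y] {L : Set Y} {a : Y → B} (S : CofStr Y L) (ha : ContinuousOn a L)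
    (f : PtdMap (Adj B Y L a) T) {g : PtdMap B T} (h : (f.comp (Adj.inl B Y L a)).Homotopic g) :
    ∃ f' : PtdMap (Adj B Y L a) T, (∀ b, f' (Adj.inl B Y L a b) = g b) ∧ f.Homotopic f' := by
  obtain ⟨F, hF, h0, h1, hp⟩ := h.exists
  have hG : ContinuousOn (fun p : ℝ × Y ↦ F (cI p.1) (a p.2)) (Set.univ ×ˢ L) :=
    hF.comp_continuousOn (f := fun p : ℝ × Y ↦ (cI p.1, a p.2))
      (ContinuousOn.prodMk (Continuous.continuousOn (by fun_prop))
        (ha.comp continuousOn_snd fun p hp ↦ hp.2))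
  have hG0 : ∀ y ∈ L, F (cI 0) (a y) = f (Adj.inr y) := by
    intro y hy
    rw [cI_zero, h0, Adj.inr_eq hy]
    rfl
  have hc : Continuous fun p : I × Y ↦
      S.ext (fun y ↦ f (Adj.inr y)) (fun t y ↦ F (cI t) (a y)) p.1 p.2 :=
    S.continuous_ext (by fun_prop) hG hG0 (by fun_prop) (by fun_prop) fun p ↦ p.1.2.2
  have hL : ∀ t : I, ∀ y ∈ L,
      S.ext (fun y ↦ f (Adj.inr y)) (fun t y ↦ F (cI t) (a y)) t y = F t (a y) := by
    intro t y hy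
    rw [S.ext_rel hy t.2.1, cI_coe]
  refine ⟨Adj.desc g (fun y ↦ S.ext (fun y ↦ f (Adj.inr y)) (fun t y ↦ F (cI t) (a y))
    ((1 : I) : ℝ) y) (hc.comp (f := fun y ↦ ((1 : I), y)) (by fun_prop)) fun y hy ↦ ?_,
    fun b ↦ rfl, Adj.homotopic F (fun t y ↦ S.ext (fun y ↦ f (Adj.inr y))
      (fun t y ↦ F (cI t) (a y)) t y) hF hc hL hp h0 (fun b ↦ h1 b) (fun y ↦ ?_) fun y ↦ rfl⟩
  · rw [hL _ y hy, h1]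
  · rw [Set.Icc.coe_zero, S.ext_zero hG0]

section Component

variable {X A P : PtdSpace.{u}} {i : PtdMap (Susp A) P} {ε : PtdMap (Susp X) P}
  {r : PtdMap P (Susp X)}

/-- A retraction of the second filtration up to homotopy is homotopic to a retraction. -/
theorem exists_strict_retraction (D : CylData i ε r) (ρ : PtdMap (J2 i) (Susp X))
    (h : ((ρ.comp (J2.incl i)).comp ε).Homotopic (PtdMap.id _)) :
    ∃ ρ' : PtdMap (J2 i) (Susp X), (∀ p, ρ' (J2.incl i p) = r p) ∧ ρ.Homotopic ρ' := by
  obtain ⟨φ, ν, φ1, -, φ3, φ4⟩ := exists_equiv_J2 D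
  have hr : (ε.comp r).Homotopic (PtdMap.id P) := PtdMap.Homotopic.symm <|
    PtdMap.homotopic_of D.H D.cont_H D.H_zero D.H_one fun t ↦ by
      rw [← map_pt' ε, D.H_ε]
  have h1 : ((ρ.comp φ).comp (Adj.inl _ _ _ _)).Homotopic r := by
    have e1 : ((ρ.comp φ).comp (Adj.inl _ _ _ _)).Homotopic (ρ.comp (J2.incl i)) :=
      PtdMap.Homotopic.of_eq fun p ↦ congrArg ρ (φ1 p)
    exact e1.trans ((hr.comp_left (ρ.comp (J2.incl i))).symm.trans (h.comp_right r) :)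
  obtain ⟨f', h2, h3⟩ := Adj.exists_extension (squareCof D.SX D.SA) (continuousOn_squareAtt D)
    (ρ.comp φ) h1
  refine ⟨f'.comp ν, fun p ↦ ?_, ?_⟩
  · change f' (ν (J2.incl i p)) = _
    rw [← φ1, φ3, h2]
  · exact ((φ4.comp_left ρ).symm.trans (h3.comp_right ν) :)

open Classical in
/-- The deformation of the composite of the attaching map with a retraction. -/
def faceFun (D : CylData i ε r) (ρ : PtdMap (J2 i) (Susp X)) (t : I) (p : JoinData X A A) : Susp X :=
  if p.s₃ = 1 then ρ (J2.mk i (ε (Susp.mk p.s₁ p.x)) (Susp.mk p.s₂ p.y))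
  else if p.s₂ = 1 then ρ (J2.mk i (ε (Susp.mk p.s₁ p.x)) (Susp.mk p.s₃ p.z))
  else ρ (J2.mk i (D.H t (i (Susp.mk p.s₂ p.y))) (Susp.mk p.s₃ p.z))

variable (D : CylData i ε r) {ρ : PtdMap (J2 i) (Susp X)}

theorem faceFun_of_s₃ (t : I) {p : JoinData X A A} (h : p.s₃ = 1) :
    faceFun D ρ t p = ρ (J2.mk i (ε (Susp.mk p.s₁ p.x)) (Susp.mk p.s₂ p.y)) := if_pos h

theorem faceFun_of_s₂ (t : I) {p : JoinData X A A} (h : p.s₂ = 1) :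
    faceFun D ρ t p = ρ (J2.mk i (ε (Susp.mk p.s₁ p.x)) (Susp.mk p.s₃ p.z)) := by
  unfold faceFun
  split_ifs with h'
  · rw [h, h', Susp.mk_one, Susp.mk_one]
  · rfl

theorem CylData.H_pt (t : I) : D.H t P.pt = P.pt := by rw [← map_pt' ε, D.H_ε]

theorem faceFun_of_s₁ (hρ : ∀ p, ρ (J2.mk i p (Susp A).pt) = r p) (t : I) {p : JoinData X A A}
    (h : p.s₁ = 1) :
    faceFun D ρ t p = ρ (J2.mk i (D.H t (i (Susp.mk p.s₂ p.y))) (Susp.mk p.s₃ p.z)) := by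
  by_cases h3 : p.s₃ = 1
  · rw [faceFun_of_s₃ D t h3, h, h3, Susp.mk_one, Susp.mk_one, map_pt', hρ, D.r_H, ← hρ, J2.swap]
  · by_cases h2 : p.s₂ = 1
    · rw [faceFun_of_s₂ D t h2, h, h2, Susp.mk_one, Susp.mk_one, map_pt', map_pt', D.H_pt]
    · unfold faceFun
      rw [if_neg h3, if_neg h2]

theorem continuous_faceFun (hρ : ∀ p, ρ (J2.mk i p (Susp A).pt) = r p) :
    Continuous fun q : I × JoinData X A A ↦ faceFun D ρ q.1 q.2 := by
  rw [← continuousOn_univ]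
  have hu : (Set.univ : Set (I × JoinData X A A)) =
      ({p | p.2.s₁ = 1} ∪ {p | p.2.s₂ = 1}) ∪ {p | p.2.s₃ = 1} := by
    ext p
    simp only [Set.mem_univ, Set.mem_union, Set.mem_ofPred_eq, true_iff, or_assoc]
    exact p.2.outer
  have c₁ : IsClosed {p : I × JoinData X A A | p.2.s₁ = 1} :=
    isClosed_eq (by fun_prop) continuous_const
  have c₂ : IsClosed {p : I × JoinData X A A | p.2.s₂ = 1} :=
    isClosed_eq (by fun_prop) continuous_const
  have c₃ : IsClosed {p : I × JoinData X A A | p.2.s₃ = 1} :=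
    isClosed_eq (by fun_prop) continuous_const
  rw [hu]
  refine ContinuousOn.union_of_isClosed
    (ContinuousOn.union_of_isClosed ?_ ?_ c₁ c₂) ?_ (c₁.union c₂) c₃
  · refine ContinuousOn.congr ?_ fun p hp ↦ faceFun_of_s₁ D hρ p.1 hp
    have hH : Continuous fun p : I × JoinData X A A ↦ D.H p.1 (i (Susp.mk p.2.s₂ p.2.y)) :=
      D.cont_H.comp (f := fun p : I × JoinData X A A ↦ (p.1, i (Susp.mk p.2.s₂ p.2.y)))
        (by fun_prop)
    exact Continuous.continuousOn (by fun_prop)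
  · exact ContinuousOn.congr (Continuous.continuousOn (by fun_prop))
      fun p hp ↦ faceFun_of_s₂ D p.1 hp
  · exact ContinuousOn.congr (Continuous.continuousOn (by fun_prop))
      fun p hp ↦ faceFun_of_s₃ D p.1 hp

/-- The double multiplication that is given by a retraction. -/
def doubleMul (i : PtdMap (Susp A) P) (ε : PtdMap (Susp X) P) (ρ : PtdMap (J2 i) (Susp X))
    (t : SSS X A A) : Susp X :=
  ρ (J2.mk i (ε (ρ (J2.mk i (ε (dfst (dfst t))) (dsnd (dfst t))))) (dsnd t))

theorem continuous_doubleMul : Continuous (doubleMul i ε ρ) := by unfold doubleMul; fun_prop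

/-- The composite of the attaching map with a retraction is null-homotopic. -/
theorem retraction_attachJoin (D : CylData i ε r) (hρ : ∀ p, ρ (J2.mk i p (Susp A).pt) = r p) :
    (ρ.comp (attachJoin i ε)).Homotopic (PtdMap.zero _ _) := by
  have hb : ∀ (s : I) {X : PtdSpace.{u}}, Susp.mk s X.pt = (Susp X).pt := fun s X ↦
    Susp.mk_eq_pt (Or.inr (Or.inr rfl))
  let F : I → Join₃ X A A → Susp X := fun t ↦ Quot.lift (faceFun D ρ t) <| by
    rintro p q ⟨h₁, h₂, h₃, hx, hy, hz⟩
    simp only [faceFun]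
    rw [← h₂, ← h₃, Susp.mk_congr h₁ hx, Susp.mk_congr rfl hy, Susp.mk_congr rfl hz]
  have hF : Continuous fun q : I × Join₃ X A A ↦ F q.1 q.2 :=
    continuous_I_prod_quot (continuous_faceFun D hρ)
  have hG : Continuous fun q : I × Join₃ X A A ↦ doubleMul i ε ρ (cubeMap q.1 q.2) :=
    continuous_doubleMul.comp continuous_cubeMap
  have hρ0 : ρ (J2.mk i P.pt (Susp A).pt) = (Susp X).pt := ρ.map_pt
  have hM0 : doubleMul i ε ρ (dpair (dpair (Susp X).pt (Susp A).pt) (Susp A).pt) = (Susp X).pt := by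
    unfold doubleMul
    simp only [dfst_dpair, dsnd_dpair, map_pt', hρ0]
  have hGpt : ∀ c, doubleMul i ε ρ (cubeMap c (Join₃ X A A).pt) = (Susp X).pt := by
    intro c
    refine Eq.trans (congrArg (doubleMul i ε ρ) ?_) hM0
    change cubeMap c (Join₃.mk ⟨(1, 1, 1), Or.inl rfl⟩ X.pt A.pt A.pt) = _
    rw [cubeMap_mk, hb, hb]
  have hFpt : ∀ t, F t (Join₃ X A A).pt = (Susp X).pt := by
    intro t
    refine (faceFun_of_s₃ D t rfl).trans ?_
    change ρ (J2.mk i (ε (Susp.mk 1 X.pt)) (Susp.mk 1 A.pt)) = _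
    rw [hb, hb, map_pt', hρ0]
  have key : ∀ j : Join₃ X A A, F 1 j = doubleMul i ε ρ (cubeMap 1 j) := by
    intro j
    obtain ⟨s, x, y, z, rfl⟩ := Join₃.exists_mk j
    change faceFun D ρ 1 (joinDatum s x y z) = _
    rw [cubeMap_mk, one_mul, one_mul, one_mul]
    unfold doubleMul
    simp only [dfst_dpair, dsnd_dpair]
    rcases s.2 with h | h | h
    · rw [faceFun_of_s₁ D hρ 1 (p := joinDatum s x y z) h, D.H_one, h, Susp.mk_one, map_pt',
        ← J2.swap, hρ]
      rfl
    · rw [faceFun_of_s₂ D 1 (p := joinDatum s x y z) h, h, Susp.mk_one, hρ, D.r_ε]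
      rfl
    · rw [faceFun_of_s₃ D 1 (p := joinDatum s x y z) h, h, Susp.mk_one, hρ, D.r_ε]
      rfl
  have h0 : ∀ j : Join₃ X A A, F 0 j = ρ (attachJoin i ε j) := by
    intro j
    induction j using Quot.ind with | mk p => ?_
    change faceFun D ρ 0 p = ρ (attachFun i ε p)
    rcases p.outer with h | h | h
    · rw [faceFun_of_s₁ D hρ 0 h, attachFun_of_s₁ i ε p h, D.H_zero]
    · rw [faceFun_of_s₂ D 0 h, attachFun_of_s₂ i ε p h]
    · rw [faceFun_of_s₃ D 0 h, attachFun_of_s₃ i ε p h]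
  let m : PtdMap (Join₃ X A A) (Susp X) :=
    ⟨⟨F 1, hF.comp (f := fun j ↦ ((1 : I), j)) (by fun_prop)⟩, hFpt 1⟩
  refine PtdMap.Homotopic.trans (g := m) (PtdMap.homotopic_of F hF h0 (fun _ ↦ rfl) hFpt) ?_
  refine PtdMap.Homotopic.symm (PtdMap.homotopic_of
    (fun c j ↦ doubleMul i ε ρ (cubeMap c j)) hG (fun j ↦ ?_) (fun j ↦ (key j).symm) hGpt)
  rw [cubeMap_zero, hM0]
  rfl

variable {e : PtdMap (Wedge (Susp X) (Smash (Susp X) (Susp A))) (J2 i)}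
  {γ : PtdMap (SS X A A) (J2 i)} {δ : PtdMap (SS X A A) (Susp (Wedge X (Smash X (Susp A))))}

include D

/-- The first component of the third order Whitehead product vanishes. -/
theorem IsSplitting.fst_homotopic_zero (he : IsSplitting i ε r e) (hγ : IsGamma₃ i ε γ)
    (hδ : ((e.comp (wedgeSusp X (Susp A))).comp δ).Homotopic γ) :
    (((Wedge.fst _ _).comp (wedgeSusp X (Susp A))).comp δ).Homotopic (PtdMap.zero _ _) := by
  obtain ⟨⟨k, hk, -⟩, he1, -⟩ := he
  have h1 : ((((Wedge.fst _ _).comp k).comp (J2.incl i)).comp ε).Homotopic (PtdMap.id _) := by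
    have a1 := he1.symm.comp_left ((Wedge.fst _ _).comp k)
    have a2 := hk.comp_left (Wedge.fst _ _) |>.comp_right (Wedge.inl _ _)
    exact (a1.trans a2 :).trans (PtdMap.Homotopic.of_eq fun x ↦ rfl)
  obtain ⟨ρ, hρ, hρ'⟩ := exists_strict_retraction D _ h1
  have h2 : (ρ.comp γ).Homotopic (PtdMap.zero _ _) :=
    ((hγ.homotopic_gammaStd D.triple).comp_left ρ).trans
      ((retraction_attachJoin D hρ).comp_right (joinSection D.triple) :)
  have h3 : (((Wedge.fst _ _).comp k).comp γ).Homotopic (PtdMap.zero _ _) :=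
    (hρ'.comp_right γ).trans h2
  have h4 := (hk.comp_left (Wedge.fst _ _)).comp_right ((wedgeSusp X (Susp A)).comp δ)
  exact (h4.symm.trans (hδ.comp_left ((Wedge.fst _ _).comp k)) :).trans h3

omit D in
theorem IsSplitting.exists_component (he : IsSplitting i ε r e) (γ : PtdMap (SS X A A) (J2 i)) :
    ∃ δ, ((e.comp (wedgeSusp X (Susp A))).comp δ).Homotopic γ := by
  obtain ⟨⟨k, -, hk⟩, -, -⟩ := he
  obtain ⟨v, hv⟩ := wedgeSusp_right_inverse X (Susp A)
  refine ⟨v.comp (k.comp γ), ?_⟩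
  exact PtdMap.Homotopic.trans (g := (e.comp k).comp γ)
    (PtdMap.Homotopic.of_eq fun x ↦ congrArg e (hv (k (γ x)))) (hk.comp_right γ :)

/-- The third filtration as the mapping cone of a map to the wedge. -/
theorem IsSplitting.exists_cone_equiv (he : IsSplitting i ε r e) (hγ : IsGamma₃ i ε γ)
    (hδ : ((e.comp (wedgeSusp X (Susp A))).comp δ).Homotopic γ) :
    ∃ h : PtdMap (MapCone ((wedgeSusp X (Susp A)).comp δ)) (J3 i), h.IsHomotopyEquiv ∧
      (h.comp (MapCone.incl ((wedgeSusp X (Susp A)).comp δ))).Homotopic ((J3.incl i).comp e) := by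
  have SV : CofStr (SS X A A) {(SS X A A).pt} := ((D.SX.smash D.SA).smash D.SA).susp.susp
  obtain ⟨h₁, a1, b1⟩ := MapCone.exists_equiv_of_comp SV ((wedgeSusp X (Susp A)).comp δ) he.1
  obtain ⟨h₂, a2, b2⟩ := MapCone.exists_equiv_of_homotopic SV
    (γ := e.comp ((wedgeSusp X (Susp A)).comp δ)) (γ' := γ) hδ
  obtain ⟨h₃, a3, b3⟩ := exists_cone_equiv_J3 D hγ
  refine ⟨h₃.comp (h₂.comp h₁), a3.comp (a2.comp a1), ?_⟩
  have c1 := b1.comp_left (h₃.comp h₂)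
  have c2 := (b2.comp_left h₃).comp_right e
  have c3 := b3.comp_right e
  exact (c1.trans (c2.trans c3 :) :)

end Component

end RelJames

namespace RelJames

/-! ### The James construction as a monoid -/

namespace James

variable {Z : PtdSpace.{u}}

theorem ext_letters {v w : James Z} (h : letters v = letters w) : v = w := Subtype.ext h

theorem ne_pt_of_mem_letters {w : James Z} {z : Z} (h : z ∈ letters w) : z ≠ Z.pt := w.2 z h

open Classical in
theorem letters_mk (l : List Z) : letters (mk l) = l.filter fun z ↦ z ≠ Z.pt := by
  simp only [letters, mk, reduceWord]

theorem mk_letters (w : James Z) : mk (letters w) = w := by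
  refine ext_letters ?_
  classical
  rw [letters_mk]
  exact List.filter_eq_self.2 fun z hz ↦ by simpa using ne_pt_of_mem_letters hz

instance : Monoid (James Z) where
  mul v w := mk (letters v ++ letters w)
  one := (James Z).pt
  mul_assoc u v w := by
    refine ext_letters ?_
    change letters (mk (letters (mk _) ++ _)) = letters (mk (_ ++ letters (mk _)))
    classical
    simp [letters_mk]
  one_mul w := mk_letters w
  mul_one w := (congrArg mk (List.append_nil _)).trans (mk_letters w)

theorem mk_append (l l' : List Z) : mk (l ++ l') = mk l * mk l' := by
  refine ext_letters ?_
  change _ = letters (mk (letters (mk l) ++ letters (mk l')))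
  classical
  simp [letters_mk]

/-- The word with one letter. -/
def letter (z : Z) : James Z := mk [z]

theorem mk_cons (z : Z) (l : List Z) : mk (z :: l) = letter z * mk l := mk_append [z] l

@[simp] theorem letter_pt : letter Z.pt = (1 : James Z) := by
  refine ext_letters ?_
  classical
  rw [letter, letters_mk]
  simp only [ne_eq, not_true_eq_false, decide_false, List.filter_cons_of_neg, Bool.false_eq_true,
    not_false_eq_true, List.filter_nil]
  rfl

theorem mk_pt_cons (l : List Z) : mk (Z.pt :: l) = mk l := by rw [mk_cons, letter_pt, one_mul]

variable (Z) in
/-- The space of all words, including those with letters that are equal to the base point. -/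
abbrev Words : Type u := WithGeneratedByTopology (fun n ↦ Fin n → ℝ) (Σ n : ℕ, (Fin n → Z))

variable (Z) in
theorem isQuotientMap_words : IsQuotientMap fun w : Words Z ↦
    mk (List.ofFn (WithGeneratedByTopology.equiv w).2) := by
  refine ⟨⟨rfl⟩, fun w ↦ ?_⟩
  refine ⟨WithGeneratedByTopology.equiv.symm ⟨_, (letters w).get⟩, ?_⟩
  change mk (List.ofFn (letters w).get) = w
  rw [List.ofFn_get, mk_letters]

theorem continuous_mk_ofFn {T : Type*} [TopologicalSpace T] [DeltaGeneratedSpace T] {n : ℕ}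
    {g : T → Fin n → Z} (hg : Continuous g) : Continuous fun t ↦ mk (List.ofFn (g t)) :=
  (isQuotientMap_words Z).continuous.comp
    (f := fun t ↦ WithGeneratedByTopology.equiv.symm ⟨n, g t⟩)
    ((IsGeneratedBy.equiv_symm_comp_continuous_iff (X := fun n ↦ Fin n → ℝ)
      (fun t ↦ (⟨n, g t⟩ : Σ n : ℕ, (Fin n → Z)))).2 (continuous_sigmaMk.comp hg))

theorem exists_lift_words {k : ℕ} {q : (Fin k → ℝ) → Words Z} (hq : Continuous q) :
    ∃ (n : ℕ) (g : (Fin k → ℝ) → Fin n → Z), Continuous g ∧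
      ∀ v, mk (List.ofFn (WithGeneratedByTopology.equiv (q v)).2) = mk (List.ofFn (g v)) := by
  obtain ⟨n, g, hg, h⟩ :=
    (WithGeneratedByTopology.continuous_equiv.comp hq).exists_lift_sigma
  refine ⟨n, g, hg, fun v ↦ ?_⟩
  have : WithGeneratedByTopology.equiv (q v) = ⟨n, g v⟩ := congrFun h v
  rw [this]

section Continuity

variable {S : Type*} [TopologicalSpace S] {Y : Type u} [TopologicalSpace Y]

theorem continuous_dprod_of_words {f : DProd Y (James Z) → S}
    (h : ∀ (k n : ℕ) (y : (Fin k → ℝ) → Y) (g : (Fin k → ℝ) → Fin n → Z), Continuous y →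
      Continuous g → Continuous fun v ↦ f (dpair (y v) (mk (List.ofFn (g v))))) :
    Continuous f := by
  refine continuous_dprod_right_of_isQuotientMap (isQuotientMap_words Z) ?_
  rw [continuous_dprod_iff]
  intro k y q hy hq
  obtain ⟨n, g, hg, hgq⟩ := exists_lift_words hq
  simpa only [dfst_dpair, dsnd_dpair, hgq] using h k n y g hy hg

theorem continuous_real_prod_of_words {f : ℝ × James Z → S}
    (h : ∀ (k n : ℕ) (t : (Fin k → ℝ) → ℝ) (g : (Fin k → ℝ) → Fin n → Z), Continuous t →
      Continuous g → Continuous fun v ↦ f (t v, mk (List.ofFn (g v)))) :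
    Continuous f := by
  refine (isQuotientMap_words Z).continuous_lift_prod_right ?_
  rw [IsGeneratedBy.continuous_iff (fun n ↦ Fin n → ℝ)]
  intro k q
  obtain ⟨n, g, hg, hgq⟩ := exists_lift_words (continuous_snd.comp q.continuous)
  have := h k n (fun v ↦ (q v).1) g (by fun_prop) hg
  refine this.congr fun v ↦ ?_
  exact congrArg f (Prod.ext rfl (hgq v).symm)

theorem continuous_of_words {f : James Z → S}
    (h : ∀ (k n : ℕ) (g : (Fin k → ℝ) → Fin n → Z),
      Continuous g → Continuous fun v ↦ f (mk (List.ofFn (g v)))) : Continuous f :=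
  (continuous_real_prod_of_words (f := fun p : ℝ × James Z ↦ f p.2)
    fun k n _ g _ hg ↦ h k n g hg).comp (f := fun w ↦ ((0 : ℝ), w)) (by fun_prop)

theorem continuous_dmul :
    Continuous fun p : DProd (James Z) (James Z) ↦ dfst p * dsnd p := by
  refine continuous_dprod_of_words fun k n y g hy hg ↦ ?_
  simp only [dfst_dpair, dsnd_dpair]
  have hfin : ∀ {m : ℕ} (x : Fin m → Z) (x' : Fin n → Z),
      mk (List.ofFn x) * mk (List.ofFn x') = mk (List.ofFn (Fin.append x x')) := fun x x' ↦ by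
    rw [← mk_append, List.ofFn_fin_append]
  have key : Continuous fun p : (Fin k → ℝ) × James Z ↦ p.2 * mk (List.ofFn (g p.1)) := by
    refine (isQuotientMap_words Z).continuous_lift_prod_right ?_
    rw [IsGeneratedBy.continuous_iff (fun n ↦ Fin n → ℝ)]
    intro j q
    obtain ⟨m, g', hg', hgq⟩ := exists_lift_words (continuous_snd.comp q.continuous)
    have hc : Continuous fun v ↦ mk (List.ofFn (Fin.append (g' v) (g (q v).1))) := by
      refine continuous_mk_ofFn (continuous_pi fun i ↦ ?_)
      refine Fin.addCases (fun j ↦ ?_) (fun j ↦ ?_) i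
      · simp only [Fin.append_left]; fun_prop
      · simp only [Fin.append_right]; fun_prop
    refine hc.congr fun v ↦ ?_
    rw [← hfin]
    exact congrArg (· * mk (List.ofFn (g (q v).1))) (hgq v).symm
  exact key.comp (f := fun v ↦ (v, y v)) (by fun_prop)

end Continuity

section Mul

variable {T : Type*} [TopologicalSpace T] [DeltaGeneratedSpace T] {f g : T → James Z}

@[fun_prop] theorem continuous_mul (hf : Continuous f) (hg : Continuous g) :
    Continuous fun t ↦ f t * g t :=
  continuous_dmul.comp (continuous_dpair' hf hg)

theorem continuousOn_mul {U : Set T} (hU : IsOpen U) (hf : ContinuousOn f U)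
    (hg : ContinuousOn g U) : ContinuousOn (fun t ↦ f t * g t) U :=
  continuous_dmul.comp_continuousOn (ContinuousOn.dpair hU hf hg)

theorem continuous_letter : Continuous (letter : Z → James Z) := by
  have := continuous_mk_ofFn (T := Z) (n := 1) (g := fun z _ ↦ z) (by fun_prop)
  exact this

@[fun_prop] theorem continuous_letter' {T : Type*} [TopologicalSpace T] {z : T → Z}
    (hz : Continuous z) : Continuous fun t ↦ letter (z t) := continuous_letter.comp hz

end Mul

/-- Words are connected to the empty word. -/
theorem pathConnectedSpace (h : ∀ z : Z, Joined Z.pt z) : PathConnectedSpace (James Z) := by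
  have key : ∀ l : List Z, Joined (1 : James Z) (mk l) := by
    intro l
    induction l with
    | nil => exact Joined.refl _
    | cons z l ih =>
      obtain ⟨p⟩ := h z
      obtain ⟨q⟩ := ih
      refine ⟨⟨⟨fun t ↦ letter (p t) * q t, by fun_prop⟩, ?_, ?_⟩⟩
      · simp
      · simp [mk_cons]
  exact ⟨⟨1⟩, fun v w ↦ by
    rw [← mk_letters v, ← mk_letters w]
    exact (key _).symm.trans (key _)⟩

end James

end RelJames

namespace RelJames

/-! ### Words as loops -/

variable {Z : PtdSpace.{u}}

theorem CofStr.isLength (S : CofStr Z {Z.pt}) : IsLength (⟨S.u, S.cont_u⟩ : C(Z, ℝ)) :=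
  ⟨S.u_nonneg, fun z ↦ (S.mem_iff z).symm⟩

variable {ℓ : C(Z, ℝ)}

theorem wordLoop_of_nonpos (hℓ : IsLength ℓ) (l : List Z) {s : ℝ} (hs : s ≤ 0) :
    wordLoop ℓ l s = (Susp Z).pt := by
  cases l with
  | nil => rfl
  | cons z l =>
    rw [wordLoop, if_pos (hs.trans (hℓ.1 z))]
    exact Susp.mk_eq_pt (Or.inl (Set.projIcc_of_le_left _ (div_nonpos_of_nonpos_of_nonneg hs (hℓ.1 z))))

theorem sum_length_nonneg (hℓ : IsLength ℓ) (l : List Z) : 0 ≤ (l.map ℓ).sum :=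
  List.sum_nonneg fun x hx ↦ by
    obtain ⟨z, -, rfl⟩ := List.mem_map.1 hx
    exact hℓ.1 z

theorem mk_projIcc_self (ℓ : C(Z, ℝ)) (z : Z) :
    Susp.mk (Set.projIcc 0 1 zero_le_one (ℓ z / ℓ z) : I) z = (Susp Z).pt := by
  rcases eq_or_ne (ℓ z) 0 with h | h
  · exact Susp.mk_eq_pt (Or.inl (Set.projIcc_of_le_left _ (by rw [h, div_zero])))
  · exact Susp.mk_eq_pt (Or.inr (Or.inl (Set.projIcc_of_right_le _ (by rw [div_self h]))))

theorem wordLoop_append_right (hℓ : IsLength ℓ) (l l' : List Z) {s : ℝ} (hs : 0 ≤ s) :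
    wordLoop ℓ (l ++ l') ((l.map ℓ).sum + s) = wordLoop ℓ l' s := by
  induction l with
  | nil => simp
  | cons z l ih =>
    have h0 := sum_length_nonneg hℓ l
    rw [List.cons_append, wordLoop, List.map_cons, List.sum_cons]
    split_ifs with h
    · have h1 : (l.map ℓ).sum = 0 := by linarith
      have h2 : s = 0 := by linarith
      rw [h1, h2, add_zero, add_zero, mk_projIcc_self, wordLoop_of_nonpos hℓ _ le_rfl]
    · rw [← ih]
      congr 1
      ring

theorem wordLoop_of_ge (hℓ : IsLength ℓ) (l : List Z) {s : ℝ} (hs : (l.map ℓ).sum ≤ s) :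
    wordLoop ℓ l s = (Susp Z).pt := by
  have := wordLoop_append_right hℓ l [] (sub_nonneg.2 hs)
  rwa [List.append_nil, add_sub_cancel] at this

theorem wordLoop_append_left (hℓ : IsLength ℓ) (l l' : List Z) {s : ℝ}
    (hs : s ≤ (l.map ℓ).sum) : wordLoop ℓ (l ++ l') s = wordLoop ℓ l s := by
  induction l generalizing s with
  | nil => exact wordLoop_of_nonpos hℓ _ (by simpa using hs)
  | cons z l ih =>
    rw [List.map_cons, List.sum_cons] at hs
    rw [List.cons_append, wordLoop, wordLoop, ih (by linarith)]

theorem wordLoop_pt_cons (hℓ : IsLength ℓ) (l : List Z) (s : ℝ) :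
    wordLoop ℓ (Z.pt :: l) s = wordLoop ℓ l s := by
  rw [wordLoop, (hℓ.2 _).2 rfl]
  split_ifs with h
  · rw [wordLoop_of_nonpos hℓ l h]
    exact Susp.mk_eq_pt (Or.inr (Or.inr rfl))
  · rw [sub_zero]

theorem wordLoop_letters_mk (hℓ : IsLength ℓ) (l : List Z) (s : ℝ) :
    wordLoop ℓ (James.letters (James.mk l)) s = wordLoop ℓ l s := by
  classical
  induction l generalizing s with
  | nil => rw [James.letters_mk, List.filter_nil]
  | cons z l ih =>
    rw [James.letters_mk] at ih ⊢
    rcases eq_or_ne z Z.pt with rfl | h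
    · rw [List.filter_cons_of_neg (by simp), ih, wordLoop_pt_cons hℓ]
    · rw [List.filter_cons_of_pos (by simpa using h), wordLoop, wordLoop, ih]

theorem sum_letters_mk (hℓ : IsLength ℓ) (l : List Z) :
    ((James.letters (James.mk l)).map ℓ).sum = (l.map ℓ).sum := by
  classical
  induction l with
  | nil => rw [James.letters_mk, List.filter_nil]
  | cons z l ih =>
    rw [James.letters_mk] at ih ⊢
    rcases eq_or_ne z Z.pt with rfl | h
    · rw [List.filter_cons_of_neg (by simp), ih, List.map_cons, List.sum_cons, (hℓ.2 _).2 rfl,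
        zero_add]
    · rw [List.filter_cons_of_pos (by simpa using h), List.map_cons, List.map_cons, List.sum_cons,
        List.sum_cons, ih]

/-- The loop of a letter, run through in time `ℓ z`. -/
theorem continuous_letterLoop (hℓ : IsLength ℓ) : Continuous fun p : ℝ × Z ↦
    (Susp.mk (Set.projIcc 0 1 zero_le_one (p.1 / ℓ p.2)) p.2 : Susp Z) := by
  rw [continuous_iff_continuousAt]
  rintro ⟨s, z⟩
  by_cases hz : ℓ z = 0
  · have hz' := (hℓ.2 z).1 hz
    subst hz'
    intro V hV
    dsimp only at hV
    rw [Susp.mk_eq_pt (Or.inr (Or.inr rfl))] at hV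
    obtain ⟨V', hV', hVo, hVm⟩ := mem_nhds_iff.1 hV
    have hc : Continuous fun p : I × Z ↦ Susp.mk p.1 p.2 := by fun_prop
    have hsub : (Set.univ : Set I) ×ˢ {Z.pt} ⊆ (fun p : I × Z ↦ Susp.mk p.1 p.2) ⁻¹' V' := by
      rintro ⟨t, z⟩ ⟨-, rfl⟩
      change Susp.mk t Z.pt ∈ V'
      rwa [Susp.mk_eq_pt (Or.inr (Or.inr rfl))]
    obtain ⟨A, B, -, hB, hA, hBm, hAB⟩ :=
      generalized_tube_lemma isCompact_univ isCompact_singleton (hVo.preimage hc) hsub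
    rw [Filter.mem_map]
    refine Filter.mem_of_superset ((hB.preimage continuous_snd).mem_nhds (x := (s, Z.pt))
      (hBm rfl)) ?_
    exact fun p hp ↦ hV' (hAB (Set.mk_mem_prod (hA trivial) hp))
  · have h1 : ContinuousAt (fun p : ℝ × Z ↦ p.1 / ℓ p.2) (s, z) :=
      ContinuousAt.div (by fun_prop) (by fun_prop) hz
    have h2 : Continuous fun p : ℝ × Z ↦ Susp.mk (cI p.1) p.2 := by fun_prop
    exact h2.continuousAt.comp (f := fun p : ℝ × Z ↦ (p.1 / ℓ p.2, p.2))
      (h1.prodMk continuousAt_snd)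

theorem continuous_wordLoop_ofFn (hℓ : IsLength ℓ) {T : Type*} [TopologicalSpace T] {n : ℕ}
    {t : T → ℝ} {g : T → Fin n → Z} (ht : Continuous t) (hg : Continuous g) :
    Continuous fun v ↦ wordLoop ℓ (List.ofFn (g v)) (t v) := by
  induction n generalizing t with
  | zero => simpa [wordLoop] using continuous_const
  | succ n ih =>
    simp only [List.ofFn_succ, wordLoop]
    refine Continuous.if_le ?_ (ih (t := fun v ↦ t v - ℓ (g v 0)) (by fun_prop)
      (g := fun v i ↦ g v i.succ) (by fun_prop)) ht (by fun_prop) fun v hv ↦ ?_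
    · exact (continuous_letterLoop hℓ).comp (f := fun v ↦ (t v, g v 0)) (by fun_prop)
    · rw [hv, mk_projIcc_self, sub_self, wordLoop_of_nonpos hℓ _ le_rfl]

theorem continuous_wordLoop (hℓ : IsLength ℓ) :
    Continuous fun p : ℝ × James Z ↦ wordLoop ℓ (James.letters p.2) p.1 := by
  refine James.continuous_real_prod_of_words fun k n t g ht hg ↦ ?_
  simp only [wordLoop_letters_mk hℓ]
  exact continuous_wordLoop_ofFn hℓ ht hg

/-- The length of a word. -/
def James.length (ℓ : C(Z, ℝ)) (w : James Z) : ℝ := ((James.letters w).map ℓ).sum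

theorem James.length_nonneg (hℓ : IsLength ℓ) (w : James Z) : 0 ≤ James.length ℓ w :=
  sum_length_nonneg hℓ _

theorem James.continuous_length (hℓ : IsLength ℓ) : Continuous (James.length ℓ) := by
  refine James.continuous_of_words fun k n g hg ↦ ?_
  simp only [James.length, sum_letters_mk hℓ, List.map_ofFn, List.sum_ofFn]
  exact continuous_finsetSum _ fun i _ ↦ ℓ.continuous.comp ((continuous_apply i).comp hg)

theorem James.length_mul (hℓ : IsLength ℓ) (v w : James Z) :
    James.length ℓ (v * w) = James.length ℓ v + James.length ℓ w :=
  (sum_letters_mk hℓ _).trans (by rw [List.map_append, List.sum_append]; rfl)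

theorem James.length_letter (hℓ : IsLength ℓ) (z : Z) : James.length ℓ (letter z) = ℓ z :=
  (sum_letters_mk hℓ _).trans (by simp)

theorem James.length_one : James.length ℓ (1 : James Z) = 0 := by
  change ((James.letters (James.mk [])).map ℓ).sum = 0
  classical
  rw [James.letters_mk]
  simp

theorem continuous_jamesOmega (hℓ : IsLength ℓ) {T : Type*} [TopologicalSpace T] {w : T → James Z}
    {t : T → I} (hw : Continuous w) (ht : Continuous t) :
    Continuous fun v ↦ jamesOmega ℓ (w v) (t v) := by
  have := (James.continuous_length hℓ).comp hw
  exact (continuous_wordLoop hℓ).comp (f := fun v ↦ ((t v : ℝ) * James.length ℓ (w v), w v))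
    (by fun_prop)

theorem jamesOmega_zero (hℓ : IsLength ℓ) (w : James Z) : jamesOmega ℓ w 0 = (Susp Z).pt :=
  wordLoop_of_nonpos hℓ _ (by simp)

theorem jamesOmega_one (hℓ : IsLength ℓ) (w : James Z) : jamesOmega ℓ w 1 = (Susp Z).pt :=
  wordLoop_of_ge hℓ _ (by simp)

/-! ### The second James-Hopf invariant -/

theorem mk_smashPairs_letters (l : List Z) :
    James.mk (smashPairs (James.letters (James.mk l))) = James.mk (smashPairs l) := by
  classical
  have hmap : ∀ (z : Z) (l : List Z),
      James.mk ((l.filter fun z ↦ z ≠ Z.pt).map fun z' ↦ Smash.mk z z') =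
        James.mk (l.map fun z' ↦ Smash.mk z z') := by
    intro z l
    induction l with
    | nil => rfl
    | cons z' l ih =>
      rcases eq_or_ne z' Z.pt with rfl | h
      · rw [List.filter_cons_of_neg (by simp), ih, List.map_cons,
          Smash.mk_eq_pt (Or.inr rfl), James.mk_pt_cons]
      · rw [List.filter_cons_of_pos (by simpa using h), List.map_cons, List.map_cons,
          James.mk_cons, ih, James.mk_cons]
  have hpt : ∀ l : List Z, James.mk (l.map fun z' ↦ Smash.mk Z.pt z') = 1 := by
    intro l
    induction l with
    | nil => rfl
    | cons z' l ih => rw [List.map_cons, Smash.mk_eq_pt (Or.inl rfl), James.mk_pt_cons, ih]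
  rw [James.letters_mk]
  induction l with
  | nil => rfl
  | cons z l ih =>
    rw [smashPairs, James.mk_append]
    rcases eq_or_ne z Z.pt with rfl | h
    · rw [List.filter_cons_of_neg (by simp), ih, hpt, one_mul]
    · rw [List.filter_cons_of_pos (by simpa using h), smashPairs, James.mk_append, ih, hmap]

theorem continuous_jamesHopf : Continuous (jamesHopf : James Z → James (Smash Z Z)) := by
  refine James.continuous_of_words fun k n g hg ↦ ?_
  simp only [jamesHopf, mk_smashPairs_letters]
  induction n with
  | zero => simpa [smashPairs] using continuous_const
  | succ n ih =>
    simp only [List.ofFn_succ, smashPairs, James.mk_append, List.map_ofFn]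
    have h0 : ∀ i, Continuous fun v ↦ g v i := fun i ↦ (continuous_apply i).comp hg
    refine James.continuous_mul (James.continuous_mk_ofFn (continuous_pi fun i ↦ ?_))
      (ih (fun v i ↦ g v i.succ) (by fun_prop))
    exact continuous_quot_mk.comp (continuous_dpair' (h0 0) (h0 _))

theorem exists_isJamesHopf {W : PtdSpace.{u}} (S : CofStr Z {Z.pt}) (hℓ : IsLength ℓ)
    {δ f₀ : PtdMap (Susp W) (Susp Z)} (g : PtdMap W (James Z))
    (hf : ∀ t w, f₀ (Susp.mk t w) = jamesOmega ℓ (g w) t) (h : f₀.Homotopic δ) :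
    ∃ H, IsJamesHopf δ H := by
  have hℓ' := (S.smash S).isLength
  have hg := g.cont
  let h₀ : PtdMap (Susp W) (Susp (Smash Z Z)) :=
    Susp.lift (fun t w ↦ jamesOmega ⟨(S.smash S).u, (S.smash S).cont_u⟩ (jamesHopf (g w)) t)
      (continuous_jamesOmega hℓ' (continuous_jamesHopf.comp (by fun_prop)) (by fun_prop)) <| by
        rintro t w (rfl | rfl | rfl)
        · exact jamesOmega_zero hℓ' _
        · exact jamesOmega_one hℓ' _
        · rw [map_pt']
          rfl
  exact ⟨h₀, ℓ, _, g, f₀, h₀, hℓ, hℓ', hf, h, fun _ _ ↦ rfl, PtdMap.Homotopic.refl _⟩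

/-! ### Paths that are given by a word and a part of a further letter -/

/-- The Moore path that consists of the loop of a word and of the part up to height `h` of the loop
of a letter, with its length. -/
def hook (ℓ : C(Z, ℝ)) (hℓ : IsLength ℓ) (m : James Z) (h : I) (z : Z) : C(ℝ, Susp Z) × ℝ :=
  (⟨fun s ↦ wordLoop ℓ (James.letters (m * James.letter z))
      (min s (James.length ℓ m + h * ℓ z)),
    (continuous_wordLoop hℓ).comp
      (f := fun s : ℝ ↦ (min s (James.length ℓ m + h * ℓ z), m * James.letter z)) (by fun_prop)⟩,
    James.length ℓ m + h * ℓ z)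

theorem wordLoop_letters_mul (hℓ : IsLength ℓ) (v w : James Z) (s : ℝ) :
    wordLoop ℓ (James.letters (v * w)) s = wordLoop ℓ (James.letters v ++ James.letters w) s :=
  wordLoop_letters_mk hℓ _ _

theorem wordLoop_min_length (hℓ : IsLength ℓ) (w : James Z) (s : ℝ) :
    wordLoop ℓ (James.letters w) (min s (James.length ℓ w)) = wordLoop ℓ (James.letters w) s := by
  rcases le_total s (James.length ℓ w) with h | h
  · rw [min_eq_left h]
  · rw [min_eq_right h, wordLoop_of_ge hℓ _ h]
    exact wordLoop_of_ge hℓ _ le_rfl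

section Hook

variable (hℓ : IsLength ℓ)

theorem hook_zero (m : James Z) (z : Z) (s : ℝ) :
    (hook ℓ hℓ m 0 z).1 s = wordLoop ℓ (James.letters m) s := by
  change wordLoop ℓ (James.letters (m * James.letter z)) (min s (James.length ℓ m + (0 : ℝ) * ℓ z))
    = _
  rw [zero_mul, add_zero, wordLoop_letters_mul hℓ]
  refine (wordLoop_append_left hℓ _ _ (min_le_right _ _)).trans ?_
  exact wordLoop_min_length hℓ m s

theorem hook_zero_eq (m : James Z) (z z' : Z) : hook ℓ hℓ m 0 z = hook ℓ hℓ m 0 z' := by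
  refine Prod.ext (ContinuousMap.ext fun s ↦ ?_) ?_
  · rw [hook_zero, hook_zero]
  · simp [hook]

theorem hook_one (m : James Z) (z z' : Z) :
    hook ℓ hℓ m 1 z = hook ℓ hℓ (m * James.letter z) 0 z' := by
  refine Prod.ext (ContinuousMap.ext fun s ↦ ?_) ?_
  · rw [hook_zero]
    change wordLoop ℓ (James.letters (m * James.letter z))
      (min s (James.length ℓ m + (1 : ℝ) * ℓ z)) = _
    have hL : James.length ℓ m + (1 : ℝ) * ℓ z = James.length ℓ (m * James.letter z) := by
      rw [James.length_mul hℓ, James.length_letter hℓ, one_mul]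
    rw [hL]
    exact wordLoop_min_length hℓ _ s
  · simp [hook, James.length_mul hℓ, James.length_letter hℓ]

theorem hook_length_nonneg (m : James Z) (h : I) (z : Z) : 0 ≤ (hook ℓ hℓ m h z).2 :=
  add_nonneg (James.length_nonneg hℓ m) (mul_nonneg h.2.1 (hℓ.1 z))

theorem hook_apply_zero (m : James Z) (h : I) (z : Z) :
    (hook ℓ hℓ m h z).1 0 = (Susp Z).pt :=
  wordLoop_of_nonpos hℓ _ (min_le_left _ _)

theorem hook_apply_length (m : James Z) (h : I) (z : Z) :
    (hook ℓ hℓ m h z).1 (hook ℓ hℓ m h z).2 = Susp.mk h z := by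
  change wordLoop ℓ (James.letters (m * James.letter z))
    (min (James.length ℓ m + h * ℓ z) (James.length ℓ m + h * ℓ z)) = _
  rw [min_self, wordLoop_letters_mul hℓ]
  refine (wordLoop_append_right hℓ _ _ (mul_nonneg h.2.1 (hℓ.1 z))).trans ?_
  refine (wordLoop_letters_mk hℓ _ _).trans ?_
  rw [wordLoop, if_pos (mul_le_of_le_one_left (hℓ.1 z) h.2.2)]
  rcases eq_or_ne (ℓ z) 0 with hz | hz
  · rw [(hℓ.2 z).1 hz]
    rw [Susp.mk_eq_pt (Or.inr (Or.inr rfl)), Susp.mk_eq_pt (Or.inr (Or.inr rfl))]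
  · rw [mul_div_cancel_right₀ _ hz, Set.projIcc_val]

theorem continuous_hook {T : Type*} [TopologicalSpace T] [DeltaGeneratedSpace T] {m : T → James Z}
    {h : T → I} {z : T → Z} (hm : Continuous m) (hh : Continuous h) (hz : Continuous z) :
    Continuous fun t ↦ hook ℓ hℓ (m t) (h t) (z t) := by
  have hL := (James.continuous_length hℓ).comp hm
  have hL' : Continuous fun t ↦ James.length ℓ (m t) + h t * ℓ (z t) := by
    exact hL.add (by fun_prop)
  have hc : Continuous fun t ↦ m t * James.letter (z t) := by fun_prop
  refine Continuous.prodMk (ContinuousMap.continuous_of_continuous_uncurry _ ?_) hL'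
  exact (continuous_wordLoop hℓ).comp (f := fun p : T × ℝ ↦
    (min p.2 (James.length ℓ (m p.1) + h p.1 * ℓ (z p.1)), m p.1 * James.letter (z p.1)))
    ((continuous_snd.min (hL'.comp continuous_fst)).prodMk (hc.comp continuous_fst))

theorem continuousOn_hook {T : Type*} [TopologicalSpace T] [DeltaGeneratedSpace T] {U : Set T}
    (hU : IsOpen U) {m : T → James Z} {h : T → I} {z : T → Z} (hm : ContinuousOn m U)
    (hh : ContinuousOn h U) (hz : ContinuousOn z U) :
    ContinuousOn (fun t ↦ hook ℓ hℓ (m t) (h t) (z t)) U :=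
  continuousOn_of_probes hU fun _ _ hp hpU ↦ continuous_hook hℓ (hm.comp_continuous hp hpU)
    (hh.comp_continuous hp hpU) (hz.comp_continuous hp hpU)

end Hook

end RelJames

namespace RelJames

/-! ### Inverses up to homotopy -/

variable {X A Y Z : PtdSpace.{u}}

/-- A pointed map to a James construction has a right inverse up to pointed homotopy, with respect
to the pointwise multiplication. -/
def HasRightInverse (f : PtdMap Z (James Y)) : Prop :=
  ∃ (r : PtdMap Z (James Y)) (H : I → Z → James Y), Continuous (fun p : I × Z ↦ H p.1 p.2) ∧
    (∀ z, H 0 z = 1) ∧ (∀ z, H 1 z = f z * r z) ∧ ∀ t, H t Z.pt = 1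

theorem PtdMap.map_pt_one (f : PtdMap Z (James Y)) : f Z.pt = 1 := f.map_pt

theorem hasRightInverse_wedge {f : PtdMap (Wedge X Z) (James Y)}
    (h₁ : HasRightInverse (f.comp (Wedge.inl X Z))) (h₂ : HasRightInverse (f.comp (Wedge.inr X Z))) :
    HasRightInverse f := by
  obtain ⟨r, H, hH, H0, H1, Hp⟩ := h₁
  obtain ⟨r', H', hH', H0', H1', Hp'⟩ := h₂
  refine ⟨Wedge.desc r r', fun t ↦ Quot.lift (Sum.elim (H t) (H' t)) ?_, ?_, ?_, ?_, Hp⟩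
  · rintro _ _ ⟨rfl, rfl⟩
    exact (Hp t).trans (Hp' t).symm
  · exact continuous_I_prod_quot (continuous_I_prod_sum hH hH')
  · intro z
    induction z using Quot.ind with | mk z => ?_
    rcases z with x | z
    · exact H0 x
    · exact H0' z
  · intro z
    induction z using Quot.ind with | mk z => ?_
    rcases z with x | z
    · exact H1 x
    · exact H1' z

/-- The self-map of a suspension that is given by a map of the interval. -/
def Susp.reparam (A : PtdSpace.{u}) (φ : I → I) (hφ : Continuous φ) (h0 : φ 0 = 0 ∨ φ 0 = 1)
    (h1 : φ 1 = 0 ∨ φ 1 = 1) : PtdMap (Susp A) (Susp A) :=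
  Susp.lift (fun t a ↦ Susp.mk (φ t) a) (by fun_prop) <| by
    rintro t a (rfl | rfl | rfl)
    · exact Susp.mk_eq_pt (h0.elim Or.inl fun h ↦ Or.inr (Or.inl h))
    · exact Susp.mk_eq_pt (h1.elim Or.inl fun h ↦ Or.inr (Or.inl h))
    · exact Susp.mk_eq_pt (Or.inr (Or.inr rfl))

theorem continuous_smash_reparam {φ : I → I → I} (hφ : ∀ t, Continuous (φ t))
    (hc : Continuous fun p : I × I ↦ φ p.1 p.2) (h0 : ∀ t, φ t 0 = 0 ∨ φ t 0 = 1)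
    (h1 : ∀ t, φ t 1 = 0 ∨ φ t 1 = 1) : Continuous fun p : I × Smash X (Susp A) ↦
      Smash.map (PtdMap.id X) (Susp.reparam A (φ p.1) (hφ p.1) (h0 p.1) (h1 p.1)) p.2 := by
  have h2 : Continuous fun p : I × Susp A ↦
      Susp.reparam A (φ p.1) (hφ p.1) (h0 p.1) (h1 p.1) p.2 := by
    refine continuous_I_prod_quot ?_
    change Continuous fun p : I × (I × A) ↦ (Susp.mk (φ p.1 p.2.1) p.2.2 : Susp A)
    have := hc.comp (f := fun p : I × (I × A) ↦ (p.1, p.2.1)) (by fun_prop)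
    exact Susp.continuous_mk this (by fun_prop)
  refine continuous_I_prod_quot ?_
  exact continuous_quot_mk.comp (continuous_dpair'
    (f := fun p : I × DProd X (Susp A) ↦ dfst p.2) (by fun_prop)
    (h2.comp (f := fun p : I × DProd X (Susp A) ↦ (p.1, dsnd p.2)) (by fun_prop)))

theorem smash_mk_cases (z : Smash X (Susp A)) : ∃ x s a, z = Smash.mk x (Susp.mk s a) := by
  induction z using Quot.ind with | mk z => ?_
  obtain ⟨b, hb⟩ : ∃ b, b = dsnd z := ⟨_, rfl⟩
  induction b using Quot.ind with | mk q => ?_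
  exact ⟨dfst z, q.1, q.2, congrArg (Quot.mk _) (congrArg (dpair (dfst z)) hb.symm)⟩

theorem hasRightInverse_smash_susp (f : PtdMap (Smash X (Susp A)) (James Y)) :
    HasRightInverse f := by
  let τ : I → I → I := fun u s ↦ cI (2 * u * (1 - |2 * (s : ℝ) - 1|))
  let α : I → I → I := fun u s ↦ cI ((3 - 2 * u) * s)
  let β : I → I → I := fun u s ↦ cI ((3 - 2 * u) * (1 - s))
  have hτ : Continuous fun p : I × I ↦ τ p.1 p.2 := by fun_prop
  have hα : Continuous fun p : I × I ↦ α p.1 p.2 := by fun_prop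
  have hβ : Continuous fun p : I × I ↦ β p.1 p.2 := by fun_prop
  have hle : ∀ u : I, (1 : ℝ) ≤ 3 - 2 * u := fun u ↦ by have := u.2.2; linarith
  have τ0 : ∀ u, τ u 0 = 0 ∨ τ u 0 = 1 := fun u ↦ Or.inl (by simp [τ])
  have τ1 : ∀ u, τ u 1 = 0 ∨ τ u 1 = 1 := fun u ↦ Or.inl (by norm_num [τ])
  have α0 : ∀ u, α u 0 = 0 ∨ α u 0 = 1 := fun u ↦ Or.inl (by simp [α])
  have α1 : ∀ u, α u 1 = 0 ∨ α u 1 = 1 := fun u ↦ Or.inr (cI_of_ge (by simpa using hle u))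
  have β0 : ∀ u, β u 0 = 0 ∨ β u 0 = 1 := fun u ↦ Or.inr (cI_of_ge (by simpa using hle u))
  have β1 : ∀ u, β u 1 = 0 ∨ β u 1 = 1 := fun u ↦ Or.inl (by simp [β])
  have hτ' : ∀ u, Continuous (τ u) := fun u ↦ by fun_prop
  have hα' : ∀ u, Continuous (α u) := fun u ↦ by fun_prop
  have hβ' : ∀ u, Continuous (β u) := fun u ↦ by fun_prop
  let G : ∀ (φ : I → I → I) (_ : ∀ u, Continuous (φ u)) (_ : ∀ u, φ u 0 = 0 ∨ φ u 0 = 1)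
    (_ : ∀ u, φ u 1 = 0 ∨ φ u 1 = 1), I → PtdMap (Smash X (Susp A)) (James Y) :=
    fun φ h h0 h1 u ↦ f.comp (Smash.map (PtdMap.id X) (Susp.reparam A (φ u) (h u) (h0 u) (h1 u)))
  have hG : ∀ φ h h0 h1, Continuous (fun p : I × I ↦ φ p.1 p.2) →
      Continuous fun p : I × Smash X (Susp A) ↦ G φ h h0 h1 p.1 p.2 := fun φ h h0 h1 hc ↦
    f.cont.comp (continuous_smash_reparam h hc h0 h1)
  have hGv : ∀ φ h h0 h1 u x s a, G φ h h0 h1 u (Smash.mk x (Susp.mk s a)) =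
      f (Smash.mk x (Susp.mk (φ u s) a)) := fun _ _ _ _ _ _ _ _ ↦ rfl
  have hf0 : ∀ x a, f (Smash.mk x (Susp.mk 0 a)) = 1 := fun x a ↦ by
    rw [Susp.mk_zero, Smash.mk_eq_pt (Or.inr rfl), f.map_pt_one]
  have hf1 : ∀ x a, f (Smash.mk x (Susp.mk 1 a)) = 1 := fun x a ↦ by
    rw [Susp.mk_one, Smash.mk_eq_pt (Or.inr rfl), f.map_pt_one]
  refine ⟨G β hβ' β0 β1 1, fun u z ↦ if (u : ℝ) ≤ 1 / 2 then G τ hτ' τ0 τ1 u z else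
    G α hα' α0 α1 u z * G β hβ' β0 β1 u z, ?_, ?_, ?_, ?_⟩
  · refine Continuous.if_le (hG _ _ _ _ hτ)
      (James.continuous_mul (hG _ _ _ _ hα) (hG _ _ _ _ hβ)) (by fun_prop) (by fun_prop) ?_
    rintro ⟨u, z⟩ hu
    change (u : ℝ) = 1 / 2 at hu
    obtain ⟨x, s, a, rfl⟩ := smash_mk_cases z
    simp only [hGv, τ, α, β, hu]
    rcases le_total (s : ℝ) (1 / 2) with h | h
    · rw [cI_of_ge (t := (3 - 2 * (1 / 2)) * (1 - (s : ℝ))) (by linarith), hf1, mul_one,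
        abs_of_nonpos (by linarith)]
      congr 4
      ring
    · rw [cI_of_ge (t := (3 - 2 * (1 / 2)) * (s : ℝ)) (by linarith), hf1, one_mul,
        abs_of_nonneg (by linarith)]
      congr 4
      ring
  · intro z
    obtain ⟨x, s, a, rfl⟩ := smash_mk_cases z
    refine (if_pos (by norm_num)).trans ((hGv _ _ _ _ _ _ _ _).trans ?_)
    simp [τ, hf0]
  · intro z
    obtain ⟨x, s, a, rfl⟩ := smash_mk_cases z
    refine (if_neg (by norm_num)).trans (congrArg (· * _) ((hGv _ _ _ _ _ _ _ _).trans ?_))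
    congr 3
    norm_num [α]
  · intro u
    beta_reduce
    split_ifs
    · exact map_pt' _
    · rw [PtdMap.map_pt_one, PtdMap.map_pt_one, one_mul]

section Cells

theorem deltaGenerated_ball (n : ℕ) : DeltaGeneratedSpace (Ball n) := by
  have hq : IsQuotientMap (fun v : Fin n → ℝ ↦ (⟨(max ‖v‖ 1)⁻¹ • v, by
      rw [mem_closedBall_zero_iff, norm_smul, norm_inv,
        Real.norm_of_nonneg (le_max_of_le_right zero_le_one), inv_mul_le_iff₀ (by positivity),
        mul_one]
      exact le_max_left _ _⟩ : Ball n)) := by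
    refine IsQuotientMap.of_inverse (f := Subtype.val) continuous_subtype_val ?_ fun y ↦ ?_
    · have h : Continuous fun v : Fin n → ℝ ↦ (max ‖v‖ 1)⁻¹ :=
        Continuous.inv₀ (by fun_prop) fun v ↦ by positivity
      exact (h.smul continuous_id).subtype_mk _
    · have := max_eq_right (Ball.norm_le y)
      exact Subtype.ext (by simp [this])
  exact hq.isGeneratedBy

/-- Products of continuous functions on the boundary of a ball. -/
theorem James.continuousOn_mul_sphere {n : ℕ} {f g : ℝ × Ball n → James Y}
    (hf : ContinuousOn f (Set.univ ×ˢ {y | ‖y.1‖ = 1}))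
    (hg : ContinuousOn g (Set.univ ×ˢ {y | ‖y.1‖ = 1})) :
    ContinuousOn (fun p ↦ f p * g p) (Set.univ ×ˢ {y | ‖y.1‖ = 1}) := by
  let ρ : (Fin n → ℝ) → Ball n := fun v ↦ ⟨(max ‖v‖ 1)⁻¹ • (max 1 ‖v‖⁻¹ • v), by
    rw [mem_closedBall_zero_iff, norm_smul, norm_smul, norm_inv,
      Real.norm_of_nonneg (le_max_of_le_right zero_le_one),
      Real.norm_of_nonneg (le_max_of_le_left zero_le_one), inv_mul_le_iff₀ (by positivity), mul_one]
    rcases eq_or_lt_of_le (norm_nonneg v) with h | h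
    · rw [← h, mul_zero]; exact zero_le_one.trans (le_max_right _ _)
    · rw [max_mul_of_nonneg _ _ h.le, inv_mul_cancel₀ h.ne', one_mul]⟩
  have hU : IsOpen {p : ℝ × (Fin n → ℝ) | p.2 ≠ 0} := isOpen_ne.preimage continuous_snd
  have hρ : ContinuousOn (fun p : ℝ × (Fin n → ℝ) ↦ (p.1, ρ p.2)) {p | p.2 ≠ 0} := by
    have hi : ContinuousOn (fun p : ℝ × (Fin n → ℝ) ↦ ‖p.2‖⁻¹) {p | p.2 ≠ 0} :=
      ContinuousOn.inv₀ (Continuous.continuousOn (by fun_prop)) fun p hp ↦ norm_ne_zero_iff.2 hp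
    refine continuousOn_fst.prodMk (Topology.IsInducing.subtypeVal.continuousOn_iff.2 ?_)
    have hj : Continuous fun p : ℝ × (Fin n → ℝ) ↦ (max ‖p.2‖ 1)⁻¹ :=
      Continuous.inv₀ (by fun_prop) fun p ↦ by positivity
    refine hj.continuousOn.smul ?_
    exact (continuousOn_const.sup hi).smul continuousOn_snd
  have hm : Set.MapsTo (fun p : ℝ × (Fin n → ℝ) ↦ (p.1, ρ p.2)) {p | p.2 ≠ 0}
      (Set.univ ×ˢ {y | ‖y.1‖ = 1}) := by
    intro p hp
    refine ⟨trivial, ?_⟩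
    have h : 0 < ‖p.2‖ := norm_pos_iff.2 hp
    change ‖(max ‖p.2‖ 1)⁻¹ • (max 1 ‖p.2‖⁻¹ • p.2)‖ = 1
    rw [norm_smul, norm_smul, norm_inv,
      Real.norm_of_nonneg (le_max_of_le_right zero_le_one),
      Real.norm_of_nonneg (le_max_of_le_left zero_le_one), max_mul_of_nonneg _ _ h.le,
      inv_mul_cancel₀ h.ne', one_mul, inv_mul_cancel₀ (by positivity)]
  have hc := James.continuousOn_mul hU (hf.comp hρ hm) (hg.comp hρ hm)
  have hn : ∀ y : Ball n, ‖y.1‖ = 1 → ρ y.1 = y := fun y hy ↦ Subtype.ext (by simp [ρ, hy])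
  refine ContinuousOn.congr (hc.comp (f := fun p : ℝ × Ball n ↦ (p.1, p.2.1))
    (Continuous.continuousOn (by fun_prop)) fun p hp ↦ ?_) fun p hp ↦ ?_
  · have h2 : ‖p.2.1‖ = 1 := hp.2
    exact norm_ne_zero_iff.1 (by rw [h2]; norm_num)
  · simp only [Function.comp_apply, hn p.2 hp.2]

theorem hasRightInverse_cw (hX : X.IsCW) [PathConnectedSpace (James Y)]
    (f : PtdMap X (James Y)) : HasRightInverse f := by
  obtain ⟨_, _, v, hv⟩ := hX
  rw [RelCWComplex.closedCell_zero_eq_singleton] at hv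
  have hv' : X.pt = RelCWComplex.map 0 v ![] := hv
  let E := {e : X × James Y × C(I, James Y) // e.2.2 0 = 1 ∧ e.2.2 1 = f e.1 * e.2.1}
  have hE : ∀ e : E, e.1.2.2 0 = 1 ∧ e.1.2.2 1 = f e.1.1 * e.1.2.1 := fun e ↦ e.2
  let p : E → X := fun e ↦ e.1.1
  have hp : ExtendsOverCells p := by
    refine extendsOverCells_of fun n χ hχ s hs hps ↦ ?_
    have : ContractibleSpace (Ball n) :=
      (convex_closedBall (0 : Fin n → ℝ) 1).contractibleSpace ⟨0, by simp⟩
    obtain ⟨F⟩ : (ContinuousMap.const (Ball n) (1 : James Y)).Homotopic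
        ⟨fun y ↦ f (χ y), by fun_prop⟩ := by
      obtain ⟨m, hm⟩ := (id_nullhomotopic (Ball n)).comp_right
        (⟨fun y ↦ f (χ y), by fun_prop⟩ : C(Ball n, James Y))
      obtain ⟨γ⟩ := PathConnectedSpace.joined (1 : James Y) m
      refine ContinuousMap.Homotopic.trans ⟨⟨⟨fun q ↦ γ q.1, by fun_prop⟩, ?_, ?_⟩⟩ hm.symm
      · intro y; simp
      · intro y; simp
    let φ : ℝ → Ball n → James Y := fun t y ↦ F (cI t, y)
    have hφ : Continuous fun q : ℝ × Ball n ↦ φ q.1 q.2 := by fun_prop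
    have φ0 : ∀ {t} y, t ≤ 0 → φ t y = 1 := fun y ht ↦ by
      simp only [φ, cI_of_le ht]; exact F.apply_zero y
    have φ1 : ∀ {t} y, 1 ≤ t → φ t y = f (χ y) := fun y ht ↦ by
      simp only [φ, cI_of_ge ht]; exact F.apply_one y
    let α : ℝ → Ball n → James Y := fun x y ↦
      if x ≤ 1 then (s y).1.2.2 (cI x) else φ (2 - x) y * (s y).1.2.1
    have hs' : ContinuousOn (fun q : ℝ × Ball n ↦ (s q.2).1.2) (Set.univ ×ˢ {y | ‖y.1‖ = 1}) :=
      (continuous_snd.comp continuous_subtype_val).comp_continuousOn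
        (hs.comp continuousOn_snd fun q hq ↦ hq.2)
    have hα : ContinuousOn (fun q : ℝ × Ball n ↦ α q.1 q.2) (Set.univ ×ˢ {y | ‖y.1‖ = 1}) := by
      have h1 : ContinuousOn (fun q : ℝ × Ball n ↦ (s q.2).1.2.2 (cI q.1))
          (Set.univ ×ˢ {y | ‖y.1‖ = 1}) :=
        ContinuousEval.continuous_eval.comp_continuousOn
          ((continuous_snd.comp_continuousOn hs').prodMk (Continuous.continuousOn (by fun_prop)))
      have h2 : ContinuousOn (fun q : ℝ × Ball n ↦ φ (2 - q.1) q.2 * (s q.2).1.2.1)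
          (Set.univ ×ˢ {y | ‖y.1‖ = 1}) :=
        James.continuousOn_mul_sphere (Continuous.continuousOn
          (hφ.comp (f := fun q : ℝ × Ball n ↦ (2 - q.1, q.2)) (by fun_prop)))
          (continuous_fst.comp_continuousOn hs')
      rw [continuousOn_iff_continuous_domRestrict] at h1 h2 ⊢
      refine Continuous.if_le h1 h2 (by fun_prop) continuous_const ?_
      rintro ⟨⟨x, y⟩, -, hy⟩ (hx : x = 1)
      subst hx
      change (s y).1.2.2 (cI 1) = φ (2 - 1) y * (s y).1.2.1
      rw [cI_one, (s y).2.2, φ1 y (by norm_num), ← hps y hy]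
    have α0 : ∀ {x} y, x ≤ 0 → α x y = 1 := fun y hx ↦ by
      simp only [α, if_pos (hx.trans zero_le_one), cI_of_le hx, (s y).2.1]
    let S := CofStr.ball n
    let R : ℝ → Ball n → James Y := S.ext (fun _ ↦ 1) (fun t y ↦ α (2 * t) y)
    have hR0 : ∀ y ∈ {y : Ball n | ‖y.1‖ = 1}, α (2 * 0) y = 1 := fun y _ ↦ α0 y (by norm_num)
    have hG : ContinuousOn (fun q : ℝ × Ball n ↦ α (2 * q.1) q.2)
        (Set.univ ×ˢ {y | ‖y.1‖ = 1}) :=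
      hα.comp (f := fun q : ℝ × Ball n ↦ (2 * q.1, q.2)) (Continuous.continuousOn (by fun_prop))
        fun q hq ↦ ⟨trivial, hq.2⟩
    have hR : Continuous fun q : ℝ × Ball n ↦ R (min 1 q.1) q.2 :=
      S.continuous_ext continuous_const hG hR0 (by fun_prop) (by fun_prop)
        fun q ↦ min_le_left _ _
    have R0 : ∀ y, R 0 y = 1 := fun y ↦ S.ext_zero hR0 y
    have RL : ∀ {t} y, ‖y.1‖ = 1 → 0 ≤ t → R t y = α (2 * t) y := fun y hy ht ↦
      S.ext_rel (L := {y : Ball n | ‖y.1‖ = 1}) hy ht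
    have R1 : ∀ y, ‖y.1‖ = 1 → R 1 y = (s y).1.2.1 := fun y hy ↦ by
      rw [RL y hy zero_le_one]
      simp only [α]
      rw [if_neg (by norm_num), φ0 y (by norm_num), one_mul]
    let η : I × Ball n → James Y := fun q ↦
      if (q.1 : ℝ) ≤ 1 / 2 then R (min 1 (2 * q.1)) q.2 else φ (2 * q.1 - 1) q.2 * R (min 1 1) q.2
    have hη : Continuous η := by
      have c1 : Continuous fun q : I × Ball n ↦ R (min 1 1) q.2 :=
        hR.comp (f := fun q : I × Ball n ↦ ((1 : ℝ), q.2)) (by fun_prop)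
      have c2 : Continuous fun q : I × Ball n ↦ φ (2 * q.1 - 1) q.2 :=
        hφ.comp (f := fun q : I × Ball n ↦ (2 * (q.1 : ℝ) - 1, q.2)) (by fun_prop)
      have c3 : Continuous fun q : I × Ball n ↦ R (min 1 (2 * q.1)) q.2 :=
        hR.comp (f := fun q : I × Ball n ↦ (2 * (q.1 : ℝ), q.2)) (by fun_prop)
      have : DeltaGeneratedSpace (Ball n) := deltaGenerated_ball n
      refine Continuous.if_le c3 (James.continuous_mul c2 c1) (by fun_prop) (by fun_prop) ?_
      rintro ⟨t, y⟩ (ht : (t : ℝ) = 1 / 2)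
      simp only [ht]
      rw [φ0 y (by norm_num), one_mul]
      norm_num
    have η0 : ∀ y, η (0, y) = 1 := fun y ↦ by
      simp only [η, Set.Icc.coe_zero]
      rw [if_pos (by norm_num), mul_zero, min_eq_right zero_le_one, R0]
    have η1 : ∀ y, η (1, y) = f (χ y) * R 1 y := fun y ↦ by
      simp only [η, Set.Icc.coe_one]
      rw [if_neg (by norm_num), φ1 y (by norm_num), min_self]
    have ηL : ∀ (t : I) y, ‖y.1‖ = 1 → η (t, y) = α (min (4 * t) (3 - 2 * t)) y := by
      intro t y hy
      have ht := t.2.1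
      have ht' := t.2.2
      simp only [η]
      split_ifs with h
      · rw [min_eq_right (by linarith : 2 * (t : ℝ) ≤ 1), RL y hy (by linarith),
          min_eq_left (by linarith)]
        congr 1
        ring
      · rw [min_self, R1 y hy, min_eq_right (by linarith)]
        rcases eq_or_lt_of_le ht' with h1 | h1
        · simp only [α, h1]
          rw [if_pos (by norm_num), φ1 y (by norm_num), cI_of_ge (by norm_num), (s y).2.2,
            ← hps y hy]
        · simp only [α]
          rw [if_neg (by linarith)]
          congr 2
          ring
    let S₂ := CofStr.prodI CofStr.ends S
    let κ : ℝ → I → ℝ := fun x t ↦ (1 - x) * min (4 * (t : ℝ)) (3 - 2 * (t : ℝ)) + x * t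
    let G₂ : ℝ → I × Ball n → James Y := fun x q ↦
      if ‖q.2.1‖ = 1 then α (κ x q.1) q.2 else η q
    have κ0 : ∀ x, κ x 0 = 0 := fun x ↦ by simp [κ]
    have κ1 : ∀ x, κ x 1 = 1 := fun x ↦ by norm_num [κ]
    have G₂L : ∀ x (q : I × Ball n), ‖q.2.1‖ = 1 → G₂ x q = α (κ x q.1) q.2 :=
      fun x q hq ↦ if_pos hq
    have G₂e : ∀ x (q : I × Ball n), (q.1 = 0 ∨ q.1 = 1) → G₂ x q = η q := by
      rintro x ⟨t, y⟩ h
      simp only [G₂]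
      split_ifs with hy
      · rw [ηL t y hy]
        rcases h with rfl | rfl
        · rw [κ0]; norm_num
        · rw [κ1]; norm_num
      · rfl
    have hG₂ : ContinuousOn (fun q : ℝ × (I × Ball n) ↦ G₂ q.1 q.2)
        (Set.univ ×ˢ {q | (q.1 = 0 ∨ q.1 = 1) ∨ ‖q.2.1‖ = 1}) := by
      have hu : (Set.univ ×ˢ {q | (q.1 = 0 ∨ q.1 = 1) ∨ ‖q.2.1‖ = 1} : Set (ℝ × (I × Ball n))) =
          {q | q.2.1 = 0 ∨ q.2.1 = 1} ∪ {q | ‖q.2.2.1‖ = 1} := by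
        ext q; simp
      rw [hu]
      refine ContinuousOn.union_of_isClosed ?_ ?_ ?_ ?_
      · exact ContinuousOn.congr (f := fun q ↦ η q.2) (Continuous.continuousOn (by fun_prop))
          fun q hq ↦ G₂e _ _ hq
      · refine ContinuousOn.congr (f := fun q ↦ α (κ q.1 q.2.1) q.2.2) ?_
          fun q hq ↦ G₂L _ _ hq
        exact hα.comp (f := fun q : ℝ × (I × Ball n) ↦ (κ q.1 q.2.1, q.2.2))
          (Continuous.continuousOn (by fun_prop)) fun q hq ↦ ⟨trivial, hq⟩
      · exact (isClosed_eq (f := fun q : ℝ × (I × Ball n) ↦ q.2.1) (by fun_prop)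
          continuous_const).union (isClosed_eq (by fun_prop) continuous_const)
      · exact isClosed_eq (by fun_prop) continuous_const
    have hG₂0 : ∀ q ∈ {q : I × Ball n | (q.1 = 0 ∨ q.1 = 1) ∨ ‖q.2.1‖ = 1}, G₂ 0 q = η q := by
      rintro q (hq | hq)
      · exact G₂e 0 q hq
      · rw [G₂L 0 q hq, ηL q.1 q.2 hq]
        simp [κ]
    have hc : Continuous fun q : Ball n × I ↦ S₂.ext η G₂ 1 (q.2, q.1) :=
      S₂.continuous_ext hη hG₂ hG₂0 continuous_const (by fun_prop) fun _ ↦ le_rfl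
    have hrel : ∀ q : I × Ball n, ((q.1 = 0 ∨ q.1 = 1) ∨ ‖q.2.1‖ = 1) →
        S₂.ext η G₂ 1 q = G₂ 1 q := fun q hq ↦
      S₂.ext_rel (L := {q : I × Ball n | (q.1 = 0 ∨ q.1 = 1) ∨ ‖q.2.1‖ = 1}) hq zero_le_one
    let Q : C(Ball n, C(I, James Y)) := ContinuousMap.curry ⟨_, hc⟩
    have hQ : ∀ y t, Q y t = S₂.ext η G₂ 1 (t, y) := fun _ _ ↦ rfl
    have hR1 : Continuous fun y ↦ R 1 y := by
      refine (hR.comp (f := fun y : Ball n ↦ ((1 : ℝ), y)) (by fun_prop)).congr fun y ↦ ?_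
      change R (min 1 1) y = _
      rw [min_self]
    refine ⟨fun y ↦ ⟨(χ y, R 1 y, Q y), ?_, ?_⟩, by fun_prop, fun y ↦ rfl, fun y hy ↦ ?_⟩
    · rw [hQ, hrel _ (Or.inl (Or.inl rfl)), G₂e _ _ (Or.inl rfl), η0]
    · rw [hQ, hrel _ (Or.inl (Or.inr rfl)), G₂e _ _ (Or.inr rfl), η1]
    · refine Subtype.ext (Prod.ext (hps y hy).symm (Prod.ext (R1 y hy)
        (ContinuousMap.ext fun t ↦ ?_)))
      change Q y t = _
      rw [hQ, hrel _ (Or.inr hy), G₂L _ _ hy]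
      simp only [κ, α]
      rw [sub_self, zero_mul, zero_add, one_mul, if_pos t.2.2, cI_coe]
  let e₀ : E := ⟨(X.pt, 1, ContinuousMap.const I 1), rfl, by
    rw [mul_one]; exact f.map_pt.symm⟩
  obtain ⟨g, hg, hpg, hg0⟩ := exists_section hp (v := v) (e₀ := e₀) hv'
  rw [← hv'] at hg0
  let q : E → James Y × C(I, James Y) := fun e ↦ e.1.2
  have hg1 : Continuous fun x ↦ q (g x) := by fun_prop
  refine ⟨⟨⟨fun x ↦ (q (g x)).1, by fun_prop⟩, ?_⟩, fun t x ↦ (q (g x)).2 t, ?_, fun x ↦ (hE (g x)).1,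
    fun x ↦ (hE (g x)).2.trans ?_, fun t ↦ ?_⟩
  · change (q (g X.pt)).1 = _
    rw [hg0]
    rfl
  · exact ContinuousEval.continuous_eval.comp
      (((continuous_snd.comp hg1).comp continuous_snd).prodMk continuous_fst)
  · exact congrArg (fun x' ↦ f x' * (q (g x)).1) (hpg x)
  · beta_reduce
    rw [hg0]
    rfl

end Cells

end RelJames

namespace RelJames

/-! ### Coherent inverses -/

open FundamentalGroupoid in
/-- A homotopy equivalence induces a surjection on homotopy classes of paths. -/
theorem exists_path_of_homotopyEquiv {A B : Type u} [TopologicalSpace A] [TopologicalSpace B]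
    (h : ContinuousMap.HomotopyEquiv A B) {a a' : A} (q : Path (h.toFun a) (h.toFun a')) :
    ∃ p : Path a a', (p.map h.toFun.continuous).Homotopic q := by
  have hF : (map h.toFun).Full :=
    (inferInstance : (FundamentalGroupoidFunctor.equivOfHomotopyEquiv h).functor.Full)
  obtain ⟨p, hp⟩ := (map h.toFun).map_surjective (X := .mk a) (Y := .mk a')
    (fromPath (Path.Homotopic.Quotient.mk q))
  obtain ⟨p, rfl⟩ := Path.Homotopic.Quotient.mk_surjective p
  exact ⟨p, Path.Homotopic.Quotient.exact hp⟩

/-- The space of maps to a James construction. -/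
def MapSp (Z Y : PtdSpace.{u}) : Type u :=
  WithGeneratedByTopology (fun n ↦ Fin n → ℝ) C(Z, James Y)

namespace MapSp

variable {Z Y : PtdSpace.{u}}

instance : TopologicalSpace (MapSp Z Y) :=
  inferInstanceAs (TopologicalSpace (WithGeneratedByTopology (fun n ↦ Fin n → ℝ) C(Z, James Y)))

instance : DeltaGeneratedSpace (MapSp Z Y) :=
  inferInstanceAs
    (DeltaGeneratedSpace (WithGeneratedByTopology (fun n ↦ Fin n → ℝ) C(Z, James Y)))

/-- The underlying map. -/
def val (f : MapSp Z Y) : C(Z, James Y) := WithGeneratedByTopology.equiv f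

/-- The point given by a map. -/
def of (f : C(Z, James Y)) : MapSp Z Y := WithGeneratedByTopology.equiv.symm f

theorem ext {f g : MapSp Z Y} (h : ∀ z, f.val z = g.val z) : f = g :=
  WithGeneratedByTopology.equiv.injective (ContinuousMap.ext h)

variable {T : Type*} [TopologicalSpace T] [DeltaGeneratedSpace T]

theorem continuous_val {φ : T → MapSp Z Y} {z : T → Z} (hφ : Continuous φ) (hz : Continuous z) :
    Continuous fun t ↦ (φ t).val (z t) := by
  rw [IsGeneratedBy.continuous_iff (fun n ↦ Fin n → ℝ)]
  intro n p
  have h1 : Continuous fun v ↦ (φ (p v)).val :=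
    WithGeneratedByTopology.continuous_equiv.comp (hφ.comp p.continuous)
  have h2 : Continuous fun v ↦ (φ (p v)).val.comp (⟨fun v ↦ z (p v), by fun_prop⟩ : C(_, Z)) :=
    (ContinuousMap.continuous_precomp _).comp h1
  exact ContinuousEval.continuous_eval.comp (h2.prodMk continuous_id)

theorem continuous_of {F : T → C(Z, James Y)} (hF : Continuous fun p : T × Z ↦ F p.1 p.2) :
    Continuous fun t ↦ of (F t) :=
  (IsGeneratedBy.equiv_symm_comp_continuous_iff (X := fun n ↦ Fin n → ℝ) F).2
    (ContinuousMap.continuous_of_continuous_uncurry _ hF)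

instance : Monoid (MapSp Z Y) where
  mul f g := of ⟨fun z ↦ f.val z * g.val z, by fun_prop⟩
  one := of (ContinuousMap.const Z 1)
  mul_assoc f g h := ext fun z ↦ mul_assoc (f.val z) (g.val z) (h.val z)
  one_mul f := ext fun z ↦ one_mul (f.val z)
  mul_one f := ext fun z ↦ mul_one (f.val z)

@[fun_prop] theorem continuous_mul {φ ψ : T → MapSp Z Y} (hφ : Continuous φ) (hψ : Continuous ψ) :
    Continuous fun t ↦ φ t * ψ t := by
  rw [IsGeneratedBy.continuous_iff (fun n ↦ Fin n → ℝ)]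
  intro n p
  refine continuous_of (F := fun v ↦ ⟨fun z ↦ (φ (p v)).val z * (ψ (p v)).val z, by fun_prop⟩) ?_
  exact James.continuous_mul
    (continuous_val (φ := fun q : (Fin n → ℝ) × Z ↦ φ (p q.1)) (by fun_prop) continuous_snd)
    (continuous_val (φ := fun q : (Fin n → ℝ) × Z ↦ ψ (p q.1)) (by fun_prop) continuous_snd)

theorem joined_mul_left (f : MapSp Z Y) {g h : MapSp Z Y} (p : Joined g h) :
    Joined (f * g) (f * h) := p.map (f := fun g ↦ f * g) (by fun_prop)

theorem joined_mul_right (f : MapSp Z Y) {g h : MapSp Z Y} (p : Joined g h) :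
    Joined (g * f) (h * f) := p.map (f := fun g ↦ g * f) (by fun_prop)

end MapSp

/-- Left multiplication by an invertible element is a homotopy equivalence. -/
def MapSp.mulEquiv {Z Y : PtdSpace.{u}} (j r : MapSp Z Y) (h : Joined 1 (r * j))
    (h' : Joined 1 (j * r)) : ContinuousMap.HomotopyEquiv (MapSp Z Y) (MapSp Z Y) where
  toFun := ⟨fun f ↦ j * f, by fun_prop⟩
  invFun := ⟨fun f ↦ r * f, by fun_prop⟩
  left_inv := by
    refine ContinuousMap.Homotopic.symm ⟨⟨⟨fun p ↦ h.somePath p.1 * p.2, by fun_prop⟩, ?_, ?_⟩⟩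
    · intro f; simp
    · intro f; simp [mul_assoc]
  right_inv := by
    refine ContinuousMap.Homotopic.symm ⟨⟨⟨fun p ↦ h'.somePath p.1 * p.2, by fun_prop⟩, ?_, ?_⟩⟩
    · intro f; simp
    · intro f; simp [mul_assoc]

/-- A map `r` with homotopies `H : 1 ≃ j r` and `K : 1 ≃ r j` and a homotopy `Θ : H j ≃ j K`. -/
structure CoherentInverse {Z Y : PtdSpace.{u}} (j : Z → James Y) where
  /-- the inverse -/
  r : Z → James Y
  /-- the right homotopy -/
  H : I → Z → James Y
  /-- the left homotopy -/
  K : I → Z → James Y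
  /-- the coherence -/
  Θ : I → I → Z → James Y
  cont_r : Continuous r
  cont_H : Continuous fun p : I × Z ↦ H p.1 p.2
  cont_K : Continuous fun p : I × Z ↦ K p.1 p.2
  cont_Θ : Continuous fun p : I × (I × Z) ↦ Θ p.1 p.2.1 p.2.2
  H_zero : ∀ z, H 0 z = 1
  H_one : ∀ z, H 1 z = j z * r z
  K_zero : ∀ z, K 0 z = 1
  K_one : ∀ z, K 1 z = r z * j z
  Θ_zero : ∀ t z, Θ 0 t z = H t z * j z
  Θ_one : ∀ t z, Θ 1 t z = j z * K t z
  Θ_bot : ∀ s z, Θ s 0 z = j z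
  Θ_top : ∀ s z, Θ s 1 z = j z * r z * j z

theorem HasRightInverse.exists_path {Z Y : PtdSpace.{u}} {f : PtdMap Z (James Y)}
    (h : HasRightInverse f) : ∃ (r : PtdMap Z (James Y)),
      Joined 1 (MapSp.of f.toContinuousMap * MapSp.of r.toContinuousMap) := by
  obtain ⟨r, H, hH, H0, H1, -⟩ := h
  refine ⟨r, ⟨⟨⟨fun t ↦ MapSp.of ⟨H t, hH.comp (f := fun z ↦ (t, z)) (by fun_prop)⟩,
    MapSp.continuous_of hH⟩, ?_, ?_⟩⟩⟩
  · exact MapSp.ext H0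
  · exact MapSp.ext H1

theorem exists_coherentInverse {Z Y : PtdSpace.{u}}
    (h : ∀ f : PtdMap Z (James Y), HasRightInverse f) (f : PtdMap Z (James Y)) :
    Nonempty (CoherentInverse f) := by
  obtain ⟨r', hr⟩ := (h f).exists_path
  obtain ⟨s', hs⟩ := (h r').exists_path
  set j : MapSp Z Y := MapSp.of f.toContinuousMap
  set r : MapSp Z Y := MapSp.of r'.toContinuousMap
  set s : MapSp Z Y := MapSp.of s'.toContinuousMap
  have hl : Joined 1 (r * j) := by
    have h1 := MapSp.joined_mul_left (r * j) hs
    have h2 := MapSp.joined_mul_left r (MapSp.joined_mul_right s hr)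
    rw [mul_one] at h1
    rw [one_mul] at h2
    rw [show r * (j * r * s) = r * j * (r * s) by simp only [mul_assoc]] at h2
    exact (hs.trans h2).trans h1.symm
  let H := hr.somePath
  let e := MapSp.mulEquiv j r hl hr
  let q : Path (e.toFun 1) (e.toFun (r * j)) :=
    ⟨⟨fun t ↦ H t * j, by fun_prop⟩, by simp [e, MapSp.mulEquiv],
      by simp [e, MapSp.mulEquiv, mul_assoc]⟩
  obtain ⟨K, hK⟩ := exists_path_of_homotopyEquiv e q
  obtain ⟨Θ⟩ := hK.symm
  have hΘ : Continuous fun p : I × (I × Z) ↦ (p.1, p.2.1) := by fun_prop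
  refine ⟨⟨r.val, fun t z ↦ (H t).val z, fun t z ↦ (K t).val z, fun x t z ↦ (Θ (x, t)).val z,
    by fun_prop, ?_, ?_, ?_, ?_, ?_, ?_, ?_, ?_, ?_, ?_, ?_⟩⟩
  · exact MapSp.continuous_val (φ := fun p : I × Z ↦ H p.1) (by fun_prop) continuous_snd
  · exact MapSp.continuous_val (φ := fun p : I × Z ↦ K p.1) (by fun_prop) continuous_snd
  · exact MapSp.continuous_val (φ := fun p : I × (I × Z) ↦ Θ (p.1, p.2.1)) (by fun_prop)
      (by fun_prop)
  · intro z; rw [H.source]; rfl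
  · intro z; rw [H.target]; rfl
  · intro z; rw [K.source]; rfl
  · intro z; rw [K.target]; rfl
  · intro t z; rw [Θ.apply_zero]; rfl
  · intro t z; rw [Θ.apply_one]; rfl
  · intro x z
    rw [Θ.source]
    exact mul_one (f z)
  · intro x z
    rw [Θ.target]
    exact (mul_assoc (f z) (r.val z) (f z)).symm

end RelJames

namespace RelJames

/-! ### Gluing -/

section Glue

variable {T S : Type*} [TopologicalSpace T] [TopologicalSpace S] {U : Set T} {f g : T → S}
  {c : T → ℝ} {p q : ℝ}

theorem continuousOn_of_lt_of_gt (hU : IsOpen U) (hc : Continuous c) (hpq : p < q)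
    (hf : ContinuousOn f (U ∩ {t | c t < q})) (hg : ContinuousOn f (U ∩ {t | p < c t})) :
    ContinuousOn f U := by
  intro t ht
  rcases lt_or_ge (c t) q with h | h
  · exact (hf.continuousAt ((hU.inter (isOpen_lt hc continuous_const)).mem_nhds
      ⟨ht, h⟩)).continuousWithinAt
  · exact (hg.continuousAt ((hU.inter (isOpen_lt continuous_const hc)).mem_nhds
      ⟨ht, hpq.trans_le h⟩)).continuousWithinAt

omit [TopologicalSpace T] [TopologicalSpace S] in
theorem glue_right (heq : ∀ t ∈ U, p < c t → c t < q → f t = g t) {t : T} (ht : t ∈ U)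
    (hp : p < c t) : (if c t < q then f t else g t) = g t := by
  split_ifs with h
  · exact heq t ht hp h
  · rfl

/-- Functions on overlapping open sets are glued to a continuous function. -/
theorem ContinuousOn.glue (hU : IsOpen U) (hc : Continuous c) (hpq : p < q)
    (hf : ContinuousOn f (U ∩ {t | c t < q})) (hg : ContinuousOn g (U ∩ {t | p < c t}))
    (heq : ∀ t ∈ U, p < c t → c t < q → f t = g t) :
    ContinuousOn (fun t ↦ if c t < q then f t else g t) U :=
  continuousOn_of_lt_of_gt hU hc hpq (hf.congr fun _ ht ↦ if_pos ht.2)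
    (hg.congr fun _ ht ↦ glue_right heq ht.1 ht.2)

end Glue

/-- The piecewise linear function that is `0` up to `p` and `1` from `q` on. -/
def ramp (p q x : ℝ) : I := cI ((x - p) / (q - p))

@[fun_prop] theorem continuous_ramp {T : Type*} [TopologicalSpace T] {f : T → ℝ}
    (hf : Continuous f) (p q : ℝ) : Continuous fun t ↦ ramp p q (f t) := by
  unfold ramp
  fun_prop

theorem ramp_of_le {p q x : ℝ} (hpq : p < q) (h : x ≤ p) : ramp p q x = 0 :=
  cI_of_le (div_nonpos_of_nonpos_of_nonneg (by linarith) (by linarith))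

theorem ramp_of_ge {p q x : ℝ} (hpq : p < q) (h : q ≤ x) : ramp p q x = 1 :=
  cI_of_ge (by rw [le_div_iff₀ (by linarith)]; linarith)

/-! ### Height and label of a point of a suspension -/

variable {Z : PtdSpace.{u}}

theorem Susp.exists_mk (x : Susp Z) : ∃ t z, x = Susp.mk t z := by
  induction x using Quot.ind with | mk p => ?_
  exact ⟨p.1, p.2, rfl⟩

namespace CofStr

variable (S : CofStr Z {Z.pt})

theorem k_pt (t : ℝ) : S.k t Z.pt = Z.pt := S.k_rel t _ rfl

theorem u_pt : S.u Z.pt = 0 := S.u_rel _ rfl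

theorem k_one {z : Z} (h : S.u z ≤ 1) : S.k 1 z = Z.pt := S.k_mem 1 z h le_rfl

/-- A function on the suspension that is `0` exactly at the base point. -/
def height (x : Susp Z) : ℝ :=
  Quot.lift (fun p : I × Z ↦ min 1 (S.u p.2) * (1 - |2 * (p.1 : ℝ) - 1|)) (by
    have key : ∀ p : I × Z, SuspCollapsed Z p →
        min 1 (S.u p.2) * (1 - |2 * (p.1 : ℝ) - 1|) = 0 := by
      rintro ⟨t, z⟩ (rfl | rfl | rfl)
      · simp
      · norm_num
      · simp [S.u_pt]
    exact fun p q h ↦ (key p h.1).trans (key q h.2).symm) x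

@[fun_prop] theorem continuous_height {T : Type*} [TopologicalSpace T] {x : T → Susp Z}
    (hx : Continuous x) : Continuous fun t ↦ S.height (x t) :=
  (continuous_quot_lift _ (by fun_prop)).comp hx

theorem height_mk (t : I) (z : Z) :
    S.height (Susp.mk t z) = min 1 (S.u z) * (1 - |2 * (t : ℝ) - 1|) := rfl

theorem height_pt : S.height (Susp Z).pt = 0 := by
  change S.height (Susp.mk 0 Z.pt) = 0
  rw [height_mk]
  simp

open Classical in
/-- The label of a point of the suspension of height in `(0, 1)`. -/
def label (x : Susp Z) : Z :=
  Quot.lift (fun p : I × Z ↦ if SuspCollapsed Z p ∨ 1 / 2 < (p.1 : ℝ) then Z.pt else S.k 1 p.2)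
    (fun _ _ h ↦ (if_pos (Or.inl h.1)).trans (if_pos (Or.inl h.2)).symm) x

theorem label_mk_of_le {t : I} {z : Z} (h : 0 < S.height (Susp.mk t z)) (ht : (t : ℝ) ≤ 1 / 2) :
    S.label (Susp.mk t z) = S.k 1 z := by
  refine if_neg ?_
  rintro (h' | h')
  · have h0 : Susp.mk t z = (Susp Z).pt := Susp.mk_eq_pt h'
    rw [h0, S.height_pt] at h
    exact lt_irrefl _ h
  · exact absurd ht (not_le.2 h')

theorem label_mk_of_gt {t : I} {z : Z} (ht : 1 / 2 < (t : ℝ)) :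
    S.label (Susp.mk t z) = Z.pt := if_pos (Or.inr ht)

theorem continuousOn_label : ContinuousOn S.label {x | 0 < S.height x ∧ S.height x < 1} := by
  have hU : IsOpen {x : Susp Z | 0 < S.height x ∧ S.height x < 1} :=
    (isOpen_lt continuous_const (S.continuous_height continuous_id)).inter
      (isOpen_lt (S.continuous_height continuous_id) continuous_const)
  refine (isQuotientMap_quot_mk.continuousOn_isOpen_iff hU).2 ?_
  rw [continuousOn_iff_continuous_domRestrict]
  have h1 : Continuous fun p : (Quot.mk _ ⁻¹' {x : Susp Z | 0 < S.height x ∧ S.height x < 1} :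
      Set (I × Z)) ↦ if (p.1.1 : ℝ) ≤ 1 / 2 then S.k 1 p.1.2 else Z.pt := by
    refine Continuous.if_le (by fun_prop) continuous_const (by fun_prop) continuous_const ?_
    rintro ⟨⟨t, z⟩, h, h'⟩ (ht : (t : ℝ) = 1 / 2)
    refine S.k_one ?_
    change S.height (Susp.mk t z) < 1 at h'
    rw [height_mk, ht] at h'
    norm_num at h'
    exact h'.le
  refine h1.congr fun p ↦ ?_
  obtain ⟨⟨t, z⟩, h, h'⟩ := p
  change _ = S.label (Susp.mk t z)
  split_ifs with ht
  · exact (S.label_mk_of_le h ht).symm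
  · exact (S.label_mk_of_gt (not_le.1 ht)).symm

/-- A self-map of the suspension that is homotopic to the identity and depends only on height and
label. -/
def normalize : PtdMap (Susp Z) (Susp Z) :=
  Susp.lift (fun t z ↦ Susp.mk (ramp (1 / 2) (11 / 20) (2 * t)) (S.k 1 z)) (by fun_prop) <| by
    rintro t z (rfl | rfl | rfl)
    · exact Susp.mk_eq_pt (Or.inl (ramp_of_le (by norm_num) (by norm_num)))
    · exact Susp.mk_eq_pt (Or.inr (Or.inl (ramp_of_ge (by norm_num) (by norm_num))))
    · exact Susp.mk_eq_pt (Or.inr (Or.inr (S.k_pt 1)))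

theorem normalize_homotopic : (PtdMap.id (Susp Z)).Homotopic S.normalize := by
  let F : I → Susp Z → Susp Z := fun τ ↦ Susp.lift
    (fun t z ↦ Susp.mk (cI ((1 - τ) * t + τ * ramp (1 / 2) (11 / 20) (2 * t))) (S.k τ z))
    (by fun_prop) <| by
      rintro t z (rfl | rfl | rfl)
      · refine Susp.mk_eq_pt (Or.inl ?_)
        rw [ramp_of_le (by norm_num) (by norm_num)]
        simp
      · refine Susp.mk_eq_pt (Or.inr (Or.inl ?_))
        rw [ramp_of_ge (by norm_num) (by norm_num)]
        simp
      · exact Susp.mk_eq_pt (Or.inr (Or.inr (S.k_pt _)))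
  refine PtdMap.homotopic_of F (continuous_I_prod_quot ?_) ?_ ?_ ?_
  · change Continuous fun p : I × (I × Z) ↦ (Susp.mk (cI ((1 - p.1) * p.2.1 +
      p.1 * ramp (1 / 2) (11 / 20) (2 * p.2.1))) (S.k p.1 p.2.2) : Susp Z)
    fun_prop
  · intro x
    obtain ⟨t, z, rfl⟩ := Susp.exists_mk x
    change Susp.mk _ _ = Susp.mk t z
    simp [S.k_zero]
  · intro x
    obtain ⟨t, z, rfl⟩ := Susp.exists_mk x
    change Susp.mk _ _ = Susp.mk _ _
    simp
  · intro τ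
    exact map_pt' _

theorem normalize_eq (x : Susp Z) :
    S.normalize x = Susp.mk (ramp (1 / 2) (11 / 20) (S.height x)) (S.label x) := by
  obtain ⟨t, z, rfl⟩ := Susp.exists_mk x
  change Susp.mk (ramp (1 / 2) (11 / 20) (2 * t)) (S.k 1 z) = _
  have hu := S.u_nonneg z
  rcases le_or_gt (S.u z) 1 with h | h
  · rw [S.k_one h, Susp.mk_eq_pt (Or.inr (Or.inr rfl))]
    symm
    rcases lt_or_ge (1 / 2) (t : ℝ) with ht | ht
    · exact Susp.mk_eq_pt (Or.inr (Or.inr (S.label_mk_of_gt ht)))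
    · rcases le_or_gt (S.height (Susp.mk t z)) 0 with h0 | h0
      · exact Susp.mk_eq_pt (Or.inl (ramp_of_le (by norm_num) (by linarith)))
      · exact Susp.mk_eq_pt (Or.inr (Or.inr ((S.label_mk_of_le h0 ht).trans (S.k_one h))))
  · have hc : S.height (Susp.mk t z) = 1 - |2 * (t : ℝ) - 1| := by
      rw [height_mk, min_eq_left h.le, one_mul]
    rcases lt_or_ge (1 / 2) (t : ℝ) with ht | ht
    · rw [S.label_mk_of_gt ht, ramp_of_ge (x := 2 * (t : ℝ)) (by norm_num) (by linarith)]
      rw [Susp.mk_one, Susp.mk_eq_pt (Or.inr (Or.inr rfl))]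
    · rw [abs_of_nonpos (by linarith)] at hc
      rcases eq_or_lt_of_le t.2.1 with h0 | h0
      · rw [hc, ramp_of_le (x := 2 * (t : ℝ)) (by norm_num) (by linarith),
          ramp_of_le (by norm_num) (by linarith), Susp.mk_zero, Susp.mk_zero]
      · rw [S.label_mk_of_le (by linarith) ht, hc]
        congr 2
        ring

end CofStr

end RelJames

namespace RelJames

/-! ### Transport of words along a short path -/

variable {Z : PtdSpace.{u}}

namespace CofStr

section Transport

variable (S : CofStr Z {Z.pt}) {ℓ : C(Z, ℝ)} (hℓ : IsLength ℓ)
  (C : CoherentInverse (James.letter : Z → James Z))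
  {T : Type*} [TopologicalSpace T] {U : Set T} {x : T → Susp Z}
  {m : T → James Z} {τ : T → I}

theorem continuousOn_label_comp (hx : Continuous x)
    (h : ∀ t ∈ U, 0 < S.height (x t) ∧ S.height (x t) < 1) :
    ContinuousOn (fun t ↦ S.label (x t)) U :=
  S.continuousOn_label.comp hx.continuousOn h

/-- The path that is given by a word over a point of the suspension. -/
def hookAt (m : James Z) (x : Susp Z) : C(ℝ, Susp Z) × ℝ :=
  hook ℓ hℓ m (ramp (1 / 2) (11 / 20) (S.height x)) (S.label x)

theorem hookAt_low (m : James Z) {x : Susp Z} (h : S.height x ≤ 1 / 2) :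
    S.hookAt hℓ m x = hook ℓ hℓ m 0 Z.pt := by
  rw [hookAt, ramp_of_le (by norm_num) h, hook_zero_eq]

theorem hookAt_high (m : James Z) {x : Susp Z} (h : 11 / 20 ≤ S.height x) :
    S.hookAt hℓ m x = hook ℓ hℓ (m * James.letter (S.label x)) 0 Z.pt := by
  rw [hookAt, ramp_of_ge (by norm_num) h, hook_one]

theorem continuousOn_base [DeltaGeneratedSpace T] (hU : IsOpen U) (hm : ContinuousOn m U) :
    ContinuousOn (fun t ↦ hook ℓ hℓ (m t) 0 Z.pt) U :=
  continuousOn_hook hℓ hU hm continuousOn_const continuousOn_const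

theorem continuousOn_hookAt [DeltaGeneratedSpace T] (hU : IsOpen U) (hm : ContinuousOn m U)
    (hx : Continuous x) (h : ∀ t ∈ U, S.height (x t) < 1) :
    ContinuousOn (fun t ↦ S.hookAt hℓ (m t) (x t)) U := by
  have hc : Continuous fun t ↦ S.height (x t) := by fun_prop
  refine continuousOn_of_lt_of_gt hU hc (p := 1 / 4) (q := 1 / 2) (by norm_num) ?_ ?_
  · refine (continuousOn_base hℓ (hU.inter (isOpen_lt hc continuous_const))
      (hm.mono Set.inter_subset_left)).congr fun t ht ↦ S.hookAt_low hℓ _ (le_of_lt ht.2)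
  · refine continuousOn_hook hℓ (hU.inter (isOpen_lt continuous_const hc))
      (hm.mono Set.inter_subset_left) (Continuous.continuousOn (by fun_prop)) ?_
    exact S.continuousOn_label_comp hx fun t ht ↦
      ⟨lt_trans (by norm_num) ht.2, h t ht.1⟩

/-- The right homotopy of an inverse, switched off near the base point. -/
def right (τ : I) (x : Susp Z) : James Z :=
  C.H (cI (τ * ramp (32 / 100) (38 / 100) (S.height x))) (S.label x)

theorem right_low (τ : I) {x : Susp Z} (h : S.height x ≤ 32 / 100) : S.right C τ x = 1 := by
  rw [right, ramp_of_le (by norm_num) h, Set.Icc.coe_zero, mul_zero, cI_zero, C.H_zero]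

theorem right_high (τ : I) {x : Susp Z} (h : 38 / 100 ≤ S.height x) :
    S.right C τ x = C.H τ (S.label x) := by
  rw [right, ramp_of_ge (by norm_num) h, Set.Icc.coe_one, mul_one, cI_coe]

theorem right_zero (x : Susp Z) : S.right C 0 x = 1 := by
  rw [right, Set.Icc.coe_zero, zero_mul, cI_zero, C.H_zero]

theorem continuousOn_right (hU : IsOpen U) (hτ : Continuous τ) (hx : Continuous x)
    (h : ∀ t ∈ U, S.height (x t) < 1) : ContinuousOn (fun t ↦ S.right C (τ t) (x t)) U := by
  have hc : Continuous fun t ↦ S.height (x t) := by fun_prop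
  refine continuousOn_of_lt_of_gt hU hc (p := 1 / 4) (q := 32 / 100) (by norm_num) ?_ ?_
  · exact continuousOn_const.congr fun t ht ↦ S.right_low C _ (le_of_lt ht.2)
  · have h1 := S.continuousOn_label_comp (U := U ∩ {t | 1 / 4 < S.height (x t)}) hx
      fun t ht ↦ ⟨lt_trans (by norm_num) ht.2, h t ht.1⟩
    exact C.cont_H.comp_continuousOn (ContinuousOn.prodMk (Continuous.continuousOn
      (f := fun t ↦ cI (τ t * ramp (32 / 100) (38 / 100) (S.height (x t)))) (by fun_prop)) h1)

/-- The left homotopy of an inverse, switched off at large height. -/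
def left (τ : I) (x : Susp Z) : James Z :=
  C.K (cI (τ * (1 - ramp (64 / 100) (70 / 100) (S.height x)))) (S.label x)

theorem left_low (τ : I) {x : Susp Z} (h : S.height x ≤ 64 / 100) :
    S.left C τ x = C.K τ (S.label x) := by
  rw [left, ramp_of_le (by norm_num) h, Set.Icc.coe_zero, sub_zero, mul_one, cI_coe]

theorem left_high (τ : I) {x : Susp Z} (h : 70 / 100 ≤ S.height x) : S.left C τ x = 1 := by
  rw [left, ramp_of_ge (by norm_num) h, Set.Icc.coe_one, sub_self, mul_zero, cI_zero, C.K_zero]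

theorem left_zero (x : Susp Z) : S.left C 0 x = 1 := by
  rw [left, Set.Icc.coe_zero, zero_mul, cI_zero, C.K_zero]

theorem continuousOn_left (hU : IsOpen U) (hτ : Continuous τ) (hx : Continuous x)
    (h : ∀ t ∈ U, 0 < S.height (x t)) : ContinuousOn (fun t ↦ S.left C (τ t) (x t)) U := by
  have hc : Continuous fun t ↦ S.height (x t) := by fun_prop
  refine continuousOn_of_lt_of_gt hU hc (p := 70 / 100) (q := 80 / 100) (by norm_num) ?_ ?_
  · have h1 := S.continuousOn_label_comp (U := U ∩ {t | S.height (x t) < 80 / 100}) hx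
      fun t ht ↦ ⟨h t ht.1, lt_trans ht.2 (by norm_num)⟩
    exact C.cont_K.comp_continuousOn (ContinuousOn.prodMk (Continuous.continuousOn
      (f := fun t ↦ cI (τ t * (1 - ramp (64 / 100) (70 / 100) (S.height (x t))))) (by fun_prop)) h1)
  · exact continuousOn_const.congr fun t ht ↦ S.left_high C _ (le_of_lt ht.2)

end Transport

section Step

variable (S : CofStr Z {Z.pt}) {ℓ : C(Z, ℝ)} (hℓ : IsLength ℓ)
  {W : Type*} [TopologicalSpace W]

/-- Words over the points of a suspension: `a` is used at small height, `b` at large height. -/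
structure IsState (x : W → Susp Z) (a b : W → James Z) : Prop where
  cont_a : ContinuousOn a {w | S.height (x w) < 64 / 100}
  cont_b : ContinuousOn b {w | 30 / 100 < S.height (x w)}
  mul_eq : ∀ w, 30 / 100 < S.height (x w) → S.height (x w) < 64 / 100 →
    a w * James.letter (S.label (x w)) = b w

/-- The path that is given by words over a point of the suspension. -/
def stateHook (a b : James Z) (x : Susp Z) : C(ℝ, Susp Z) × ℝ :=
  if S.height x < 56 / 100 then S.hookAt hℓ a x else hook ℓ hℓ b 0 Z.pt

/-- The Moore path `e` from the base point to `y`. -/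
def EndsAt (e : C(ℝ, Susp Z) × ℝ) (y : Susp Z) : Prop :=
  0 ≤ e.2 ∧ e.1 0 = (Susp Z).pt ∧ e.1 e.2 = y

theorem endsAt_hookAt (m : James Z) (x : Susp Z) :
    EndsAt (S.hookAt hℓ m x) (S.normalize x) := by
  rw [S.normalize_eq]
  exact ⟨hook_length_nonneg hℓ _ _ _, hook_apply_zero hℓ _ _ _, hook_apply_length hℓ _ _ _⟩

theorem endsAt_base (m : James Z) {x : Susp Z} (h : 11 / 20 ≤ S.height x) :
    EndsAt (hook ℓ hℓ m 0 Z.pt) (S.normalize x) := by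
  rw [S.normalize_eq, ramp_of_ge (by norm_num) h]
  refine ⟨hook_length_nonneg hℓ _ _ _, hook_apply_zero hℓ _ _ _, ?_⟩
  rw [hook_apply_length, Susp.mk_zero, Susp.mk_one]

variable (W) in
/-- A family of paths along which the height varies little, with words over the initial points. -/
structure Step where
  /-- the paths -/
  d : I → W → Susp Z
  /-- the words at small height -/
  a : W → James Z
  /-- the words at large height -/
  b : W → James Z
  cont_d : Continuous fun p : I × W ↦ d p.1 p.2
  osc : ∀ s w, |S.height (d s w) - S.height (d 0 w)| < 1 / 50
  state : S.IsState (d 0) a b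

variable {S} (C : CoherentInverse (James.letter : Z → James Z)) (D : S.Step W)

namespace Step

/-- The initial height. -/
abbrev c (w : W) : ℝ := S.height (D.d 0 w)

/-- The change of the words over a fixed point. -/
def vertical (p : I × W) : C(ℝ, Susp Z) × ℝ :=
  if D.c p.2 < 56 / 100 then S.hookAt hℓ (D.a p.2 * S.right C p.1 (D.d 0 p.2)) (D.d 0 p.2)
  else if D.c p.2 < 64 / 100 then
    hook ℓ hℓ (D.a p.2 * C.Θ (ramp (56 / 100) (60 / 100) (D.c p.2)) p.1
      (S.label (D.d 0 p.2))) 0 Z.pt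
  else hook ℓ hℓ (D.b p.2 * S.left C p.1 (D.d 0 p.2)) 0 Z.pt

/-- The time at which the inverse letter is read off. -/
def readTime (p : I × W) : I := cI (p.1 * ramp (40 / 100) (45 / 100) (D.c p.2))

/-- The words along the path. -/
def horizontal (p : I × W) : C(ℝ, Susp Z) × ℝ :=
  if D.c p.2 < 40 / 100 then S.hookAt hℓ (D.a p.2 * S.right C 1 (D.d 0 p.2)) (D.d p.1 p.2)
  else if D.c p.2 < 58 / 100 then
    S.hookAt hℓ (D.b p.2 * C.r (S.label (D.d (D.readTime p) p.2))) (D.d p.1 p.2)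
  else hook ℓ hℓ (D.b p.2 * S.left C 1 (D.d p.1 p.2)) 0 Z.pt

/-- The word at the end of the path, at small height. -/
def nextA (w : W) : James Z :=
  if D.c w < 40 / 100 then D.a w * S.right C 1 (D.d 0 w)
  else D.b w * C.r (S.label (D.d (D.readTime (1, w)) w))

/-- The word at the end of the path, at large height. -/
def nextB (w : W) : James Z :=
  if S.height (D.d 1 w) < 64 / 100 then D.nextA C w * James.letter (S.label (D.d 1 w))
  else D.b w * S.left C 1 (D.d 1 w)

theorem osc_lt (s : I) (w : W) : S.height (D.d s w) < D.c w + 2 / 100 ∧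
    D.c w < S.height (D.d s w) + 2 / 100 := by
  have := abs_lt.1 (D.osc s w)
  constructor <;> linarith [this.1, this.2]

@[fun_prop] theorem continuous_d {T : Type*} [TopologicalSpace T] {f : T → I} {g : T → W}
    (hf : Continuous f) (hg : Continuous g) : Continuous fun t ↦ D.d (f t) (g t) :=
  D.cont_d.comp (hf.prodMk hg)

@[fun_prop] theorem continuous_readTime : Continuous D.readTime := by
  unfold readTime
  fun_prop

theorem mul_eq {w : W} (h : 30 / 100 < D.c w) (h' : D.c w < 64 / 100) :
    D.a w * James.letter (S.label (D.d 0 w)) = D.b w := D.state.mul_eq w h h'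

theorem isOpen_lt (q : ℝ) : IsOpen {p : I × W | D.c p.2 < q} :=
  _root_.isOpen_lt (by fun_prop) continuous_const

theorem isOpen_gt (q : ℝ) : IsOpen {p : I × W | q < D.c p.2} :=
  _root_.isOpen_lt continuous_const (by fun_prop)

theorem continuousOn_a {U : Set (I × W)} (h : ∀ p ∈ U, D.c p.2 < 64 / 100) :
    ContinuousOn (fun p : I × W ↦ D.a p.2) U :=
  D.state.cont_a.comp continuousOn_snd h

theorem continuousOn_b {U : Set (I × W)} (h : ∀ p ∈ U, 30 / 100 < D.c p.2) :
    ContinuousOn (fun p : I × W ↦ D.b p.2) U :=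
  D.state.cont_b.comp continuousOn_snd h

theorem continuous_vertical [DeltaGeneratedSpace W] : Continuous (D.vertical hℓ C) := by
  have hc : Continuous fun p : I × W ↦ D.c p.2 := by fun_prop
  rw [← continuousOn_univ]
  refine ContinuousOn.glue isOpen_univ hc (p := 55 / 100) (by norm_num) ?_ ?_ ?_
  · rw [Set.univ_inter]
    have h : ∀ p ∈ {p : I × W | D.c p.2 < 56 / 100}, D.c p.2 < 64 / 100 ∧ D.c p.2 < 1 :=
      fun p (hp : D.c p.2 < 56 / 100) ↦ ⟨by linarith, by linarith⟩
    exact S.continuousOn_hookAt hℓ (D.isOpen_lt _) (James.continuousOn_mul (D.isOpen_lt _)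
      (D.continuousOn_a fun p hp ↦ (h p hp).1)
      (S.continuousOn_right C (D.isOpen_lt _) continuous_fst (by fun_prop) fun p hp ↦ (h p hp).2))
      (by fun_prop) fun p hp ↦ (h p hp).2
  · rw [Set.univ_inter]
    refine ContinuousOn.glue (D.isOpen_gt _) hc (p := 60 / 100) (by norm_num) ?_ ?_ ?_
    · have hU := (D.isOpen_gt (55 / 100)).inter (D.isOpen_lt (64 / 100))
      refine continuousOn_base hℓ hU (James.continuousOn_mul hU
        (D.continuousOn_a fun p hp ↦ hp.2) ?_)
      have h1 := S.continuousOn_label_comp (U := {p : I × W | 55 / 100 < D.c p.2} ∩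
        {p | D.c p.2 < 64 / 100}) (x := fun p ↦ D.d 0 p.2) (by fun_prop) fun p hp ↦
          ⟨lt_trans (by norm_num) hp.1, lt_trans hp.2 (by norm_num)⟩
      exact C.cont_Θ.comp_continuousOn (ContinuousOn.prodMk (Continuous.continuousOn
        (f := fun p : I × W ↦ ramp (56 / 100) (60 / 100) (D.c p.2)) (by fun_prop))
        (continuousOn_fst.prodMk h1))
    · have hU := (D.isOpen_gt (55 / 100)).inter (D.isOpen_gt (60 / 100))
      exact continuousOn_base hℓ hU (James.continuousOn_mul hU
        (D.continuousOn_b fun p hp ↦ lt_trans (by norm_num) hp.2)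
        (S.continuousOn_left C hU continuous_fst (by fun_prop)
          fun p hp ↦ lt_trans (by norm_num) hp.2))
    · intro p _ h h'
      rw [ramp_of_ge (by norm_num) h.le, C.Θ_one, S.left_low C _ h'.le, ← mul_assoc,
        D.mul_eq (by linarith) h']
  · intro p _ h h'
    rw [if_pos (by linarith), S.hookAt_high hℓ _ (by linarith), S.right_high C _ (by linarith),
      ramp_of_le (by norm_num) h'.le, C.Θ_zero, mul_assoc]

theorem vertical_zero (w : W) :
    D.vertical hℓ C (0, w) = S.stateHook hℓ (D.a w) (D.b w) (D.d 0 w) := by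
  simp only [vertical, stateHook]
  split_ifs with h1 h2
  · rw [S.right_zero, mul_one]
  · rw [C.Θ_bot, D.mul_eq (by linarith) h2]
  · rw [S.left_zero, mul_one]

theorem endsAt_vertical (p : I × W) :
    EndsAt (D.vertical hℓ C p) (S.normalize (D.d 0 p.2)) := by
  unfold vertical
  split_ifs with h1 h2
  · exact S.endsAt_hookAt hℓ _ _
  · exact S.endsAt_base hℓ _ (by linarith)
  · exact S.endsAt_base hℓ _ (by linarith)

theorem right_eq {w : W} (h : 38 / 100 < D.c w) (h' : D.c w < 64 / 100) :
    D.a w * S.right C 1 (D.d 0 w) = D.b w * C.r (S.label (D.d 0 w)) := by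
  rw [S.right_high C _ h.le, C.H_one, ← mul_assoc, D.mul_eq (by linarith) h']

theorem left_eq {w : W} {s : I} (h : S.height (D.d s w) < 64 / 100) :
    D.b w * S.left C 1 (D.d s w) =
      D.b w * C.r (S.label (D.d s w)) * James.letter (S.label (D.d s w)) := by
  rw [S.left_low C _ h.le, C.K_one, mul_assoc]

theorem vertical_one (w : W) : D.vertical hℓ C (1, w) = D.horizontal hℓ C (0, w) := by
  have hr : D.readTime (0, w) = 0 := by simp [readTime]
  simp only [vertical, horizontal, hr]
  by_cases h1 : D.c w < 40 / 100
  · rw [if_pos (by linarith), if_pos h1]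
  rw [if_neg h1]
  by_cases h2 : D.c w < 56 / 100
  · rw [if_pos h2, if_pos (by linarith), D.right_eq C (by linarith) (by linarith)]
  rw [if_neg h2]
  by_cases h3 : D.c w < 64 / 100
  · rw [if_pos h3, C.Θ_top, ← mul_assoc, ← mul_assoc, D.mul_eq (by linarith) h3,
      S.hookAt_high hℓ _ (by linarith), D.left_eq C h3, ite_self]
  · rw [if_neg h3, if_neg (by linarith)]

theorem readTime_low {p : I × W} (h : D.c p.2 ≤ 40 / 100) : D.readTime p = 0 := by
  rw [readTime, ramp_of_le (by norm_num) h, Set.Icc.coe_zero, mul_zero, cI_zero]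

theorem readTime_high {p : I × W} (h : 45 / 100 ≤ D.c p.2) : D.readTime p = p.1 := by
  rw [readTime, ramp_of_ge (by norm_num) h, Set.Icc.coe_one, mul_one, cI_coe]

theorem continuousOn_read [DeltaGeneratedSpace W] {U : Set (I × W)} (hU : IsOpen U)
    (h : ∀ p ∈ U, 38 / 100 < D.c p.2 ∧ D.c p.2 < 70 / 100) :
    ContinuousOn (fun p : I × W ↦ D.b p.2 * C.r (S.label (D.d (D.readTime p) p.2))) U := by
  refine James.continuousOn_mul hU
    (D.continuousOn_b fun p hp ↦ lt_trans (by norm_num) (h p hp).1) ?_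
  refine C.cont_r.comp_continuousOn (S.continuousOn_label_comp (by fun_prop) fun p hp ↦ ?_)
  have h1 := h p hp
  have h2 := D.osc_lt (D.readTime p) p.2
  constructor <;> linarith [h1.1, h1.2, h2.1, h2.2]

theorem continuous_horizontal [DeltaGeneratedSpace W] : Continuous (D.horizontal hℓ C) := by
  have hc : Continuous fun p : I × W ↦ D.c p.2 := by fun_prop
  rw [← continuousOn_univ]
  refine ContinuousOn.glue isOpen_univ hc (p := 38 / 100) (by norm_num) ?_ ?_ ?_
  · rw [Set.univ_inter]
    have h : ∀ p ∈ {p : I × W | D.c p.2 < 40 / 100}, D.c p.2 < 64 / 100 ∧ D.c p.2 < 1 ∧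
        S.height (D.d p.1 p.2) < 1 := fun p (hp : D.c p.2 < 40 / 100) ↦ by
      have := D.osc_lt p.1 p.2
      exact ⟨by linarith, by linarith, by linarith⟩
    exact S.continuousOn_hookAt hℓ (D.isOpen_lt _) (James.continuousOn_mul (D.isOpen_lt _)
      (D.continuousOn_a fun p hp ↦ (h p hp).1)
      (S.continuousOn_right C (D.isOpen_lt _) continuous_const (by fun_prop)
        fun p hp ↦ (h p hp).2.1)) (by fun_prop) fun p hp ↦ (h p hp).2.2
  · rw [Set.univ_inter]
    refine ContinuousOn.glue (D.isOpen_gt _) hc (p := 57 / 100) (by norm_num) ?_ ?_ ?_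
    · have hU := (D.isOpen_gt (38 / 100)).inter (D.isOpen_lt (58 / 100))
      refine S.continuousOn_hookAt hℓ hU (D.continuousOn_read C hU
        fun p hp ↦ ⟨hp.1, lt_trans hp.2 (by norm_num)⟩) (by fun_prop) ?_
      rintro p ⟨h1 : 38 / 100 < D.c p.2, h2 : D.c p.2 < 58 / 100⟩
      have := D.osc_lt p.1 p.2
      linarith
    · have hU := (D.isOpen_gt (38 / 100)).inter (D.isOpen_gt (57 / 100))
      refine continuousOn_base hℓ hU (James.continuousOn_mul hU
        (D.continuousOn_b fun p hp ↦ lt_trans (by norm_num) hp.2)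
        (S.continuousOn_left C hU continuous_const (by fun_prop) ?_))
      rintro p ⟨-, h2 : 57 / 100 < D.c p.2⟩
      have := D.osc_lt p.1 p.2
      linarith
    · intro p _ h h'
      have := D.osc_lt p.1 p.2
      rw [D.readTime_high (by linarith), S.hookAt_high hℓ _ (by linarith),
        D.left_eq C (by linarith)]
  · intro p _ h h'
    rw [if_pos (by linarith), D.readTime_low h'.le, D.right_eq C h (by linarith)]

theorem endsAt_horizontal (p : I × W) :
    EndsAt (D.horizontal hℓ C p) (S.normalize (D.d p.1 p.2)) := by
  have := D.osc_lt p.1 p.2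
  unfold horizontal
  split_ifs with h1 h2
  · exact S.endsAt_hookAt hℓ _ _
  · exact S.endsAt_hookAt hℓ _ _
  · exact S.endsAt_base hℓ _ (by linarith)

theorem nextB_eq {w : W} (h : 55 / 100 < D.c w) :
    D.nextB C w = D.b w * S.left C 1 (D.d 1 w) := by
  unfold nextB
  split_ifs with h1
  · rw [nextA, if_neg (by linarith), D.readTime_high (by linarith), D.left_eq C h1]
  · rfl

theorem horizontal_one (w : W) :
    D.horizontal hℓ C (1, w) = S.stateHook hℓ (D.nextA C w) (D.nextB C w) (D.d 1 w) := by
  have ho := D.osc_lt 1 w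
  have hA : 55 / 100 ≤ S.height (D.d 1 w) → S.height (D.d 1 w) < 64 / 100 →
      S.hookAt hℓ (D.nextA C w) (D.d 1 w) = hook ℓ hℓ (D.nextB C w) 0 Z.pt := fun h h' ↦ by
    rw [S.hookAt_high hℓ _ (by linarith), nextB, if_pos h']
  have key : D.c w < 58 / 100 → S.hookAt hℓ (D.nextA C w) (D.d 1 w) =
      S.stateHook hℓ (D.nextA C w) (D.nextB C w) (D.d 1 w) := fun h ↦ by
    unfold stateHook
    split_ifs with h3
    · rfl
    · exact hA (by linarith) (by linarith)
  simp only [horizontal]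
  split_ifs with h1 h2
  · rw [← key (by linarith), nextA, if_pos h1]
  · rw [← key (by linarith), nextA, if_neg h1]
  · rw [← D.nextB_eq C (by linarith)]
    unfold stateHook
    split_ifs with h3
    · exact (hA (by linarith) (by linarith)).symm
    · rfl

/-- The words over the terminal points. -/
theorem isState_next [DeltaGeneratedSpace W] : S.IsState (D.d 1) (D.nextA C) (D.nextB C) := by
  have hc : Continuous fun w ↦ D.c w := by fun_prop
  have hc1 : Continuous fun w ↦ S.height (D.d 1 w) := by fun_prop
  have hlt : ∀ q, IsOpen {w | D.c w < q} := fun q ↦ _root_.isOpen_lt hc continuous_const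
  have hgt : ∀ q, IsOpen {w | q < D.c w} := fun q ↦ _root_.isOpen_lt continuous_const hc
  have hA : ContinuousOn (D.nextA C) {w | S.height (D.d 1 w) < 64 / 100} := by
    have hU : IsOpen {w | S.height (D.d 1 w) < 64 / 100} := _root_.isOpen_lt hc1 continuous_const
    refine ContinuousOn.glue hU hc (p := 38 / 100) (by norm_num) ?_ ?_ ?_
    · refine ContinuousOn.mono (s := {w | D.c w < 40 / 100}) ?_ Set.inter_subset_right
      have h : ∀ w ∈ {w | D.c w < 40 / 100}, D.c w < 64 / 100 ∧ D.c w < 1 :=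
        fun w (hw : D.c w < 40 / 100) ↦ ⟨by linarith, by linarith⟩
      exact James.continuousOn_mul (hlt _) (D.state.cont_a.mono fun w hw ↦ (h w hw).1)
        (S.continuousOn_right C (hlt _) continuous_const (by fun_prop) fun w hw ↦ (h w hw).2)
    · refine ContinuousOn.comp (t := {p : I × W | 38 / 100 < D.c p.2} ∩ {p | D.c p.2 < 70 / 100})
        (f := fun w : W ↦ ((1 : I), w))
        (D.continuousOn_read C ((D.isOpen_gt _).inter (D.isOpen_lt _)) fun p hp ↦ hp)
        (Continuous.continuousOn (by fun_prop)) ?_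
      rintro w ⟨h1 : S.height (D.d 1 w) < 64 / 100, h2 : 38 / 100 < D.c w⟩
      have := D.osc_lt 1 w
      exact ⟨h2, (by linarith : D.c w < 70 / 100)⟩
    · intro w _ h h'
      rw [D.readTime_low h'.le, D.right_eq C h (by linarith)]
  refine ⟨hA, ?_, fun w _ h ↦ (if_pos h).symm⟩
  have hU : IsOpen {w | 30 / 100 < S.height (D.d 1 w)} := _root_.isOpen_lt continuous_const hc1
  refine ContinuousOn.glue hU hc1 (p := 57 / 100) (by norm_num) ?_ ?_ ?_
  · have hU' := hU.inter (_root_.isOpen_lt hc1 (continuous_const (y := 64 / 100)))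
    refine James.continuousOn_mul hU' (hA.mono Set.inter_subset_right) ?_
    refine James.continuous_letter.comp_continuousOn
      (S.continuousOn_label_comp (by fun_prop) fun w hw ↦ ⟨?_, ?_⟩)
    · exact lt_trans (by norm_num) hw.1
    · exact lt_trans hw.2 (by norm_num)
  · have hU' := hU.inter (_root_.isOpen_lt (continuous_const (y := 57 / 100)) hc1)
    refine James.continuousOn_mul hU' (D.state.cont_b.mono ?_)
      (S.continuousOn_left C hU' continuous_const (by fun_prop)
        fun w hw ↦ lt_trans (by norm_num) hw.1)
    rintro w ⟨-, h : 57 / 100 < S.height (D.d 1 w)⟩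
    have := D.osc_lt 1 w
    exact (by linarith : 30 / 100 < D.c w)
  · intro w _ h h'
    have ho := D.osc_lt 1 w
    have h2 := D.nextB_eq C (w := w) (by linarith)
    rwa [nextB, if_pos h'] at h2

theorem nextA_low {w : W} (h : D.c w ≤ 30 / 100) : D.nextA C w = D.a w := by
  rw [nextA, if_pos (by linarith), S.right_low C _ (by linarith), mul_one]

/-- The path of words over the path. -/
def lift (p : I × W) : C(ℝ, Susp Z) × ℝ :=
  if (p.1 : ℝ) ≤ 1 / 2 then D.vertical hℓ C (cI (2 * p.1), p.2)
  else D.horizontal hℓ C (cI (2 * p.1 - 1), p.2)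

theorem continuous_lift [DeltaGeneratedSpace W] : Continuous (D.lift hℓ C) := by
  refine Continuous.if_le
    ((D.continuous_vertical hℓ C).comp (f := fun p : I × W ↦ (cI (2 * p.1), p.2)) (by fun_prop))
    ((D.continuous_horizontal hℓ C).comp (f := fun p : I × W ↦ (cI (2 * p.1 - 1), p.2))
      (by fun_prop)) (by fun_prop) continuous_const ?_
  rintro p (hp : (p.1 : ℝ) = 1 / 2)
  have h1 : cI (2 * (p.1 : ℝ)) = 1 := cI_of_ge (by linarith)
  have h0 : cI (2 * (p.1 : ℝ) - 1) = 0 := cI_of_le (by linarith)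
  exact (congrArg (fun s ↦ D.vertical hℓ C (s, p.2)) h1).trans ((D.vertical_one hℓ C p.2).trans
    (congrArg (fun s ↦ D.horizontal hℓ C (s, p.2)) h0.symm))

theorem lift_zero (w : W) :
    D.lift hℓ C (0, w) = S.stateHook hℓ (D.a w) (D.b w) (D.d 0 w) := by
  simp only [lift, Set.Icc.coe_zero]
  rw [if_pos (by norm_num), mul_zero, cI_zero, D.vertical_zero]

theorem lift_one (w : W) :
    D.lift hℓ C (1, w) = S.stateHook hℓ (D.nextA C w) (D.nextB C w) (D.d 1 w) := by
  simp only [lift, Set.Icc.coe_one]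
  rw [if_neg (by norm_num), cI_of_ge (by norm_num), D.horizontal_one]

theorem endsAt_lift (p : I × W) :
    EndsAt (D.lift hℓ C p) (S.normalize (D.d (cI (2 * p.1 - 1)) p.2)) := by
  unfold lift
  split_ifs with h
  · rw [cI_of_le (t := 2 * (p.1 : ℝ) - 1) (by linarith)]
    exact D.endsAt_vertical hℓ C _
  · exact D.endsAt_horizontal hℓ C _

theorem lift_low {p : I × W} (h : ∀ s, S.height (D.d s p.2) ≤ 30 / 100) :
    D.lift hℓ C p = hook ℓ hℓ (D.a p.2) 0 Z.pt := by
  have h0 := h 0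
  unfold lift
  split_ifs
  · rw [vertical, if_pos (by linarith), S.right_low C _ (by linarith), mul_one,
      S.hookAt_low hℓ _ (by linarith)]
  · have h1 := h (cI (2 * p.1 - 1))
    rw [horizontal, if_pos (by linarith), S.right_low C _ (by linarith), mul_one,
      S.hookAt_low hℓ _ (by linarith)]

end Step
end Step
end CofStr

end RelJames

namespace RelJames

/-! ### Maps of two parameters -/

/-- The concatenation of homotopies `f 0, f 1, …`. -/
theorem continuous_concat {W Y : Type*} [TopologicalSpace W] [TopologicalSpace Y]
    {f : ℕ → I × W → Y} (hf : ∀ n, Continuous (f n)) (h : ∀ n w, f n (1, w) = f (n + 1) (0, w)) :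
    Continuous fun p : ℝ × W ↦ f ⌊p.1⌋₊ (cI (p.1 - ⌊p.1⌋₊), p.2) := by
  let A : ℕ → Set (ℝ × W) := fun n ↦ {p | (n : ℝ) ≤ max p.1 0 ∧ p.1 ≤ n + 1}
  have hA : LocallyFinite A := by
    intro p
    refine ⟨{q | q.1 < ⌈p.1⌉₊ + 1}, (isOpen_lt continuous_fst continuous_const).mem_nhds
      (by simpa using lt_of_le_of_lt (Nat.le_ceil p.1) (lt_add_one _)),
      (Set.finite_Iic (⌈p.1⌉₊ + 1)).subset ?_⟩
    rintro n ⟨q, ⟨h1, -⟩, h2 : q.1 < ⌈p.1⌉₊ + 1⟩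
    have h3 : (n : ℝ) ≤ (⌈p.1⌉₊ + 1 : ℕ) := by
      push_cast
      exact h1.trans (max_le h2.le (by positivity))
    exact Nat.cast_le.1 h3
  refine hA.continuous ?_ (fun n ↦ ?_) (fun n ↦ ?_)
  · refine Set.eq_univ_of_forall fun p ↦ Set.mem_iUnion.2 ⟨⌊p.1⌋₊, ?_, (Nat.lt_floor_add_one _).le⟩
    rcases le_total 0 p.1 with h0 | h0
    · exact (Nat.floor_le h0).trans (le_max_left _ _)
    · rw [Nat.floor_of_nonpos h0, Nat.cast_zero]
      exact le_max_right _ _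
  · exact (isClosed_le continuous_const (continuous_fst.max continuous_const)).inter
      (isClosed_le continuous_fst continuous_const)
  · refine ContinuousOn.congr (f := fun p : ℝ × W ↦ f n (cI (p.1 - n), p.2))
      ((hf n).comp (by fun_prop)).continuousOn ?_
    rintro ⟨t, w⟩ ⟨h1 : (n : ℝ) ≤ max t 0, h2 : t ≤ n + 1⟩
    dsimp only
    rcases h2.lt_or_eq with h2 | h2
    · have : ⌊t⌋₊ = n := by
        rcases le_total 0 t with h0 | h0
        · rw [max_eq_left h0] at h1
          exact (Nat.floor_eq_iff h0).2 ⟨h1, h2⟩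
        · rw [max_eq_right h0] at h1
          rw [Nat.floor_of_nonpos h0]
          exact_mod_cast h1.antisymm' (Nat.cast_nonneg n)
      rw [this]
    · have : ⌊t⌋₊ = n + 1 := by
        rw [h2]
        exact_mod_cast Nat.floor_natCast (R := ℝ) (n + 1)
      rw [this, cI_of_ge (t := t - n) (by linarith), h n, cI_of_le (by push_cast; linarith)]

/-- Paths in a metrizable space of functions have a continuous modulus of continuity. -/
theorem exists_modulus {ε : ℝ} (hε : 0 < ε) : ∃ r : C(C(I, ℝ), ℝ), ∀ f, 0 < r f ∧
    ∀ s s' : I, |(s : ℝ) - s'| ≤ r f → |f s - f s'| < ε := by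
  refine exists_continuous_forall_mem_convex_of_local_const
    (t := fun f : C(I, ℝ) ↦ {x : ℝ | 0 < x ∧ ∀ s s' : I, |(s : ℝ) - s'| ≤ x → |f s - f s'| < ε})
    (fun f ↦ ?_) fun f ↦ ?_
  · refine Set.OrdConnected.convex ⟨fun x hx y hy z hz ↦ ⟨hx.1.trans_le hz.1, fun s s' h ↦ ?_⟩⟩
    exact hy.2 s s' (h.trans hz.2)
  · have hu := CompactSpace.uniformContinuous_of_continuous f.continuous
    obtain ⟨η, hη, h⟩ := Metric.uniformContinuous_iff.1 hu (ε / 3) (by positivity)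
    refine ⟨η / 2, Filter.mem_of_superset (Metric.ball_mem_nhds f (ε := ε / 3) (by positivity)) ?_⟩
    refine fun g hg ↦ ⟨by positivity, fun s s' hs ↦ ?_⟩
    have h1 := abs_lt.1 (h (a := s) (b := s') (lt_of_le_of_lt hs (half_lt_self hη)))
    have h2 := abs_lt.1 (lt_of_le_of_lt (ContinuousMap.dist_apply_le_dist (f := g) (g := f) s) hg)
    have h3 := abs_lt.1 (lt_of_le_of_lt (ContinuousMap.dist_apply_le_dist (f := g) (g := f) s') hg)
    rw [abs_lt]
    constructor <;> linarith [h1.1, h1.2, h2.1, h2.2, h3.1, h3.2]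

/-- A homotopy of maps of a suspension. -/
theorem Susp.homotopic_of {W Y : PtdSpace.{u}} {f g : PtdMap (Susp W) Y} (G : I → I → W → Y)
    (hG : Continuous fun p : I × (I × W) ↦ G p.1 p.2.1 p.2.2)
    (hp : ∀ τ t w, (t = 0 ∨ t = 1 ∨ w = W.pt) → G τ t w = Y.pt)
    (h0 : ∀ t w, f (Susp.mk t w) = G 0 t w) (h1 : ∀ t w, g (Susp.mk t w) = G 1 t w) :
    f.Homotopic g := by
  refine PtdMap.homotopic_of (fun τ ↦ Susp.lift (G τ)
    (hG.comp (f := fun p : I × W ↦ (τ, p)) (by fun_prop)) (hp τ))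
    (continuous_I_prod_quot hG) ?_ ?_ fun τ ↦ map_pt' _
  · intro x
    obtain ⟨t, w, rfl⟩ := Susp.exists_mk x
    exact (h0 t w).symm
  · intro x
    obtain ⟨t, w, rfl⟩ := Susp.exists_mk x
    exact (h1 t w).symm

/-! ### Words along a path -/

variable {Z : PtdSpace.{u}}

namespace CofStr

/-- A family of paths that is divided into pieces along which the height varies little. -/
structure Walk (S : CofStr Z {Z.pt}) (W : Type*) [TopologicalSpace W] where
  /-- the pieces -/
  d : ℕ → I → W → Susp Z
  cont_d : ∀ n, Continuous fun p : I × W ↦ d n p.1 p.2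
  osc : ∀ n s w, |S.height (d n s w) - S.height (d n 0 w)| < 1 / 50
  d_zero : ∀ w, d 0 0 w = (Susp Z).pt
  d_succ : ∀ n w, d n 1 w = d (n + 1) 0 w

namespace Walk

variable {S : CofStr Z {Z.pt}} {ℓ : C(Z, ℝ)} (hℓ : IsLength ℓ) {W : Type*} [TopologicalSpace W]
  [DeltaGeneratedSpace W] (P : S.Walk W) (C : CoherentInverse (James.letter : Z → James Z))

/-- The words over the points where the pieces begin. -/
def words : ∀ n, {ab : (W → James Z) × (W → James Z) // S.IsState (P.d n 0) ab.1 ab.2}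
  | 0 => ⟨(1, 1), continuousOn_const, continuousOn_const, fun w h ↦ by
      rw [P.d_zero, S.height_pt] at h
      norm_num at h⟩
  | n + 1 =>
    let D : S.Step W := ⟨P.d n, (words n).1.1, (words n).1.2, P.cont_d n, P.osc n, (words n).2⟩
    ⟨(D.nextA C, D.nextB C), (funext (P.d_succ n) : P.d n 1 = P.d (n + 1) 0) ▸ D.isState_next C⟩

/-- The pieces with words over the points where they begin. -/
def step (n : ℕ) : S.Step W :=
  ⟨P.d n, (P.words C n).1.1, (P.words C n).1.2, P.cont_d n, P.osc n, (P.words C n).2⟩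

theorem step_succ_a (n : ℕ) : (P.step C (n + 1)).a = (P.step C n).nextA C := rfl

theorem step_succ_b (n : ℕ) : (P.step C (n + 1)).b = (P.step C n).nextB C := rfl

theorem step_d (n : ℕ) : (P.step C n).d = P.d n := rfl

/-- The paths of words over the paths. -/
def lift (p : ℝ × W) : C(ℝ, Susp Z) × ℝ :=
  (P.step C ⌊p.1⌋₊).lift hℓ C (cI (p.1 - ⌊p.1⌋₊), p.2)

theorem continuous_lift : Continuous (P.lift hℓ C) := by
  refine continuous_concat (f := fun n ↦ (P.step C n).lift hℓ C)
    (fun n ↦ (P.step C n).continuous_lift hℓ C) fun n w ↦ ?_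
  rw [Step.lift_one, Step.lift_zero, step_succ_a, step_succ_b, step_d, step_d, P.d_succ]

theorem endsAt_lift (p : ℝ × W) : EndsAt (P.lift hℓ C p)
    (S.normalize (P.d ⌊p.1⌋₊ (cI (2 * cI (p.1 - ⌊p.1⌋₊) - 1)) p.2)) :=
  (P.step C _).endsAt_lift hℓ C _

theorem step_a_eq {w : W} {m n : ℕ} (hmn : m ≤ n) (h : ∀ k, m ≤ k → P.d k 0 w = (Susp Z).pt) :
    (P.step C n).a w = (P.step C m).a w := by
  induction n, hmn using Nat.le_induction with
  | base => rfl
  | succ n hn ih =>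
    rw [step_succ_a, Step.nextA_low, ih]
    change S.height (P.d n 0 w) ≤ _
    rw [h n hn, S.height_pt]
    norm_num

theorem lift_of_le {w : W} {m : ℕ} (h : ∀ k, m ≤ k → ∀ s, P.d k s w = (Susp Z).pt) {T : ℝ}
    (hT : m ≤ T) : P.lift hℓ C (T, w) = hook ℓ hℓ ((P.step C m).a w) 0 Z.pt := by
  have hm : m ≤ ⌊T⌋₊ := Nat.le_floor hT
  rw [← P.step_a_eq C hm fun k hk ↦ h k hk 0]
  refine Step.lift_low hℓ C _ fun s ↦ ?_
  rw [step_d, h _ hm, S.height_pt]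
  norm_num

theorem step_zero_a (w : W) : (P.step C 0).a w = 1 := rfl

theorem lift_zero (w : W) : P.lift hℓ C (0, w) = hook ℓ hℓ 1 0 Z.pt := by
  have h1 : P.lift hℓ C (0, w) = (P.step C 0).lift hℓ C (0, w) := by
    simp only [lift, Nat.floor_zero, Nat.cast_zero, sub_zero, cI_zero]
  rw [h1, Step.lift_zero, step_d, P.d_zero, stateHook, S.height_pt, if_pos (by norm_num),
    hookAt_low _ _ _ (by rw [S.height_pt]; norm_num), step_zero_a]

end Walk
end CofStr

/-! ### Maps to a suspension come from maps to the James construction -/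

section JamesLift

variable {W : PtdSpace.{u}} (S : CofStr Z {Z.pt}) (δ : PtdMap (Susp W) (Susp Z))

theorem exists_speed : ∃ r : C(W, ℝ), ∀ w, 0 < r w ∧ ∀ s s' : I, |(s : ℝ) - s'| ≤ r w →
    |S.height (δ (Susp.mk s w)) - S.height (δ (Susp.mk s' w))| < 1 / 50 := by
  obtain ⟨r, hr⟩ := exists_modulus (ε := 1 / 50) (by norm_num)
  let F : C(W, C(I, ℝ)) := ContinuousMap.curry ⟨fun p : W × I ↦ S.height (δ (Susp.mk p.2 p.1)),
    by fun_prop⟩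
  exact ⟨r.comp F, fun w ↦ hr (F w)⟩

theorem map_mk_pt {X Y : PtdSpace.{u}} (f : PtdMap (Susp X) Y) {t : I} {x : X}
    (h : t = 0 ∨ t = 1 ∨ x = X.pt) : f (Susp.mk t x) = Y.pt :=
  (congrArg f (Susp.mk_eq_pt h)).trans f.map_pt

/-- The reparametrization of the time along which words are lifted. -/
def walkTime (T : ℝ) : ℝ := ⌊T⌋₊ + cI (2 * cI (T - ⌊T⌋₊) - 1)

@[fun_prop] theorem continuous_walkTime {T : Type*} [TopologicalSpace T] {f : T → ℝ}
    (hf : Continuous f) : Continuous fun t ↦ walkTime (f t) := by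
  have h := continuous_concat (W := Unit) (f := fun n p ↦ (n : ℝ) + cI (2 * p.1 - 1))
    (fun n ↦ by fun_prop) fun n w ↦ by
      simp only [Set.Icc.coe_one, Set.Icc.coe_zero]
      rw [cI_of_ge (by norm_num), cI_of_le (by norm_num)]
      push_cast
      ring
  exact h.comp (f := fun t ↦ (f t, ())) (by fun_prop)

theorem walkTime_zero : walkTime 0 = 0 := by
  rw [walkTime, Nat.floor_zero, Nat.cast_zero, sub_zero, cI_zero, cI_of_le (by norm_num)]
  simp

theorem sub_one_le_walkTime (T : ℝ) : T - 1 ≤ walkTime T := by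
  have h1 := (Nat.lt_floor_add_one T).le
  have h2 := (cI (2 * cI (T - ⌊T⌋₊) - 1)).2.1
  rw [walkTime]
  linarith

/-- The map `δ` with its parameter interval divided according to a speed. -/
def suspWalk (r : C(W, ℝ)) (hr : ∀ w, 0 < r w ∧ ∀ s s' : I, |(s : ℝ) - s'| ≤ r w →
    |S.height (δ (Susp.mk s w)) - S.height (δ (Susp.mk s' w))| < 1 / 50) : S.Walk W where
  d n s w := δ (Susp.mk (cI (r w * (n + s))) w)
  cont_d n := by fun_prop
  osc n s w := by
    refine (hr w).2 _ _ ((Set.abs_projIcc_sub_projIcc zero_le_one).trans ?_)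
    have h0 := (hr w).1.le
    rw [Set.Icc.coe_zero, add_zero, ← mul_sub, add_sub_cancel_left,
      abs_of_nonneg (mul_nonneg h0 s.2.1)]
    exact mul_le_of_le_one_right h0 s.2.2
  d_zero w := map_mk_pt δ (Or.inl (by simp))
  d_succ n w := by simp

/-- If the letters are invertible up to homotopy, every map to the suspension is homotopic to the
adjoint of a map to the James construction. -/
theorem exists_jamesLift (S : CofStr Z {Z.pt}) (δ : PtdMap (Susp W) (Susp Z)) {ℓ : C(Z, ℝ)} (hℓ : IsLength ℓ)
    (C : CoherentInverse (James.letter : Z → James Z)) :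
    ∃ (g : PtdMap W (James Z)) (f₀ : PtdMap (Susp W) (Susp Z)),
      (∀ t w, f₀ (Susp.mk t w) = jamesOmega ℓ (g w) t) ∧ f₀.Homotopic δ := by
  obtain ⟨r, hr⟩ := exists_speed S δ
  have r_pos : ∀ w, 0 < r w := fun w ↦ (hr w).1
  let P := suspWalk S δ r hr
  let N : W → ℝ := fun w ↦ 1 / r w
  have hN : Continuous N := continuous_const.div r.continuous fun w ↦ (r_pos w).ne'
  have N_pos : ∀ w, 0 < N w := fun w ↦ by have := r_pos w; positivity
  have hrN : ∀ w T, N w ≤ T → 1 ≤ r w * T := fun w T h ↦ by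
    have := mul_le_mul_of_nonneg_left h (r_pos w).le
    rwa [mul_one_div_cancel (r_pos w).ne'] at this
  have P_pt : ∀ w (m : ℕ), N w ≤ m → ∀ k, m ≤ k → ∀ s, P.d k s w = (Susp Z).pt := by
    intro w m hm k hk s
    refine map_mk_pt δ (Or.inr (Or.inl (cI_of_ge (hrN w _ ?_))))
    have h1 : (m : ℝ) ≤ k := Nat.cast_le.2 hk
    have h2 := s.2.1
    linarith
  have P_base : ∀ k s, P.d k s W.pt = (Susp Z).pt := fun k s ↦ map_mk_pt δ (Or.inr (Or.inr rfl))
  let a : W → James Z := fun w ↦ (P.step C ⌈N w⌉₊).a w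
  have ha : ∀ w (m : ℕ), N w ≤ m → (P.step C m).a w = a w := fun w m hm ↦
    P.step_a_eq C (Nat.ceil_le.2 hm) fun k hk ↦ P_pt w _ (Nat.le_ceil _) k hk 0
  have cont_a : Continuous a := by
    rw [continuous_iff_continuousAt]
    intro w₀
    obtain ⟨m, hm⟩ := exists_nat_gt (N w₀)
    have hU : IsOpen {w | N w < m} := isOpen_lt hN continuous_const
    have h1 : ContinuousOn (P.step C m).a {w | N w < m} :=
      (P.step C m).state.cont_a.mono fun w (hw : N w < m) ↦ by
        change S.height (P.d m 0 w) < _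
        rw [P_pt w m hw.le m le_rfl, S.height_pt]
        norm_num
    exact (h1.congr fun w (hw : N w < m) ↦ (ha w m hw.le).symm).continuousAt (hU.mem_nhds hm)
  have a_pt : a W.pt = 1 := P.step_a_eq C (Nat.zero_le _) fun k _ ↦ P_base k 0
  let g : PtdMap W (James Z) := ⟨⟨a, cont_a⟩, a_pt⟩
  let L : ℝ × W → C(ℝ, Susp Z) × ℝ := P.lift hℓ C
  have cont_L : Continuous L := P.continuous_lift hℓ C
  let q : ℝ → W → Susp Z := fun T w ↦ S.normalize (δ (Susp.mk (cI (r w * walkTime T)) w))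
  have hL : ∀ T w, CofStr.EndsAt (L (T, w)) (q T w) := fun T w ↦ P.endsAt_lift hℓ C (T, w)
  have L_end : ∀ w T, N w + 1 ≤ T → L (T, w) = hook ℓ hℓ (a w) 0 Z.pt := fun w T hT ↦
    P.lift_of_le hℓ C (P_pt w _ (Nat.le_ceil _)) (by
      have := Nat.ceil_lt_add_one (N_pos w).le
      linarith)
  have L_zero : ∀ w, L (0, w) = hook ℓ hℓ 1 0 Z.pt := P.lift_zero hℓ C
  have L_pt : ∀ T, 0 ≤ T → L (T, W.pt) = hook ℓ hℓ 1 0 Z.pt := fun T hT ↦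
    P.lift_of_le hℓ C (m := 0) (fun k _ s ↦ P_base k s) (by simpa using hT)
  have hook_len : ∀ m : James Z, (hook ℓ hℓ m 0 Z.pt).2 = James.length ℓ m := fun m ↦ by
    simp [hook]
  have q_end : ∀ w T, N w + 1 ≤ T → r w * walkTime T ≥ 1 := fun w T hT ↦
    hrN w _ (by linarith [sub_one_le_walkTime T])
  have nf : S.normalize (Susp Z).pt = (Susp Z).pt := map_pt' _
  have q_pt : ∀ w T, N w + 1 ≤ T → q T w = (Susp Z).pt := fun w T hT ↦
    (congrArg _ (map_mk_pt δ (Or.inr (Or.inl (cI_of_ge (q_end w T hT)))))).trans nf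
  have q_base : ∀ T, q T W.pt = (Susp Z).pt := fun T ↦
    (congrArg _ (map_mk_pt δ (Or.inr (Or.inr rfl)))).trans nf
  let M : W → ℝ := fun w ↦ N w + 1
  have hM : Continuous M := by fun_prop
  have M_pos : ∀ w, 0 < M w := fun w ↦ by have := N_pos w; positivity
  let x : I → I → W → ℝ := fun τ t w ↦ t * ((L (τ * M w, w)).2 + (1 - τ) * M w)
  let G : I → I → W → Susp Z := fun τ t w ↦
    if x τ t w ≤ (L (τ * M w, w)).2 then (L (τ * M w, w)).1 (x τ t w)
    else q (τ * M w + (x τ t w - (L (τ * M w, w)).2)) w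
  have cont_G : Continuous fun p : I × (I × W) ↦ G p.1 p.2.1 p.2.2 := by
    have h1 : Continuous fun p : I × (I × W) ↦ L (p.1 * M p.2.2, p.2.2) :=
      cont_L.comp (by fun_prop)
    have h2 : Continuous fun p : I × (I × W) ↦ x p.1 p.2.1 p.2.2 := by
      have := continuous_snd.comp h1
      fun_prop
    refine Continuous.if_le ?_ ?_ h2 (continuous_snd.comp h1) ?_
    · exact ContinuousEval.continuous_eval.comp ((continuous_fst.comp h1).prodMk h2)
    · have := continuous_snd.comp h1
      fun_prop
    · intro p hp
      rw [hp, (hL _ _).2.2, sub_self, add_zero]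
  have G_pt : ∀ τ t w, (t = 0 ∨ t = 1 ∨ w = W.pt) → G τ t w = (Susp Z).pt := by
    rintro τ t w (rfl | rfl | rfl)
    · have h0 : x τ 0 w = 0 := by simp [x]
      refine (if_pos ?_).trans ?_
      · rw [h0]
        exact (hL _ _).1
      · rw [h0]
        exact (hL _ _).2.1
    · have h0 : x τ 1 w = (L (τ * M w, w)).2 + (1 - τ) * M w := by simp [x]
      have h1 : 0 ≤ (1 - τ) * M w := mul_nonneg (by linarith [τ.2.2]) (M_pos w).le
      have h2 : q (τ * M w + (x τ 1 w - (L (τ * M w, w)).2)) w = (Susp Z).pt :=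
        q_pt w _ (by rw [h0]; simp only [M]; linarith)
      dsimp only [G]
      split_ifs with h
      · have h3 : (1 - τ) * M w = 0 := le_antisymm (by linarith) h1
        rw [h3, add_zero] at h0
        rw [h0, sub_self, add_zero] at h2
        rw [h0, (hL _ _).2.2, h2]
      · exact h2
    · dsimp only [G]
      rw [L_pt _ (mul_nonneg τ.2.1 (M_pos _).le)]
      split_ifs
      · exact hook_zero hℓ _ _ _
      · exact q_base _
  let f₀ : PtdMap (Susp W) (Susp Z) := Susp.lift (fun t w ↦ jamesOmega ℓ (g w) t)
    (continuous_jamesOmega hℓ (by fun_prop) (by fun_prop)) <| by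
      rintro t w (rfl | rfl | rfl)
      · exact jamesOmega_zero hℓ _
      · exact jamesOmega_one hℓ _
      · rw [map_pt']
        rfl
  let f₁ : PtdMap (Susp W) (Susp Z) := Susp.lift (G 0)
    (cont_G.comp (f := fun p : I × W ↦ (0, p)) (by fun_prop)) (G_pt 0)
  have h10 : f₁.Homotopic f₀ := by
    refine Susp.homotopic_of G cont_G G_pt (fun _ _ ↦ rfl) fun t w ↦ ?_
    change jamesOmega ℓ (a w) t = G 1 t w
    have h1 : L ((1 : I) * M w, w) = hook ℓ hℓ (a w) 0 Z.pt := L_end w _ (by simp [M])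
    have h2 : x 1 t w = t * James.length ℓ (a w) := by
      simp only [x, h1, hook_len]
      simp
    dsimp only [G]
    rw [if_pos, h1, h2, hook_zero]
    · rfl
    · rw [h1, h2, hook_len]
      exact mul_le_of_le_one_left (James.length_nonneg hℓ _) t.2.2
  have h1n : f₁.Homotopic (S.normalize.comp δ) := by
    refine Susp.homotopic_of (fun τ t w ↦ S.normalize (δ (Susp.mk
      (cI ((1 - τ) * (r w * walkTime (t * M w)) + τ * t)) w))) (by fun_prop) ?_ ?_ ?_
    · rintro τ t w (rfl | rfl | rfl)
      · exact (congrArg _ (map_mk_pt δ (Or.inl (by simp [walkTime_zero])))).trans nf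
      · refine (congrArg _ (map_mk_pt δ (Or.inr (Or.inl (cI_of_ge ?_))))).trans nf
        have h1 := q_end w ((1 : I) * M w) (by simp [M])
        have h2 := mul_le_mul_of_nonneg_left h1 (sub_nonneg.2 τ.2.2)
        rw [Set.Icc.coe_one] at h2 ⊢
        linarith
      · exact (congrArg _ (map_mk_pt δ (Or.inr (Or.inr rfl)))).trans nf
    · intro t w
      change G 0 t w = _
      have h1 : L ((0 : I) * M w, w) = hook ℓ hℓ 1 0 Z.pt := by
        rw [Set.Icc.coe_zero, zero_mul, L_zero]
      have h2 : (hook ℓ hℓ (1 : James Z) 0 Z.pt).2 = 0 := by rw [hook_len, James.length_one]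
      have h3 : x 0 t w = t * M w := by
        simp only [x, h1, h2]
        simp
      have h4 : G 0 t w = q (t * M w) w := by
        dsimp only [G]
        rw [h1, h2, h3]
        split_ifs with h
        · have h5 : t * M w = 0 := le_antisymm h (mul_nonneg t.2.1 (M_pos w).le)
          rw [h5, hook_apply_zero]
          exact ((congrArg _ (map_mk_pt δ (Or.inl (by simp [walkTime_zero])))).trans nf).symm
        · simp
      rw [h4]
      simp [q]
    · intro t w
      change S.normalize (δ (Susp.mk t w)) = _
      simp
  exact ⟨g, f₀, fun _ _ ↦ rfl, h10.symm.trans (h1n.trans (S.normalize_homotopic.symm.comp_right δ))⟩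

end JamesLift

/-! ### Existence of the second James-Hopf invariant -/

theorem joined_of_cw {X : PtdSpace.{u}} [ConnectedSpace X] (x : X) : Joined X.pt x := by
  have : PathConnectedSpace X := pathConnectedSpace_iff_connectedSpace.2 inferInstance
  exact PathConnectedSpace.joined _ _

theorem joined_smash_susp {X A : PtdSpace.{u}} (y : Smash X (Susp A)) :
    Joined (Smash X (Susp A)).pt y := by
  induction y using Quot.ind with | mk p => ?_
  obtain ⟨s, a, h⟩ := Susp.exists_mk (dsnd p)
  refine ⟨⟨⟨fun t ↦ Smash.mk (dfst p) (Susp.mk (cI (t * s)) a), ?_⟩, ?_, ?_⟩⟩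
  · exact continuous_quot_mk.comp (continuous_dpair' continuous_const (by fun_prop))
  · exact Smash.mk_eq_pt (Or.inr (Susp.mk_eq_pt (Or.inl (by simp))))
  · change Smash.mk (dfst p) (Susp.mk (cI (((1 : I) : ℝ) * s)) a) = Smash.mk (dfst p) (dsnd p)
    rw [Set.Icc.coe_one, one_mul, cI_coe, h]

theorem joined_wedge {X Y : PtdSpace.{u}} (hX : ∀ x : X, Joined X.pt x)
    (hY : ∀ y : Y, Joined Y.pt y) (z : Wedge X Y) : Joined (Wedge X Y).pt z := by
  induction z using Quot.ind with | mk z => ?_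
  rcases z with x | y
  · exact (hX x).map (Wedge.inl X Y).cont
  · have := (hY y).map (Wedge.inr X Y).cont
    rwa [map_pt' (Wedge.inr X Y)] at this

theorem exists_isJamesHopf_wedge {X A W : PtdSpace.{u}} (hX : X.IsCW) [ConnectedSpace X]
    (SX : CofStr X {X.pt}) (SA : CofStr A {A.pt})
    (δ : PtdMap (Susp W) (Susp (Wedge X (Smash X (Susp A))))) : ∃ H, IsJamesHopf δ H := by
  let Z := Wedge X (Smash X (Susp A))
  let S : CofStr Z {Z.pt} := SX.wedge (SX.smash SA.susp)
  have : PathConnectedSpace (James Z) :=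
    James.pathConnectedSpace (joined_wedge joined_of_cw joined_smash_susp)
  let j : PtdMap Z (James Z) := ⟨⟨James.letter, James.continuous_letter⟩, James.letter_pt⟩
  obtain ⟨C⟩ := exists_coherentInverse (fun f : PtdMap Z (James Z) ↦
    hasRightInverse_wedge (hasRightInverse_cw hX _) (hasRightInverse_smash_susp _)) j
  obtain ⟨g, f₀, hf, h⟩ := exists_jamesLift S δ S.isLength C
  exact exists_isJamesHopf S S.isLength g hf h

end RelJames

namespace RelJames

/-! ### The third order Whitehead product -/

/-- The first component of the third order Whitehead product is even null-homotopic for every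
splitting, so that its formula holds with the zero map in the place of `μ`. -/
theorem CylData.gamma₃Claim {X A P : PtdSpace.{u}} {i : PtdMap (Susp A) P}
    {ε : PtdMap (Susp X) P} {r : PtdMap P (Susp X)} (D : CylData i ε r) (hX : X.IsCW) :
    Gamma₃Claim i ε r := by
  refine ⟨⟨_, isGamma₃_gammaStd D.triple i ε⟩, fun γ hγ ↦ ⟨exists_cone_equiv_J3 D hγ,
    hγ.pinchTo_homotopic_zero D, fun hW ↦ ⟨exists_isSplitting D hW, fun e he ↦
    ⟨he.exists_component γ, fun δ hδ ↦ ⟨he.exists_cone_equiv D hγ hδ, fun _ ↦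
    ⟨exists_isJamesHopf_wedge hX D.SX D.SA δ, fun H _ ↦
    ⟨PtdMap.zero _ _, PtdMap.zero _ _, ?_, ?_⟩⟩⟩⟩⟩⟩⟩
  · exact isWhitehead_zero _
  · exact he.fst_homotopic_zero D hγ hδ

/-- The identity of a suspension as a mapping cylinder. -/
def CylData.id {X A : PtdSpace.{u}} (SX : CofStr X {X.pt}) (SA : CofStr A {A.pt})
    (i : PtdMap (Susp A) (Susp X)) : CylData i (PtdMap.id _) (PtdMap.id _) where
  SX := SX
  SA := SA
  H _ p := p
  r_ε _ := rfl
  cont_H := continuous_snd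
  H_zero _ := rfl
  H_one _ := rfl
  H_ε _ _ := rfl
  r_H _ _ := rfl
  SP :=
    { u := fun _ ↦ 0
      k := fun _ y ↦ y
      cont_u := continuous_const
      cont_k := continuous_snd
      u_nonneg := fun _ ↦ le_rfl
      u_rel := fun _ _ ↦ rfl
      k_zero := fun _ ↦ rfl
      k_rel := fun _ _ _ ↦ rfl
      k_mem := fun _ y _ _ ↦ ⟨y, rfl⟩ }
  u_le _ := zero_le_one

/-- The deformation of a mapping cylinder. -/
def MapCyl.push {X Y : PtdSpace.{u}} (f : PtdMap X Y) (t : I) : MapCyl f → MapCyl f :=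
  Quot.lift (Sum.elim (MapCyl.target f) fun p ↦ Quot.mk _ (Sum.inr (max p.1 t, p.2))) <| by
    rintro _ _ (x | s)
    · exact (congrArg (fun s ↦ Quot.mk (CylRel f) (Sum.inr (s, x)))
        (max_eq_left (a := (1 : I)) t.2.2)).trans (Quot.sound (CylRel.glue x))
    · exact Quot.sound (CylRel.base _)

/-- The data of a mapping cylinder. -/
def CylData.mapCyl {X Y : PtdSpace.{u}} (SY : CofStr Y {Y.pt}) (SX : CofStr X {X.pt})
    (f : PtdMap (Susp X) (Susp Y)) :
    CylData (MapCyl.source f) (MapCyl.target f) (MapCyl.retr f) where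
  SX := SY
  SA := SX
  H := MapCyl.push f
  r_ε _ := rfl
  cont_H := by
    refine continuous_I_prod_quot (continuous_I_prod_sum ?_ ?_)
    · exact (MapCyl.target f).cont.comp continuous_snd
    · exact continuous_quot_mk.comp (continuous_inr.comp
        (f := fun p : I × (I × Susp X) ↦ (max p.2.1 p.1, p.2.2)) (by fun_prop))
  H_zero p := by
    induction p using Quot.ind with | mk p => ?_
    rcases p with y | ⟨s, x⟩
    · rfl
    · exact congrArg (fun s ↦ Quot.mk (CylRel f) (Sum.inr (s, x)))
        (max_eq_left (b := (0 : I)) s.2.1)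
  H_one p := by
    induction p using Quot.ind with | mk p => ?_
    rcases p with y | ⟨s, x⟩
    · rfl
    · exact (congrArg (fun s ↦ Quot.mk (CylRel f) (Sum.inr (s, x)))
        (max_eq_right (b := (1 : I)) s.2.2)).trans (Quot.sound (CylRel.glue x))
  H_ε _ _ := rfl
  r_H t p := by
    induction p using Quot.ind with | mk p => ?_
    rcases p with y | ⟨s, x⟩ <;> rfl
  SP := CofStr.mapCyl SX.susp f
  u_le := CofStr.mapCyl_u_le SX.susp f

end RelJames

end

theorem lemma2p6 :
    (∀ (X' A' : RelJames.PtdSpace.{u}) (_ : X'.IsCW) (_ : A'.IsCW)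
      (i : RelJames.PtdMap (RelJames.Susp A') (RelJames.Susp X')) (_ : i.IsCWPair),
      RelJames.Gamma₃Claim i (RelJames.PtdMap.id _) (RelJames.PtdMap.id _)) ∧
    (∀ (X' Y' : RelJames.PtdSpace.{u}) (_ : X'.IsCW) (_ : Y'.IsCW)
      (f : RelJames.PtdMap (RelJames.Susp X') (RelJames.Susp Y')),
      RelJames.Gamma₃Claim (RelJames.MapCyl.source f) (RelJames.MapCyl.target f)
        (RelJames.MapCyl.retr f)) := by
  refine ⟨fun X A hX hA i _ ↦ ?_, fun X Y hX hY f ↦ ?_⟩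
  · obtain ⟨SX⟩ := RelJames.exists_cofStr_of_cw hX
    obtain ⟨SA⟩ := RelJames.exists_cofStr_of_cw hA
    exact (RelJames.CylData.id SX SA i).gamma₃Claim hX
  · obtain ⟨SX⟩ := RelJames.exists_cofStr_of_cw hX
    obtain ⟨SY⟩ := RelJames.exists_cofStr_of_cw hY
    exact (RelJames.CylData.mapCyl SY SX f).gamma₃Claim hY
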